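/- Let $\mathbb F=\mathbb Z/2$ and let $n>0$. All DG algebras and DG modules are over $\mathbb F$ and bigraded: the first (cohomological) degree is raised by one by the differential, and the second ($q$-)degree is preserved by it. $M[1]$ and $M\{1\}$ are the shifts $M[1]^{i,j}=M^{i+1,j}$, $M\{1\}^{i,j}=M^{i,j+1}$. For a DG algebra $A$, $H^0(DG(A))$ has the left DG $A$-modules as objects and, as morphisms, the closed $A$-linear maps of degree $(0,0)$ modulo $\{dh+hd\}$, $h$ of degree $(-1,0)$; it is triangulated by $[1]$ and mapping cones. **The algebra $R_n$.** Vertices are the subsets $x\subseteq\{0,\dots,n\}$. There is an arrow $x\xrightarrow{s}y$ if $s,s+1\notin x$ and $y=x\sqcup\{s,s+1\}\subseteq\{0,\dots,n\}$. $R_n$ is the quotient of the path algebra of this quiver over $\mathbb F$ (with idempotents $e(x)$, $\sum_x e(x)=1$, and generators $r(x\xrightarrow{s}y)=e(x)r(x\xrightarrow{s}y)e(y)$) by the relations that the two paths $x\xrightarrow{s}\cdot\xrightarrow{t}w$ and $x\xrightarrow{t}\cdot\xrightarrow{s}w$ are equal. It has zero differential, and $r(x\xrightarrow{s}y)$ has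 bidegree $(0,n-1-2s)$. **The DG algebra $R_n\boxtimes R_n$.** It is defined by the quiver with vertices $(x,y)$ and with the arrows $(s,\emptyset)$, which apply $s$ to $x$; $(\emptyset,s)$, which apply $s$ to $y$; and $(s,s+1)$, which apply $s$ to $x$ and $s+1$ to $y$ (if all these arrows exist). The relations say that any two arrows commute (whenever the arrows involved exist), except that $(s,\emptyset)$ and $(\emptyset,s+1)$ do not. The bidegree of $(s,\emptyset)$ and of $(\emptyset,s)$ is $(0,n-1-2s)$, that of $(s,s+1)$ is $(-1,(n-1-2s)+(n-1-2(s+1)))$. The differential vanishes on $e(x,y)$ and on the arrows $(s,\emptyset)$, $(\emptyset,s)$, and sends the arrow $(s,s+1)$ to the sum of the two paths "$(s,\emptyset)$ then $(\emptyset,s+1)$" and "$(\emptyset,s+1)$ then $(s,\emptyset)$". There is a homomorphism of DG algebras $H:R_n\boxtimes R_n\to R_n\otimes_{\mathbb F}R_n$ (zero differential on the target) with $e(x,y)\mapsto e(x)\otimes e(y)$, $(s,\emptyset)\mapsto r(x\xrightarrow{s}x')\otimes e(y)$, $(\emptyset,s)\mapsto e(x)\otimes r(y\xrightarrow{s}y')$,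 $(s,s+1)\mapsto 0$. $H^0(DGP(R_n))$ and $H^0(DGP(R_n\boxtimes R_n))$ are the full subcategories of $H^0(DG(R_n))$ and $H^0(DG(R_n\boxtimes R_n))$ whose objects are those isomorphic to an object obtained from $P(x)=R_ne(x)$, respectively $P(x,y)=(R_n\boxtimes R_n)e(x,y)$, by the shifts $[\pm1]$, $\{\pm1\}$ and mapping cones. **The bimodule $T_n$.** For $x,y\subseteq\{0,\dots,n\}$ let $p(x,y)=\{s: s\in x,\ s+1\in y\}$ and $\mu(x,y)=\sum_{a\in x,\,b\in y,\,a+1<b}(-1)^{a+b+1}$. For $I\subseteq p(x,y)$ let $x_I=x\setminus\{s:s\in p(x,y)\setminus I\}$ and $y_I=y\setminus\{s+1:s\in p(x,y)\setminus I\}$. As a left $R_n$-module, $T_n$ is the direct sum, over all $(x,y,I)$ with $x_I\cap y_I=\emptyset$, of $P(x_I\cup y_I)\{\sum_{s\in p(x,y)\setminus I}(2s+1-n)\}$, placed in cohomological degree $\mu(x,y)+|I|$. The differential maps the summand $(x,y,I)$ to the summands $(x,y,I\sqcup\{s\})$, by right multiplication by the arrow $\xrightarrow{s}$. In $T_n$,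 $e(x,y)$ acts on the right as the projection to the summands $(x,y,I)$, and an arrow $(x,y)\to(x',y')$ maps the summand $(x,y,I)$ to the summand $(x',y',I')$ (to zero, if the latter is not there) as follows. For $(\emptyset,t)$: $I'=I\cup\{t-1\}$ if $t-1\in x$ and $I'=I$ otherwise; the map is the identity if $t\in x$, and right multiplication by the arrow $\xrightarrow{t}$ otherwise. For $(t,\emptyset)$: $I'=I\cup\{t+1\}$ if $t+2\in y$ and $I'=I$ otherwise; the map is the identity if $t+1\in y$, and right multiplication by the arrow $\xrightarrow{t}$ otherwise. For $(t,t+1)$: $I'=I$, and the map is the identity. These formulas define a DG $(R_n,R_n\boxtimes R_n)$-bimodule $T_n$. **Products and lifts.** For $X,Y$ in $H^0(DGP(R_n))$ there is an object $\chi_n(X,Y)$ of $H^0(DGP(R_n\boxtimes R_n))$, with $(R_n\otimes R_n)\otimes_{R_n\boxtimes R_n}\chi_n(X,Y)\cong X\otimes_{\mathbb F}Y$ in $H^0(DG(R_n\otimes R_n))$, the tensor product being taken along $H$. Put $\rho_n(X,Y)=T_n\otimes_{R_n\boxtimes R_n}\chi_n(X,Y)$. The letters $1,q,q^{-1},E,F$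 are lifted to $P(\emptyset)$, $P(\emptyset)\{1\}$, $P(\emptyset)\{-1\}$, $\bigoplus_{0\le i\le n,\ i\text{ even}}P(\{i\})$, $\bigoplus_{0\le i\le n,\ i\text{ odd}}P(\{i\})$, and a product of finitely many letters, with any placing of brackets, is lifted by iterating $\rho_n$ accordingly. Let $\mathcal U_n$ be the smallest triangulated full subcategory of $H^0(DG(R_n))$, closed under isomorphisms, that contains all lifts of words, and let $\mathcal U_{n,n}$ be the smallest triangulated full subcategory of $H^0(DG(R_n\boxtimes R_n))$, closed under isomorphisms, that contains all $\chi_n(X,Y)$ with $X,Y\in\mathcal U_n$. **The integral form.** $\mathbf U_n$ is the unital associative $\mathbb Z[q^{\pm1}]$-algebra with generators $E,F$ and relations $E^2=F^2=0$, $EF+FE=q^{n-1}+q^{n-3}+\cdots+q^{1-n}$, and $m_n:\mathbf U_n\otimes_{\mathbb Z[q^{\pm1}]}\mathbf U_n\to\mathbf U_n$ is its multiplication. **Theorem.** For every $n>0$: $\mathcal U_n\subseteq H^0(DGP(R_n))$ and $\mathcal U_{n,n}\subseteq H^0(DGP(R_n\boxtimes R_n))$; $\mathcal U_n$ and $\mathcal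 U_{n,n}$ are triangulated categories stable under $\{\pm1\}$; and there are isomorphisms of groups $$\kappa_1:K_0(\mathcal U_n)\cong\mathbf U_n,\qquad \kappa_2:K_0(\mathcal U_{n,n})\cong\mathbf U_n\otimes_{\mathbb Z[q^{\pm1}]}\mathbf U_n,$$ $\mathbb Z[q^{\pm1}]$-linear in the sense that $\{1\}$ on objects corresponds to multiplication by $q$, such that $\kappa_1$ sends the class of every lift of a word to the value of the word in $\mathbf U_n$, and $\kappa_2[\chi_n(X,Y)]=\kappa_1[X]\otimes\kappa_1[Y]$ for $X,Y\in\mathcal U_n$. The functor $T_n\otimes_{R_n\boxtimes R_n}-$ maps $\mathcal U_{n,n}$ to $\mathcal U_n$, the resulting functor $\mathcal F_n:\mathcal U_{n,n}\to\mathcal U_n$ is exact, and under these isomorphisms the induced map $K_0(\mathcal F_n):K_0(\mathcal U_{n,n})\to K_0(\mathcal U_n)$ is the multiplication $m_n$. -/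

import Mathlib

open CategoryTheory Limits
open scoped TensorProduct

/-- The ground field with two elements. -/
abbrev 𝔽 : Type := ZMod 2

namespace QDG

noncomputable section

/-! ### Internal gradings by `ℤ × ℤ` -/

section Internal

variable {M : Type} [AddCommGroup M] [Module 𝔽 M]

/-- In characteristic two every element is its own negative. -/
theorem add_self (m : M) : m + m = 0 := by
  have h : ((1 : 𝔽) + 1) • m = 0 := by
    have : (1 : 𝔽) + 1 = 0 := by decide
    rw [this, zero_smul]
  simpa [add_smul] using h

theorem neg_eq (m : M) : -m = m := neg_eq_of_add_eq_zero_left (add_self m)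

theorem isInternal_of_comp (gr : ℤ × ℤ → Submodule 𝔽 M) (c : M →ₗ[𝔽] (ℤ × ℤ →₀ M))
    (hsum : ∀ m, (c m).sum (fun _ x => x) = m) (hmem : ∀ m k, c m k ∈ gr k)
    (hs : ∀ k, ∀ m ∈ gr k, c m = Finsupp.single k m) : DirectSum.IsInternal gr := by
  classical
  constructor
  · intro x y hxy
    have key : ∀ z : DirectSum (ℤ × ℤ) (fun k => gr k), ∀ k,
        c (DirectSum.coeAddMonoidHom gr z) k = (z k : M) := by
      intro z
      induction z using DirectSum.induction_on with
      | zero => intro k; simp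
      | of i m =>
        intro k
        rw [DirectSum.coeAddMonoidHom_of, hs i m m.2]
        by_cases h : i = k
        · subst h; simp
        · rw [Finsupp.single_eq_of_ne (Ne.symm h), DirectSum.of_eq_of_ne _ _ _ (Ne.symm h)]; simp
      | add a b ha hb => intro k; simp [ha k, hb k]
    ext k
    rw [← key x k, ← key y k, hxy]
  · intro m
    refine ⟨(c m).sum (fun k _ => DirectSum.of (fun k => gr k) k ⟨c m k, hmem m k⟩), ?_⟩
    rw [Finsupp.sum, map_sum]
    simp only [DirectSum.coeAddMonoidHom_of]
    exact hsum m

/-- The homogeneous components of an internal grading. -/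
theorem exists_comp {gr : ℤ × ℤ → Submodule 𝔽 M} (h : DirectSum.IsInternal gr) :
    ∃ c : M →ₗ[𝔽] (ℤ × ℤ →₀ M), (∀ m, (c m).sum (fun _ x => x) = m) ∧
      (∀ m k, c m k ∈ gr k) ∧ (∀ k, ∀ m ∈ gr k, c m = Finsupp.single k m) := by
  classical
  let _ := h.chooseDecomposition
  refine ⟨{ toFun := fun m => Finsupp.onFinset (DirectSum.decompose gr m).support
              (fun k => (DirectSum.decompose gr m k : M)) (by
                intro k hk
                rw [DFinsupp.mem_support_iff]
                intro h0; exact hk (by rw [h0]; rfl))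
            map_add' := ?_, map_smul' := ?_ }, ?_, ?_, ?_⟩
  · intro x y; ext k; simp
  · intro a x; ext k; simp; rfl
  · intro m
    simp only [LinearMap.coe_mk, AddHom.coe_mk]
    rw [Finsupp.onFinset_sum _ (fun _ => rfl)]
    exact DirectSum.sum_support_decompose gr m
  · intro m k; simp
  · intro k m hm
    ext l
    by_cases hkl : k = l
    · subst hkl; simp [DirectSum.decompose_of_mem_same gr hm]
    · simp [DirectSum.decompose_of_mem_ne gr hm hkl, Finsupp.single_eq_of_ne (Ne.symm hkl)]

theorem isInternal_shift {gr : ℤ × ℤ → Submodule 𝔽 M} (h : DirectSum.IsInternal gr) (a : ℤ × ℤ) :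
    DirectSum.IsInternal (fun k => gr (k + a)) := by
  obtain ⟨c, h1, h2, h3⟩ := exists_comp h
  refine isInternal_of_comp _
    ((Finsupp.domLCongr (Equiv.addRight (-a))).toLinearMap ∘ₗ c) ?_ ?_ ?_
  · intro m
    simp only [LinearMap.comp_apply, LinearEquiv.coe_coe, Finsupp.domLCongr_apply,
      Finsupp.domCongr_apply]
    rw [Finsupp.equivMapDomain_eq_mapDomain, Finsupp.sum_mapDomain_index (by simp) (by simp)]
    exact h1 m
  · intro m k
    simpa [Finsupp.domCongr_apply, Finsupp.equivMapDomain_apply] using h2 m (k + a)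
  · intro k m hm
    simp [h3 _ m hm, Finsupp.domCongr_apply, Finsupp.equivMapDomain_single]

theorem isInternal_prod {N : Type} [AddCommGroup N] [Module 𝔽 N]
    {gr : ℤ × ℤ → Submodule 𝔽 M} {gr' : ℤ × ℤ → Submodule 𝔽 N}
    (h : DirectSum.IsInternal gr) (h' : DirectSum.IsInternal gr') :
    DirectSum.IsInternal (fun k => (gr k).prod (gr' k)) := by
  obtain ⟨c, h1, h2, h3⟩ := exists_comp h
  obtain ⟨c', h1', h2', h3'⟩ := exists_comp h'
  refine isInternal_of_comp _
    ((Finsupp.mapRange.linearMap (LinearMap.inl 𝔽 M N)) ∘ₗ c ∘ₗ LinearMap.fst 𝔽 M N +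
      (Finsupp.mapRange.linearMap (LinearMap.inr 𝔽 M N)) ∘ₗ c' ∘ₗ LinearMap.snd 𝔽 M N) ?_ ?_ ?_
  · rintro ⟨m, n⟩
    simp only [LinearMap.add_apply, LinearMap.comp_apply]
    rw [Finsupp.sum_add_index' (by simp) (by simp)]
    simp only [Finsupp.mapRange.linearMap_apply]
    rw [Finsupp.sum_mapRange_index (by simp), Finsupp.sum_mapRange_index (by simp)]
    simp only [LinearMap.fst_apply, LinearMap.snd_apply]
    have e1 := congrArg (LinearMap.inl 𝔽 M N) (h1 m)
    have e2 := congrArg (LinearMap.inr 𝔽 M N) (h1' n)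
    rw [Finsupp.sum, map_sum] at e1 e2
    rw [Finsupp.sum, Finsupp.sum, e1, e2]; simp
  · rintro ⟨m, n⟩ k
    simp [Submodule.mem_prod, h2, h2']
  · rintro k ⟨m, n⟩ hm
    rw [Submodule.mem_prod] at hm
    simp only [LinearMap.add_apply, LinearMap.comp_apply, LinearMap.fst_apply, LinearMap.snd_apply,
      h3 k m hm.1, h3' k n hm.2, Finsupp.mapRange.linearMap_apply, Finsupp.mapRange_single]
    rw [← Finsupp.single_add]; simp

theorem isInternal_pi {ι : Type} [Fintype ι] {N : ι → Type} [∀ i, AddCommGroup (N i)]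
    [∀ i, Module 𝔽 (N i)] {gr : ∀ i, ℤ × ℤ → Submodule 𝔽 (N i)}
    (h : ∀ i, DirectSum.IsInternal (gr i)) :
    DirectSum.IsInternal (fun k => Submodule.pi Set.univ (fun i => gr i k)) := by
  classical
  choose c h1 h2 h3 using fun i => exists_comp (h i)
  refine isInternal_of_comp _ (∑ i, (Finsupp.mapRange.linearMap (LinearMap.single 𝔽 N i)) ∘ₗ
    c i ∘ₗ LinearMap.proj i) ?_ ?_ ?_
  · intro m
    have hadd : ∀ s : Finset ι, ∀ f : ι → (ℤ × ℤ →₀ (∀ i, N i)),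
        (∑ i ∈ s, f i).sum (fun _ x => x) = ∑ i ∈ s, (f i).sum (fun _ x => x) := by
      intro s f
      induction s using Finset.induction_on with
      | empty => simp
      | insert a s ha ih =>
        rw [Finset.sum_insert ha, Finset.sum_insert ha,
          Finsupp.sum_add_index' (by simp) (by simp), ih]
    simp only [LinearMap.sum_apply, LinearMap.comp_apply, LinearMap.proj_apply]
    rw [hadd]
    simp only [Finsupp.mapRange.linearMap_apply]
    have : ∀ i, (Finsupp.mapRange (LinearMap.single 𝔽 N i) (map_zero _) (c i (m i))).sum
        (fun _ x => x) = Pi.single i (m i) := by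
      intro i
      rw [Finsupp.sum_mapRange_index (by simp)]
      have e1 := congrArg (LinearMap.single 𝔽 N i) (h1 i (m i))
      rw [Finsupp.sum, map_sum] at e1
      rw [Finsupp.sum, e1]; rfl
    simp only [this]
    exact Finset.univ_sum_single m
  · intro m k
    rw [Submodule.mem_pi]
    intro i _
    simp only [LinearMap.sum_apply, LinearMap.comp_apply, LinearMap.proj_apply,
      Finsupp.finsetSum_apply, Finset.sum_apply, Finsupp.mapRange.linearMap_apply,
      Finsupp.mapRange_apply, LinearMap.coe_single]
    rw [Finset.sum_eq_single i (fun j _ hj => by simp [Pi.single_eq_of_ne (Ne.symm hj)]) (by simp)]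
    simpa using h2 i (m i) k
  · intro k m hm
    rw [Submodule.mem_pi] at hm
    simp only [LinearMap.sum_apply, LinearMap.comp_apply, LinearMap.proj_apply,
      Finsupp.mapRange.linearMap_apply]
    simp only [fun i => h3 i k (m i) (hm i trivial), Finsupp.mapRange_single]
    refine (map_sum (Finsupp.singleAddHom k) _ _).symm.trans ?_
    exact congrArg (Finsupp.single k) (Finset.univ_sum_single m)

/-- The grading of a tensor product by total degree. -/
def tensorGr {N : Type} [AddCommGroup N] [Module 𝔽 N]
    (gr : ℤ × ℤ → Submodule 𝔽 M) (gr' : ℤ × ℤ → Submodule 𝔽 N) (k : ℤ × ℤ) :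
    Submodule 𝔽 (M ⊗[𝔽] N) :=
  Submodule.span 𝔽 {t | ∃ i j : ℤ × ℤ, i + j = k ∧ ∃ m ∈ gr i, ∃ n ∈ gr' j, t = m ⊗ₜ[𝔽] n}

theorem exists_tensor_comp {N : Type} [AddCommGroup N] [Module 𝔽 N]
    {gr : ℤ × ℤ → Submodule 𝔽 M} {gr' : ℤ × ℤ → Submodule 𝔽 N}
    (h : DirectSum.IsInternal gr) (h' : DirectSum.IsInternal gr') :
    ∃ c : M ⊗[𝔽] N →ₗ[𝔽] (ℤ × ℤ →₀ M ⊗[𝔽] N), (∀ m, (c m).sum (fun _ x => x) = m) ∧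
      (∀ m k, c m k ∈ tensorGr gr gr' k) ∧
      (∀ k, ∀ m ∈ tensorGr gr gr' k, c m = Finsupp.single k m) := by
  classical
  obtain ⟨c, h1, h2, h3⟩ := exists_comp h
  obtain ⟨c', h1', h2', h3'⟩ := exists_comp h'
  let C : M ⊗[𝔽] N →ₗ[𝔽] (ℤ × ℤ →₀ M ⊗[𝔽] N) :=
    Finsupp.lmapDomain (M ⊗[𝔽] N) 𝔽 (fun p : (ℤ × ℤ) × (ℤ × ℤ) => p.1 + p.2) ∘ₗ
      (finsuppTensorFinsupp 𝔽 𝔽 M N (ℤ × ℤ) (ℤ × ℤ)).toLinearMap ∘ₗ TensorProduct.map c c'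
  have hC : ∀ i j, ∀ m ∈ gr i, ∀ n ∈ gr' j, C (m ⊗ₜ n) = Finsupp.single (i + j) (m ⊗ₜ n) := by
    intro i j m hm n hn
    simp [C, h3 i m hm, h3' j n hn]
  have hind : ∀ p : M ⊗[𝔽] N → Prop, p 0 → (∀ x y, p x → p y → p (x + y)) →
      (∀ i j, ∀ m ∈ gr i, ∀ n ∈ gr' j, p (m ⊗ₜ n)) → ∀ x, p x := by
    intro p p0 padd ph x
    induction x using TensorProduct.induction_on with
    | zero => exact p0
    | add x y hx hy => exact padd x y hx hy
    | tmul m n =>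
      have psum : ∀ {α : Type} (s : Finset α) (f : α → M ⊗[𝔽] N), (∀ a ∈ s, p (f a)) →
          p (∑ a ∈ s, f a) := fun s f hf => Finset.sum_induction f p padd p0 hf
      rw [← h1 m, ← h1' n, Finsupp.sum, Finsupp.sum, TensorProduct.sum_tmul]
      refine psum _ _ fun a _ => ?_
      rw [TensorProduct.tmul_sum]
      exact psum _ _ fun b _ => ph a b _ (h2 _ _) _ (h2' _ _)
  refine ⟨C, ?_, ?_, ?_⟩
  · refine hind _ (by simp) (fun x y hx hy => ?_) (fun i j m hm n hn => ?_)
    · rw [map_add, Finsupp.sum_add_index' (by simp) (by simp), hx, hy]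
    · rw [hC i j m hm n hn]; simp
  · refine hind _ (by simp) (fun x y hx hy k => ?_) (fun i j m hm n hn k => ?_)
    · rw [map_add]; exact add_mem (hx k) (hy k)
    · rw [hC i j m hm n hn]
      by_cases hk : i + j = k
      · subst hk; rw [Finsupp.single_eq_same]
        exact Submodule.subset_span ⟨i, j, rfl, m, hm, n, hn, rfl⟩
      · rw [Finsupp.single_eq_of_ne (Ne.symm hk)]; exact zero_mem _
  · intro k m hm
    induction hm using Submodule.span_induction with
    | mem x hx =>
      obtain ⟨i, j, rfl, m, hm, n, hn, rfl⟩ := hx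
      exact hC i j m hm n hn
    | zero => simp
    | add x y _ _ hx hy => rw [map_add, hx, hy, Finsupp.single_add]
    | smul a x _ hx => rw [map_smul, hx, Finsupp.smul_single]

theorem isInternal_tensor {N : Type} [AddCommGroup N] [Module 𝔽 N]
    {gr : ℤ × ℤ → Submodule 𝔽 M} {gr' : ℤ × ℤ → Submodule 𝔽 N}
    (h : DirectSum.IsInternal gr) (h' : DirectSum.IsInternal gr') :
    DirectSum.IsInternal (tensorGr gr gr') := by
  obtain ⟨c, h1, h2, h3⟩ := exists_tensor_comp h h'
  exact isInternal_of_comp _ c h1 h2 h3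

end Internal

/-! ### `q`-graded DG algebras and DG modules -/

/-- A `q`-graded DG algebra over `𝔽`: the first degree is cohomological, the second is the
`q`-degree, and the differential has degree `(1, 0)`. -/
structure QDGAlg where
  carrier : Type
  [ring : Ring carrier]
  [algebra : Algebra 𝔽 carrier]
  gr : ℤ × ℤ → Submodule 𝔽 carrier
  internal : DirectSum.IsInternal gr
  one_mem : (1 : carrier) ∈ gr 0
  mul_mem : ∀ {k l : ℤ × ℤ} {a b : carrier}, a ∈ gr k → b ∈ gr l → a * b ∈ gr (k + l)
  d : carrier →ₗ[𝔽] carrier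
  d_mem : ∀ {k : ℤ × ℤ} {a : carrier}, a ∈ gr k → d a ∈ gr (k + (1, 0))
  d_d : ∀ a, d (d a) = 0
  d_one : d 1 = 0
  leibniz : ∀ a b, d (a * b) = d a * b + a * d b

instance : CoeSort QDGAlg Type := ⟨QDGAlg.carrier⟩

attribute [instance] QDGAlg.ring QDGAlg.algebra

/-- A left `q`-graded DG module. -/
structure DGMod (A : QDGAlg) where
  carrier : Type
  [addCommGroup : AddCommGroup carrier]
  [moduleF : Module 𝔽 carrier]
  [module : Module A carrier]
  [tower : IsScalarTower 𝔽 A carrier]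
  gr : ℤ × ℤ → Submodule 𝔽 carrier
  internal : DirectSum.IsInternal gr
  smul_mem : ∀ {k l : ℤ × ℤ} {a : A} {m : carrier}, a ∈ A.gr k → m ∈ gr l → a • m ∈ gr (k + l)
  d : carrier →ₗ[𝔽] carrier
  d_mem : ∀ {k : ℤ × ℤ} {m : carrier}, m ∈ gr k → d m ∈ gr (k + (1, 0))
  d_d : ∀ m, d (d m) = 0
  leibniz : ∀ (a : A) m, d (a • m) = A.d a • m + a • d m

instance (A : QDGAlg) : CoeSort (DGMod A) Type := ⟨DGMod.carrier⟩

attribute [instance] DGMod.addCommGroup DGMod.moduleF DGMod.module DGMod.tower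

variable {A B : QDGAlg}

/-- The maps of left modules of degree `(i, 0)`. -/
def homDeg (M N : DGMod A) (i : ℤ) : AddSubgroup (M →ₗ[A] N) where
  carrier := {f | ∀ k, ∀ m ∈ M.gr k, f m ∈ N.gr (k + (i, 0))}
  zero_mem' := fun _ _ _ => zero_mem _
  add_mem' := fun hf hg k m hm => add_mem (hf k m hm) (hg k m hm)
  neg_mem' := fun hf k m hm => neg_mem (hf k m hm)

/-- The closed morphisms of degree `0`; the differential of `f` is `d ∘ f + f ∘ d`. -/
def Z0 (M N : DGMod A) : AddSubgroup (M →ₗ[A] N) where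
  carrier := {f | f ∈ homDeg M N 0 ∧ ∀ m, N.d (f m) + f (M.d m) = 0}
  zero_mem' := ⟨zero_mem _, fun m => by simp⟩
  add_mem' := fun hf hg => ⟨add_mem hf.1 hg.1, fun m => by
    have h1 := hf.2 m
    have h2 := hg.2 m
    simp only [LinearMap.add_apply, map_add]
    rw [add_add_add_comm, h1, h2, add_zero]⟩
  neg_mem' := fun hf => ⟨neg_mem hf.1, fun m => by
    have h1 := hf.2 m
    simp only [LinearMap.neg_apply, map_neg]
    rw [← neg_add, h1, neg_zero]⟩

/-- The exact morphisms of degree `0`, as a subgroup of the closed ones. -/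
def B0 (M N : DGMod A) : AddSubgroup (Z0 M N) where
  carrier := {f | ∃ h ∈ homDeg M N (-1), ∀ m, f.1 m = N.d (h m) + h (M.d m)}
  zero_mem' := ⟨0, zero_mem _, fun m => by simp⟩
  add_mem' := by
    rintro f g ⟨h, hh, ef⟩ ⟨h', hh', eg⟩
    refine ⟨h + h', add_mem hh hh', fun m => ?_⟩
    simp only [AddSubgroup.coe_add, LinearMap.add_apply, map_add, ef, eg]
    abel
  neg_mem' := by
    rintro f ⟨h, hh, ef⟩
    refine ⟨-h, neg_mem hh, fun m => ?_⟩
    simp only [AddSubgroup.coe_neg, LinearMap.neg_apply, map_neg, ef]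
    abel

theorem Z0_comm {M N : DGMod A} (f : Z0 M N) (m : M) : N.d (f.1 m) = f.1 (M.d m) := by
  have h := f.2.2 m
  rw [← neg_eq (f.1 (M.d m))]
  exact eq_neg_of_add_eq_zero_left h

theorem Z0_mem {M N : DGMod A} (f : Z0 M N) {k : ℤ × ℤ} {m : M} (hm : m ∈ M.gr k) :
    f.1 m ∈ N.gr k := by
  have h := f.2.1 k m hm
  rwa [show k + ((0 : ℤ), (0 : ℤ)) = k from add_zero k] at h

/-- Construct a closed morphism of degree `0`. -/
def zmk {M N : DGMod A} (f : M →ₗ[A] N) (h1 : ∀ k, ∀ m ∈ M.gr k, f m ∈ N.gr k)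
    (h2 : ∀ m, N.d (f m) = f (M.d m)) : Z0 M N :=
  ⟨f, fun k m hm => by
      rw [show k + ((0 : ℤ), (0 : ℤ)) = k from add_zero k]; exact h1 k m hm,
    fun m => by rw [h2 m, add_self]⟩

/-- The identity and the composition of closed morphisms. -/
def zid (M : DGMod A) : Z0 M M := zmk LinearMap.id (fun _ _ h => h) (fun _ => rfl)

def zcomp {M N P : DGMod A} (f : Z0 M N) (g : Z0 N P) : Z0 M P :=
  zmk (g.1 ∘ₗ f.1) (fun _ _ h => Z0_mem g (Z0_mem f h))
    (fun m => by simp only [LinearMap.comp_apply, Z0_comm])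

/-- The `0`-th homology category `H⁰(DG(A))`: its objects are those of `DG(A)`, its morphisms are
the closed morphisms of degree `0` modulo the exact ones. -/
structure Ho (A : QDGAlg) where
  of ::
  /-- The underlying DG module. -/
  obj : DGMod A

theorem comp_congr {M N P : DGMod A} {f f' : Z0 M N} {g g' : Z0 N P}
    (hf : -f + f' ∈ B0 M N) (hg : -g + g' ∈ B0 N P) :
    -(zcomp f g) + zcomp f' g' ∈ B0 M P := by
  obtain ⟨h, hh, e⟩ := hf
  obtain ⟨h', hh', e'⟩ := hg
  have e1 : ∀ m, f'.1 m = f.1 m + (N.d (h m) + h (M.d m)) := fun m => by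
    rw [← e m]; simp
  have e2 : ∀ m, g'.1 m = g.1 m + (P.d (h' m) + h' (N.d m)) := fun m => by
    rw [← e' m]; simp
  refine ⟨g'.1 ∘ₗ h + h' ∘ₗ f.1, ?_, fun m => ?_⟩
  · refine add_mem (fun k m hm => ?_) (fun k m hm => ?_)
    · exact Z0_mem g' (hh k m hm)
    · exact hh' k _ (Z0_mem f hm)
  · have e3 : g'.1 (f'.1 m) = g'.1 (f.1 m) + (P.d (g'.1 (h m)) + g'.1 (h (M.d m))) := by
      rw [e1, map_add, map_add, Z0_comm]
    simp only [AddSubgroup.coe_add, AddSubgroup.coe_neg, LinearMap.add_apply, LinearMap.neg_apply,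
      LinearMap.comp_apply, zcomp, zmk, map_add]
    rw [e3, e2 (f.1 m), ← Z0_comm f m]
    abel

instance : Category (Ho A) where
  Hom M N := Z0 M.obj N.obj ⧸ B0 M.obj N.obj
  id M := QuotientAddGroup.mk (zid M.obj)
  comp := fun {M N P} f g => Quotient.map₂ (fun (f : Z0 M.obj N.obj) (g : Z0 N.obj P.obj) => zcomp f g)
    (fun f f' hf g g' hg => by
      have hf' := QuotientAddGroup.leftRel_apply.1 hf
      have hg' := QuotientAddGroup.leftRel_apply.1 hg
      exact QuotientAddGroup.leftRel_apply.2 (comp_congr hf' hg')) f g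
  id_comp := by rintro M N ⟨f⟩; rfl
  comp_id := by rintro M N ⟨f⟩; rfl
  assoc := by rintro M N P Q ⟨f⟩ ⟨g⟩ ⟨h⟩; rfl

/-- The class of a closed morphism in the homology category. -/
def cls {M N : DGMod A} (f : Z0 M N) : Ho.of M ⟶ Ho.of N := QuotientAddGroup.mk f

theorem cls_surj {M N : Ho A} (f : M ⟶ N) : ∃ g : Z0 M.obj N.obj, cls g = f :=
  QuotientAddGroup.mk_surjective f

theorem cls_eq {M N : DGMod A} {f g : Z0 M N} (h : M →ₗ[A] N) (hh : h ∈ homDeg M N (-1))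
    (e : ∀ m, f.1 m = g.1 m + (N.d (h m) + h (M.d m))) : cls f = cls g := by
  have hm : -g + f ∈ B0 M N := ⟨h, hh, fun m => by simp [e m]⟩
  exact (QuotientAddGroup.eq.2 hm).symm

theorem cls_eq_iff {M N : DGMod A} {f g : Z0 M N} : cls f = cls g ↔
    ∃ h ∈ homDeg M N (-1), ∀ m, f.1 m = g.1 m + (N.d (h m) + h (M.d m)) := by
  constructor
  · intro e
    obtain ⟨h, hh, e⟩ := QuotientAddGroup.eq.1 (show QuotientAddGroup.mk g = _ from e.symm)
    refine ⟨h, hh, fun m => ?_⟩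
    rw [← e m]; simp
  · rintro ⟨h, hh, e⟩
    exact cls_eq h hh e

theorem cls_comp {M N P : DGMod A} (f : Z0 M N) (g : Z0 N P) :
    cls f ≫ cls g = cls (zcomp f g) := rfl

theorem cls_id (M : DGMod A) : cls (zid M) = 𝟙 (Ho.of M) := rfl

instance : Preadditive (Ho A) where
  homGroup M N := inferInstanceAs (AddCommGroup (Z0 M.obj N.obj ⧸ B0 M.obj N.obj))
  add_comp := by
    rintro M N P ⟨f⟩ ⟨f'⟩ ⟨g⟩
    exact congrArg QuotientAddGroup.mk (Subtype.ext (LinearMap.ext fun m => map_add g.1 _ _))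
  comp_add := by
    rintro M N P ⟨f⟩ ⟨g⟩ ⟨g'⟩
    rfl

theorem cls_add {M N : DGMod A} (f g : Z0 M N) : cls (f + g) = cls f + cls g := rfl

theorem cls_zero {M N : DGMod A} : cls (0 : Z0 M N) = 0 := rfl

theorem hom_add_self {M N : Ho A} (f : M ⟶ N) : f + f = 0 := by
  obtain ⟨g, rfl⟩ := cls_surj f
  have : g + g = 0 := Subtype.ext (LinearMap.ext fun m => add_self (g.1 m))
  exact (cls_add g g).symm.trans (by rw [this]; rfl)

theorem hom_neg {M N : Ho A} (f : M ⟶ N) : -f = f :=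
  neg_eq_of_add_eq_zero_left (hom_add_self f)

/-- The zero module. -/
def zeroMod (A : QDGAlg) : DGMod A where
  carrier := PUnit
  gr := fun _ => ⊤
  internal := isInternal_of_comp _ 0 (fun _ => rfl) (fun _ _ => trivial)
    (fun _ _ _ => Subsingleton.elim _ _)
  smul_mem := fun _ _ => trivial
  d := 0
  d_mem := fun _ => trivial
  d_d := fun _ => rfl
  leibniz := fun _ _ => rfl

theorem isZero_zeroMod : IsZero (Ho.of (zeroMod A)) := by
  rw [IsZero.iff_id_eq_zero]
  exact congrArg QuotientAddGroup.mk (Subtype.ext (LinearMap.ext fun m => rfl))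

instance : HasZeroObject (Ho A) := ⟨⟨_, isZero_zeroMod⟩⟩

/-! ### Shifts -/

/-- The shift of a DG module, `M.shift a` having `M^{k + a}` in degree `k`.  Thus `M[1]` is
`M.shift (1, 0)` and `M{1}` is `M.shift (0, 1)`. -/
abbrev DGMod.shift (M : DGMod A) (a : ℤ × ℤ) : DGMod A where
  carrier := M.carrier
  gr := fun k => M.gr (k + a)
  internal := isInternal_shift M.internal a
  smul_mem := fun {k l x m} hx hm => by
    have h := M.smul_mem hx hm
    rwa [← add_assoc] at h
  d := M.d
  d_mem := fun {k m} hm => by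
    have h := M.d_mem hm
    rwa [add_right_comm] at h
  d_d := M.d_d
  leibniz := M.leibniz

/-- Shifting a closed morphism: the underlying map is the same. -/
def zshift {M N : DGMod A} (f : Z0 M N) (a : ℤ × ℤ) : Z0 (M.shift a) (N.shift a) :=
  zmk (M := M.shift a) (N := N.shift a) f.1 (fun _ _ h => Z0_mem f h) (fun m => Z0_comm f m)

theorem shift_congr {M N : DGMod A} (a : ℤ × ℤ) {f g : Z0 M N} (h : -f + g ∈ B0 M N) :
    -(zshift f a) + zshift g a ∈ B0 (M.shift a) (N.shift a) := by
  obtain ⟨h, hh, e⟩ := h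
  refine ⟨h, fun k m hm => ?_, e⟩
  have := hh _ m hm
  rwa [add_right_comm] at this

/-- The shift functor `[a]` (and `{b}`) on the homology category. -/
def hoShift (A : QDGAlg) (a : ℤ × ℤ) : Ho A ⥤ Ho A where
  obj M := Ho.of (M.obj.shift a)
  map {M N} f := Quotient.map (fun f : Z0 M.obj N.obj => zshift f a)
    (fun _ _ h => QuotientAddGroup.leftRel_apply.2
      (shift_congr a (QuotientAddGroup.leftRel_apply.1 h))) f
  map_id _ := rfl
  map_comp := by rintro _ _ _ ⟨f⟩ ⟨g⟩; rfl

theorem hoShift_cls {M N : DGMod A} (a : ℤ × ℤ) (f : Z0 M N) :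
    (hoShift A a).map (cls f) = cls (zshift f a) := rfl

/-- The identity map between two gradings on the same module that agree. -/
def regrade {M : DGMod A} {a b : ℤ × ℤ} (h : a = b) : Z0 (M.shift a) (M.shift b) :=
  zmk (M := M.shift a) (N := M.shift b) LinearMap.id (fun k m hm => by subst h; exact hm)
    (fun _ => rfl)

def hoShiftZero (A : QDGAlg) : hoShift A (0, 0) ≅ 𝟭 (Ho A) :=
  NatIso.ofComponents (fun M =>
    { hom := cls (M := M.obj.shift (0, 0)) (N := M.obj) (zmk (M := M.obj.shift (0, 0)) (N := M.obj) LinearMap.id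
        (fun k m hm => by
          have h : m ∈ M.obj.gr (k + (0, 0)) := hm
          rwa [show k + ((0 : ℤ), (0 : ℤ)) = k from add_zero k] at h) (fun _ => rfl))
      inv := cls (M := M.obj) (N := M.obj.shift (0, 0)) (zmk (M := M.obj) (N := M.obj.shift (0, 0)) LinearMap.id
        (fun k m hm => by
          change m ∈ M.obj.gr (k + (0, 0))
          rwa [show k + ((0 : ℤ), (0 : ℤ)) = k from add_zero k]) (fun _ => rfl))
      hom_inv_id := rfl
      inv_hom_id := rfl })
    (by rintro M N ⟨f⟩; rfl)

def hoShiftAdd (A : QDGAlg) (a b c : ℤ × ℤ) (h : a + b = c) :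
    hoShift A c ≅ hoShift A a ⋙ hoShift A b :=
  NatIso.ofComponents (fun M =>
    { hom := cls (M := M.obj.shift c) (N := (M.obj.shift a).shift b) (zmk (M := M.obj.shift c) (N := (M.obj.shift a).shift b) LinearMap.id
        (fun k m hm => by
          have hm' : m ∈ M.obj.gr (k + c) := hm
          change m ∈ M.obj.gr (k + b + a)
          rwa [add_assoc, add_comm b a, h]) (fun _ => rfl))
      inv := cls (M := (M.obj.shift a).shift b) (N := M.obj.shift c) (zmk (M := (M.obj.shift a).shift b) (N := M.obj.shift c) LinearMap.id
        (fun k m hm => by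
          have hm' : m ∈ M.obj.gr (k + b + a) := hm
          change m ∈ M.obj.gr (k + c)
          rwa [add_assoc, add_comm b a, h] at hm') (fun _ => rfl))
      hom_inv_id := rfl
      inv_hom_id := rfl })
    (by rintro M N ⟨f⟩; rfl)

theorem eqToHom_shift (M : DGMod A) {a b : ℤ × ℤ} (h : a = b) :
    eqToHom (congrArg (fun c => Ho.of (M.shift c)) h) = cls (regrade h) := by
  subst h; rfl

instance : HasShift (Ho A) ℤ := hasShiftMk (Ho A) ℤ
  { F := fun n => hoShift A (n, 0)
    zero := hoShiftZero A
    add := fun n m => hoShiftAdd A (n, 0) (m, 0) (n + m, 0) (by simp)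
    assoc_hom_app := fun a b c X => by
      have e : ((a + b + c, 0) : ℤ × ℤ) = (a + (b + c), 0) := by rw [add_assoc]
      exact Eq.trans (by rfl) (congrArg (fun t => t ≫ _) (eqToHom_shift X.obj e).symm)
    zero_add_hom_app := fun n X => by
      have e : ((0 + n, 0) : ℤ × ℤ) = (n, 0) := by rw [zero_add]
      exact Eq.trans (by rfl) (congrArg (fun t => t ≫ _) (eqToHom_shift X.obj e).symm)
    add_zero_hom_app := fun n X => by
      have e : ((n + 0, 0) : ℤ × ℤ) = (n, 0) := by rw [add_zero]
      exact Eq.trans (by rfl) (congrArg (fun t => t ≫ _) (eqToHom_shift X.obj e).symm) }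

theorem shiftFunctor_eq (n : ℤ) : shiftFunctor (Ho A) n = hoShift A (n, 0) := rfl

instance (n : ℤ) : (shiftFunctor (Ho A) n).Additive where
  map_add := by
    intro M N f g
    obtain ⟨f, rfl⟩ := cls_surj f
    obtain ⟨g, rfl⟩ := cls_surj g
    rw [← cls_add]
    rfl

/-! ### Mapping cones and the triangulated structure -/

/-- The mapping cone `C(f) = N ⊕ M[1]` with `d (n, m) = (d n + f m, d m)`. -/
abbrev cone {M N : DGMod A} (f : Z0 M N) : DGMod A where
  carrier := N.carrier × M.carrier
  gr := fun k => (N.gr k).prod (M.gr (k + (1, 0)))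
  internal := isInternal_prod N.internal (isInternal_shift M.internal (1, 0))
  smul_mem := fun ha hm => ⟨N.smul_mem ha hm.1, (M.shift (1, 0)).smul_mem ha hm.2⟩
  d := (N.d ∘ₗ LinearMap.fst 𝔽 N M + (f.1.restrictScalars 𝔽) ∘ₗ LinearMap.snd 𝔽 N M).prod
    (M.d ∘ₗ LinearMap.snd 𝔽 N M)
  d_mem := fun {k m} hm => ⟨add_mem (N.d_mem hm.1) (Z0_mem f hm.2), (M.shift (1, 0)).d_mem hm.2⟩
  d_d := fun m => by
    refine Prod.ext ?_ ?_
    · change N.d (N.d m.1 + f.1 m.2) + f.1 (M.d m.2) = 0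
      rw [map_add, N.d_d, Z0_comm, zero_add, add_self]
    · exact M.d_d m.2
  leibniz := fun a m => by
    refine Prod.ext ?_ ?_
    · change N.d (a • m.1) + f.1 (a • m.2) = A.d a • m.1 + a • (N.d m.1 + f.1 m.2)
      rw [N.leibniz, map_smul, smul_add, add_assoc]
    · exact M.leibniz a m.2

theorem cone_d {M N : DGMod A} (f : Z0 M N) (x : cone f) :
    (cone f).d x = (N.d x.1 + f.1 x.2, M.d x.2) := rfl

/-- The inclusion `N ⟶ C(f)` and the projection `C(f) ⟶ M[1]`. -/
def coneIn {M N : DGMod A} (f : Z0 M N) : Z0 N (cone f) :=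
  zmk (M := N) (N := cone f) (LinearMap.inl A N M) (fun k n hn => ⟨hn, zero_mem _⟩)
    (fun n => by
      refine Prod.ext ?_ ?_
      · exact (congrArg (N.d n + ·) (map_zero f.1)).trans (add_zero _)
      · exact map_zero M.d)

def coneOut {M N : DGMod A} (f : Z0 M N) : Z0 (cone f) (M.shift (1, 0)) :=
  zmk (M := cone f) (N := M.shift (1, 0)) (LinearMap.snd A N M) (fun _ _ hn => hn.2)
    (fun _ => rfl)

/-- The standard triangle `M ⟶ N ⟶ C(f) ⟶ M[1]`. -/
abbrev coneTriangle {M N : DGMod A} (f : Z0 M N) : Pretriangulated.Triangle (Ho A) :=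
  Pretriangulated.Triangle.mk (X := Ho.of M) (Y := Ho.of N) (Z := Ho.of (cone f))
    (cls f) (cls (coneIn f)) (cls (coneOut f))

/-- The distinguished triangles are those isomorphic to a standard one. -/
def distTri (A : QDGAlg) : Set (Pretriangulated.Triangle (Ho A)) :=
  {T | ∃ (M N : DGMod A) (f : Z0 M N), Nonempty (T ≅ coneTriangle f)}

/-- Two closed maps inverse to each other up to homotopy give an isomorphism. -/
def isoOf {M N : DGMod A} (f : Z0 M N) (g : Z0 N M) (h1 : cls (zcomp f g) = cls (zid M))
    (h2 : cls (zcomp g f) = cls (zid N)) : Ho.of M ≅ Ho.of N where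
  hom := cls f
  inv := cls g
  hom_inv_id := h1
  inv_hom_id := h2

theorem shiftCompIsoId_hom (M : DGMod A) (a b : ℤ) (h : a + b = 0) :
    (shiftFunctorCompIsoId (Ho A) a b h).hom.app (Ho.of M) =
      cls (M := (M.shift (a, 0)).shift (b, 0)) (N := M)
        (zmk (M := (M.shift (a, 0)).shift (b, 0)) (N := M) LinearMap.id
          (fun k m hm => by
            have hm' : m ∈ M.gr (k + (b, 0) + (a, 0)) := hm
            rwa [add_assoc, show ((b, 0) + (a, 0) : ℤ × ℤ) = 0 by
              rw [Prod.mk_add_mk, add_comm, h]; rfl, add_zero] at hm') (fun _ => rfl)) := by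
  have e : ((0, 0) : ℤ × ℤ) = (a + b, 0) := by rw [h]
  simp only [shiftFunctorCompIsoId, shiftFunctorAdd', Iso.trans_hom, Iso.symm_hom,
    NatTrans.comp_app, Iso.trans_inv, eqToIso.inv, eqToHom_app]
  have e' := eqToHom_shift M e.symm
  refine Eq.trans (congrArg (fun t => (_ ≫ t) ≫ _) e') ?_
  rfl

theorem shiftCompIsoId_inv (M : DGMod A) (a b : ℤ) (h : a + b = 0) :
    (shiftFunctorCompIsoId (Ho A) a b h).inv.app (Ho.of M) =
      cls (M := M) (N := (M.shift (a, 0)).shift (b, 0))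
        (zmk (M := M) (N := (M.shift (a, 0)).shift (b, 0)) LinearMap.id
          (fun k m hm => by
            change m ∈ M.gr (k + (b, 0) + (a, 0))
            rwa [add_assoc, show ((b, 0) + (a, 0) : ℤ × ℤ) = 0 by
              rw [Prod.mk_add_mk, add_comm, h]; rfl, add_zero]) (fun _ => rfl)) := by
  have e : ((0, 0) : ℤ × ℤ) = (a + b, 0) := by rw [h]
  simp only [shiftFunctorCompIsoId, shiftFunctorAdd', Iso.trans_inv, Iso.symm_inv,
    NatTrans.comp_app, Iso.trans_hom, eqToIso.hom, eqToHom_app]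
  have e' := eqToHom_shift M e
  refine Eq.trans (congrArg (fun t => _ ≫ t ≫ _) e') ?_
  rfl

theorem contractible_dist (X : Ho A) : Pretriangulated.contractibleTriangle X ∈ distTri A := by
  refine ⟨X.obj, X.obj, zid X.obj, ⟨?_⟩⟩
  have hz : IsZero (Ho.of (cone (zid X.obj))) := by
    rw [IsZero.iff_id_eq_zero]
    refine cls_eq (M := cone (zid X.obj)) (N := cone (zid X.obj))
      ((LinearMap.inr A X.obj X.obj) ∘ₗ (LinearMap.fst A X.obj X.obj)) ?_ ?_
    · intro k m hm
      refine ⟨zero_mem _, ?_⟩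
      change m.1 ∈ X.obj.gr (k + (-1, 0) + (1, 0))
      rw [add_assoc, show ((-1, 0) + (1, 0) : ℤ × ℤ) = 0 from rfl, add_zero]
      exact hm.1
    · intro m
      refine Prod.ext ?_ ?_
      · change m.1 = 0 + ((X.obj.d 0 + m.1) + 0)
        simp
      · change m.2 = 0 + (X.obj.d m.1 + (X.obj.d m.1 + m.2))
        rw [← add_assoc (X.obj.d m.1), add_self]; simp
  have h0 : IsZero (Pretriangulated.contractibleTriangle X).obj₃ := isZero_zero (Ho A)
  refine Pretriangulated.Triangle.isoMk _ _ (Iso.refl _) (Iso.refl _) (h0.iso hz) ?_ ?_ ?_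
  · rfl
  · exact hz.eq_of_tgt _ _
  · exact h0.eq_of_src _ _

theorem rotate_cone {M N : DGMod A} (f : Z0 M N) : (coneTriangle f).rotate ∈ distTri A := by
  refine ⟨N, cone f, coneIn f, ⟨?_⟩⟩
  let u : Z0 (M.shift (1, 0)) (cone (coneIn f)) :=
    zmk (M := M.shift (1, 0)) (N := cone (coneIn f))
      (((LinearMap.inr A N M).prod f.1 : M →ₗ[A] (N × M) × N))
      (fun k m hm => ⟨⟨zero_mem _, hm⟩, Z0_mem f hm⟩)
      (fun m => by
        refine Prod.ext (Prod.ext ?_ ?_) ?_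
        · change (N.d 0 + f.1 m) + f.1 m = 0
          rw [map_zero, zero_add, add_self]
        · change M.d m + 0 = M.d m
          rw [add_zero]
        · exact Z0_comm f m)
  let v : Z0 (cone (coneIn f)) (M.shift (1, 0)) :=
    zmk (M := cone (coneIn f)) (N := M.shift (1, 0))
      (LinearMap.snd A N M ∘ₗ LinearMap.fst A (N × M) N)
      (fun k m hm => hm.1.2) (fun m => by
        change M.d m.1.2 = M.d m.1.2 + 0
        rw [add_zero])
  have huv : cls (zcomp v u) = cls (zid (cone (coneIn f))) := by
    refine cls_eq (M := cone (coneIn f)) (N := cone (coneIn f))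
      ((LinearMap.inr A (N × M) N) ∘ₗ (LinearMap.fst A N M) ∘ₗ (LinearMap.fst A (N × M) N)) ?_ ?_
    · intro k m hm
      refine ⟨zero_mem _, ?_⟩
      change m.1.1 ∈ N.gr (k + (-1, 0) + (1, 0))
      rw [add_assoc, show ((-1, 0) + (1, 0) : ℤ × ℤ) = 0 from rfl, add_zero]
      exact hm.1.1
    · rintro ⟨⟨n, m⟩, n'⟩
      refine Prod.ext (Prod.ext ?_ ?_) ?_
      · change 0 = n + (((N.d 0 + f.1 0) + n) + 0)
        simp [add_self]
      · change m = m + ((M.d 0 + 0) + 0)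
        simp
      · change f.1 m = n' + (N.d n + ((N.d n + f.1 m) + n'))
        rw [← add_assoc (N.d n), ← add_assoc (N.d n), add_self, zero_add, add_comm (f.1 m),
          ← add_assoc, add_self, zero_add]
  refine Pretriangulated.Triangle.isoMk _ _ (Iso.refl _) (Iso.refl _)
    (isoOf u v rfl huv) ?_ ?_ ?_
  · refine (Category.comp_id _).trans (Eq.trans ?_ (Category.id_comp _).symm)
    rfl
  · refine Eq.trans ?_ (Category.id_comp _).symm
    refine (cls_eq (M := cone f) (N := cone (coneIn f))
      ((LinearMap.inr A (N × M) N) ∘ₗ (LinearMap.fst A N M)) ?_ ?_)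
    · intro k m hm
      refine ⟨zero_mem _, ?_⟩
      change m.1 ∈ N.gr (k + (-1, 0) + (1, 0))
      rw [add_assoc, show ((-1, 0) + (1, 0) : ℤ × ℤ) = 0 from rfl, add_zero]
      exact hm.1
    · rintro ⟨n, m⟩
      refine Prod.ext (Prod.ext ?_ ?_) ?_
      · change 0 = n + (((N.d 0 + f.1 0) + n) + 0)
        simp [add_self]
      · change m = m + ((M.d 0 + 0) + 0)
        simp
      · change f.1 m = 0 + (N.d n + (N.d n + f.1 m))
        rw [← add_assoc (N.d n), add_self]; simp
  · refine (congrArg (fun t => t ≫ _) (hom_neg _)).trans ?_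
    refine (congrArg (fun t => _ ≫ t) ((shiftFunctor (Ho A) (1 : ℤ)).map_id _)).trans ?_
    refine (Category.comp_id _).trans ?_
    rfl

theorem invRotate_cone {M N : DGMod A} (f : Z0 M N) :
    (coneTriangle f).invRotate ∈ distTri A := by
  let w : Z0 ((cone f).shift (-1, 0)) M :=
    zmk (M := (cone f).shift (-1, 0)) (N := M) (LinearMap.snd A N M)
      (fun k m hm => by
        have h : m.2 ∈ M.gr (k + (-1, 0) + (1, 0)) := hm.2
        rwa [add_assoc, show ((-1, 0) + (1, 0) : ℤ × ℤ) = 0 from rfl, add_zero] at h)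
      (fun _ => rfl)
  refine ⟨_, _, w, ⟨?_⟩⟩
  have hcancel : ∀ k : ℤ × ℤ, k + (1, 0) + (-1, 0) = k := fun k => by
    rw [add_assoc, show ((1, 0) + (-1, 0) : ℤ × ℤ) = 0 from rfl, add_zero]
  let u : Z0 N (cone w) :=
    zmk (M := N) (N := cone w) (LinearMap.inr A M (N × M) ∘ₗ LinearMap.inl A N M)
      (fun k n hn => ⟨zero_mem _, by
        have : n ∈ N.gr (k + (1, 0) + (-1, 0)) := by rwa [hcancel]
        exact this, zero_mem _⟩)
      (fun n => by
        refine Prod.ext ?_ (Prod.ext ?_ ?_)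
        · change M.d 0 + 0 = 0
          simp
        · change N.d n + f.1 0 = N.d n
          simp
        · change M.d 0 = 0
          simp)
  let v : Z0 (cone w) N :=
    zmk (M := cone w) (N := N) (LinearMap.coprod f.1 (LinearMap.fst A N M))
      (fun k x hx => by
        have h : x.2.1 ∈ N.gr (k + (1, 0) + (-1, 0)) := hx.2.1
        rw [hcancel] at h
        exact add_mem (Z0_mem f hx.1) h)
      (fun x => by
        change N.d (f.1 x.1 + x.2.1) = f.1 (M.d x.1 + x.2.2) + (N.d x.2.1 + f.1 x.2.2)
        rw [map_add, map_add, Z0_comm, add_comm (N.d x.2.1), add_assoc, ← add_assoc (f.1 x.2.2),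
          add_self, zero_add])
  have hvu : cls (zcomp v u) = cls (zid (cone w)) := by
    refine cls_eq (M := cone w) (N := cone w)
      (LinearMap.inr A M (N × M) ∘ₗ LinearMap.inr A N M ∘ₗ LinearMap.fst A M (N × M)) ?_ ?_
    · intro k m hm
      refine ⟨zero_mem _, zero_mem _, ?_⟩
      change m.1 ∈ M.gr (k + (-1, 0) + (1, 0) + (-1, 0) + (1, 0))
      rw [hcancel, add_assoc, show ((-1, 0) + (1, 0) : ℤ × ℤ) = 0 from rfl, add_zero]
      exact hm.1
    · rintro ⟨m, n, m'⟩
      refine Prod.ext ?_ (Prod.ext ?_ ?_)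
      · change 0 = m + ((M.d 0 + m) + 0)
        simp [add_self]
      · change f.1 m + n = n + ((N.d 0 + f.1 m) + 0)
        simp [add_comm]
      · change 0 = m' + (M.d m + (M.d m + m'))
        rw [← add_assoc (M.d m), add_self, zero_add, add_self]
  have huv : cls (zcomp u v) = cls (zid N) := by
    refine congrArg cls (Subtype.ext (LinearMap.ext fun n => ?_))
    change f.1 0 + n = n
    simp
  refine Pretriangulated.Triangle.isoMk _ _ (Iso.refl _) (Iso.refl _)
    (isoOf u v huv hvu) ?_ ?_ ?_
  · refine (Category.comp_id _).trans (Eq.trans ?_ (Category.id_comp _).symm)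
    refine (hom_neg _).trans ?_
    refine (congrArg (fun t => _ ≫ t) (shiftCompIsoId_hom M 1 (-1) (by norm_num))).trans ?_
    rfl
  · refine Eq.trans ?_ (Category.id_comp _).symm
    refine (cls_eq (M := M) (N := cone w)
      (LinearMap.inr A M (N × M) ∘ₗ LinearMap.inr A N M) ?_ ?_)
    · intro k m hm
      refine ⟨zero_mem _, zero_mem _, ?_⟩
      change m ∈ M.gr (k + (-1, 0) + (1, 0) + (-1, 0) + (1, 0))
      rw [hcancel, add_assoc, show ((-1, 0) + (1, 0) : ℤ × ℤ) = 0 from rfl, add_zero]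
      exact hm
    · intro m
      refine Prod.ext ?_ (Prod.ext ?_ ?_)
      · change 0 = m + ((M.d 0 + m) + 0)
        simp [add_self]
      · change f.1 m = 0 + ((N.d 0 + f.1 m) + 0)
        simp
      · change 0 = 0 + (M.d m + M.d m)
        rw [add_self, add_zero]
  · refine (congrArg (fun t => _ ≫ t) ((shiftFunctor (Ho A) (1 : ℤ)).map_id _)).trans ?_
    refine (Category.comp_id _).trans ?_
    refine (congrArg (fun t => _ ≫ t)
      (shiftCompIsoId_inv (cone f) (-1) 1 (by norm_num))).trans ?_
    rfl

theorem dist_of_iso {T T' : Pretriangulated.Triangle (Ho A)} (h : T ∈ distTri A) (e : T' ≅ T) :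
    T' ∈ distTri A := by
  obtain ⟨M, N, f, ⟨e'⟩⟩ := h
  exact ⟨M, N, f, ⟨e ≪≫ e'⟩⟩

theorem complete_cone {M N M' N' : DGMod A} (f : Z0 M N) (f' : Z0 M' N')
    (a : Ho.of M ⟶ Ho.of M') (b : Ho.of N ⟶ Ho.of N') (h : cls f ≫ b = a ≫ cls f') :
    ∃ c : Ho.of (cone f) ⟶ Ho.of (cone f'), cls (coneIn f) ≫ c = b ≫ cls (coneIn f') ∧
      cls (coneOut f) ≫ (hoShift A (1, 0)).map a = c ≫ cls (coneOut f') := by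
  obtain ⟨a, rfl⟩ := cls_surj a
  obtain ⟨b, rfl⟩ := cls_surj b
  obtain ⟨s, hs, e⟩ := cls_eq_iff.1 h
  have e' : ∀ m, b.1 (f.1 m) = f'.1 (a.1 m) + (N'.d (s m) + s (M.d m)) := e
  refine ⟨cls (zmk (M := cone f) (N := cone f')
    ((LinearMap.coprod b.1 s).prod (a.1 ∘ₗ LinearMap.snd A N M)) (fun k x hx => ?_)
      (fun x => ?_)), ?_, ?_⟩
  · refine ⟨add_mem (Z0_mem b hx.1) ?_, ?_⟩
    · have h := hs _ x.2 hx.2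
      rwa [add_assoc, show ((1, 0) + (-1, 0) : ℤ × ℤ) = 0 from rfl, add_zero] at h
    · exact Z0_mem a (k := k + (1, 0)) hx.2
  · obtain ⟨n, m⟩ := x
    refine Prod.ext ?_ ?_
    · change N'.d (b.1 n + s m) + f'.1 (a.1 m) = b.1 (N.d n + f.1 m) + s (M.d m)
      rw [map_add, map_add, e', Z0_comm]
      have h2 := add_self (s (M.d m))
      calc _ = b.1 (N.d n) + (f'.1 (a.1 m) + (N'.d (s m) + 0)) := by abel
        _ = _ := by rw [← h2]; abel
    · exact Z0_comm a m
  · refine congrArg cls (Subtype.ext (LinearMap.ext fun n => ?_))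
    refine Prod.ext ?_ ?_
    · change b.1 n + s 0 = b.1 n
      simp
    · change a.1 0 = 0
      simp
  · rfl

theorem complete_of_iso {T T' S S' : Pretriangulated.Triangle (Ho A)} (e : T ≅ S) (e' : T' ≅ S')
    (H : ∀ (a : S.obj₁ ⟶ S'.obj₁) (b : S.obj₂ ⟶ S'.obj₂), S.mor₁ ≫ b = a ≫ S'.mor₁ →
      ∃ c : S.obj₃ ⟶ S'.obj₃, S.mor₂ ≫ c = b ≫ S'.mor₂ ∧
        S.mor₃ ≫ (shiftFunctor (Ho A) (1 : ℤ)).map a = c ≫ S'.mor₃)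
    (a : T.obj₁ ⟶ T'.obj₁) (b : T.obj₂ ⟶ T'.obj₂) (h : T.mor₁ ≫ b = a ≫ T'.mor₁) :
    ∃ c : T.obj₃ ⟶ T'.obj₃, T.mor₂ ≫ c = b ≫ T'.mor₂ ∧
      T.mor₃ ≫ (shiftFunctor (Ho A) (1 : ℤ)).map a = c ≫ T'.mor₃ := by
  obtain ⟨c, hc1, hc2⟩ := H (e.inv.hom₁ ≫ a ≫ e'.hom.hom₁) (e.inv.hom₂ ≫ b ≫ e'.hom.hom₂) (by
    have h1 := e.inv.comm₁
    have h2 := e'.hom.comm₁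
    rw [reassoc_of% h1, reassoc_of% h, h2]; simp)
  refine ⟨e.hom.hom₃ ≫ c ≫ e'.inv.hom₃, ?_, ?_⟩
  · have h1 := e.hom.comm₂
    have h2 := e'.inv.comm₂
    rw [reassoc_of% h1, reassoc_of% hc1, h2]; simp
  · have h1 := e.hom.comm₃
    have h2 := e'.inv.comm₃
    rw [Category.assoc, Category.assoc, ← h2, ← reassoc_of% hc2, ← reassoc_of% h1]
    simp only [← Functor.map_comp]
    simp

instance : Pretriangulated (Ho A) where
  distinguishedTriangles := distTri A
  isomorphic_distinguished := fun _ h _ e => dist_of_iso h e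
  contractible_distinguished := contractible_dist
  distinguished_cocone_triangle := fun {X Y} f => by
    obtain ⟨f, rfl⟩ := cls_surj f
    exact ⟨Ho.of (cone f), cls (coneIn f), cls (coneOut f), X.obj, Y.obj, f, ⟨Iso.refl _⟩⟩
  rotate_distinguished_triangle := fun T => by
    constructor
    · rintro ⟨M, N, f, ⟨e⟩⟩
      exact dist_of_iso (rotate_cone f) ((Pretriangulated.rotate (Ho A)).mapIso e)
    · rintro ⟨M, N, f, ⟨e⟩⟩
      exact dist_of_iso (invRotate_cone f) ((Pretriangulated.rotCompInvRot).app T ≪≫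
        (Pretriangulated.invRotate (Ho A)).mapIso e)
  complete_distinguished_triangle_morphism := by
    rintro T T' ⟨M, N, f, ⟨e⟩⟩ ⟨M', N', f', ⟨e'⟩⟩ a b h
    exact complete_of_iso e e' (fun a b h => complete_cone f f' a b h) a b h

/-! ### DG bimodules and tensor products over a DG algebra -/

/-- A `q`-graded DG `(B, A)`-bimodule. -/
structure DGBimod (B A : QDGAlg) where
  carrier : Type
  [addCommGroup : AddCommGroup carrier]
  [moduleF : Module 𝔽 carrier]
  [left : Module B carrier]
  [right : Module (A.carrier)ᵐᵒᵖ carrier]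
  [comm : SMulCommClass B (A.carrier)ᵐᵒᵖ carrier]
  [towerLeft : IsScalarTower 𝔽 B carrier]
  [towerRight : IsScalarTower 𝔽 (A.carrier)ᵐᵒᵖ carrier]
  gr : ℤ × ℤ → Submodule 𝔽 carrier
  internal : DirectSum.IsInternal gr
  smul_mem : ∀ {k l : ℤ × ℤ} {b : B} {t : carrier}, b ∈ B.gr k → t ∈ gr l → b • t ∈ gr (k + l)
  mul_mem : ∀ {k l : ℤ × ℤ} {a : A} {t : carrier}, t ∈ gr k → a ∈ A.gr l →
    MulOpposite.op a • t ∈ gr (k + l)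
  d : carrier →ₗ[𝔽] carrier
  d_mem : ∀ {k : ℤ × ℤ} {t : carrier}, t ∈ gr k → d t ∈ gr (k + (1, 0))
  d_d : ∀ t, d (d t) = 0
  leibniz : ∀ (b : B) t, d (b • t) = B.d b • t + b • d t
  leibniz_right : ∀ (a : A) t,
    d (MulOpposite.op a • t) = MulOpposite.op a • d t + MulOpposite.op (A.d a) • t

instance (B A : QDGAlg) : CoeSort (DGBimod B A) Type := ⟨DGBimod.carrier⟩

attribute [instance] DGBimod.addCommGroup DGBimod.moduleF DGBimod.left DGBimod.right DGBimod.comm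
  DGBimod.towerLeft DGBimod.towerRight

theorem internal_induction {M : Type} [AddCommGroup M] [Module 𝔽 M] {gr : ℤ × ℤ → Submodule 𝔽 M}
    (h : DirectSum.IsInternal gr) {p : M → Prop} (p0 : p 0) (padd : ∀ x y, p x → p y → p (x + y))
    (ph : ∀ k, ∀ m ∈ gr k, p m) (m : M) : p m := by
  obtain ⟨c, h1, h2, _⟩ := exists_comp h
  rw [← h1 m, Finsupp.sum]
  exact Finset.sum_induction _ p padd p0 fun k _ => ph k _ (h2 m k)

theorem isInternal_map {M Q : Type} [AddCommGroup M] [Module 𝔽 M] [AddCommGroup Q] [Module 𝔽 Q]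
    {gr : ℤ × ℤ → Submodule 𝔽 M} (h : DirectSum.IsInternal gr) (π : M →ₗ[𝔽] Q)
    (hπ : Function.Surjective π)
    (hk : ∀ m, π m = 0 → m ∈ Submodule.span 𝔽 {w | π w = 0 ∧ ∃ k, w ∈ gr k}) :
    DirectSum.IsInternal (fun k => (gr k).map π) := by
  obtain ⟨c, h1, h2, h3⟩ := exists_comp h
  obtain ⟨σ, hσ⟩ := π.exists_rightInverse_of_surjective (LinearMap.range_eq_top.2 hπ)
  have hσ' : ∀ q, π (σ q) = q := fun q => LinearMap.congr_fun hσ q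
  have key : ∀ m, π m = 0 → Finsupp.mapRange.linearMap π (c m) = 0 := by
    intro m hm
    induction hk m hm using Submodule.span_induction with
    | mem x hx =>
      obtain ⟨hx0, k, hx⟩ := hx
      rw [h3 k x hx, Finsupp.mapRange.linearMap_apply, Finsupp.mapRange_single, hx0,
        Finsupp.single_zero]
    | zero => simp
    | add x y hx' hy' hx hy =>
      have e : ∀ z ∈ Submodule.span 𝔽 {w | π w = 0 ∧ ∃ k, w ∈ gr k}, π z = 0 := by
        intro z hz
        have : Submodule.span 𝔽 {w | π w = 0 ∧ ∃ k, w ∈ gr k} ≤ LinearMap.ker π :=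
          Submodule.span_le.2 fun w hw => hw.1
        exact this hz
      rw [map_add, map_add, hx (e x hx'), hy (e y hy'), add_zero]
    | smul a x hx' hx =>
      have e : π x = 0 := by
        have : Submodule.span 𝔽 {w | π w = 0 ∧ ∃ k, w ∈ gr k} ≤ LinearMap.ker π :=
          Submodule.span_le.2 fun w hw => hw.1
        exact this hx'
      rw [map_smul, map_smul, hx e, smul_zero]
  refine isInternal_of_comp _ (Finsupp.mapRange.linearMap π ∘ₗ c ∘ₗ σ) ?_ ?_ ?_
  · intro q
    rw [LinearMap.comp_apply, LinearMap.comp_apply, Finsupp.mapRange.linearMap_apply,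
      Finsupp.sum_mapRange_index (by simp)]
    have e := congrArg π (h1 (σ q))
    rw [Finsupp.sum, map_sum, hσ'] at e
    exact e
  · intro q k
    exact ⟨_, h2 (σ q) k, by simp⟩
  · rintro k _ ⟨m, hm, rfl⟩
    have e := key (σ (π m) - m) (by rw [map_sub, hσ', sub_self])
    rw [map_sub, map_sub, sub_eq_zero, h3 k m hm] at e
    rw [LinearMap.comp_apply, LinearMap.comp_apply, e]
    simp

section Tensor

variable (T : DGBimod B A)

/-- The relations `t a ⊗ n = t ⊗ a n` in `T ⊗ N`. -/
def balanced (N : DGMod A) : Submodule B (T ⊗[𝔽] N) :=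
  Submodule.span B {w | ∃ (t : T) (a : A) (n : N), w = (MulOpposite.op a • t) ⊗ₜ n - t ⊗ₜ (a • n)}

/-- The differential of the tensor product over `𝔽`. -/
def tensorD {M N : Type} [AddCommGroup M] [Module 𝔽 M] [AddCommGroup N] [Module 𝔽 N]
    (d : M →ₗ[𝔽] M) (d' : N →ₗ[𝔽] N) : M ⊗[𝔽] N →ₗ[𝔽] M ⊗[𝔽] N :=
  TensorProduct.map d LinearMap.id + TensorProduct.map LinearMap.id d'

theorem tensorD_tmul {M N : Type} [AddCommGroup M] [Module 𝔽 M] [AddCommGroup N] [Module 𝔽 N]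
    (d : M →ₗ[𝔽] M) (d' : N →ₗ[𝔽] N) (m : M) (n : N) :
    tensorD d d' (m ⊗ₜ n) = d m ⊗ₜ n + m ⊗ₜ d' n := rfl

theorem tensorD_mem {M N : Type} [AddCommGroup M] [Module 𝔽 M] [AddCommGroup N] [Module 𝔽 N]
    {d : M →ₗ[𝔽] M} {d' : N →ₗ[𝔽] N} {gr : ℤ × ℤ → Submodule 𝔽 M} {gr' : ℤ × ℤ → Submodule 𝔽 N}
    (h : ∀ k, ∀ m ∈ gr k, d m ∈ gr (k + (1, 0))) (h' : ∀ k, ∀ n ∈ gr' k, d' n ∈ gr' (k + (1, 0)))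
    (k : ℤ × ℤ) (x : M ⊗[𝔽] N) (hx : x ∈ tensorGr gr gr' k) :
    tensorD d d' x ∈ tensorGr gr gr' (k + (1, 0)) := by
  induction hx using Submodule.span_induction with
  | mem x hx =>
    obtain ⟨i, j, rfl, m, hm, n, hn, rfl⟩ := hx
    rw [tensorD_tmul]
    refine add_mem (Submodule.subset_span ⟨i + (1, 0), j, add_right_comm _ _ _, _, h i m hm, n, hn,
      rfl⟩) (Submodule.subset_span ⟨i, j + (1, 0), (add_assoc _ _ _).symm, m, hm, _, h' j n hn, rfl⟩)
  | zero => rw [map_zero]; exact zero_mem _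
  | add x y _ _ hx hy => rw [map_add]; exact add_mem hx hy
  | smul a x _ hx => rw [map_smul]; exact Submodule.smul_mem _ _ hx

theorem tensorD_tensorD {M N : Type} [AddCommGroup M] [Module 𝔽 M] [AddCommGroup N] [Module 𝔽 N]
    {d : M →ₗ[𝔽] M} {d' : N →ₗ[𝔽] N} (h : ∀ m, d (d m) = 0) (h' : ∀ n, d' (d' n) = 0)
    (x : M ⊗[𝔽] N) : tensorD d d' (tensorD d d' x) = 0 := by
  induction x using TensorProduct.induction_on with
  | zero => simp
  | add x y hx hy => rw [map_add, map_add, hx, hy, add_zero]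
  | tmul m n =>
    rw [tensorD_tmul, map_add, tensorD_tmul, tensorD_tmul, h, h', TensorProduct.zero_tmul,
      TensorProduct.tmul_zero, zero_add, add_zero, add_self]

theorem tensorD_smul (N : DGMod A) (b : B) (x : T ⊗[𝔽] N) :
    tensorD T.d N.d (b • x) = B.d b • x + b • tensorD T.d N.d x := by
  induction x using TensorProduct.induction_on with
  | zero => simp
  | add x y hx hy => rw [smul_add, map_add, hx, hy, map_add, smul_add, smul_add]; abel
  | tmul m n =>
    simp only [TensorProduct.smul_tmul', tensorD_tmul, T.leibniz, TensorProduct.add_tmul, smul_add,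
      add_assoc]

theorem tensorGr_smul (N : DGMod A) {k l : ℤ × ℤ} {b : B} {x : T ⊗[𝔽] N} (hb : b ∈ B.gr k)
    (hx : x ∈ tensorGr T.gr N.gr l) : b • x ∈ tensorGr T.gr N.gr (k + l) := by
  induction hx using Submodule.span_induction with
  | mem x hx =>
    obtain ⟨i, j, rfl, m, hm, n, hn, rfl⟩ := hx
    exact Submodule.subset_span ⟨k + i, j, add_assoc _ _ _, _, T.smul_mem hb hm, n, hn, rfl⟩
  | zero => rw [smul_zero]; exact zero_mem _
  | add x y _ _ hx hy => rw [smul_add]; exact add_mem hx hy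
  | smul a x _ hx => rw [smul_comm]; exact Submodule.smul_mem _ _ hx

theorem balanced_d (N : DGMod A) (w : T ⊗[𝔽] N) (hw : w ∈ balanced T N) :
    tensorD T.d N.d w ∈ balanced T N := by
  induction hw using Submodule.span_induction with
  | mem x hx =>
    obtain ⟨t, a, n, rfl⟩ := hx
    have h1 : ∀ (t : T) (a : A) (n : N),
        (MulOpposite.op a • t) ⊗ₜ[𝔽] n - t ⊗ₜ (a • n) ∈ balanced T N :=
      fun t a n => Submodule.subset_span ⟨t, a, n, rfl⟩
    have h2 := add_mem (add_mem (h1 (T.d t) a n) (h1 t (A.d a) n)) (h1 t a (N.d n))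
    refine (congrArg (· ∈ balanced T N) ?_).mpr h2
    rw [map_sub, tensorD_tmul, tensorD_tmul, T.leibniz_right, N.leibniz, TensorProduct.add_tmul,
      TensorProduct.tmul_add]
    abel
  | zero => rw [map_zero]; exact zero_mem _
  | add x y _ _ hx hy => rw [map_add]; exact add_mem hx hy
  | smul b x hx' hx =>
    rw [tensorD_smul]
    exact add_mem (Submodule.smul_mem _ _ hx') (Submodule.smul_mem _ _ hx)

theorem balanced_homog_smul (N : DGMod A) (x : T ⊗[𝔽] N)
    (hx : x ∈ Submodule.span 𝔽 {w | w ∈ balanced T N ∧ ∃ k, w ∈ tensorGr T.gr N.gr k}) (b : B) :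
    b • x ∈ Submodule.span 𝔽 {w | w ∈ balanced T N ∧ ∃ k, w ∈ tensorGr T.gr N.gr k} := by
  induction hx using Submodule.span_induction with
  | mem x hx =>
    obtain ⟨hx, k, hk⟩ := hx
    refine internal_induction (p := fun b : B => b • x ∈ Submodule.span 𝔽
      {w | w ∈ balanced T N ∧ ∃ k, w ∈ tensorGr T.gr N.gr k}) B.internal ?_ ?_ ?_ b
    · rw [zero_smul]; exact zero_mem _
    · intro b b' h h'; rw [add_smul]; exact add_mem h h'
    · intro i b hb
      exact Submodule.subset_span ⟨Submodule.smul_mem _ _ hx, i + k, tensorGr_smul T N hb hk⟩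
  | zero => rw [smul_zero]; exact zero_mem _
  | add x y _ _ hx hy => rw [smul_add]; exact add_mem hx hy
  | smul a x _ hx => rw [smul_comm]; exact Submodule.smul_mem _ _ hx

theorem balanced_homog (N : DGMod A) (w : T ⊗[𝔽] N) (hw : w ∈ balanced T N) :
    w ∈ Submodule.span 𝔽 {w | w ∈ balanced T N ∧ ∃ k, w ∈ tensorGr T.gr N.gr k} := by
  set H := Submodule.span 𝔽 {w | w ∈ balanced T N ∧ ∃ k, w ∈ tensorGr T.gr N.gr k} with hH
  induction hw using Submodule.span_induction with
  | mem x hx =>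
    obtain ⟨t, a, n, rfl⟩ := hx
    refine internal_induction (p := fun t => ∀ (a : A) (n : N),
      (MulOpposite.op a • t) ⊗ₜ[𝔽] n - t ⊗ₜ (a • n) ∈ H) T.internal ?_ ?_ ?_ t a n
    · intro a n; simp
    · intro t t' h h' a n
      have e := add_mem (h a n) (h' a n)
      rw [smul_add, TensorProduct.add_tmul, TensorProduct.add_tmul, add_sub_add_comm]
      exact e
    · intro i t ht a
      refine internal_induction (p := fun a => ∀ n : N,
        (MulOpposite.op a • t) ⊗ₜ[𝔽] n - t ⊗ₜ (a • n) ∈ H) A.internal ?_ ?_ ?_ a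
      · intro n; simp
      · intro a a' h h' n
        have e := add_mem (h n) (h' n)
        rw [MulOpposite.op_add, add_smul, add_smul, TensorProduct.add_tmul, TensorProduct.tmul_add,
          add_sub_add_comm]
        exact e
      · intro j a ha n
        refine internal_induction (p := fun n =>
          (MulOpposite.op a • t) ⊗ₜ[𝔽] n - t ⊗ₜ (a • n) ∈ H) N.internal ?_ ?_ ?_ n
        · simp
        · intro n n' h h'
          have e := add_mem h h'
          rw [smul_add, TensorProduct.tmul_add, TensorProduct.tmul_add, add_sub_add_comm]
          exact e
        · intro l n hn
          refine Submodule.subset_span ⟨Submodule.subset_span ⟨t, a, n, rfl⟩, i + j + l, ?_⟩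
          exact sub_mem (Submodule.subset_span ⟨i + j, l, rfl, _, T.mul_mem ht ha, n, hn, rfl⟩)
            (Submodule.subset_span ⟨i, j + l, (add_assoc _ _ _).symm, t, ht, _,
              N.smul_mem ha hn, rfl⟩)
  | zero => exact zero_mem _
  | add x y _ _ hx hy => exact add_mem hx hy
  | smul b x _ hx =>
    have key : ∀ x ∈ H, ∀ b : B, b • x ∈ H := balanced_homog_smul T N
    exact key x hx b

end Tensor

section Tensor

variable (T : DGBimod B A)

/-- The projection `T ⊗ N ⟶ T ⊗_A N`. -/
def tensorMk (N : DGMod A) : T ⊗[𝔽] N →ₗ[𝔽] (T ⊗[𝔽] N) ⧸ balanced T N :=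
  (balanced T N).mkQ.restrictScalars 𝔽

theorem tensorMk_surj (N : DGMod A) : Function.Surjective (tensorMk T N) := by
  rintro ⟨x⟩
  exact ⟨x, rfl⟩

theorem tensorMk_eq_zero (N : DGMod A) (w : T ⊗[𝔽] N) :
    tensorMk T N w = 0 ↔ w ∈ balanced T N := Submodule.Quotient.mk_eq_zero _

theorem tensorMk_smul (N : DGMod A) (b : B) (w : T ⊗[𝔽] N) :
    tensorMk T N (b • w) = b • tensorMk T N w := rfl

/-- The grading and the differential of `T ⊗_A N`. -/
def tensorModGr (N : DGMod A) (k : ℤ × ℤ) : Submodule 𝔽 ((T ⊗[𝔽] N) ⧸ balanced T N) :=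
  (tensorGr T.gr N.gr k).map (tensorMk T N)

theorem tensorModGr_internal (N : DGMod A) : DirectSum.IsInternal (tensorModGr T N) :=
  isInternal_map (isInternal_tensor T.internal N.internal) (tensorMk T N) (tensorMk_surj T N)
    (fun w hw => by
      refine Submodule.span_mono ?_ (balanced_homog T N w ((tensorMk_eq_zero T N w).1 hw))
      rintro x ⟨hx, hk⟩
      exact ⟨(tensorMk_eq_zero T N x).2 hx, hk⟩)

def tensorModD (N : DGMod A) :
    (T ⊗[𝔽] N) ⧸ balanced T N →ₗ[𝔽] (T ⊗[𝔽] N) ⧸ balanced T N where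
  toFun := Quotient.lift (fun x => tensorMk T N (tensorD T.d N.d x)) (fun x y h => by
    have h' := balanced_d T N _ ((Submodule.quotientRel_def _).1 h)
    rw [map_sub] at h'
    have h2 := (tensorMk_eq_zero T N _).2 h'
    rw [map_sub] at h2
    exact sub_eq_zero.1 h2)
  map_add' := by
    rintro ⟨x⟩ ⟨y⟩
    exact (congrArg (tensorMk T N) (map_add (tensorD T.d N.d) x y)).trans (map_add _ _ _)
  map_smul' := by
    rintro a ⟨x⟩
    exact (congrArg (tensorMk T N) (map_smul (tensorD T.d N.d) a x)).trans (map_smul _ _ _)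

theorem tensorModD_mk (N : DGMod A) (x : T ⊗[𝔽] N) :
    tensorModD T N (tensorMk T N x) = tensorMk T N (tensorD T.d N.d x) := rfl

/-- The tensor product `T ⊗_A N` of a DG bimodule and a DG module. -/
abbrev tensorMod (N : DGMod A) : DGMod B where
  carrier := (T ⊗[𝔽] N) ⧸ balanced T N
  gr := tensorModGr T N
  internal := tensorModGr_internal T N
  smul_mem := by
    rintro k l b _ hb ⟨x, hx, rfl⟩
    exact ⟨b • x, tensorGr_smul T N hb hx, tensorMk_smul T N b x⟩
  d := tensorModD T N
  d_mem := by
    rintro k _ ⟨x, hx, rfl⟩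
    exact ⟨tensorD T.d N.d x, tensorD_mem (fun _ _ h => T.d_mem h) (fun _ _ h => N.d_mem h) k x hx,
      rfl⟩
  d_d := by
    intro x
    obtain ⟨x, rfl⟩ := tensorMk_surj T N x
    rw [tensorModD_mk, tensorModD_mk, tensorD_tensorD T.d_d N.d_d, map_zero]
  leibniz := by
    intro b x
    obtain ⟨x, rfl⟩ := tensorMk_surj T N x
    rw [← tensorMk_smul, tensorModD_mk, tensorD_smul, map_add, tensorMk_smul, tensorMk_smul,
      tensorModD_mk]

/-- The map `id ⊗ f` on tensor products. -/
def tensorMap {N N' : DGMod A} (f : N →ₗ[A] N') : tensorMod T N →ₗ[B] tensorMod T N' :=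
  Submodule.mapQ (balanced T N) (balanced T N')
    (TensorProduct.AlgebraTensorModule.map (LinearMap.id : T →ₗ[B] T) (f.restrictScalars 𝔽)) (by
      refine Submodule.span_le.2 ?_
      rintro _ ⟨t, a, n, rfl⟩
      refine Submodule.subset_span ⟨t, a, f n, ?_⟩
      rw [map_sub]
      change (MulOpposite.op a • t) ⊗ₜ f n - t ⊗ₜ f (a • n) = _
      rw [f.map_smul])

theorem tensorMod_ind {N : DGMod A} {p : tensorMod T N → Prop} (p0 : p 0)
    (padd : ∀ x y, p x → p y → p (x + y))
    (pt : ∀ (t : T) (n : N), p (tensorMk T N (t ⊗ₜ n))) (x : tensorMod T N) : p x := by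
  obtain ⟨x, rfl⟩ := tensorMk_surj T N x
  induction x using TensorProduct.induction_on with
  | zero => rw [map_zero]; exact p0
  | add x y hx hy => rw [map_add]; exact padd _ _ hx hy
  | tmul t n => exact pt t n

theorem tensorMap_mk {N N' : DGMod A} (f : N →ₗ[A] N') (t : T) (n : N) :
    tensorMap T f (tensorMk T N (t ⊗ₜ n)) = tensorMk T N' (t ⊗ₜ f n) := rfl

theorem tensorMod_d_mk (N : DGMod A) (t : T) (n : N) :
    (tensorMod T N).d (tensorMk T N (t ⊗ₜ n)) =
      tensorMk T N (T.d t ⊗ₜ n) + tensorMk T N (t ⊗ₜ N.d n) := rfl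

theorem tensorMap_mem {N N' : DGMod A} {f : N →ₗ[A] N'} {i : ℤ} (hf : f ∈ homDeg N N' i) :
    tensorMap T f ∈ homDeg (tensorMod T N) (tensorMod T N') i := by
  rintro k _ ⟨x, hx, rfl⟩
  refine ⟨TensorProduct.AlgebraTensorModule.map (LinearMap.id : T →ₗ[B] T) (f.restrictScalars 𝔽) x,
    ?_, rfl⟩
  induction hx using Submodule.span_induction with
  | mem x hx =>
    obtain ⟨a, b, rfl, t, ht, n, hn, rfl⟩ := hx
    exact Submodule.subset_span ⟨a, b + (i, 0), (add_assoc _ _ _).symm, t, ht, f n, hf b n hn, rfl⟩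
  | zero => rw [map_zero]; exact zero_mem _
  | add x y _ _ hx hy => rw [map_add]; exact add_mem hx hy
  | smul a x _ hx =>
    refine (congrArg (· ∈ tensorGr T.gr N'.gr (k + (i, 0))) ?_).mpr (Submodule.smul_mem _ a hx)
    exact map_smul ((TensorProduct.AlgebraTensorModule.map (LinearMap.id : T →ₗ[B] T)
      (f.restrictScalars 𝔽)).restrictScalars 𝔽) a x

/-- The closed morphism `id ⊗ f`. -/
def tensorZ {N N' : DGMod A} (f : Z0 N N') : Z0 (tensorMod T N) (tensorMod T N') :=
  ⟨tensorMap T f.1, tensorMap_mem T f.2.1, fun x => by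
    refine tensorMod_ind T (p := fun x => (tensorMod T N').d (tensorMap T f.1 x) +
      tensorMap T f.1 ((tensorMod T N).d x) = 0) ?_ ?_ ?_ x
    · simp
    · intro x y hx hy
      rw [map_add, map_add, map_add, map_add, add_add_add_comm, hx, hy, add_zero]
    · intro t n
      rw [tensorMap_mk, tensorMod_d_mk, tensorMod_d_mk, map_add, tensorMap_mk, tensorMap_mk,
        Z0_comm, add_self]⟩

theorem tensor_congr {N N' : DGMod A} {f g : Z0 N N'} (h : -f + g ∈ B0 N N') :
    -(tensorZ T f) + tensorZ T g ∈ B0 (tensorMod T N) (tensorMod T N') := by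
  obtain ⟨h, hh, e⟩ := h
  have e' : ∀ n, g.1 n = f.1 n + (N'.d (h n) + h (N.d n)) := fun n => by rw [← e n]; simp
  refine ⟨tensorMap T h, tensorMap_mem T hh, fun x => ?_⟩
  refine tensorMod_ind T (p := fun x => -(tensorMap T f.1 x) + tensorMap T g.1 x =
    (tensorMod T N').d (tensorMap T h x) + tensorMap T h ((tensorMod T N).d x)) ?_ ?_ ?_ x
  · simp
  · intro x y hx hy
    simp only [map_add] at hx hy ⊢
    rw [neg_add, add_add_add_comm, hx, hy]; abel
  · intro t n
    rw [tensorMap_mk, tensorMap_mk, tensorMap_mk, tensorMod_d_mk, tensorMod_d_mk, map_add,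
      tensorMap_mk, tensorMap_mk, e', TensorProduct.tmul_add, TensorProduct.tmul_add, map_add,
      map_add]
    have h2 := add_self (tensorMk T N' (T.d t ⊗ₜ[𝔽] h n))
    calc _ = tensorMk T N' (t ⊗ₜ[𝔽] N'.d (h n)) + tensorMk T N' (t ⊗ₜ[𝔽] h (N.d n)) + 0 := by
          abel
      _ = _ := by rw [← h2]; abel

theorem tensorZ_id (N : DGMod A) : tensorZ T (zid N) = zid (tensorMod T N) :=
  Subtype.ext (LinearMap.ext fun x => by
    refine tensorMod_ind T (p := fun x => (tensorZ T (zid N)).1 x = x) ?_ ?_ ?_ x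
    · rw [map_zero]
    · intro x y hx hy; rw [map_add, hx, hy]
    · intro t n; rfl)

theorem tensorZ_comp {N N' N'' : DGMod A} (f : Z0 N N') (g : Z0 N' N'') :
    tensorZ T (zcomp f g) = zcomp (tensorZ T f) (tensorZ T g) :=
  Subtype.ext (LinearMap.ext fun x => by
    refine tensorMod_ind T (p := fun x => (tensorZ T (zcomp f g)).1 x =
      (tensorZ T g).1 ((tensorZ T f).1 x)) ?_ ?_ ?_ x
    · rw [map_zero, map_zero, map_zero]
    · intro x y hx hy; rw [map_add, map_add, map_add, hx, hy]
    · intro t n; rfl)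

/-- The functor `T ⊗_A -` on `0`-th homology categories. -/
def tensorFunctor : Ho A ⥤ Ho B where
  obj N := Ho.of (tensorMod T N.obj)
  map {N N'} f := Quotient.map (fun f : Z0 N.obj N'.obj => tensorZ T f)
    (fun _ _ h => QuotientAddGroup.leftRel_apply.2
      (tensor_congr T (QuotientAddGroup.leftRel_apply.1 h))) f
  map_id N := congrArg QuotientAddGroup.mk (tensorZ_id T N.obj)
  map_comp := by
    rintro N N' N'' ⟨f⟩ ⟨g⟩
    exact congrArg QuotientAddGroup.mk (tensorZ_comp T f g)

end Tensor

/-! ### Tensor products over the ground field, and induction -/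

theorem tensorGr_mul (A B : QDGAlg) {k l : ℤ × ℤ} {x y : A ⊗[𝔽] B}
    (hx : x ∈ tensorGr A.gr B.gr k) (hy : y ∈ tensorGr A.gr B.gr l) :
    x * y ∈ tensorGr A.gr B.gr (k + l) := by
  induction hx using Submodule.span_induction with
  | mem x hx =>
    obtain ⟨i, j, rfl, a, ha, b, hb, rfl⟩ := hx
    induction hy using Submodule.span_induction with
    | mem y hy =>
      obtain ⟨i', j', rfl, a', ha', b', hb', rfl⟩ := hy
      exact Submodule.subset_span ⟨i + i', j + j', add_add_add_comm _ _ _ _, _, A.mul_mem ha ha', _,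
        B.mul_mem hb hb', Algebra.TensorProduct.tmul_mul_tmul _ _ _ _⟩
    | zero => rw [mul_zero]; exact zero_mem _
    | add x y _ _ hx hy => rw [mul_add]; exact add_mem hx hy
    | smul c x _ hx => rw [mul_smul_comm]; exact Submodule.smul_mem _ _ hx
  | zero => rw [zero_mul]; exact zero_mem _
  | add x y _ _ hx hy => rw [add_mul]; exact add_mem hx hy
  | smul c x _ hx => rw [smul_mul_assoc]; exact Submodule.smul_mem _ _ hx

theorem tensorD_mul (A B : QDGAlg) (x y : A ⊗[𝔽] B) :
    tensorD A.d B.d (x * y) = tensorD A.d B.d x * y + x * tensorD A.d B.d y := by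
  induction x using TensorProduct.induction_on with
  | zero => simp
  | add x x' hx hx' => rw [add_mul, map_add, hx, hx', map_add, add_mul, add_mul]; abel
  | tmul a b =>
    induction y using TensorProduct.induction_on with
    | zero => simp
    | add y y' hy hy' => rw [mul_add, map_add, hy, hy', map_add, mul_add, mul_add]; abel
    | tmul a' b' =>
      simp only [Algebra.TensorProduct.tmul_mul_tmul, tensorD_tmul, A.leibniz, B.leibniz,
        TensorProduct.add_tmul, TensorProduct.tmul_add, add_mul, mul_add]
      abel

/-- The tensor product `A ⊗ B` of `q`-graded DG algebras over the ground field. -/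
abbrev QDGAlg.tensor (A B : QDGAlg) : QDGAlg where
  carrier := A ⊗[𝔽] B
  gr := tensorGr A.gr B.gr
  internal := isInternal_tensor A.internal B.internal
  one_mem := Submodule.subset_span ⟨0, 0, add_zero 0, 1, A.one_mem, 1, B.one_mem, rfl⟩
  mul_mem := tensorGr_mul A B
  d := tensorD A.d B.d
  d_mem := fun {k a} => tensorD_mem (fun _ _ h => A.d_mem h) (fun _ _ h => B.d_mem h) k a
  d_d := tensorD_tensorD A.d_d B.d_d
  d_one := by
    rw [Algebra.TensorProduct.one_def, tensorD_tmul, A.d_one, B.d_one, TensorProduct.zero_tmul,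
      TensorProduct.tmul_zero, add_zero]
  leibniz := tensorD_mul A B

/-- The action `(a ⊗ b) (x ⊗ y) = a x ⊗ b y`. -/
def extAction (X : DGMod A) (Y : DGMod B) : A ⊗[𝔽] B →ₐ[𝔽] Module.End 𝔽 (X ⊗[𝔽] Y) :=
  (Module.endTensorEndAlgHom (R := 𝔽) (A := 𝔽) (S := 𝔽) (M := X) (N := Y)).comp
    (Algebra.TensorProduct.map (Algebra.lsmul 𝔽 𝔽 X) (Algebra.lsmul 𝔽 𝔽 Y))

theorem extAction_tmul (X : DGMod A) (Y : DGMod B) (a : A) (b : B) (x : X) (y : Y) :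
    extAction X Y (a ⊗ₜ b) (x ⊗ₜ y) = (a • x) ⊗ₜ (b • y) := rfl

theorem extAction_gr (X : DGMod A) (Y : DGMod B) {k l : ℤ × ℤ} {r : A ⊗[𝔽] B} {m : X ⊗[𝔽] Y}
    (hr : r ∈ tensorGr A.gr B.gr k) (hm : m ∈ tensorGr X.gr Y.gr l) :
    extAction X Y r m ∈ tensorGr X.gr Y.gr (k + l) := by
  induction hr using Submodule.span_induction with
  | mem x hx =>
    obtain ⟨i, j, rfl, a, ha, b, hb, rfl⟩ := hx
    induction hm using Submodule.span_induction with
    | mem y hy =>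
      obtain ⟨i', j', rfl, a', ha', b', hb', rfl⟩ := hy
      exact Submodule.subset_span ⟨i + i', j + j', add_add_add_comm _ _ _ _, _, X.smul_mem ha ha', _,
        Y.smul_mem hb hb', rfl⟩
    | zero => rw [map_zero]; exact zero_mem _
    | add x y _ _ hx hy => rw [map_add]; exact add_mem hx hy
    | smul c x _ hx => rw [map_smul]; exact Submodule.smul_mem _ _ hx
  | zero => rw [map_zero]; exact zero_mem _
  | add x y _ _ hx hy => rw [map_add]; exact add_mem hx hy
  | smul c x _ hx => rw [map_smul]; exact Submodule.smul_mem _ _ hx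

theorem extAction_d (X : DGMod A) (Y : DGMod B) (r : A ⊗[𝔽] B) (m : X ⊗[𝔽] Y) :
    tensorD X.d Y.d (extAction X Y r m) =
      extAction X Y (tensorD A.d B.d r) m + extAction X Y r (tensorD X.d Y.d m) := by
  induction r using TensorProduct.induction_on with
  | zero => simp
  | add x x' hx hx' =>
    simp only [map_add, LinearMap.add_apply, hx, hx']; abel
  | tmul a b =>
    induction m using TensorProduct.induction_on with
    | zero => simp
    | add y y' hy hy' => simp only [map_add, hy, hy']; abel
    | tmul x y =>
      simp only [extAction_tmul, tensorD_tmul, X.leibniz, Y.leibniz, TensorProduct.add_tmul,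
        TensorProduct.tmul_add, map_add, LinearMap.add_apply]
      abel

/-- The external tensor product `X ⊗ Y` over the ground field, a DG module over `A ⊗ B`. -/
def extTensor (X : DGMod A) (Y : DGMod B) : DGMod (A.tensor B) :=
  letI : Module (A.tensor B).carrier (X ⊗[𝔽] Y) := Module.compHom _ (extAction X Y).toRingHom
  { carrier := X ⊗[𝔽] Y
    tower := ⟨fun c r m => LinearMap.congr_fun (map_smul (extAction X Y) c r) m⟩
    gr := tensorGr X.gr Y.gr
    internal := isInternal_tensor X.internal Y.internal
    smul_mem := fun hr hm => extAction_gr X Y hr hm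
    d := tensorD X.d Y.d
    d_mem := fun {k a} => tensorD_mem (fun _ _ h => X.d_mem h) (fun _ _ h => Y.d_mem h) k a
    d_d := tensorD_tensorD X.d_d Y.d_d
    leibniz := extAction_d X Y }

/-- Homomorphisms of `q`-graded DG algebras. -/
structure DGHom (A B : QDGAlg) where
  toAlgHom : A →ₐ[𝔽] B
  map_mem : ∀ k, ∀ a ∈ A.gr k, toAlgHom a ∈ B.gr k
  map_d : ∀ a, B.d (toAlgHom a) = toAlgHom (A.d a)

/-- `B` as a `(B, A)`-bimodule, for a homomorphism `φ : A ⟶ B`; the functor `B ⊗_A -` is the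
induction functor. -/
def indBimod (φ : DGHom A B) : DGBimod B A :=
  letI : Module (A.carrier)ᵐᵒᵖ B.carrier := Module.compHom B.carrier (φ.toAlgHom.toRingHom.op)
  { carrier := B
    comm := ⟨fun b a x => (mul_assoc b x (φ.toAlgHom a.unop)).symm⟩
    towerRight := ⟨fun c a x => by
      change x * φ.toAlgHom (c • a.unop) = c • (x * φ.toAlgHom a.unop)
      rw [map_smul, mul_smul_comm]⟩
    gr := B.gr
    internal := B.internal
    smul_mem := fun hb ht => B.mul_mem hb ht
    mul_mem := fun ht ha => B.mul_mem ht (φ.map_mem _ _ ha)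
    d := B.d
    d_mem := B.d_mem
    d_d := B.d_d
    leibniz := B.leibniz
    leibniz_right := fun a t => by
      change B.d (t * φ.toAlgHom a) = B.d t * φ.toAlgHom a + t * φ.toAlgHom (A.d a)
      rw [B.leibniz, φ.map_d] }

/-! ### Algebras of labelled quivers with commutation relations -/

/-- A finite quiver whose arrows are labelled: a vertex `v` has at most one outgoing arrow with
label `l`, which exists if `valid v l` holds, and then ends at `move v l`.  Besides, we are given
which labels commute and the degrees of the arrows. -/
structure LQuiver where
  V : Type
  [fintype : Fintype V]
  [decEq : DecidableEq V]
  L : Type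
  valid : V → L → Prop
  move : V → L → V
  comm : L → L → Prop
  deg : L → ℤ × ℤ

attribute [instance] LQuiver.fintype LQuiver.decEq

namespace LQuiver

variable (Q : LQuiver)

/-- The generators: an idempotent for each vertex, and a symbol for each vertex and label. -/
inductive Gen : Type
  | idem (v : Q.V) : Gen
  | arr (v : Q.V) (l : Q.L) : Gen

/-- The relations.  The symbols that do not belong to an arrow are zero; in particular, the
commutation relation only matters if the arrows in it exist. -/
inductive Rel : FreeAlgebra 𝔽 Q.Gen → FreeAlgebra 𝔽 Q.Gen → Prop
  | idem (v w : Q.V) : Rel (FreeAlgebra.ι 𝔽 (Gen.idem v) * FreeAlgebra.ι 𝔽 (Gen.idem w))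
      (if v = w then FreeAlgebra.ι 𝔽 (Gen.idem v) else 0)
  | src (v : Q.V) (l : Q.L) : Rel (FreeAlgebra.ι 𝔽 (Gen.idem v) * FreeAlgebra.ι 𝔽 (Gen.arr v l))
      (FreeAlgebra.ι 𝔽 (Gen.arr v l))
  | tgt (v : Q.V) (l : Q.L) :
      Rel (FreeAlgebra.ι 𝔽 (Gen.arr v l) * FreeAlgebra.ι 𝔽 (Gen.idem (Q.move v l)))
        (FreeAlgebra.ι 𝔽 (Gen.arr v l))
  | invalid (v : Q.V) (l : Q.L) (h : ¬ Q.valid v l) : Rel (FreeAlgebra.ι 𝔽 (Gen.arr v l)) 0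
  | comm (v : Q.V) (l l' : Q.L) (h : Q.comm l l') :
      Rel (FreeAlgebra.ι 𝔽 (Gen.arr v l) * FreeAlgebra.ι 𝔽 (Gen.arr (Q.move v l) l'))
        (FreeAlgebra.ι 𝔽 (Gen.arr v l') * FreeAlgebra.ι 𝔽 (Gen.arr (Q.move v l') l))
  | unit : Rel (∑ v : Q.V, FreeAlgebra.ι 𝔽 (Gen.idem v)) 1

/-- The quotient of the path algebra by the commutation relations. -/
def Alg : Type := RingQuot Q.Rel

instance : Ring Q.Alg := inferInstanceAs (Ring (RingQuot Q.Rel))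

instance : Algebra 𝔽 Q.Alg := inferInstanceAs (Algebra 𝔽 (RingQuot Q.Rel))

def quot : FreeAlgebra 𝔽 Q.Gen →ₐ[𝔽] Q.Alg := RingQuot.mkAlgHom 𝔽 Q.Rel

theorem quot_surj : Function.Surjective Q.quot := RingQuot.mkAlgHom_surjective 𝔽 Q.Rel

theorem quot_rel {x y : FreeAlgebra 𝔽 Q.Gen} (h : Q.Rel x y) : Q.quot x = Q.quot y :=
  RingQuot.mkAlgHom_rel 𝔽 h

/-- The idempotents `e(v)`. -/
def e (v : Q.V) : Q.Alg := Q.quot (FreeAlgebra.ι 𝔽 (Gen.idem v))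

/-- The arrows `r(v ⟶ move v l)`. -/
def r (v : Q.V) (l : Q.L) : Q.Alg := Q.quot (FreeAlgebra.ι 𝔽 (Gen.arr v l))

theorem e_mul (v w : Q.V) : Q.e v * Q.e w = if v = w then Q.e v else 0 := by
  have h := Q.quot_rel (Rel.idem v w)
  rw [map_mul] at h
  refine h.trans ?_
  split_ifs
  · rfl
  · exact map_zero _

theorem e_r (v : Q.V) (l : Q.L) : Q.e v * Q.r v l = Q.r v l := by
  have h := Q.quot_rel (Rel.src v l)
  rwa [map_mul] at h

theorem r_e (v : Q.V) (l : Q.L) : Q.r v l * Q.e (Q.move v l) = Q.r v l := by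
  have h := Q.quot_rel (Rel.tgt v l)
  rwa [map_mul] at h

theorem r_invalid {v : Q.V} {l : Q.L} (h : ¬ Q.valid v l) : Q.r v l = 0 :=
  (Q.quot_rel (Rel.invalid v l h)).trans (map_zero _)

theorem r_comm (v : Q.V) {l l' : Q.L} (h : Q.comm l l') :
    Q.r v l * Q.r (Q.move v l) l' = Q.r v l' * Q.r (Q.move v l') l := by
  have h := Q.quot_rel (Rel.comm v l l' h)
  rwa [map_mul, map_mul] at h

theorem sum_e : ∑ v : Q.V, Q.e v = 1 := by
  have h := Q.quot_rel Rel.unit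
  rwa [map_sum, map_one] at h

/-- Elements of an algebra satisfying the relations. -/
structure Rep (S : Type) [Ring S] [Algebra 𝔽 S] where
  e : Q.V → S
  r : Q.V → Q.L → S
  e_mul : ∀ v w, e v * e w = if v = w then e v else 0
  e_r : ∀ v l, e v * r v l = r v l
  r_e : ∀ v l, r v l * e (Q.move v l) = r v l
  r_invalid : ∀ v l, ¬ Q.valid v l → r v l = 0
  r_comm : ∀ v l l', Q.comm l l' → r v l * r (Q.move v l) l' = r v l' * r (Q.move v l') l
  sum_e : ∑ v, e v = 1

variable {Q}
variable {S : Type} [Ring S] [Algebra 𝔽 S]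

/-- The universal property. -/
def lift (ρ : Q.Rep S) : Q.Alg →ₐ[𝔽] S :=
  RingQuot.liftAlgHom 𝔽 ⟨FreeAlgebra.lift 𝔽 (fun g => Gen.rec ρ.e ρ.r g), by
    intro x y h
    induction h with
    | idem v w =>
      rw [map_mul, FreeAlgebra.lift_ι_apply, FreeAlgebra.lift_ι_apply]
      refine (ρ.e_mul v w).trans ?_
      split_ifs
      · rw [FreeAlgebra.lift_ι_apply]
      · rw [map_zero]
    | src v l =>
      rw [map_mul, FreeAlgebra.lift_ι_apply, FreeAlgebra.lift_ι_apply]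
      exact ρ.e_r v l
    | tgt v l =>
      rw [map_mul, FreeAlgebra.lift_ι_apply, FreeAlgebra.lift_ι_apply]
      exact ρ.r_e v l
    | invalid v l h =>
      rw [map_zero, FreeAlgebra.lift_ι_apply]
      exact ρ.r_invalid v l h
    | comm v l l' h =>
      rw [map_mul, map_mul, FreeAlgebra.lift_ι_apply, FreeAlgebra.lift_ι_apply,
        FreeAlgebra.lift_ι_apply, FreeAlgebra.lift_ι_apply]
      exact ρ.r_comm v l l' h
    | unit =>
      rw [map_sum, map_one]
      simp only [FreeAlgebra.lift_ι_apply]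
      exact ρ.sum_e⟩

theorem lift_e (ρ : Q.Rep S) (v : Q.V) : lift ρ (Q.e v) = ρ.e v := by
  refine (RingQuot.liftAlgHom_mkAlgHom_apply 𝔽 _ _ _).trans ?_
  rw [FreeAlgebra.lift_ι_apply]

theorem lift_r (ρ : Q.Rep S) (v : Q.V) (l : Q.L) : lift ρ (Q.r v l) = ρ.r v l := by
  refine (RingQuot.liftAlgHom_mkAlgHom_apply 𝔽 _ _ _).trans ?_
  rw [FreeAlgebra.lift_ι_apply]

/-- Every element is a sum of elements of a multiplicative set containing the generators. -/
theorem mem_span (s : Set Q.Alg) (h1 : 1 ∈ s) (hm : ∀ a ∈ s, ∀ b ∈ s, a * b ∈ s)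
    (he : ∀ v, Q.e v ∈ s) (hr : ∀ v l, Q.r v l ∈ s) (a : Q.Alg) : a ∈ Submodule.span 𝔽 s := by
  obtain ⟨a, rfl⟩ := Q.quot_surj a
  induction a using FreeAlgebra.induction with
  | grade0 c =>
    rw [AlgHom.commutes, Algebra.algebraMap_eq_smul_one]
    exact Submodule.smul_mem _ _ (Submodule.subset_span h1)
  | grade1 g =>
    cases g with
    | idem v => exact Submodule.subset_span (he v)
    | arr v l => exact Submodule.subset_span (hr v l)
  | mul a b ha hb =>
    rw [map_mul]
    have h := Submodule.mul_mem_mul ha hb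
    rw [Submodule.span_mul_span] at h
    refine Submodule.span_mono ?_ h
    rintro _ ⟨x, hx, y, hy, rfl⟩
    exact hm x hx y hy
  | add a b ha hb => rw [map_add]; exact add_mem ha hb

theorem algHom_ext {f g : Q.Alg →ₐ[𝔽] S} (he : ∀ v, f (Q.e v) = g (Q.e v))
    (hr : ∀ v l, f (Q.r v l) = g (Q.r v l)) : f = g := by
  refine AlgHom.ext fun a => ?_
  have h := mem_span {a : Q.Alg | f a = g a} (by simp)
    (fun a ha b hb => by
      have ha' : f a = g a := ha
      have hb' : f b = g b := hb
      change f (a * b) = g (a * b)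
      rw [map_mul, map_mul, ha', hb']) he hr a
  induction h using Submodule.span_induction with
  | mem x hx => exact hx
  | zero => rw [map_zero, map_zero]
  | add x y _ _ hx hy => rw [map_add, map_add, hx, hy]
  | smul c x _ hx => rw [map_smul, map_smul, hx]

/-! The grading: `e(v)` has degree `0` and an arrow with label `l` has degree `deg l`. -/

variable (Q)

/-- The homomorphism multiplying an element of degree `k` by `X ^ k`. -/
def coaction : Q.Alg →ₐ[𝔽] AddMonoidAlgebra Q.Alg (ℤ × ℤ) :=
  lift
    { e := fun v => AddMonoidAlgebra.single 0 (Q.e v)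
      r := fun v l => AddMonoidAlgebra.single (Q.deg l) (Q.r v l)
      e_mul := fun v w => by
        rw [AddMonoidAlgebra.single_mul_single, e_mul, add_zero]
        split_ifs
        · rfl
        · exact AddMonoidAlgebra.single_zero _
      e_r := fun v l => by rw [AddMonoidAlgebra.single_mul_single, e_r, zero_add]
      r_e := fun v l => by rw [AddMonoidAlgebra.single_mul_single, r_e, add_zero]
      r_invalid := fun v l h => by rw [Q.r_invalid h]; exact AddMonoidAlgebra.single_zero _
      r_comm := fun v l l' h => by
        rw [AddMonoidAlgebra.single_mul_single, AddMonoidAlgebra.single_mul_single, Q.r_comm v h,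
          add_comm]
      sum_e := by
        rw [AddMonoidAlgebra.one_def, ← Q.sum_e]
        exact (map_sum (AddMonoidAlgebra.singleAddHom (0 : ℤ × ℤ)) _ _).symm }

/-- The homogeneous elements of degree `k`. -/
def gr (k : ℤ × ℤ) : Submodule 𝔽 Q.Alg where
  carrier := {a | Q.coaction a = AddMonoidAlgebra.single k a}
  zero_mem' := by
    change Q.coaction 0 = AddMonoidAlgebra.single k 0
    rw [map_zero, AddMonoidAlgebra.single_zero]
  add_mem' := fun {a b} ha hb => by
    change Q.coaction (a + b) = AddMonoidAlgebra.single k (a + b)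
    rw [map_add, AddMonoidAlgebra.single_add]
    exact congrArg₂ (· + ·) ha hb
  smul_mem' := fun c a ha => by
    change Q.coaction (c • a) = AddMonoidAlgebra.single k (c • a)
    rw [map_smul, ← AddMonoidAlgebra.smul_single]
    exact congrArg (c • ·) ha

variable {Q}

theorem mem_gr {k : ℤ × ℤ} {a : Q.Alg} : a ∈ Q.gr k ↔ Q.coaction a = AddMonoidAlgebra.single k a :=
  Iff.rfl

theorem e_mem (v : Q.V) : Q.e v ∈ Q.gr 0 := mem_gr.2 (lift_e _ v)

theorem r_mem (v : Q.V) (l : Q.L) : Q.r v l ∈ Q.gr (Q.deg l) := mem_gr.2 (lift_r _ v l)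

theorem one_mem_gr : (1 : Q.Alg) ∈ Q.gr 0 := mem_gr.2 (map_one _)

theorem mul_mem_gr {k l : ℤ × ℤ} {a b : Q.Alg} (ha : a ∈ Q.gr k) (hb : b ∈ Q.gr l) :
    a * b ∈ Q.gr (k + l) := by
  rw [mem_gr] at ha hb ⊢
  rw [map_mul, ha, hb, AddMonoidAlgebra.single_mul_single]

theorem mem_span_homog (a : Q.Alg) : a ∈ Submodule.span 𝔽 {a : Q.Alg | ∃ k, a ∈ Q.gr k} :=
  mem_span {a : Q.Alg | ∃ k, a ∈ Q.gr k} ⟨0, one_mem_gr⟩ (fun _ ⟨k, ha⟩ _ ⟨l, hb⟩ => ⟨k + l, mul_mem_gr ha hb⟩)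
    (fun v => ⟨0, e_mem v⟩) (fun v l => ⟨_, r_mem v l⟩) a

variable (Q)

/-- The homogeneous components. -/
def comp : Q.Alg →ₗ[𝔽] (ℤ × ℤ →₀ Q.Alg) where
  toFun a := (Q.coaction a).coeff
  map_add' a b := by rw [map_add]; rfl
  map_smul' c a := by rw [map_smul]; rfl

variable {Q}

theorem comp_of_mem {k : ℤ × ℤ} {a : Q.Alg} (ha : a ∈ Q.gr k) : Q.comp a = Finsupp.single k a :=
  congrArg AddMonoidAlgebra.coeff (mem_gr.1 ha)

theorem comp_induction {p : Q.Alg → Prop} (p0 : p 0) (padd : ∀ a b, p a → p b → p (a + b))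
    (ph : ∀ k, ∀ a ∈ Q.gr k, p a) (a : Q.Alg) : p a := by
  induction mem_span_homog a using Submodule.span_induction with
  | mem x hx => obtain ⟨k, hx⟩ := hx; exact ph k x hx
  | zero => exact p0
  | add x y _ _ hx hy => exact padd x y hx hy
  | smul c x _ hx =>
    have hc : c = 0 ∨ c = 1 := by revert c; decide
    rcases hc with rfl | rfl
    · rw [zero_smul]; exact p0
    · rwa [one_smul]

theorem gr_internal : DirectSum.IsInternal Q.gr := by
  refine isInternal_of_comp _ Q.comp ?_ ?_ (fun k a ha => comp_of_mem ha)
  · refine comp_induction (by simp) (fun a b ha hb => ?_) (fun k a ha => ?_)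
    · rw [map_add, Finsupp.sum_add_index' (by simp) (by simp), ha, hb]
    · rw [comp_of_mem ha]; simp
  · refine comp_induction (fun k => by rw [map_zero]; exact zero_mem _)
      (fun a b ha hb k => by rw [map_add]; exact add_mem (ha k) (hb k)) (fun k a ha l => ?_)
    rw [comp_of_mem ha]
    by_cases h : k = l
    · subst h; rw [Finsupp.single_eq_same]; exact ha
    · rw [Finsupp.single_eq_of_ne (Ne.symm h)]; exact zero_mem _

/-! Derivations given on the arrows. -/

variable (Q)

/-- Values of a derivation on the arrows that are compatible with the relations. -/
structure DerivData where
  δ : Q.V → Q.L → Q.Alg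
  src : ∀ v l, Q.e v * δ v l = δ v l
  tgt : ∀ v l, δ v l * Q.e (Q.move v l) = δ v l
  invalid : ∀ v l, ¬ Q.valid v l → δ v l = 0
  comm : ∀ v l l', Q.comm l l' → δ v l * Q.r (Q.move v l) l' + Q.r v l * δ (Q.move v l) l' =
    δ v l' * Q.r (Q.move v l') l + Q.r v l' * δ (Q.move v l') l
  mem : ∀ v l, δ v l ∈ Q.gr (Q.deg l + (1, 0))

variable {Q}

/-- The homomorphism `a ↦ a + ε d a`. -/
def dualHom (D : Q.DerivData) : Q.Alg →ₐ[𝔽] TrivSqZeroExt Q.Alg Q.Alg :=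
  lift
    { e := fun v => TrivSqZeroExt.inl (Q.e v)
      r := fun v l => TrivSqZeroExt.inl (Q.r v l) + TrivSqZeroExt.inr (D.δ v l)
      e_mul := fun v w => by
        rw [TrivSqZeroExt.inl_mul_inl, e_mul]
        split_ifs
        · rfl
        · exact TrivSqZeroExt.inl_zero _
      e_r := fun v l => by
        refine TrivSqZeroExt.ext ?_ ?_
        · simp [e_r]
        · simp [D.src]
      r_e := fun v l => by
        refine TrivSqZeroExt.ext ?_ ?_
        · simp [r_e]
        · simp [D.tgt]
      r_invalid := fun v l h => by rw [Q.r_invalid h, D.invalid v l h]; simp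
      r_comm := fun v l l' h => by
        refine TrivSqZeroExt.ext ?_ ?_
        · simp [Q.r_comm v h]
        · have := D.comm v l l' h
          simp only [TrivSqZeroExt.snd_mul, TrivSqZeroExt.fst_add, TrivSqZeroExt.fst_inl,
            TrivSqZeroExt.fst_inr, TrivSqZeroExt.snd_add, TrivSqZeroExt.snd_inl,
            TrivSqZeroExt.snd_inr, add_zero, zero_add, smul_eq_mul, MulOpposite.smul_eq_mul_unop,
            MulOpposite.unop_op]
          rw [add_comm, this, add_comm]
      sum_e := by
        rw [← TrivSqZeroExt.inl_sum, Q.sum_e]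
        rfl }

theorem dualHom_fst (D : Q.DerivData) (a : Q.Alg) : (dualHom D a).fst = a := by
  have h : (TrivSqZeroExt.fstHom 𝔽 Q.Alg Q.Alg).comp (dualHom D) = AlgHom.id 𝔽 _ :=
    algHom_ext (fun v => by
      rw [AlgHom.comp_apply, dualHom, lift_e]; rfl) (fun v l => by
      rw [AlgHom.comp_apply, dualHom, lift_r]; simp)
  exact AlgHom.congr_fun h a

/-- The derivation with the given values on the arrows, vanishing on the idempotents. -/
def deriv (D : Q.DerivData) : Q.Alg →ₗ[𝔽] Q.Alg where
  toFun a := (dualHom D a).snd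
  map_add' a b := by rw [map_add]; rfl
  map_smul' c a := by rw [map_smul]; rfl

theorem deriv_mul (D : Q.DerivData) (a b : Q.Alg) :
    deriv D (a * b) = deriv D a * b + a * deriv D b := by
  change (dualHom D (a * b)).snd = _
  rw [map_mul, TrivSqZeroExt.snd_mul, dualHom_fst, dualHom_fst, smul_eq_mul,
    MulOpposite.smul_eq_mul_unop, add_comm]
  rfl

theorem deriv_e (D : Q.DerivData) (v : Q.V) : deriv D (Q.e v) = 0 := by
  change (dualHom D (Q.e v)).snd = 0
  rw [dualHom, lift_e]; rfl

theorem deriv_r (D : Q.DerivData) (v : Q.V) (l : Q.L) : deriv D (Q.r v l) = D.δ v l := by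
  change (dualHom D (Q.r v l)).snd = _
  rw [dualHom, lift_r]; simp

theorem deriv_one (D : Q.DerivData) : deriv D 1 = 0 := by
  change (dualHom D 1).snd = 0
  rw [map_one]; rfl

theorem deriv_mem (D : Q.DerivData) {k : ℤ × ℤ} {a : Q.Alg} (ha : a ∈ Q.gr k) :
    deriv D a ∈ Q.gr (k + (1, 0)) := by
  have key : ∀ a : Q.Alg, ∀ k, deriv D (Q.comp a k) ∈ Q.gr (k + (1, 0)) := by
    intro a
    have h := mem_span {a : Q.Alg | ∃ k, a ∈ Q.gr k ∧ deriv D a ∈ Q.gr (k + (1, 0))}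
      ⟨0, one_mem_gr, by rw [deriv_one]; exact zero_mem _⟩
      (by
        rintro a ⟨k, ha, hda⟩ b ⟨l, hb, hdb⟩
        refine ⟨k + l, mul_mem_gr ha hb, ?_⟩
        rw [deriv_mul]
        refine add_mem ?_ ?_
        · rw [add_right_comm]; exact mul_mem_gr hda hb
        · rw [add_assoc]; exact mul_mem_gr ha hdb)
      (fun v => ⟨0, e_mem v, by rw [deriv_e]; exact zero_mem _⟩)
      (fun v l => ⟨_, r_mem v l, by rw [deriv_r]; exact D.mem v l⟩) a
    induction h using Submodule.span_induction with
    | mem x hx =>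
      obtain ⟨i, hx, hdx⟩ := hx
      intro k
      rw [comp_of_mem hx]
      by_cases h : i = k
      · subst h; rw [Finsupp.single_eq_same]; exact hdx
      · rw [Finsupp.single_eq_of_ne (Ne.symm h), map_zero]; exact zero_mem _
    | zero => intro k; simp
    | add x y _ _ hx hy =>
      intro k
      rw [map_add, Finsupp.add_apply, map_add]
      exact add_mem (hx k) (hy k)
    | smul c x _ hx =>
      intro k
      rw [map_smul, Finsupp.smul_apply, map_smul]
      exact Submodule.smul_mem _ _ (hx k)
  have h := key a k
  rwa [comp_of_mem ha, Finsupp.single_eq_same] at h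

theorem deriv_deriv (D : Q.DerivData) (h : ∀ v l, deriv D (D.δ v l) = 0) (a : Q.Alg) :
    deriv D (deriv D a) = 0 := by
  have hs := mem_span {a : Q.Alg | deriv D (deriv D a) = 0} (by
      change deriv D (deriv D 1) = 0
      rw [deriv_one, map_zero])
    (fun a ha b hb => by
      have ha' : deriv D (deriv D a) = 0 := ha
      have hb' : deriv D (deriv D b) = 0 := hb
      change deriv D (deriv D (a * b)) = 0
      rw [deriv_mul, map_add, deriv_mul, deriv_mul, ha', hb', zero_mul, mul_zero, zero_add,
        add_zero, add_self])
    (fun v => by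
      change deriv D (deriv D (Q.e v)) = 0
      rw [deriv_e, map_zero])
    (fun v l => by
      change deriv D (deriv D (Q.r v l)) = 0
      rw [deriv_r, h]) a
  induction hs using Submodule.span_induction with
  | mem x hx => exact hx
  | zero => rw [map_zero, map_zero]
  | add x y _ _ hx hy => rw [map_add, map_add, hx, hy, add_zero]
  | smul c x _ hx => rw [map_smul, map_smul, hx, smul_zero]

/-- The `q`-graded DG algebra given by a labelled quiver and a differential. -/
abbrev dgAlg (D : Q.DerivData) (h : ∀ v l, deriv D (D.δ v l) = 0) : QDGAlg where
  carrier := Q.Alg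
  gr := Q.gr
  internal := gr_internal
  one_mem := one_mem_gr
  mul_mem := mul_mem_gr
  d := deriv D
  d_mem := deriv_mem D
  d_d := deriv_deriv D h
  d_one := deriv_one D
  leibniz := deriv_mul D

end LQuiver

/-! ### The algebras `R_n` and `R_n ⊠ R_n` -/

/-- The vertices of `Γ_n`: decreasing sequences of integers between `n` and `0`, that is, subsets
of `{0, …, n}`. -/
abbrev Vert (n : ℕ) : Type := Finset (Fin (n + 1))

/-- The pair `{s, s + 1}`. -/
def pair (n s : ℕ) : Vert n := Finset.univ.filter fun i => i.val = s ∨ i.val = s + 1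

/-- The pair `{s, s + 1}` can be added to `x`. -/
def CanAdd {n : ℕ} (x : Vert n) (s : ℕ) : Prop := s + 1 ≤ n ∧ Disjoint (pair n s) x

theorem canAdd_swap {n : ℕ} {x : Vert n} {s t : ℕ} (h : CanAdd x s) (h' : CanAdd (x ∪ pair n s) t) :
    CanAdd x t ∧ CanAdd (x ∪ pair n t) s := by
  obtain ⟨h1, h2⟩ := h
  obtain ⟨h3, h4⟩ := h'
  rw [Finset.disjoint_union_right] at h4
  exact ⟨⟨h3, h4.1⟩, h1, Finset.disjoint_union_right.2 ⟨h2, h4.2.symm⟩⟩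

/-- The quiver `Γ_n`: the arrow with label `s` adds the pair `{s, s + 1}`. -/
abbrev quiver (n : ℕ) : LQuiver where
  V := Vert n
  L := ℕ
  valid := CanAdd
  move := fun x s => x ∪ pair n s
  comm := fun _ _ => True
  deg := fun s => (0, (n : ℤ) - 1 - 2 * s)

/-- The zero derivation. -/
def zeroDeriv (Q : LQuiver) : Q.DerivData where
  δ := fun _ _ => 0
  src := fun _ _ => mul_zero _
  tgt := fun _ _ => zero_mul _
  invalid := fun _ _ _ => rfl
  comm := fun _ _ _ _ => by simp
  mem := fun _ _ => zero_mem _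

/-- The `q`-graded algebra `R_n`, with zero differential. -/
abbrev R (n : ℕ) : QDGAlg :=
  LQuiver.dgAlg (zeroDeriv (quiver n)) (fun _ _ => map_zero _)

/-- The labels of the arrows of `Γ_n ⊠ Γ_n`: the arrows `(s, ∅)`, `(∅, s)` and `(s, s + 1)`. -/
inductive Lab : Type
  | left (s : ℕ) : Lab
  | right (s : ℕ) : Lab
  | both (s : ℕ) : Lab

namespace Lab

/-- The end of an arrow of `Γ_n ⊠ Γ_n`, and the condition for its existence. -/
def move {n : ℕ} : Vert n × Vert n → Lab → Vert n × Vert n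
  | (x, y), left s => (x ∪ pair n s, y)
  | (x, y), right s => (x, y ∪ pair n s)
  | (x, y), both s => (x ∪ pair n s, y ∪ pair n (s + 1))

def valid {n : ℕ} : Vert n × Vert n → Lab → Prop
  | (x, _), left s => CanAdd x s
  | (_, y), right s => CanAdd y s
  | (x, y), both s => CanAdd x s ∧ CanAdd y (s + 1)

/-- The labels that commute: all, except `(s, ∅)` and `(∅, s + 1)`. -/
def comm : Lab → Lab → Prop
  | left s, right t => t ≠ s + 1
  | right t, left s => t ≠ s + 1
  | _, _ => True

/-- The cohomological degree and the `q`-degree. -/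
def deg (n : ℕ) : Lab → ℤ × ℤ
  | left s => (0, (n : ℤ) - 1 - 2 * s)
  | right s => (0, (n : ℤ) - 1 - 2 * s)
  | both s => (-1, ((n : ℤ) - 1 - 2 * s) + ((n : ℤ) - 1 - 2 * (s + 1)))

end Lab

/-- The quiver `Γ_n ⊠ Γ_n`. -/
abbrev boxQuiver (n : ℕ) : LQuiver where
  V := Vert n × Vert n
  L := Lab
  valid := Lab.valid
  move := Lab.move
  comm := Lab.comm
  deg := Lab.deg n

section Box

variable {n : ℕ}

theorem box_move_move (v : Vert n × Vert n) (l l' : Lab) :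
    Lab.move (Lab.move v l) l' = Lab.move (Lab.move v l') l := by
  obtain ⟨x, y⟩ := v
  cases l <;> cases l' <;> simp only [Lab.move, Finset.union_comm] <;>
    simp only [Finset.union_comm, Finset.union_left_comm]

/-- Both ways around the square at `v`. -/
theorem box_comm (v : Vert n × Vert n) {l l' : Lab} (h : Lab.comm l l') :
    (boxQuiver n).r v l * (boxQuiver n).r (Lab.move v l) l' =
      (boxQuiver n).r v l' * (boxQuiver n).r (Lab.move v l') l :=
  (boxQuiver n).r_comm v h

/-- The differential of `R_n ⊠ R_n` on the arrows. -/
def boxδ (v : Vert n × Vert n) : Lab → (boxQuiver n).Alg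
  | Lab.both s =>
      (boxQuiver n).r v (Lab.left s) *
          (boxQuiver n).r (Lab.move v (Lab.left s)) (Lab.right (s + 1)) +
        (boxQuiver n).r v (Lab.right (s + 1)) *
          (boxQuiver n).r (Lab.move v (Lab.right (s + 1))) (Lab.left s)
  | _ => 0

theorem box_move_left_right (v : Vert n × Vert n) (s : ℕ) :
    Lab.move (Lab.move v (Lab.left s)) (Lab.right (s + 1)) = Lab.move v (Lab.both s) := rfl

theorem box_move_right_left (v : Vert n × Vert n) (s : ℕ) :
    Lab.move (Lab.move v (Lab.right (s + 1))) (Lab.left s) = Lab.move v (Lab.both s) := rfl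

/-- Moving an arrow with label `l` past the differential of an arrow with label `both s`. -/
theorem boxδ_comm (v : Vert n × Vert n) (s : ℕ) (l : Lab) (h1 : Lab.comm (Lab.left s) l)
    (h2 : Lab.comm (Lab.right (s + 1)) l) :
    boxδ v (Lab.both s) * (boxQuiver n).r (Lab.move v (Lab.both s)) l =
      (boxQuiver n).r v l * boxδ (Lab.move v l) (Lab.both s) := by
  have e1 := box_comm (Lab.move v (Lab.left s)) h2
  have e2 := box_comm (Lab.move v (Lab.right (s + 1))) h1
  have e3 := box_comm v h1
  have e4 := box_comm v h2
  rw [box_move_left_right, box_move_move v (Lab.left s) l] at e1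
  rw [box_move_right_left, box_move_move v (Lab.right (s + 1)) l] at e2
  simp only [boxδ]
  rw [add_mul, mul_assoc, e1, mul_assoc, e2, ← mul_assoc, e3, ← mul_assoc, e4, mul_add, mul_assoc,
    mul_assoc]

theorem not_canAdd_self (x : Vert n) (s : ℕ) : ¬ CanAdd (x ∪ pair n s) s := by
  rintro ⟨h1, h2⟩
  have hs : (⟨s, by omega⟩ : Fin (n + 1)) ∈ pair n s := by simp [pair]
  exact Finset.disjoint_left.1 h2 hs (Finset.mem_union_right _ hs)

theorem boxδ_invalid (v : Vert n × Vert n) (l : Lab) (h : ¬ Lab.valid v l) : boxδ v l = 0 := by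
  cases l with
  | left s => rfl
  | right s => rfl
  | both s =>
    simp only [boxδ]
    by_cases hx : CanAdd v.1 s
    · have hy : ¬ CanAdd v.2 (s + 1) := fun hy => h ⟨hx, hy⟩
      rw [(boxQuiver n).r_invalid (v := v) (l := Lab.right (s + 1)) hy,
        (boxQuiver n).r_invalid (v := Lab.move v (Lab.left s)) (l := Lab.right (s + 1)) hy,
        mul_zero, zero_mul, add_zero]
    · rw [(boxQuiver n).r_invalid (v := v) (l := Lab.left s) hx,
        (boxQuiver n).r_invalid (v := Lab.move v (Lab.right (s + 1))) (l := Lab.left s) hx,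
        mul_zero, zero_mul, add_zero]

theorem boxδ_comm_left (v : Vert n × Vert n) (s t : ℕ) :
    boxδ v (Lab.both s) * (boxQuiver n).r (Lab.move v (Lab.both s)) (Lab.left t) =
      (boxQuiver n).r v (Lab.left t) * boxδ (Lab.move v (Lab.left t)) (Lab.both s) := by
  by_cases h : s = t
  · subst h
    rw [boxδ_invalid (Lab.move v (Lab.left s)) (Lab.both s) (fun h => not_canAdd_self _ _ h.1),
      (boxQuiver n).r_invalid (v := Lab.move v (Lab.both s)) (l := Lab.left s)
        (not_canAdd_self _ _), mul_zero, mul_zero]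
  · exact boxδ_comm v s _ trivial (fun e => h (Nat.succ_injective e))

theorem boxδ_comm_right (v : Vert n × Vert n) (s t : ℕ) :
    boxδ v (Lab.both s) * (boxQuiver n).r (Lab.move v (Lab.both s)) (Lab.right t) =
      (boxQuiver n).r v (Lab.right t) * boxδ (Lab.move v (Lab.right t)) (Lab.both s) := by
  by_cases h : t = s + 1
  · subst h
    rw [boxδ_invalid (Lab.move v (Lab.right (s + 1))) (Lab.both s)
        (fun h => not_canAdd_self _ _ h.2),
      (boxQuiver n).r_invalid (v := Lab.move v (Lab.both s)) (l := Lab.right (s + 1))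
        (not_canAdd_self _ _), mul_zero, mul_zero]
  · exact boxδ_comm v s _ h trivial

end Box

/-- The differential of `R_n ⊠ R_n`: the arrow `(s, s + 1)` is sent to the sum of the two paths
around the corresponding square, the other arrows are sent to zero. -/
def boxDeriv (n : ℕ) : (boxQuiver n).DerivData where
  δ := boxδ
  src := fun v l => by
    cases l with
    | left s => exact mul_zero _
    | right s => exact mul_zero _
    | both s =>
      simp only [boxδ]
      rw [mul_add, ← mul_assoc, ← mul_assoc, LQuiver.e_r, LQuiver.e_r]
  tgt := fun v l => by
    cases l with
    | left s => exact zero_mul _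
    | right s => exact zero_mul _
    | both s =>
      have h1 := (boxQuiver n).r_e (Lab.move v (Lab.left s)) (Lab.right (s + 1))
      have h2 := (boxQuiver n).r_e (Lab.move v (Lab.right (s + 1))) (Lab.left s)
      simp only [box_move_left_right, box_move_right_left] at h1 h2
      simp only [boxδ]
      rw [add_mul, mul_assoc, mul_assoc, h1, h2]
  invalid := boxδ_invalid
  comm := fun v l l' h => by
    cases l with
    | left s =>
      cases l' with
      | left t => simp [boxδ]
      | right t => simp [boxδ]
      | both t =>
        rw [boxδ_comm_left]
        simp [boxδ]
    | right s =>
      cases l' with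
      | left t => simp [boxδ]
      | right t => simp [boxδ]
      | both t =>
        rw [boxδ_comm_right]
        simp [boxδ]
    | both s =>
      cases l' with
      | left t =>
        rw [boxδ_comm_left]
        simp [boxδ]
      | right t =>
        rw [boxδ_comm_right]
        simp [boxδ]
      | both t =>
        rw [boxδ_comm v s (Lab.both t) trivial trivial, boxδ_comm v t (Lab.both s) trivial trivial,
          add_comm]
  mem := fun v l => by
    cases l with
    | left s => exact zero_mem _
    | right s => exact zero_mem _
    | both s =>
      refine add_mem ?_ ?_
      · have h := LQuiver.mul_mem_gr ((boxQuiver n).r_mem v (Lab.left s))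
          ((boxQuiver n).r_mem (Lab.move v (Lab.left s)) (Lab.right (s + 1)))
        refine (congrArg (_ ∈ (boxQuiver n).gr ·) ?_).mp h
        simp [Lab.deg]
      · have h := LQuiver.mul_mem_gr ((boxQuiver n).r_mem v (Lab.right (s + 1)))
          ((boxQuiver n).r_mem (Lab.move v (Lab.right (s + 1))) (Lab.left s))
        refine (congrArg (_ ∈ (boxQuiver n).gr ·) ?_).mp h
        simp [Lab.deg, add_comm]

/-- The `q`-graded DG algebra `R_n ⊠ R_n`. -/
abbrev RR (n : ℕ) : QDGAlg :=
  LQuiver.dgAlg (boxDeriv n) (fun v l => by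
    cases l with
    | left s => exact map_zero _
    | right s => exact map_zero _
    | both s =>
      change LQuiver.deriv (boxDeriv n) (boxδ v (Lab.both s)) = 0
      simp only [boxδ]
      rw [map_add, LQuiver.deriv_mul, LQuiver.deriv_mul, LQuiver.deriv_r, LQuiver.deriv_r,
        LQuiver.deriv_r, LQuiver.deriv_r]
      change ((0 : (boxQuiver n).Alg) * _ + _ * 0) + (0 * _ + _ * 0) = 0
      simp)

/-- The quasi-isomorphism `H : R_n ⊠ R_n ⟶ R_n ⊗ R_n`. -/
def formalityRep (n : ℕ) : (boxQuiver n).Rep ((quiver n).Alg ⊗[𝔽] (quiver n).Alg) where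
  e := fun v => (quiver n).e v.1 ⊗ₜ (quiver n).e v.2
  r := fun v l => match l with
    | Lab.left s => (quiver n).r v.1 s ⊗ₜ (quiver n).e v.2
    | Lab.right s => (quiver n).e v.1 ⊗ₜ (quiver n).r v.2 s
    | Lab.both _ => 0
  e_mul := fun v w => by
    obtain ⟨x, y⟩ := v
    obtain ⟨x', y'⟩ := w
    rw [Algebra.TensorProduct.tmul_mul_tmul, LQuiver.e_mul, LQuiver.e_mul]
    by_cases h : x = x'
    · by_cases h' : y = y'
      · simp [h, h']
      · simp [h, h']
    · simp [h]
  e_r := fun v l => by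
    cases l with
    | left s => simp [LQuiver.e_r, LQuiver.e_mul]
    | right s => simp [LQuiver.e_r, LQuiver.e_mul]
    | both s => simp
  r_e := fun v l => by
    cases l with
    | left s =>
      have h := (quiver n).r_e v.1 s
      simp only [Algebra.TensorProduct.tmul_mul_tmul, Lab.move, h, LQuiver.e_mul, if_true]
    | right s =>
      have h := (quiver n).r_e v.2 s
      simp only [Algebra.TensorProduct.tmul_mul_tmul, Lab.move, h, LQuiver.e_mul, if_true]
    | both s => exact zero_mul _
  r_invalid := fun v l h => by
    cases l with
    | left s => simp only [(quiver n).r_invalid (v := v.1) (l := s) h, TensorProduct.zero_tmul]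
    | right s => simp only [(quiver n).r_invalid (v := v.2) (l := s) h, TensorProduct.tmul_zero]
    | both s => rfl
  r_comm := fun v l l' h => by
    cases l with
    | left s =>
      cases l' with
      | left t =>
        have h := (quiver n).r_comm v.1 (l := s) (l' := t) trivial
        simp only [Algebra.TensorProduct.tmul_mul_tmul, Lab.move, h]
      | right t =>
        have h1 := (quiver n).r_e v.1 s
        have h2 := (quiver n).r_e v.2 t
        simp only [Algebra.TensorProduct.tmul_mul_tmul, Lab.move, h1, h2, LQuiver.e_r]
      | both t => simp
    | right s =>
      cases l' with
      | left t =>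
        have h1 := (quiver n).r_e v.1 t
        have h2 := (quiver n).r_e v.2 s
        simp only [Algebra.TensorProduct.tmul_mul_tmul, Lab.move, h1, h2, LQuiver.e_r]
      | right t =>
        have h := (quiver n).r_comm v.2 (l := s) (l' := t) trivial
        simp only [Algebra.TensorProduct.tmul_mul_tmul, Lab.move, h]
      | both t => simp
    | both s =>
      cases l' <;> simp
  sum_e := by
    rw [Algebra.TensorProduct.one_def, ← (quiver n).sum_e, TensorProduct.sum_tmul,
      Fintype.sum_prod_type]
    exact Finset.sum_congr rfl fun x _ => (TensorProduct.tmul_sum ((quiver n).e x) Finset.univ (quiver n).e).symm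

theorem LQuiver.deriv_zero (Q : LQuiver) (a : Q.Alg) : LQuiver.deriv (zeroDeriv Q) a = 0 := by
  have h := LQuiver.mem_span {a : Q.Alg | LQuiver.deriv (zeroDeriv Q) a = 0}
    (LQuiver.deriv_one _)
    (fun a ha b hb => by
      have ha' : LQuiver.deriv (zeroDeriv Q) a = 0 := ha
      have hb' : LQuiver.deriv (zeroDeriv Q) b = 0 := hb
      change LQuiver.deriv (zeroDeriv Q) (a * b) = 0
      rw [LQuiver.deriv_mul, ha', hb', zero_mul, mul_zero, add_zero])
    (LQuiver.deriv_e _) (LQuiver.deriv_r _) a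
  induction h using Submodule.span_induction with
  | mem x hx => exact hx
  | zero => rw [map_zero]
  | add x y _ _ hx hy => rw [map_add, hx, hy, add_zero]
  | smul c x _ hx => rw [map_smul, hx, smul_zero]

theorem tensorGr_tmul {M N : Type} [AddCommGroup M] [Module 𝔽 M] [AddCommGroup N] [Module 𝔽 N]
    {gr : ℤ × ℤ → Submodule 𝔽 M} {gr' : ℤ × ℤ → Submodule 𝔽 N} {i j k : ℤ × ℤ} {m : M} {n : N}
    (hm : m ∈ gr i) (hn : n ∈ gr' j) (h : i + j = k) : m ⊗ₜ[𝔽] n ∈ tensorGr gr gr' k :=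
  Submodule.subset_span ⟨i, j, h, m, hm, n, hn, rfl⟩

theorem formality_gen_mem (n : ℕ) (v : Vert n × Vert n) (l : Lab) :
    (formalityRep n).r v l ∈ tensorGr (quiver n).gr (quiver n).gr (Lab.deg n l) := by
  cases l with
  | left s => exact tensorGr_tmul (LQuiver.r_mem (Q := quiver n) v.1 s) (LQuiver.e_mem (Q := quiver n) v.2) (add_zero _)
  | right s => exact tensorGr_tmul (LQuiver.e_mem (Q := quiver n) v.1) (LQuiver.r_mem (Q := quiver n) v.2 s) (zero_add _)
  | both s => exact zero_mem _

theorem formality_e_mem (n : ℕ) (v : Vert n × Vert n) :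
    (formalityRep n).e v ∈ tensorGr (quiver n).gr (quiver n).gr 0 :=
  tensorGr_tmul (LQuiver.e_mem (Q := quiver n) v.1) (LQuiver.e_mem (Q := quiver n) v.2) (add_zero 0)

theorem formality_mem (n : ℕ) (k : ℤ × ℤ) (a : (boxQuiver n).Alg) (ha : a ∈ (boxQuiver n).gr k) :
    LQuiver.lift (formalityRep n) a ∈ tensorGr (quiver n).gr (quiver n).gr k := by
  have key : ∀ a : (boxQuiver n).Alg, ∀ k, LQuiver.lift (formalityRep n)
      ((boxQuiver n).comp a k) ∈ tensorGr (quiver n).gr (quiver n).gr k := by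
    intro a
    have h := LQuiver.mem_span {a : (boxQuiver n).Alg | ∃ k, a ∈ (boxQuiver n).gr k ∧
        LQuiver.lift (formalityRep n) a ∈ tensorGr (quiver n).gr (quiver n).gr k}
      ⟨0, LQuiver.one_mem_gr, by rw [map_one]; exact ((R n).tensor (R n)).one_mem⟩
      (by
        rintro a ⟨k, ha, hda⟩ b ⟨l, hb, hdb⟩
        refine ⟨k + l, LQuiver.mul_mem_gr ha hb, ?_⟩
        rw [map_mul]
        exact tensorGr_mul (R n) (R n) hda hdb)
      (fun v => ⟨0, LQuiver.e_mem v, by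
        rw [LQuiver.lift_e]
        exact formality_e_mem n v⟩)
      (fun v l => ⟨Lab.deg n l, LQuiver.r_mem v l, by
        rw [LQuiver.lift_r]
        exact formality_gen_mem n v l⟩) a
    induction h using Submodule.span_induction with
    | mem x hx =>
      obtain ⟨i, hx, hdx⟩ := hx
      intro k
      rw [LQuiver.comp_of_mem hx]
      by_cases h : i = k
      · subst h; rw [Finsupp.single_eq_same]; exact hdx
      · rw [Finsupp.single_eq_of_ne (Ne.symm h), map_zero]; exact zero_mem _
    | zero => intro k; rw [map_zero, Finsupp.zero_apply, map_zero]; exact zero_mem _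
    | add x y _ _ hx hy =>
      intro k
      rw [map_add, Finsupp.add_apply, map_add]
      exact add_mem (hx k) (hy k)
    | smul c x _ hx =>
      intro k
      rw [map_smul, Finsupp.smul_apply, map_smul]
      exact Submodule.smul_mem _ _ (hx k)
  have h := key a k
  rwa [LQuiver.comp_of_mem ha, Finsupp.single_eq_same] at h

theorem formality_d (n : ℕ) (a : (boxQuiver n).Alg) :
    LQuiver.lift (formalityRep n) (LQuiver.deriv (boxDeriv n) a) = 0 := by
  have h := LQuiver.mem_span {a : (boxQuiver n).Alg |
      LQuiver.lift (formalityRep n) (LQuiver.deriv (boxDeriv n) a) = 0}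
    (by
      change LQuiver.lift (formalityRep n) (LQuiver.deriv (boxDeriv n) 1) = 0
      rw [LQuiver.deriv_one, map_zero])
    (fun a ha b hb => by
      have ha' : LQuiver.lift (formalityRep n) (LQuiver.deriv (boxDeriv n) a) = 0 := ha
      have hb' : LQuiver.lift (formalityRep n) (LQuiver.deriv (boxDeriv n) b) = 0 := hb
      change LQuiver.lift (formalityRep n) (LQuiver.deriv (boxDeriv n) (a * b)) = 0
      rw [LQuiver.deriv_mul, map_add, map_mul, map_mul, ha', hb', zero_mul, mul_zero, add_zero])
    (fun v => by
      change LQuiver.lift (formalityRep n) (LQuiver.deriv (boxDeriv n) ((boxQuiver n).e v)) = 0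
      rw [LQuiver.deriv_e, map_zero])
    (fun v l => by
      change LQuiver.lift (formalityRep n) (LQuiver.deriv (boxDeriv n) ((boxQuiver n).r v l)) = 0
      rw [LQuiver.deriv_r]
      cases l with
      | left s => exact map_zero _
      | right s => exact map_zero _
      | both s =>
        change LQuiver.lift (formalityRep n) (boxδ v (Lab.both s)) = 0
        simp only [boxδ]
        rw [map_add, map_mul, map_mul, LQuiver.lift_r, LQuiver.lift_r, LQuiver.lift_r,
          LQuiver.lift_r]
        have h1 := (quiver n).r_e v.1 s
        have h2 := (quiver n).r_e v.2 (s + 1)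
        simp only [formalityRep, Algebra.TensorProduct.tmul_mul_tmul, Lab.move, h1, h2,
          LQuiver.e_r]
        exact add_self _) a
  induction h using Submodule.span_induction with
  | mem x hx => exact hx
  | zero => rw [map_zero, map_zero]
  | add x y _ _ hx hy => rw [map_add, map_add, hx, hy, add_zero]
  | smul c x _ hx => rw [map_smul, map_smul, hx, smul_zero]

theorem tensor_d_zero (n : ℕ) (x : (quiver n).Alg ⊗[𝔽] (quiver n).Alg) :
    tensorD (R n).d (R n).d x = 0 := by
  induction x using TensorProduct.induction_on with
  | zero => rw [map_zero]
  | add x y hx hy => rw [map_add, hx, hy, add_zero]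
  | tmul a b =>
    refine (tensorD_tmul (R n).d (R n).d a b).trans ?_
    change LQuiver.deriv (zeroDeriv (quiver n)) a ⊗ₜ b + a ⊗ₜ LQuiver.deriv (zeroDeriv (quiver n)) b = 0
    rw [LQuiver.deriv_zero, LQuiver.deriv_zero, TensorProduct.zero_tmul, TensorProduct.tmul_zero,
      add_zero]

def formality (n : ℕ) : DGHom (RR n) ((R n).tensor (R n)) where
  toAlgHom := LQuiver.lift (formalityRep n)
  map_mem := formality_mem n
  map_d := fun a => (tensor_d_zero n _).trans (formality_d n a).symm

/-! ### Projective modules and `DGP` -/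

section Proj

variable {Q : LQuiver}

/-- The left ideal generated by `e(v)`. -/
abbrev LQuiver.leftIdeal (Q : LQuiver) (v : Q.V) : Submodule Q.Alg Q.Alg :=
  Submodule.span Q.Alg {Q.e v}

theorem LQuiver.mem_leftIdeal {v : Q.V} {a : Q.Alg} : a ∈ Q.leftIdeal v ↔ a * Q.e v = a := by
  rw [Submodule.mem_span_singleton]
  constructor
  · rintro ⟨b, rfl⟩
    rw [smul_eq_mul, mul_assoc, LQuiver.e_mul, if_pos rfl]
  · intro h
    exact ⟨a, h⟩

/-- The projection `a ↦ a e(v)`. -/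
def LQuiver.toIdeal (Q : LQuiver) (v : Q.V) : Q.Alg →ₗ[𝔽] Q.leftIdeal v where
  toFun a := ⟨a * Q.e v, LQuiver.mem_leftIdeal.2 (by
    rw [mul_assoc, LQuiver.e_mul, if_pos rfl])⟩
  map_add' a b := Subtype.ext (add_mul a b _)
  map_smul' c a := Subtype.ext (smul_mul_assoc c a _)

theorem LQuiver.comp_mul_e (a : Q.Alg) (v : Q.V) (k : ℤ × ℤ) :
    Q.comp (a * Q.e v) k = Q.comp a k * Q.e v := by
  refine LQuiver.comp_induction (p := fun a => Q.comp (a * Q.e v) k = Q.comp a k * Q.e v)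
    ?_ ?_ ?_ a
  · simp
  · intro a b ha hb
    rw [add_mul, map_add, map_add, Finsupp.add_apply, Finsupp.add_apply, ha, hb, add_mul]
  · intro l a ha
    have h : a * Q.e v ∈ Q.gr l := by
      have := LQuiver.mul_mem_gr ha (LQuiver.e_mem v)
      rwa [add_zero] at this
    rw [LQuiver.comp_of_mem ha, LQuiver.comp_of_mem h]
    by_cases e : l = k
    · subst e; rw [Finsupp.single_eq_same, Finsupp.single_eq_same]
    · rw [Finsupp.single_eq_of_ne (Ne.symm e), Finsupp.single_eq_of_ne (Ne.symm e), zero_mul]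

/-- The grading of `A e(v)`. -/
def LQuiver.idealGr (Q : LQuiver) (v : Q.V) (k : ℤ × ℤ) : Submodule 𝔽 (Q.leftIdeal v) :=
  (Q.gr k).comap ((Q.leftIdeal v).subtype.restrictScalars 𝔽)

theorem LQuiver.mem_idealGr {v : Q.V} {k : ℤ × ℤ} {x : Q.leftIdeal v} :
    x ∈ Q.idealGr v k ↔ x.1 ∈ Q.gr k := Iff.rfl

theorem LQuiver.idealGr_internal (v : Q.V) : DirectSum.IsInternal (Q.idealGr v) := by
  have hc : ∀ (x : Q.leftIdeal v) (k : ℤ × ℤ), Q.comp x.1 k ∈ Q.leftIdeal v := by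
    intro x k
    rw [LQuiver.mem_leftIdeal, ← LQuiver.comp_mul_e, LQuiver.mem_leftIdeal.1 x.2]
  obtain ⟨c, h1, h2, h3⟩ := exists_comp (LQuiver.gr_internal (Q := Q))
  refine isInternal_of_comp _
    ((Finsupp.mapRange.linearMap (Q.toIdeal v)) ∘ₗ c ∘ₗ
      ((Q.leftIdeal v).subtype.restrictScalars 𝔽)) ?_ ?_ ?_
  · intro x
    rw [LinearMap.comp_apply, LinearMap.comp_apply, Finsupp.mapRange.linearMap_apply,
      Finsupp.sum_mapRange_index (by simp)]
    have e := congrArg (Q.toIdeal v) (h1 x.1)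
    rw [Finsupp.sum, map_sum] at e
    refine e.trans (Subtype.ext ?_)
    exact LQuiver.mem_leftIdeal.1 x.2
  · intro x k
    have e : c x.1 k * Q.e v ∈ Q.gr (k + 0) := LQuiver.mul_mem_gr (h2 x.1 k) (LQuiver.e_mem v)
    rw [add_zero] at e
    exact LQuiver.mem_idealGr.2 e
  · intro k x hx
    rw [LinearMap.comp_apply, LinearMap.comp_apply]
    change Finsupp.mapRange.linearMap (Q.toIdeal v) (c x.1) = _
    rw [h3 k x.1 (LQuiver.mem_idealGr.1 hx), Finsupp.mapRange.linearMap_apply, Finsupp.mapRange_single]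
    exact congrArg _ (Subtype.ext (LQuiver.mem_leftIdeal.1 x.2))

/-- The projective DG module `P(v) = A e(v)`. -/
def proj {Q : LQuiver} (D : Q.DerivData) (h : ∀ v l, LQuiver.deriv D (D.δ v l) = 0) (v : Q.V) :
    DGMod (LQuiver.dgAlg D h) where
  carrier := Q.leftIdeal v
  gr := Q.idealGr v
  internal := LQuiver.idealGr_internal v
  smul_mem := fun ha hm => LQuiver.mem_idealGr.2 (LQuiver.mul_mem_gr ha (LQuiver.mem_idealGr.1 hm))
  d :=
    { toFun := fun x => ⟨LQuiver.deriv D x.1, by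
        have h := LQuiver.deriv_mul D x.1 (Q.e v)
        rw [LQuiver.deriv_e, mul_zero, add_zero, LQuiver.mem_leftIdeal.1 x.2] at h
        exact LQuiver.mem_leftIdeal.2 h.symm⟩
      map_add' := fun x y => Subtype.ext (map_add (LQuiver.deriv D) x.1 y.1)
      map_smul' := fun c x => Subtype.ext (map_smul (LQuiver.deriv D) c x.1) }
  d_mem := fun hm => LQuiver.mem_idealGr.2 (LQuiver.deriv_mem D (LQuiver.mem_idealGr.1 hm))
  d_d := fun x => Subtype.ext (LQuiver.deriv_deriv D h x.1)
  leibniz := fun a x => Subtype.ext (LQuiver.deriv_mul D a x.1)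

end Proj

/-- The smallest class of objects containing those in `S` that is closed under isomorphisms in the
homology category, the shifts `[a]{b}` and mapping cones of closed morphisms. -/
inductive Generated (S : Ho A → Prop) : Ho A → Prop
  | basic (X : Ho A) (h : S X) : Generated S X
  | shift (M : DGMod A) (a : ℤ × ℤ) (h : Generated S (Ho.of M)) : Generated S (Ho.of (M.shift a))
  | cone {M N : DGMod A} (f : Z0 M N) (hM : Generated S (Ho.of M)) (hN : Generated S (Ho.of N)) :
      Generated S (Ho.of (cone f))
  | iso {X Y : Ho A} (e : X ≅ Y) (h : Generated S X) : Generated S Y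

/-- The projective modules `P(x)` over `R_n` and `P(x, y)` over `R_n ⊠ R_n`. -/
def P (n : ℕ) (x : Vert n) : DGMod (R n) := proj _ _ x

def PP (n : ℕ) (v : Vert n × Vert n) : DGMod (RR n) := proj _ _ v

/-- The objects of `H⁰(DGP(R_n))` and of `H⁰(DGP(R_n ⊠ R_n))`. -/
def DGP (n : ℕ) : ObjectProperty (Ho (R n)) :=
  Generated fun X => ∃ x, X = Ho.of (P n x)

def DGPP (n : ℕ) : ObjectProperty (Ho (RR n)) :=
  Generated fun X => ∃ v, X = Ho.of (PP n v)

/-- `Z` is (a representative of) `χ(X, Y)`: an object of `H⁰(DGP(R_n ⊠ R_n))` that the induction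
functor along `H : R_n ⊠ R_n ⟶ R_n ⊗ R_n` sends to `X ⊗ Y`. -/
def IsChi (n : ℕ) (X Y : Ho (R n)) (Z : Ho (RR n)) : Prop :=
  DGPP n Z ∧ Nonempty ((tensorFunctor (indBimod (formality n))).obj Z ≅
    Ho.of (extTensor X.obj Y.obj))

/-- Finite direct sums of DG modules. -/
def sumMod {ι : Type} [Fintype ι] (M : ι → DGMod A) : DGMod A where
  carrier := ∀ i, M i
  gr := fun k => Submodule.pi Set.univ (fun i => (M i).gr k)
  internal := isInternal_pi fun i => (M i).internal
  smul_mem := fun ha hm i hi => (M i).smul_mem ha (hm i hi)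
  d := LinearMap.pi fun i => (M i).d ∘ₗ LinearMap.proj i
  d_mem := fun hm i hi => (M i).d_mem (hm i hi)
  d_d := fun m => funext fun i => (M i).d_d (m i)
  leibniz := fun a m => funext fun i => (M i).leibniz a (m i)

/-! ### The stacking bimodule -/

/-- The left and right actions on a bimodule. -/
def DGBimod.lmul (T : DGBimod B A) (b : B) (t : T) : T := b • t

def DGBimod.rmul (T : DGBimod B A) (t : T) (a : A) : T := MulOpposite.op a • t

section Stacking

variable {n : ℕ}

/-- The adjacent increasing pairs of `(x, y)`: the `s` with `s ∈ x` and `s + 1 ∈ y`. -/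
def adj (v : Vert n × Vert n) : Finset (Fin n) :=
  Finset.univ.filter fun s => s.castSucc ∈ v.1 ∧ s.succ ∈ v.2

/-- What remains of `x` and of `y` if the pairs `s, s + 1` are removed for the `s` not in `I`. -/
def restLeft (p : (Vert n × Vert n) × Finset (Fin n)) : Vert n :=
  p.1.1 \ (adj p.1 \ p.2).image Fin.castSucc

def restRight (p : (Vert n × Vert n) × Finset (Fin n)) : Vert n :=
  p.1.2 \ (adj p.1 \ p.2).image Fin.succ

variable (n) in
/-- The indices of the summands of `T`: a vertex `(x, y)` of `Γ_n ⊠ Γ_n`, and a set `I` of adjacent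
increasing pairs such that the corresponding term of the product of `x` and `y`, in which the pairs
in `I` are reordered and the other ones are contracted, has no repeated number. -/
abbrev Idx : Type :=
  {p : (Vert n × Vert n) × Finset (Fin n) // p.2 ⊆ adj p.1 ∧ Disjoint (restLeft p) (restRight p)}

/-- The corresponding vertex of `Γ_n`. -/
def Idx.vtx (i : Idx n) : Vert n := restLeft i.1 ∪ restRight i.1

/-- The cohomological degree of the generator of a summand. -/
def Idx.coh (i : Idx n) : ℤ :=
  (∑ a ∈ i.1.1.1, ∑ b ∈ i.1.1.2,
    if a.val + 1 < b.val then (-1 : ℤ) ^ (a.val + b.val + 1) else 0) + i.1.2.card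

/-- The shift of the `q`-grading of a summand. -/
def Idx.qshift (i : Idx n) : ℤ := ∑ s ∈ adj i.1.1 \ i.1.2, (2 * (s.val : ℤ) + 1 - n)

/-- The matrix of the differential of `T`: from the summand of `I` to that of `I ∪ {s}`, it is
right multiplication by the arrow with label `s`. -/
def dCoeff (i j : Idx n) : (quiver n).Alg :=
  ∑ s ∈ adj i.1.1 \ i.1.2,
    if j.1 = (i.1.1, insert s i.1.2) then (quiver n).r i.vtx s.val else 0

/-- The matrix of right multiplication by `e(v)`. -/
def idemCoeff (v : Vert n × Vert n) (i j : Idx n) : (quiver n).Alg :=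
  if i.1.1 = v ∧ j = i then (quiver n).e i.vtx else 0

/-- The set of pairs after right multiplication by an arrow. -/
def nextPairs (p : (Vert n × Vert n) × Finset (Fin n)) : Lab → Finset (Fin n)
  | Lab.left t => p.2 ∪ Finset.univ.filter fun s => s.val = t + 1 ∧ s.succ ∈ p.1.2
  | Lab.right t => p.2 ∪ Finset.univ.filter fun s => s.val + 1 = t ∧ s.castSucc ∈ p.1.1
  | Lab.both _ => p.2

open Classical in
/-- The entries of the matrix of right multiplication by an arrow. -/
def arrWeight (i j : Idx n) : Lab → (quiver n).Alg
  | Lab.left t =>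
      if ∃ b ∈ i.1.1.2, b.val = t + 1 then (quiver n).e j.vtx else (quiver n).r i.vtx t
  | Lab.right t =>
      if ∃ a ∈ i.1.1.1, a.val = t then (quiver n).e j.vtx else (quiver n).r i.vtx t
  | Lab.both _ => (quiver n).e j.vtx

open Classical in
/-- The matrix of right multiplication by the arrow of `Γ_n ⊠ Γ_n` at `v` with label `l`. -/
def arrCoeff (v : Vert n × Vert n) (l : Lab) (i j : Idx n) : (quiver n).Alg :=
  if i.1.1 = v ∧ Lab.valid v l ∧ j.1 = (Lab.move v l, nextPairs i.1 l) then arrWeight i j l else 0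

variable (n) in
/-- `T` is the stacking bimodule: as a left module it is the direct sum of the projectives
`P(i.vtx)`, over the indices `i`, suitably shifted, and the differential and the right
multiplication by the generators of `R_n ⊠ R_n` are given by the matrices above. -/
def IsStacking (T : DGBimod (R n) (RR n)) : Prop :=
  ∃ ψ : T.carrier →+ (Idx n → (quiver n).Alg),
    Function.Injective ψ ∧
    (∀ f, (∃ t, ψ t = f) ↔ ∀ i, f i ∈ (quiver n).leftIdeal i.vtx) ∧
    (∀ a t i, ψ (T.lmul a t) i = a * ψ t i) ∧
    (∀ t k, t ∈ T.gr k ↔ ∀ i, ψ t i ∈ (quiver n).gr (k.1 - i.coh, k.2 + i.qshift)) ∧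
    (∀ t j, ψ (T.d t) j = ∑ i, ψ t i * dCoeff i j) ∧
    (∀ t v j, ψ (T.rmul t ((boxQuiver n).e v)) j = ∑ i, ψ t i * idemCoeff v i j) ∧
    (∀ t v l j, ψ (T.rmul t ((boxQuiver n).r v l)) j = ∑ i, ψ t i * arrCoeff v l i j)

end Stacking

/-! ### The integral form of the quantum group -/

/-- The relations `E² = F² = 0` and `E F + F E = q^(n-1) + q^(n-3) + ⋯ + q^(1-n)`, where `E` and `F`
are the generators with index `0` and `1`. -/
inductive UnRel (n : ℕ) : FreeAlgebra (LaurentPolynomial ℤ) (Fin 2) →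
    FreeAlgebra (LaurentPolynomial ℤ) (Fin 2) → Prop
  | sq (i : Fin 2) : UnRel n (FreeAlgebra.ι (LaurentPolynomial ℤ) i * FreeAlgebra.ι (LaurentPolynomial ℤ) i) 0
  | anti : UnRel n
      (FreeAlgebra.ι (LaurentPolynomial ℤ) 0 * FreeAlgebra.ι (LaurentPolynomial ℤ) 1 + FreeAlgebra.ι (LaurentPolynomial ℤ) 1 * FreeAlgebra.ι (LaurentPolynomial ℤ) 0)
      (algebraMap (LaurentPolynomial ℤ) (FreeAlgebra (LaurentPolynomial ℤ) (Fin 2))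
        (∑ i ∈ Finset.range n, LaurentPolynomial.T ((n : ℤ) - 1 - 2 * i)))

/-- The integral form `U_n`. -/
def Un (n : ℕ) : Type := RingQuot (UnRel n)

instance (n : ℕ) : Ring (Un n) := inferInstanceAs (Ring (RingQuot (UnRel n)))

instance (n : ℕ) : Algebra (LaurentPolynomial ℤ) (Un n) :=
  inferInstanceAs (Algebra (LaurentPolynomial ℤ) (RingQuot (UnRel n)))

/-- The generators `E` and `F` of `U_n`. -/
def Un.E (n : ℕ) : Un n := RingQuot.mkAlgHom (LaurentPolynomial ℤ) (UnRel n) (FreeAlgebra.ι (LaurentPolynomial ℤ) 0)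

def Un.F (n : ℕ) : Un n := RingQuot.mkAlgHom (LaurentPolynomial ℤ) (UnRel n) (FreeAlgebra.ι (LaurentPolynomial ℤ) 1)

/-! ### Words and their lifts -/

/-- The letters `1, q, q⁻¹, E, F`. -/
inductive Letter : Type
  | one : Letter
  | q : Letter
  | qinv : Letter
  | E : Letter
  | F : Letter

/-- The element of `U_n` given by a letter, and by a bracketed word in the letters. -/
def Letter.val (n : ℕ) : Letter → Un n
  | one => 1
  | q => algebraMap (LaurentPolynomial ℤ) (Un n) (LaurentPolynomial.T 1)
  | qinv => algebraMap (LaurentPolynomial ℤ) (Un n) (LaurentPolynomial.T (-1))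
  | E => Un.E n
  | F => Un.F n

def wordVal (n : ℕ) (w : FreeMagma Letter) : Un n := FreeMagma.lift (Letter.val n) w

/-- The lift of a letter. -/
def Letter.obj (n : ℕ) : Letter → Ho (R n)
  | one => Ho.of (P n ∅)
  | q => Ho.of ((P n ∅).shift (0, 1))
  | qinv => Ho.of ((P n ∅).shift (0, -1))
  | E => Ho.of (sumMod fun i : {i : Fin (n + 1) // Even i.val} => P n {i.1})
  | F => Ho.of (sumMod fun i : {i : Fin (n + 1) // Odd i.val} => P n {i.1})

/-- The lifts of a bracketed word, for the product `ρ(X, Y) = T ⊗ χ(X, Y)`. -/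
inductive IsLift (n : ℕ) (T : DGBimod (R n) (RR n)) : FreeMagma Letter → Ho (R n) → Prop
  | letter (a : Letter) : IsLift n T (FreeMagma.of a) (a.obj n)
  | mul {v w : FreeMagma Letter} {X Y : Ho (R n)} {Z : Ho (RR n)} (hX : IsLift n T v X)
      (hY : IsLift n T w Y) (hZ : IsChi n X Y Z) : IsLift n T (v * w) ((tensorFunctor T).obj Z)


/-! ### Triangulated subcategories and Grothendieck groups -/

section Triangulated

open Pretriangulated ZeroObject

variable {C : Type 1} [Category.{0} C] [HasZeroObject C] [HasShift C ℤ] [Preadditive C]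
  [∀ k : ℤ, (shiftFunctor C k).Additive] [Pretriangulated C]

/-- The smallest triangulated subcategory closed under isomorphisms that contains the objects
in `S`. -/
inductive TriClosure (S : C → Prop) : C → Prop
  | basic (X : C) (h : S X) : TriClosure S X
  | zero (X : C) (h : IsZero X) : TriClosure S X
  | shift (X : C) (k : ℤ) (h : TriClosure S X) : TriClosure S (X⟦k⟧)
  | iso {X Y : C} (e : X ≅ Y) (h : TriClosure S X) : TriClosure S Y
  | ext (T : Triangle C) (hT : T ∈ distTriang C) (h₁ : TriClosure S T.obj₁)
      (h₃ : TriClosure S T.obj₃) : TriClosure S T.obj₂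

def triClosure (S : C → Prop) : ObjectProperty C := TriClosure S

instance (S : C → Prop) : (triClosure S).IsClosedUnderIsomorphisms where
  of_iso e h := TriClosure.iso e h

instance (S : C → Prop) : (triClosure S).IsTriangulated where
  exists_zero := ⟨0, isZero_zero C, TriClosure.zero _ (isZero_zero C)⟩
  isStableUnderShiftBy k := ⟨fun X h => TriClosure.shift X k h⟩
  ext₂' T hT h₁ h₃ := ObjectProperty.le_isoClosure _ _ (TriClosure.ext T hT h₁ h₃)

/-- The subgroup generated by `[X₂] - [X₁] - [X₃]` for the distinguished triangles
`X₁ ⟶ X₂ ⟶ X₃ ⟶ X₁[1]`. -/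
def triangleRel (C : Type 1) [Category.{0} C] [HasZeroObject C] [HasShift C ℤ] [Preadditive C]
    [∀ k : ℤ, (shiftFunctor C k).Additive] [Pretriangulated C] :
    AddSubgroup (FreeAbelianGroup C) :=
  AddSubgroup.closure {x | ∃ T ∈ distTriang C, x = FreeAbelianGroup.of T.obj₂ -
    FreeAbelianGroup.of T.obj₁ - FreeAbelianGroup.of T.obj₃}

/-- The Grothendieck group of a triangulated category. -/
abbrev K0 (C : Type 1) [Category.{0} C] [HasZeroObject C] [HasShift C ℤ] [Preadditive C]
    [∀ k : ℤ, (shiftFunctor C k).Additive] [Pretriangulated C] : Type 1 :=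
  FreeAbelianGroup C ⧸ triangleRel C

/-- The class of an object. -/
def K0.cls (X : C) : K0 C := QuotientAddGroup.mk (FreeAbelianGroup.of X)

/-- The map induced by an exact functor. -/
def K0.map {D : Type 1} [Category.{0} D] [HasZeroObject D] [HasShift D ℤ] [Preadditive D]
    [∀ k : ℤ, (shiftFunctor D k).Additive] [Pretriangulated D] (F : C ⥤ D) [F.CommShift ℤ]
    [F.IsTriangulated] : K0 C →+ K0 D :=
  QuotientAddGroup.map _ _ (FreeAbelianGroup.map F.obj) (by
    rw [triangleRel, AddSubgroup.closure_le]
    rintro _ ⟨T, hT, rfl⟩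
    change FreeAbelianGroup.map F.obj _ ∈ triangleRel D
    rw [map_sub, map_sub, FreeAbelianGroup.map_of_apply, FreeAbelianGroup.map_of_apply,
      FreeAbelianGroup.map_of_apply]
    exact AddSubgroup.subset_closure ⟨_, F.map_distinguished T hT, rfl⟩)

theorem K0.map_cls {D : Type 1} [Category.{0} D] [HasZeroObject D] [HasShift D ℤ] [Preadditive D]
    [∀ k : ℤ, (shiftFunctor D k).Additive] [Pretriangulated D] (F : C ⥤ D) [F.CommShift ℤ]
    [F.IsTriangulated] (X : C) : K0.map F (K0.cls X) = K0.cls (F.obj X) := by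
  refine (QuotientAddGroup.map_mk _ _ _ _ _).trans ?_
  rw [FreeAbelianGroup.map_of_apply]
  rfl

end Triangulated

/-- The triangulated subcategory `𝒰_n` of `H⁰(DGP(R_n))` generated by the lifts of words. -/
def U (n : ℕ) (T : DGBimod (R n) (RR n)) : ObjectProperty (Ho (R n)) :=
  triClosure fun X => ∃ w, IsLift n T w X

/-- The triangulated subcategory `𝒰_{n,n}` of `H⁰(DGP(R_n ⊠ R_n))` generated by the objects
`χ(X, Y)` for `X` and `Y` in `𝒰_n`. -/
def UU (n : ℕ) (T : DGBimod (R n) (RR n)) : ObjectProperty (Ho (RR n)) :=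
  triClosure fun Z => ∃ X Y, U n T X ∧ U n T Y ∧ IsChi n X Y Z

instance (n : ℕ) (T : DGBimod (R n) (RR n)) : (U n T).IsClosedUnderIsomorphisms :=
  inferInstanceAs (triClosure _).IsClosedUnderIsomorphisms

instance (n : ℕ) (T : DGBimod (R n) (RR n)) : (U n T).IsTriangulated :=
  inferInstanceAs (triClosure _).IsTriangulated

instance (n : ℕ) (T : DGBimod (R n) (RR n)) : (UU n T).IsClosedUnderIsomorphisms :=
  inferInstanceAs (triClosure _).IsClosedUnderIsomorphisms

instance (n : ℕ) (T : DGBimod (R n) (RR n)) : (UU n T).IsTriangulated :=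
  inferInstanceAs (triClosure _).IsTriangulated

end

end QDG

open QDG

/-!
The argument has four parts.

*Classes and dense subcategories.* An object of `H⁰(DGP(R_n))` has, for every vertex `v`, a graded
Euler characteristic of its morphisms to the shifts of the simple module at `v`. These functions
(`chi`) are additive on triangles, and `P(v)` has the class `Pi.single v 1`. By an argument of
Thomason, a triangulated subcategory which is dense, in the sense that every `P(v){b}` is a direct
summand of one of its objects, contains precisely the objects whose class belongs to a certain
group, and its Grothendieck group is that group of classes (`prop_of_chi_eq`, `exists_K0_equiv`).
The same holds for `R_n ⊠ R_n`. Thus `K₀(𝒰_n)` and `K₀(𝒰_{n,n})` are computed by the classes of the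
generating objects, provided that these categories are dense.

*The objects `χ(X, Y)`.* The homomorphism `H : R_n ⊠ R_n ⟶ R_n ⊗ R_n` is a quasi-isomorphism. It has
the section `a ⊗ b ↦ (a, ∅) (∅, b)`, and every cycle is homologous to an element in the image of the
section: the arrows `(∅, t)` can be moved to the end of a path, one `t` at a time, at the cost of
boundaries (`cycle_decomp`, `exists_section`, `exists_boundary`). The homotopy is obtained from a
homomorphism of DG algebras from `R_n ⊠ R_n` to upper triangular matrices of size three
(`transport`). Hence induction along `H` is fully faithful on the objects generated by the
projective modules (`indFunctor_map_bijective`), cones lift along it (`exists_cone_lift`), and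
`χ(X, Y)` exists, is unique, and has the product class (`exists_isChi`, `chiRR_of_isChi`).

*The integral form.* On classes, `T_n ⊗ -` is given by an explicit product of vertices, the
combination `stackVec (x, y)` of the vertices `x_I ∪ y_I` (`stacking_generated`). If `i` is greater
than all elements of `x`, then the product of `x ∪ {i}` with `y` is obtained from that of `x` with `y`
by the operator `leftOp i`, the sum of the fermionic creation operator at `i` and a multiple of the
annihilation operator at `i + 1` (`stackVec_insert`). These operators satisfy Clifford relations, so
that their sums over the even and the odd `i` satisfy the relations of `E` and `F`; thus `U_n` acts on
the free module on the vertices. Acting on the vacuum vector embeds `U_n` in it, with a linear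
left inverse (`retraction_embed`), so that the tensor square embeds as well, and the product of
vertices restricts to the multiplication of `U_n` (`stackSum_embed`). Therefore the class of the
lift of a word is the image of the value of the word (`lift_class`).

*Density.* The modules `P({i})` are summands of the lifts of `E` and `F`, and if `i` is greater than
all elements of `x`, then stacking `P({i})` and `P(x)` gives `P(x ∪ {i})`. So all the `P(x){b}` are
summands of lifts of words (`liftSummand_P`), and all the `P(x, y){b}` are summands of objects of
`𝒰_{n,n}`. The first part now identifies the Grothendieck groups with `U_n` and its tensor square
(`U_K0`, `UU_K0`), and shows that `T_n ⊗ -` and the shifts `{b}` preserve the two categories, since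
they preserve the groups of classes.
-/

namespace QDG

noncomputable section

local notation "Λ" => LaurentPolynomial ℤ

/-! ### Isomorphisms and triangles in the homology category -/

section Graded

variable {M N : Type} [AddCommGroup M] [Module 𝔽 M] [AddCommGroup N] [Module 𝔽 N]

/-- An injective graded map reflects homogeneity. -/
theorem mem_gr_of_injective {gr : ℤ × ℤ → Submodule 𝔽 M} {gr' : ℤ × ℤ → Submodule 𝔽 N}
    (h : DirectSum.IsInternal gr) (h' : DirectSum.IsInternal gr') (f : M →ₗ[𝔽] N)
    (hf : Function.Injective f) (hgr : ∀ k, ∀ m ∈ gr k, f m ∈ gr' k) {k : ℤ × ℤ} {m : M}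
    (hm : f m ∈ gr' k) : m ∈ gr k := by
  classical
  obtain ⟨c, h1, h2, h3⟩ := exists_comp h
  obtain ⟨c', h1', h2', h3'⟩ := exists_comp h'
  have key : ∀ m, c' (f m) = Finsupp.mapRange.linearMap f (c m) := by
    refine internal_induction h (by simp) (fun x y hx hy => by simp only [map_add, hx, hy]) fun k m hm => ?_
    rw [h3 k m hm, h3' k _ (hgr k m hm), Finsupp.mapRange.linearMap_apply,
      Finsupp.mapRange_single]
  have h0 : ∀ i, i ≠ k → c m i = 0 := fun i hi => by
    apply hf
    have e := DFunLike.congr_fun (key m) i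
    rw [h3' k _ hm, Finsupp.single_eq_of_ne hi, Finsupp.mapRange.linearMap_apply,
      Finsupp.mapRange_apply] at e
    rw [← e, map_zero]
  have e : c m = Finsupp.single k (c m k) := by
    ext i
    by_cases hi : i = k
    · subst hi; simp
    · rw [h0 i hi, Finsupp.single_eq_of_ne hi]
  rw [← h1 m, e, Finsupp.sum_single_index rfl]
  exact h2 m k

end Graded

variable {A B : QDGAlg}

/-- A bijective closed morphism has a closed inverse. -/
def zinv {M N : DGMod A} (f : Z0 M N) (hf : Function.Bijective f.1) : Z0 N M :=
  let e := LinearEquiv.ofBijective f.1 hf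
  have he : ∀ n, f.1 (e.symm n) = n := e.apply_symm_apply
  zmk e.symm.toLinearMap
    (fun k n hn => mem_gr_of_injective M.internal N.internal (f.1.restrictScalars 𝔽) hf.1
      (fun _ _ h => Z0_mem f h) (by
        change f.1 (e.symm n) ∈ N.gr k
        rwa [he]))
    (fun n => hf.1 (by
      change f.1 (M.d (e.symm n)) = f.1 (e.symm (N.d n))
      rw [← Z0_comm, he, he]))

/-- A bijective closed morphism is an isomorphism. -/
def isoOfBijective {M N : DGMod A} (f : Z0 M N) (hf : Function.Bijective f.1) :
    Ho.of M ≅ Ho.of N :=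
  isoOf f (zinv f hf)
    (congrArg cls (Subtype.ext (LinearMap.ext
      (LinearEquiv.ofBijective f.1 hf).symm_apply_apply)))
    (congrArg cls (Subtype.ext (LinearMap.ext
      (LinearEquiv.ofBijective f.1 hf).apply_symm_apply)))

open Pretriangulated in
theorem coneTriangle_distinguished {M N : DGMod A} (f : Z0 M N) :
    coneTriangle f ∈ distTriang (Ho A) :=
  ⟨M, N, f, ⟨Iso.refl _⟩⟩

open Pretriangulated Triangulated in
/-- The octahedral axiom: for composable `f` and `g`, the cone of the map `C(f) ⟶ C(g f)` is
homotopy equivalent to `C(g)`. -/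
instance : IsTriangulated (Ho A) := by
  refine IsTriangulated.mk' fun X Y Z f g => ?_
  obtain ⟨f, rfl⟩ := cls_surj f
  obtain ⟨g, rfl⟩ := cls_surj g
  let X := X.obj
  let Y := Y.obj
  let Z := Z.obj
  refine ⟨_, _, _, _, _, _, cls f, cls g, Iso.refl _, Iso.refl _, Iso.refl _, rfl, rfl,
    _, _, coneTriangle_distinguished f, _, _, coneTriangle_distinguished g,
    _, _, coneTriangle_distinguished (zcomp f g), ⟨?_⟩⟩
  let m₁ : Z0 (cone f) (cone (zcomp f g)) :=
    zmk (M := cone f) (N := cone (zcomp f g))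
      ((g.1 ∘ₗ LinearMap.fst A Y X).prod (LinearMap.snd A Y X))
      (fun k x hx => ⟨Z0_mem g hx.1, hx.2⟩)
      (fun x => by
        refine Prod.ext ?_ rfl
        change Z.d (g.1 x.1) + g.1 (f.1 x.2) = g.1 (Y.d x.1 + f.1 x.2)
        rw [map_add, Z0_comm])
  let m₃ : Z0 (cone (zcomp f g)) (cone g) :=
    zmk (M := cone (zcomp f g)) (N := cone g)
      ((LinearMap.fst A Z X).prod (f.1 ∘ₗ LinearMap.snd A Z X))
      (fun k x hx => ⟨hx.1, Z0_mem f hx.2⟩)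
      (fun x => Prod.ext rfl (Z0_comm f x.2))
  refine ⟨cls m₁, cls m₃, rfl, rfl, ?_, ?_, ?_⟩
  · refine congrArg cls (Subtype.ext (LinearMap.ext fun z => ?_))
    exact Prod.ext rfl (map_zero f.1)
  · rfl
  · refine ⟨_, _, m₁, ⟨?_⟩⟩
    -- `C(m₁)` is the sum of `C(g)` and of a contractible complex on two copies of `X`; `u` and `v`
    -- are the inclusion and a retraction.
    let u : Z0 (cone g) (cone m₁) :=
      zmk (M := cone g) (N := cone m₁)
        (((LinearMap.inl A Z X) ∘ₗ LinearMap.fst A Z Y).prod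
          ((LinearMap.inl A Y X) ∘ₗ LinearMap.snd A Z Y))
        (fun k x hx => ⟨⟨hx.1, zero_mem _⟩, ⟨hx.2, zero_mem _⟩⟩)
        (fun x => by
          refine Prod.ext (Prod.ext ?_ ?_) (Prod.ext ?_ ?_)
          · change (Z.d x.1 + g.1 (f.1 0)) + g.1 x.2 = Z.d x.1 + g.1 x.2
            simp
          · change X.d 0 + 0 = 0
            simp
          · change Y.d x.2 + f.1 0 = Y.d x.2
            simp
          · change X.d 0 = 0
            simp)
    let v : Z0 (cone m₁) (cone g) :=
      zmk (M := cone m₁) (N := cone g)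
        ((LinearMap.fst A Z X ∘ₗ LinearMap.fst A (Z × X) (Y × X)).prod
          (LinearMap.fst A Y X ∘ₗ LinearMap.snd A (Z × X) (Y × X) +
            f.1 ∘ₗ LinearMap.snd A Z X ∘ₗ LinearMap.fst A (Z × X) (Y × X)))
        (fun k x hx => ⟨hx.1.1, add_mem hx.2.1 (Z0_mem f hx.1.2)⟩)
        (fun x => by
          refine Prod.ext ?_ ?_
          · change Z.d x.1.1 + g.1 (x.2.1 + f.1 x.1.2) = (Z.d x.1.1 + g.1 (f.1 x.1.2)) + g.1 x.2.1
            rw [map_add]; abel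
          · change Y.d (x.2.1 + f.1 x.1.2) = (Y.d x.2.1 + f.1 x.2.2) + f.1 (X.d x.1.2 + x.2.2)
            rw [map_add, map_add, Z0_comm]
            have h := add_self (f.1 x.2.2)
            calc _ = Y.d x.2.1 + f.1 (X.d x.1.2) + 0 := by abel
              _ = _ := by rw [← h]; abel)
    have huv : cls (zcomp u v) = cls (zid (cone g)) := by
      refine congrArg cls (Subtype.ext (LinearMap.ext fun x => ?_))
      refine Prod.ext rfl ?_
      change x.2 + f.1 0 = x.2
      simp
    have hvu : cls (zcomp v u) = cls (zid (cone m₁)) := by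
      refine cls_eq (M := cone m₁) (N := cone m₁)
        (LinearMap.inr A (Z × X) (Y × X) ∘ₗ LinearMap.inr A Y X ∘ₗ LinearMap.snd A Z X ∘ₗ
          LinearMap.fst A (Z × X) (Y × X)) ?_ ?_
      · intro k x hx
        refine ⟨zero_mem _, zero_mem _, ?_⟩
        change x.1.2 ∈ X.gr (k + (-1, 0) + (1, 0) + (1, 0))
        rw [add_assoc k, show ((-1, 0) + (1, 0) : ℤ × ℤ) = 0 from rfl, add_zero]
        exact hx.1.2
      · rintro ⟨⟨z, x⟩, y, x'⟩
        refine Prod.ext (Prod.ext ?_ ?_) (Prod.ext ?_ ?_)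
        · change z = z + (((Z.d 0 + g.1 (f.1 0)) + g.1 0) + 0)
          simp
        · change 0 = x + ((X.d 0 + x) + 0)
          simp [add_self]
        · change y + f.1 x = y + ((Y.d 0 + f.1 x) + 0)
          simp
        · change 0 = x' + (X.d x + (X.d x + x'))
          rw [← add_assoc (X.d x), add_self, zero_add, add_self]
    refine Triangle.isoMk _ _ (Iso.refl _) (Iso.refl _) (isoOf u v huv hvu) ?_ ?_ ?_
    · exact (Category.comp_id _).trans (Category.id_comp _).symm
    · refine Eq.trans ?_ (Category.id_comp _).symm
      refine cls_eq (M := cone (zcomp f g)) (N := cone m₁)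
        (LinearMap.inr A (Z × X) (Y × X) ∘ₗ LinearMap.inr A Y X ∘ₗ LinearMap.snd A Z X) ?_ ?_
      · intro k x hx
        refine ⟨zero_mem _, zero_mem _, ?_⟩
        change x.2 ∈ X.gr (k + (-1, 0) + (1, 0) + (1, 0))
        rw [add_assoc k, show ((-1, 0) + (1, 0) : ℤ × ℤ) = 0 from rfl, add_zero]
        exact hx.2
      · rintro ⟨z, x⟩
        refine Prod.ext (Prod.ext ?_ ?_) (Prod.ext ?_ ?_)
        · change z = z + (((Z.d 0 + g.1 (f.1 0)) + g.1 0) + 0)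
          simp
        · change 0 = x + ((X.d 0 + x) + 0)
          simp [add_self]
        · change f.1 x = 0 + ((Y.d 0 + f.1 x) + 0)
          simp
        · change 0 = 0 + (X.d x + X.d x)
          rw [add_self, add_zero]
    · refine (congrArg (fun t => _ ≫ t) ((shiftFunctor (Ho A) (1 : ℤ)).map_id _)).trans ?_
      refine (Category.comp_id _).trans ?_
      rfl

/-! ### Exactness of the shifts `{b}` and of tensor products -/

/-- A module which decomposes like a cone, as a module and compatibly with the differentials, is
isomorphic to it. -/
def splitConeMap {E M N : DGMod A} {f : Z0 M N} (p₁ : E →ₗ[A] N) (p₂ : E →ₗ[A] M) (q₁ : N →ₗ[A] E)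
    (q₂ : M →ₗ[A] E) (h₁ : ∀ u, p₁ (q₁ u) = u) (h₂ : ∀ u, p₂ (q₂ u) = u) (h₃ : ∀ u, p₁ (q₂ u) = 0)
    (h₄ : ∀ u, p₂ (q₁ u) = 0) (h₅ : ∀ u, q₁ (p₁ u) + q₂ (p₂ u) = u) (hp₁ : p₁ ∈ homDeg E N 0)
    (hp₂ : p₂ ∈ homDeg E M 1) (hd₁ : ∀ u, N.d (p₁ u) + f.1 (p₂ u) = p₁ (E.d u))
    (hd₂ : ∀ u, M.d (p₂ u) = p₂ (E.d u)) : {c : Z0 E (cone f) // Function.Bijective c.1} :=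
  ⟨zmk (M := E) (N := cone f) (p₁.prod p₂)
    (fun k u hu => ⟨by
      have h := hp₁ k u hu
      rwa [show k + ((0 : ℤ), (0 : ℤ)) = k from add_zero k] at h, hp₂ k u hu⟩)
    fun u => Prod.ext (hd₁ u) (hd₂ u),
    Function.bijective_iff_has_inverse.2 ⟨LinearMap.coprod q₁ q₂, h₅, fun u => Prod.ext
      ((map_add p₁ _ _).trans ((congrArg₂ (· + ·) (h₁ u.1) (h₃ u.2)).trans (add_zero _)))
      ((map_add p₂ _ _).trans ((congrArg₂ (· + ·) (h₄ u.1) (h₂ u.2)).trans (zero_add _)))⟩⟩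

/-- A closed bijection is an isomorphism in the homology category. -/
def isoOfBijection {M N : DGMod A} (c : {c : Z0 M N // Function.Bijective c.1}) :
    Ho.of M ≅ Ho.of N :=
  isoOfBijective c.1 c.2

theorem fst_mem_homDeg {M N : DGMod A} (f : Z0 M N) :
    (LinearMap.fst A N M : cone f →ₗ[A] N) ∈ homDeg (cone f) N 0 := fun k x hx => by
  rw [show k + ((0 : ℤ), (0 : ℤ)) = k from add_zero k]
  exact hx.1

theorem snd_mem_homDeg {M N : DGMod A} (f : Z0 M N) :
    (LinearMap.snd A N M : cone f →ₗ[A] M) ∈ homDeg (cone f) M 1 := fun _ _ hx => hx.2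

/-- The cone of a shifted map is the shifted cone. -/
def coneShiftIso {M N : DGMod A} (f : Z0 M N) (a : ℤ × ℤ) :
    Ho.of (cone (zshift f a)) ≅ Ho.of ((cone f).shift a) :=
  isoOfBijective (M := cone (zshift f a)) (N := (cone f).shift a)
    (zmk (M := cone (zshift f a)) (N := (cone f).shift a) LinearMap.id
      (fun k x hx => ⟨hx.1, by
        have h : x.2 ∈ M.gr (k + (1, 0) + a) := hx.2
        change x.2 ∈ M.gr (k + a + (1, 0))
        rwa [add_right_comm]⟩) (fun _ => rfl)) Function.bijective_id

theorem tensorGr_shift {M N : Type} [AddCommGroup M] [Module 𝔽 M] [AddCommGroup N] [Module 𝔽 N]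
    (gr : ℤ × ℤ → Submodule 𝔽 M) (gr' : ℤ × ℤ → Submodule 𝔽 N) (a k : ℤ × ℤ) :
    tensorGr gr (fun k => gr' (k + a)) k = tensorGr gr gr' (k + a) := by
  refine le_antisymm (Submodule.span_mono ?_) (Submodule.span_mono ?_)
  · rintro _ ⟨i, j, rfl, m, hm, n, hn, rfl⟩
    exact ⟨i, j + a, (add_assoc _ _ _).symm, m, hm, n, hn, rfl⟩
  · rintro _ ⟨i, j, h, m, hm, n, hn, rfl⟩
    refine ⟨i, j - a, ?_, m, hm, n, ?_, rfl⟩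
    · rw [← add_sub_assoc, h, add_sub_cancel_right]
    · change n ∈ gr' (j - a + a)
      rwa [sub_add_cancel]

section

variable (T : DGBimod B A)

theorem tensorMod_ext {N : DGMod A} {P : Type} [AddCommGroup P] [Module B P]
    {f g : tensorMod T N →ₗ[B] P}
    (h : ∀ (t : T) (n : N), f (tensorMk T N (t ⊗ₜ n)) = g (tensorMk T N (t ⊗ₜ n))) : f = g :=
  LinearMap.ext fun x => tensorMod_ind T (p := fun x => f x = g x) (by rw [map_zero, map_zero])
    (fun x y hx hy => by rw [map_add, map_add, hx, hy]) h x

theorem tensorMap_eq_self {N N' : DGMod A} {f : N →ₗ[A] N'} {g : N' →ₗ[A] N}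
    (h : ∀ n, g (f n) = n) (x : tensorMod T N) : tensorMap T g (tensorMap T f x) = x :=
  LinearMap.congr_fun (f := tensorMap T g ∘ₗ tensorMap T f) (g := LinearMap.id)
    (tensorMod_ext T fun t n => by
      change tensorMk T N (t ⊗ₜ g (f n)) = tensorMk T N (t ⊗ₜ n)
      rw [h]) x

theorem tensorMap_eq_zero {N N' N'' : DGMod A} {f : N →ₗ[A] N'} {g : N' →ₗ[A] N''}
    (h : ∀ n, g (f n) = 0) (x : tensorMod T N) : tensorMap T g (tensorMap T f x) = 0 :=
  LinearMap.congr_fun (f := tensorMap T g ∘ₗ tensorMap T f) (g := 0)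
    (tensorMod_ext T fun t n => by
      change tensorMk T N'' (t ⊗ₜ g (f n)) = 0
      rw [h, TensorProduct.tmul_zero, map_zero]) x

theorem tensorModGr_shift (N : DGMod A) (a k : ℤ × ℤ) :
    tensorModGr T (N.shift a) k = tensorModGr T N (k + a) :=
  congrArg (Submodule.map (tensorMk T N)) (tensorGr_shift T.gr N.gr a k)

/-- The tensor product commutes with the shifts. -/
def tensorShiftIso (N : DGMod A) (a : ℤ × ℤ) :
    Ho.of (tensorMod T (N.shift a)) ≅ Ho.of ((tensorMod T N).shift a) where
  hom := cls (M := tensorMod T (N.shift a)) (N := (tensorMod T N).shift a)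
    (zmk (M := tensorMod T (N.shift a)) (N := (tensorMod T N).shift a) LinearMap.id
      (fun k x hx => by
        change x ∈ tensorModGr T N (k + a)
        rw [← tensorModGr_shift]; exact hx) (fun _ => rfl))
  inv := cls (M := (tensorMod T N).shift a) (N := tensorMod T (N.shift a))
    (zmk (M := (tensorMod T N).shift a) (N := tensorMod T (N.shift a)) LinearMap.id
      (fun k x hx => by
        change x ∈ tensorModGr T (N.shift a) k
        rw [tensorModGr_shift]; exact hx) (fun _ => rfl))
  hom_inv_id := rfl
  inv_hom_id := rfl

instance : (tensorFunctor T).CommShift ℤ where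
  commShiftIso n := NatIso.ofComponents (fun N => tensorShiftIso T N.obj (n, 0)) (by
    intro N N' f
    obtain ⟨f, rfl⟩ := cls_surj f
    rfl)
  commShiftIso_zero := by
    ext N
    refine congrArg cls (Subtype.ext (tensorMod_ext T (N := N.obj.shift (0, 0)) fun t n => rfl))
  commShiftIso_add a b := by
    ext N
    rw [Functor.CommShift.isoAdd_hom_app]
    refine congrArg cls (Subtype.ext (tensorMod_ext T (N := N.obj.shift (a + b, 0)) fun t n => rfl))

/-- The bijection `T ⊗ C(f) ⟶ C(T ⊗ f)`. -/
def tensorConeMap {M N : DGMod A} (f : Z0 M N) :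
    {c : Z0 (tensorMod T (cone f)) (cone (tensorZ T f)) // Function.Bijective c.1} :=
  splitConeMap (E := tensorMod T (cone f))
    (tensorMap T (N := cone f) (N' := N) (LinearMap.fst A N M))
    (tensorMap T (N := cone f) (N' := M) (LinearMap.snd A N M))
    (tensorMap T (N := N) (N' := cone f) (LinearMap.inl A N M))
    (tensorMap T (N := M) (N' := cone f) (LinearMap.inr A N M))
    (tensorMap_eq_self T (N' := cone f) fun _ => rfl)
    (tensorMap_eq_self T (N' := cone f) fun _ => rfl)
    (tensorMap_eq_zero T (N' := cone f) fun _ => rfl)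
    (tensorMap_eq_zero T (N' := cone f) fun _ => rfl)
    (tensorMod_ind T (N := cone f) (by simp)
      (fun x y hx hy => by rw [map_add, map_add, map_add, map_add, add_add_add_comm, hx, hy])
      fun t x => by
        change tensorMk T (cone f) (t ⊗ₜ (x.1, (0 : M))) +
          tensorMk T (cone f) (t ⊗ₜ ((0 : N), x.2)) = tensorMk T (cone f) (t ⊗ₜ x)
        rw [← map_add, ← TensorProduct.tmul_add, Prod.mk_add_mk, add_zero, zero_add])
    (tensorMap_mem T (N := cone f) (fst_mem_homDeg f))
    (tensorMap_mem T (N := cone f) (snd_mem_homDeg f))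
    (tensorMod_ind T (N := cone f) (by simp)
      (fun x y hx hy => by
        rw [map_add, map_add, map_add, map_add, map_add, map_add, add_add_add_comm, hx, hy])
      fun t x => by
        change tensorMk T N (T.d t ⊗ₜ x.1) + tensorMk T N (t ⊗ₜ N.d x.1) +
          tensorMk T N (t ⊗ₜ f.1 x.2) =
          tensorMk T N (T.d t ⊗ₜ x.1) + tensorMk T N (t ⊗ₜ (N.d x.1 + f.1 x.2))
        rw [TensorProduct.tmul_add, map_add, add_assoc])
    (tensorMod_ind T (N := cone f) (by simp)
      (fun x y hx hy => by rw [map_add, map_add, map_add, map_add, hx, hy]) fun _ _ => rfl)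

def tensorConeIso {M N : DGMod A} (f : Z0 M N) :
    Ho.of (tensorMod T (cone f)) ≅ Ho.of (cone (tensorZ T f)) :=
  isoOfBijection (tensorConeMap T f)

open Pretriangulated in
instance : (tensorFunctor T).IsTriangulated where
  map_distinguished := by
    rintro S ⟨M, N, f, ⟨e⟩⟩
    refine isomorphic_distinguished _ (coneTriangle_distinguished (tensorZ T f)) _
      ((tensorFunctor T).mapTriangle.mapIso e ≪≫ ?_)
    refine Triangle.isoMk _ _ (Iso.refl _) (Iso.refl _) (tensorConeIso T f) ?_ ?_ ?_
    · exact (Category.comp_id _).trans (Category.id_comp _).symm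
    · refine Eq.trans ?_ (Category.id_comp _).symm
      refine congrArg cls (Subtype.ext (tensorMod_ext T (N := N) fun t n => ?_))
      refine Prod.ext rfl ?_
      change tensorMk T M (t ⊗ₜ (0 : M)) = 0
      rw [TensorProduct.tmul_zero, map_zero]
    · refine (congrArg (fun t => _ ≫ t) ((shiftFunctor (Ho B) (1 : ℤ)).map_id _)).trans ?_
      refine (Category.comp_id _).trans ?_
      rfl

end


/-! ### Dense triangulated subcategories -/

section Dense

set_option linter.unusedSectionVars false

open Pretriangulated ZeroObject

variable {C : Type 1} [Category.{0} C] [HasZeroObject C] [HasShift C ℤ] [Preadditive C]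
  [∀ k : ℤ, (shiftFunctor C k).Additive] [Pretriangulated C]

variable (C) in
/-- The monoid of isomorphism classes of objects under direct sums. -/
def IsoCls : Type 1 := Quotient (isIsomorphicSetoid C)

/-- The isomorphism class of an object. -/
def isoCls (X : C) : IsoCls C := Quotient.mk (isIsomorphicSetoid C) X

theorem isoCls_eq_iff {X Y : C} : isoCls X = isoCls Y ↔ Nonempty (X ≅ Y) :=
  @Quotient.eq _ (isIsomorphicSetoid C) X Y

theorem isoCls_surj (a : IsoCls C) : ∃ X : C, isoCls X = a :=
  @Quotient.exists_rep _ (isIsomorphicSetoid C) a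

instance : Add (IsoCls C) where
  add := Quotient.map₂ (fun X Y => X ⊞ Y) fun _ _ ⟨e⟩ _ _ ⟨e'⟩ => ⟨biprod.mapIso e e'⟩

instance : Zero (IsoCls C) := ⟨isoCls (0 : C)⟩

instance : AddCommMonoid (IsoCls C) where
  add_assoc := by
    rintro ⟨X⟩ ⟨Y⟩ ⟨Z⟩
    exact isoCls_eq_iff.2 ⟨biprod.associator X Y Z⟩
  zero_add := by
    rintro ⟨X⟩
    exact isoCls_eq_iff.2 ⟨(isoZeroBiprod (isZero_zero C)).symm⟩
  add_zero := by
    rintro ⟨X⟩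
    exact isoCls_eq_iff.2 ⟨(isoBiprodZero (isZero_zero C)).symm⟩
  add_comm := by
    rintro ⟨X⟩ ⟨Y⟩
    exact isoCls_eq_iff.2 ⟨biprod.braiding X Y⟩
  nsmul := nsmulRec

/-- There is a distinguished triangle with the given isomorphism classes of objects. -/
def IsTri (a b c : IsoCls C) : Prop :=
  ∃ T ∈ distTriang C, isoCls T.obj₁ = a ∧ isoCls T.obj₂ = b ∧ isoCls T.obj₃ = c

/-- The shift of an isomorphism class. -/
def IsoCls.shift (a : IsoCls C) : IsoCls C :=
  Quotient.map (sa := isIsomorphicSetoid C) (sb := isIsomorphicSetoid C) (fun X : C => X⟦(1 : ℤ)⟧)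
    (fun _ _ ⟨e⟩ => ⟨(shiftFunctor C (1 : ℤ)).mapIso e⟩) a

theorem IsTri.rotate {a b c : IsoCls C} (h : IsTri a b c) : IsTri b c a.shift := by
  obtain ⟨T, hT, rfl, rfl, rfl⟩ := h
  exact ⟨_, rot_of_distTriang T hT, rfl, rfl, rfl⟩

theorem isTri_add (a c : IsoCls C) : IsTri a (a + c) c := by
  obtain ⟨X, rfl⟩ := isoCls_surj a
  obtain ⟨Y, rfl⟩ := isoCls_surj c
  exact ⟨_, binaryBiproductTriangle_distinguished X Y, rfl, rfl, rfl⟩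

/-- The cone of the zero endomorphism of `X` is `X ⊞ X[1]`. -/
theorem isTri_zero_endo (a : IsoCls C) : IsTri a a (a + a.shift) := by
  obtain ⟨X, rfl⟩ := isoCls_surj a
  refine ⟨_, inv_rot_of_distTriang _ (binaryBiproductTriangle_distinguished X (X⟦(1 : ℤ)⟧)), ?_,
    rfl, rfl⟩
  exact isoCls_eq_iff.2 ⟨(shiftFunctorCompIsoId C (1 : ℤ) (-1) (by norm_num)).app X⟩

/-- The trivial triangle `a ⟶ a ⟶ 0`. -/
theorem isTri_contractible (a : IsoCls C) : IsTri a a 0 := by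
  obtain ⟨X, rfl⟩ := isoCls_surj a
  exact ⟨_, contractible_distinguished X, rfl, rfl, rfl⟩

theorem isoCls_piObj (f : Bool → C) : isoCls (∏ᶜ f) = isoCls (f true) + isoCls (f false) := by
  refine isoCls_eq_iff.2 ⟨?_⟩
  exact
    { hom := biprod.lift (Pi.π f true) (Pi.π f false)
      inv := Pi.lift fun j => match j with
        | true => biprod.fst
        | false => biprod.snd
      hom_inv_id := by
        refine Pi.hom_ext _ _ fun j => ?_
        cases j <;> simp
      inv_hom_id := by
        refine biprod.hom_ext _ _ ?_ ?_ <;> simp }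

theorem IsTri.add {a b c a' b' c' : IsoCls C} (h : IsTri a b c) (h' : IsTri a' b' c') :
    IsTri (a + a') (b + b') (c + c') := by
  obtain ⟨T, hT, rfl, rfl, rfl⟩ := h
  obtain ⟨T', hT', rfl, rfl, rfl⟩ := h'
  let S : Bool → Triangle C := fun j => if j then T else T'
  exact ⟨_, productTriangle_distinguished S (by rintro (_ | _) <;> assumption),
    isoCls_piObj _, isoCls_piObj _, isoCls_piObj _⟩

variable (P : ObjectProperty C)

/-- The isomorphism classes of the objects of `P`. -/
def memCls (a : IsoCls C) : Prop := ∃ X, P X ∧ isoCls X = a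

theorem memCls_isoCls [P.IsClosedUnderIsomorphisms] {X : C} : memCls P (isoCls X) ↔ P X := by
  constructor
  · rintro ⟨Y, hY, e⟩
    obtain ⟨e⟩ := isoCls_eq_iff.1 e
    exact P.prop_of_iso e hY
  · exact fun h => ⟨X, h, rfl⟩

/-- The direct summands of objects of `P`; if `P` is triangulated, this is the largest
triangulated subcategory in which `P` is dense. -/
def dens : ObjectProperty C := fun X => ∃ Y, P (X ⊞ Y)

variable [P.IsTriangulated] [P.IsClosedUnderIsomorphisms]

variable {P} in
theorem memCls_ext₂ {a b c : IsoCls C} (h : IsTri a b c) (ha : memCls P a) (hc : memCls P c) :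
    memCls P b := by
  obtain ⟨T, hT, rfl, rfl, rfl⟩ := h
  rw [memCls_isoCls] at *
  exact P.ext_of_isTriangulatedClosed₂ T hT ha hc

variable {P} in
theorem memCls_ext₃ {a b c : IsoCls C} (h : IsTri a b c) (ha : memCls P a) (hb : memCls P b) :
    memCls P c := by
  obtain ⟨T, hT, rfl, rfl, rfl⟩ := h
  rw [memCls_isoCls] at *
  exact P.ext_of_isTriangulatedClosed₃ T hT ha hb

variable {P} in
theorem memCls_add {a b : IsoCls C} (ha : memCls P a) (hb : memCls P b) : memCls P (a + b) :=
  memCls_ext₂ (isTri_add a b) ha hb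

open Classical in
/-- The class in the Grothendieck group of `P` of an object of `P`, and zero for the other
objects. -/
def kcls (a : IsoCls C) : K0 P.FullSubcategory :=
  if h : memCls P a then K0.cls ⟨h.choose, h.choose_spec.1⟩ else 0

theorem cls_triangle (T : Triangle C) (hT : T ∈ distTriang C) (h₁ : P T.obj₁) (h₂ : P T.obj₂)
    (h₃ : P T.obj₃) :
    (K0.cls ⟨T.obj₂, h₂⟩ : K0 P.FullSubcategory) = K0.cls ⟨T.obj₁, h₁⟩ + K0.cls ⟨T.obj₃, h₃⟩ := by
  let T' : Triangle P.FullSubcategory :=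
    Triangle.mk (X := ⟨T.obj₁, h₁⟩) (Y := ⟨T.obj₂, h₂⟩) (Z := ⟨T.obj₃, h₃⟩)
      (P.fullyFaithfulι.preimage T.mor₁) (P.fullyFaithfulι.preimage T.mor₂)
      (P.fullyFaithfulι.preimage (T.mor₃ ≫ (P.ι.commShiftIso (1 : ℤ)).inv.app ⟨T.obj₁, h₁⟩))
  have hT' : T' ∈ distTriang P.FullSubcategory := by
    change P.ι.mapTriangle.obj T' ∈ distTriang C
    refine isomorphic_distinguished _ hT _
      (Triangle.isoMk _ _ (Iso.refl _) (Iso.refl _) (Iso.refl _) ?_ ?_ ?_)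
    · exact (Category.comp_id _).trans (Category.id_comp _).symm
    · exact (Category.comp_id _).trans (Category.id_comp _).symm
    · refine (congrArg (fun t => _ ≫ t) ((shiftFunctor C (1 : ℤ)).map_id _)).trans ?_
      refine (Category.comp_id _).trans (Eq.trans ?_ (Category.id_comp _).symm)
      refine (Category.assoc _ _ _).trans ?_
      refine (congrArg (fun t => T.mor₃ ≫ t)
        ((P.ι.commShiftIso (1 : ℤ)).inv_hom_id_app ⟨T.obj₁, h₁⟩)).trans ?_
      exact Category.comp_id _
  have h : (FreeAbelianGroup.of T'.obj₂ - FreeAbelianGroup.of T'.obj₁ -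
      FreeAbelianGroup.of T'.obj₃ : FreeAbelianGroup P.FullSubcategory) ∈ triangleRel _ :=
    AddSubgroup.subset_closure ⟨T', hT', rfl⟩
  have h2 := (QuotientAddGroup.eq_zero_iff _).2 h
  rw [QuotientAddGroup.mk_sub, QuotientAddGroup.mk_sub, sub_sub, sub_eq_zero] at h2
  exact h2

theorem cls_iso {X Y : C} (e : X ≅ Y) (hX : P X) (hY : P Y) :
    (K0.cls ⟨X, hX⟩ : K0 P.FullSubcategory) = K0.cls ⟨Y, hY⟩ := by
  have h0 : P (0 : C) := P.prop_zero
  have hz := cls_triangle P _ (contractible_distinguished (0 : C)) h0 h0 h0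
  have h1 : Triangle.mk (0 : (0 : C) ⟶ X) e.hom (0 : Y ⟶ (0 : C)⟦(1 : ℤ)⟧) ∈ distTriang C :=
    isomorphic_distinguished _ (contractible_distinguished₁ X) _
      (Triangle.isoMk _ _ (Iso.refl _) (Iso.refl _) e.symm (by simp [Triangle.mk])
        (by simp [Triangle.mk]) (by simp [Triangle.mk]))
  have h2 := cls_triangle P _ h1 h0 hX hY
  change K0.cls _ = K0.cls _ + K0.cls _ at hz h2
  exact h2.trans ((congrArg (· + _) (left_eq_add.1 hz)).trans (zero_add _))

theorem kcls_isoCls {X : C} (h : P X) : kcls P (isoCls X) = K0.cls ⟨X, h⟩ := by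
  have hm := (memCls_isoCls P).2 h
  rw [kcls, dif_pos hm]
  obtain ⟨e⟩ := isoCls_eq_iff.1 hm.choose_spec.2
  exact cls_iso P e _ _

variable {P} in
theorem kcls_isTri {a b c : IsoCls C} (h : IsTri a b c) (ha : memCls P a) (hb : memCls P b)
    (hc : memCls P c) : kcls P b = kcls P a + kcls P c := by
  obtain ⟨T, hT, rfl, rfl, rfl⟩ := h
  rw [memCls_isoCls] at *
  rw [kcls_isoCls P ha, kcls_isoCls P hb, kcls_isoCls P hc]
  exact cls_triangle P T hT ha hb hc

variable {P} in
theorem kcls_add {a b : IsoCls C} (ha : memCls P a) (hb : memCls P b) :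
    kcls P (a + b) = kcls P a + kcls P b :=
  kcls_isTri (isTri_add a b) ha (memCls_add ha hb) hb

theorem memCls_zero : memCls P (0 : IsoCls C) := ⟨0, P.prop_zero, rfl⟩

/-- The submonoid of the classes of direct summands of objects of `P`. -/
def densCls : AddSubmonoid (IsoCls C) where
  carrier := {a | ∃ b, memCls P (a + b)}
  zero_mem' := ⟨0, by rw [add_zero]; exact memCls_zero P⟩
  add_mem' := by
    rintro a a' ⟨b, h⟩ ⟨b', h'⟩
    exact ⟨b + b', by rw [add_add_add_comm]; exact memCls_add h h'⟩

theorem mem_densCls_isoCls {X : C} : isoCls X ∈ densCls P ↔ dens P X := by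
  constructor
  · rintro ⟨b, h⟩
    obtain ⟨Y, rfl⟩ := isoCls_surj b
    exact ⟨Y, (memCls_isoCls P).1 h⟩
  · rintro ⟨Y, h⟩
    exact ⟨isoCls Y, (memCls_isoCls P).2 h⟩

variable {P}

theorem mem_densCls_of_memCls {a : IsoCls C} (h : memCls P a) : a ∈ densCls P :=
  ⟨0, by rwa [add_zero]⟩

/-- If `X` is a direct summand of an object `X ⊞ Y` of `P`, then `X ⊞ X[1]` is in `P`, being a cone
of the projection of `X ⊞ Y` to `Y`. -/
theorem memCls_add_shift {a : IsoCls C} (h : a ∈ densCls P) : memCls P (a + a.shift) := by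
  obtain ⟨b, h⟩ := h
  have ht := (isTri_zero_endo a).add (isTri_contractible b)
  rw [add_zero] at ht
  exact memCls_ext₃ ht h h

theorem densCls_shift {a : IsoCls C} (h : a ∈ densCls P) : a.shift ∈ densCls P :=
  ⟨a, by rw [add_comm]; exact memCls_add_shift h⟩

/-- The sum of a triangle with trivial triangles on `a[1]` and `c[1]`, which has its outer terms
in `P`. -/
theorem isTri_stabilize {a b c : IsoCls C} (h : IsTri a b c) :
    IsTri (a + a.shift) (b + (a.shift + c.shift)) (c + c.shift) :=
  h.add (isTri_add _ _)

theorem densCls_ext₂ {a b c : IsoCls C} (h : IsTri a b c) (ha : a ∈ densCls P)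
    (hc : c ∈ densCls P) : b ∈ densCls P :=
  ⟨_, memCls_ext₂ (isTri_stabilize h) (memCls_add_shift ha) (memCls_add_shift hc)⟩

theorem densCls_ext₃ {a b c : IsoCls C} (h : IsTri a b c) (ha : a ∈ densCls P)
    (hb : b ∈ densCls P) : c ∈ densCls P :=
  densCls_ext₂ h.rotate hb (densCls_shift ha)

variable (P)

/-- The differences of classes of objects of `P` that have the same class in its Grothendieck
group. -/
def densRel : AddSubgroup (Algebra.GrothendieckAddGroup (densCls P)) where
  carrier := {x | ∃ p p' : densCls P, memCls P p.1 ∧ memCls P p'.1 ∧ kcls P p.1 = kcls P p'.1 ∧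
    x = Algebra.GrothendieckAddGroup.of p - Algebra.GrothendieckAddGroup.of p'}
  zero_mem' := ⟨0, 0, memCls_zero P, memCls_zero P, rfl, (sub_self _).symm⟩
  add_mem' := by
    rintro _ _ ⟨p, p', h1, h2, h3, rfl⟩ ⟨q, q', h1', h2', h3', rfl⟩
    refine ⟨p + q, p' + q', memCls_add h1 h1', memCls_add h2 h2', ?_, ?_⟩
    · change kcls P (p.1 + q.1) = kcls P (p'.1 + q'.1)
      rw [kcls_add h1 h1', kcls_add h2 h2', h3, h3']
    · rw [map_add, map_add, add_sub_add_comm]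
  neg_mem' := by
    rintro _ ⟨p, p', h1, h2, h3, rfl⟩
    exact ⟨p', p, h2, h1, h3.symm, neg_sub _ _⟩

/-- The Grothendieck group of the summands of objects of `P`, compatibly with that of `P`. -/
abbrev DensGroup : Type 1 := Algebra.GrothendieckAddGroup (densCls P) ⧸ densRel P

open Classical in
/-- The class of a direct summand of an object of `P`. -/
def densK (X : C) : DensGroup P :=
  if h : isoCls X ∈ densCls P then
    QuotientAddGroup.mk (Algebra.GrothendieckAddGroup.of ⟨isoCls X, h⟩) else 0

variable {P}

/-- Equality of the classes of two summands means an isomorphism after adding objects of `P` of the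
same class: an arbitrary common summand `w` is completed to the object `w + w[1]` of `P`. -/
theorem mk_of_eq_iff {a b : densCls P} :
    (QuotientAddGroup.mk (Algebra.GrothendieckAddGroup.of a) : DensGroup P) =
      QuotientAddGroup.mk (Algebra.GrothendieckAddGroup.of b) ↔
    ∃ u v : IsoCls C, memCls P u ∧ memCls P v ∧ kcls P u = kcls P v ∧ a.1 + u = b.1 + v := by
  rw [QuotientAddGroup.eq]
  constructor
  · rintro ⟨p, p', h1, h2, h3, e⟩
    have e' : Algebra.GrothendieckAddGroup.of (b + p') = Algebra.GrothendieckAddGroup.of (a + p) := by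
      rw [map_add, map_add]
      rw [neg_add_eq_sub, sub_eq_sub_iff_add_eq_add] at e
      rw [e, add_comm]
    obtain ⟨w, hw⟩ := (AddLocalization.addMonoidOf ⊤).eq_iff_exists.1 e'
    have hw' := congrArg Subtype.val hw
    change w.1.1 + (b.1 + p'.1) = w.1.1 + (a.1 + p.1) at hw'
    have hs := memCls_add_shift w.1.2
    refine ⟨p.1 + (w.1.1 + w.1.1.shift), p'.1 + (w.1.1 + w.1.1.shift), memCls_add h1 hs,
      memCls_add h2 hs, ?_, ?_⟩
    · rw [kcls_add h1 hs, kcls_add h2 hs, h3]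
    · calc _ = (w.1.1 + (a.1 + p.1)) + w.1.1.shift := by abel
        _ = _ := by rw [← hw']; abel
  · rintro ⟨u, v, hu, hv, h, e⟩
    refine ⟨⟨u, mem_densCls_of_memCls hu⟩, ⟨v, mem_densCls_of_memCls hv⟩, hu, hv, h, ?_⟩
    rw [neg_add_eq_sub, sub_eq_sub_iff_add_eq_add, ← map_add, ← map_add]
    refine congrArg _ (Subtype.ext ?_)
    change b.1 + v = u + a.1
    rw [← e, add_comm]

theorem densK_iso {X Y : C} (e : X ≅ Y) : densK P X = densK P Y := by
  have h := isoCls_eq_iff.2 ⟨e⟩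
  by_cases hX : isoCls X ∈ densCls P
  · have hY : isoCls Y ∈ densCls P := h ▸ hX
    rw [densK, dif_pos hX, densK, dif_pos hY]
    exact congrArg _ (congrArg _ (Subtype.ext h))
  · have hY : isoCls Y ∉ densCls P := h ▸ hX
    rw [densK, dif_neg hX, densK, dif_neg hY]

theorem dens_of_isTri₃ {T : Triangle C} (hT : T ∈ distTriang C) (h₁ : dens P T.obj₁)
    (h₂ : dens P T.obj₂) : dens P T.obj₃ := by
  rw [← mem_densCls_isoCls] at *
  exact densCls_ext₃ ⟨T, hT, rfl, rfl, rfl⟩ h₁ h₂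

theorem dens_iso {X Y : C} (e : X ≅ Y) (h : dens P X) : dens P Y := by
  rwa [← mem_densCls_isoCls, ← isoCls_eq_iff.2 ⟨e⟩, mem_densCls_isoCls]

theorem dens_of_prop {X : C} (h : P X) : dens P X :=
  (mem_densCls_isoCls P).1 (mem_densCls_of_memCls ((memCls_isoCls P).2 h))

theorem densK_triangle {T : Triangle C} (hT : T ∈ distTriang C) (h₁ : dens P T.obj₁)
    (h₂ : dens P T.obj₂) (h₃ : dens P T.obj₃) :
    densK P T.obj₂ = densK P T.obj₁ + densK P T.obj₃ := by
  rw [← mem_densCls_isoCls] at *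
  have ht : IsTri (isoCls T.obj₁) (isoCls T.obj₂) (isoCls T.obj₃) := ⟨T, hT, rfl, rfl, rfl⟩
  have e (X : C) (h : isoCls X ∈ densCls P) : densK P X =
    QuotientAddGroup.mk (Algebra.GrothendieckAddGroup.of ⟨isoCls X, h⟩) := dif_pos h
  rw [e _ h₁, e _ h₂, e _ h₃]
  refine Eq.trans (mk_of_eq_iff (b := ⟨_, h₁⟩ + ⟨_, h₃⟩) |>.2 ?_) (congrArg _ (map_add _ _ _))
  have m1 := memCls_add_shift h₁
  have m3 := memCls_add_shift h₃
  have hs := isTri_stabilize ht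
  have m2 := memCls_ext₂ hs m1 m3
  refine ⟨_, _, memCls_add m1 m3, m2, ?_, ?_⟩
  · rw [kcls_isTri hs m1 m2 m3, kcls_add m1 m3]
  · change isoCls T.obj₂ + _ = isoCls T.obj₁ + isoCls T.obj₃ + _
    abel

/-- Two objects with the same class: if one of them belongs to `P`, then so does the other, and
their classes in the Grothendieck group of `P` agree. -/
theorem prop_of_densK_eq {X Y : C} (hX : dens P X) (h : densK P X = densK P Y) (hY : P Y) :
    ∃ h : P X, (K0.cls ⟨X, h⟩ : K0 P.FullSubcategory) = K0.cls ⟨Y, hY⟩ := by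
  have hX' := (mem_densCls_isoCls P).2 hX
  have hY' := (mem_densCls_isoCls P).2 (dens_of_prop hY)
  rw [densK, dif_pos hX', densK, dif_pos hY'] at h
  obtain ⟨u, v, hu, hv, e1, e2⟩ := mk_of_eq_iff.1 h
  change isoCls X + u = isoCls Y + v at e2
  have mY := (memCls_isoCls P).2 hY
  have mX : memCls P (isoCls X) := by
    refine memCls_ext₃ (isTri_add u (isoCls X)) hu ?_
    rw [add_comm, e2]
    exact memCls_add mY hv
  have e3 := kcls_add mX hu
  rw [e2, kcls_add mY hv, e1, add_left_inj] at e3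
  refine ⟨(memCls_isoCls P).1 mX, ?_⟩
  rw [← kcls_isoCls, ← kcls_isoCls P hY, e3]

theorem dens_of_retract {X L : C} (r : Retract X L) (hL : P L) : dens P X := by
  obtain ⟨Z, g, h, hT⟩ := distinguished_cocone_triangle r.i
  have h0 : h = 0 := by
    have h1 := comp_distTriang_mor_zero₃₁ _ hT
    change h ≫ r.i⟦(1 : ℤ)⟧' = 0 at h1
    have h2 : r.i⟦(1 : ℤ)⟧' ≫ r.r⟦(1 : ℤ)⟧' = 𝟙 _ := by
      rw [← Functor.map_comp, r.retract, CategoryTheory.Functor.map_id]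
    rw [← Category.comp_id h, ← h2, ← Category.assoc, h1, zero_comp]
  obtain ⟨e, -⟩ := exists_iso_binaryBiproduct_of_distTriang _ hT h0
  exact ⟨Z, P.prop_of_iso e hL⟩

/-- The class of an object changes sign under the shift, and sums correspond to direct sums, so
every element of the Grothendieck group is the class of an object. -/
theorem K0_exists_cls (x : K0 P.FullSubcategory) : ∃ X : P.FullSubcategory, x = K0.cls X := by
  have hadd : ∀ X Y : P.FullSubcategory, ∃ Z : P.FullSubcategory,
      (K0.cls X + K0.cls Y : K0 P.FullSubcategory) = K0.cls Z := fun X Y =>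
    ⟨⟨X.obj ⊞ Y.obj, P.ext_of_isTriangulatedClosed₂ _
      (binaryBiproductTriangle_distinguished X.obj Y.obj) X.2 Y.2⟩,
      (cls_triangle P _ (binaryBiproductTriangle_distinguished X.obj Y.obj) X.2 _ Y.2).symm⟩
  have h0 : P (0 : C) := P.prop_zero
  have hz : (K0.cls ⟨0, h0⟩ : K0 P.FullSubcategory) = 0 := by
    have h := cls_triangle P _ (contractible_distinguished (0 : C)) h0 h0 h0
    change K0.cls _ = K0.cls _ + K0.cls _ at h
    exact left_eq_add.1 h
  have hneg : ∀ X : P.FullSubcategory, ∃ Z : P.FullSubcategory,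
      (-K0.cls X : K0 P.FullSubcategory) = K0.cls Z := fun X => by
    refine ⟨⟨X.obj⟦(1 : ℤ)⟧, P.le_shift (1 : ℤ) _ X.2⟩, ?_⟩
    have h := cls_triangle P _ (rot_of_distTriang _ (contractible_distinguished X.obj)) X.2 h0
      (P.le_shift (1 : ℤ) _ X.2)
    exact neg_eq_of_add_eq_zero_right (h.symm.trans hz)
  obtain ⟨x, rfl⟩ := QuotientAddGroup.mk_surjective x
  induction x using FreeAbelianGroup.induction_on with
  | zero => exact ⟨_, hz.symm⟩
  | of X => exact ⟨X, rfl⟩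
  | neg X h => exact hneg X
  | add x y hx hy =>
    obtain ⟨X, hX⟩ := hx
    obtain ⟨Y, hY⟩ := hy
    obtain ⟨Z, hZ⟩ := hadd X Y
    exact ⟨Z, by rw [QuotientAddGroup.mk_add, hX, hY, hZ]⟩

end Dense


/-! ### Euler characteristics of spaces of morphisms -/

section Euler

open Pretriangulated ZeroObject

variable {A : QDGAlg}

instance (X Y : Ho A) : Module 𝔽 (X ⟶ Y) :=
  AddCommGroup.zmodModule (n := 2) fun f => by rw [two_nsmul]; exact hom_add_self f

/-- Composition with a fixed morphism, as a linear map. -/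
def precomp {X Y : Ho A} (f : X ⟶ Y) (Z : Ho A) : (Y ⟶ Z) →ₗ[𝔽] (X ⟶ Z) :=
  (Preadditive.leftComp Z f).toZModLinearMap 2

/-- Composition with a fixed morphism on the other side, as a linear map. -/
def postcomp (X : Ho A) {Y Z : Ho A} (f : Y ⟶ Z) : (X ⟶ Y) →ₗ[𝔽] (X ⟶ Z) :=
  (Preadditive.rightComp X f).toZModLinearMap 2

/-- Shifting twice is shifting by the sum. -/
def shiftShiftIso (M : DGMod A) (a b : ℤ × ℤ) :
    Ho.of ((M.shift a).shift b) ≅ Ho.of (M.shift (a + b)) :=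
  ((hoShiftAdd A a b (a + b) rfl).app (Ho.of M)).symm

/-- The translation of a shift is a shift. -/
def shiftOneIso (M : DGMod A) (a : ℤ × ℤ) :
    (shiftFunctor (Ho A) (1 : ℤ)).obj (Ho.of (M.shift a)) ≅ Ho.of (M.shift (a + (1, 0))) :=
  shiftShiftIso M a (1, 0)

/-- The shift by zero is trivial. -/
def shiftZeroIso (M : DGMod A) : Ho.of (M.shift 0) ≅ Ho.of M :=
  (hoShiftZero A).app (Ho.of M)

/-- The shifts of isomorphic modules are isomorphic. -/
def shiftIso {M N : DGMod A} (e : Ho.of M ≅ Ho.of N) (a : ℤ × ℤ) :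
    Ho.of (M.shift a) ≅ Ho.of (N.shift a) := (hoShift A a).mapIso e

variable (S : DGMod A)

/-- The dimension of the space of morphisms to a shift of `S`. -/
def hdim (X : Ho A) (k : ℤ × ℤ) : ℕ := Module.finrank 𝔽 (X ⟶ Ho.of (S.shift k))

/-- The connecting map in the long exact sequence of morphisms from a triangle to the shifts of
`S`. -/
def connecting (T : Triangle (Ho A)) (k : ℤ × ℤ) :
    (T.obj₁ ⟶ Ho.of (S.shift k)) →ₗ[𝔽] (T.obj₃ ⟶ Ho.of (S.shift (k + (1, 0)))) :=
  AddMonoidHom.toZModLinearMap 2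
    { toFun := fun f => T.mor₃ ≫ (shiftFunctor (Ho A) (1 : ℤ)).map f ≫
        (shiftOneIso S k).hom
      map_zero' := by
        rw [Functor.map_zero, zero_comp, comp_zero]
      map_add' := fun f g => by
        rw [Functor.map_add, Preadditive.add_comp, Preadditive.comp_add] }

variable {S}

theorem exact_precomp {T : Triangle (Ho A)} (hT : T ∈ distTriang (Ho A)) (Z : Ho A) :
    Function.Exact (precomp T.mor₂ Z) (precomp T.mor₁ Z) := by
  intro f
  constructor
  · intro h
    obtain ⟨g, hg⟩ := T.yoneda_exact₂ hT f h
    exact ⟨g, hg.symm⟩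
  · rintro ⟨g, rfl⟩
    change T.mor₁ ≫ T.mor₂ ≫ g = 0
    rw [← Category.assoc, comp_distTriang_mor_zero₁₂ T hT, zero_comp]

theorem exact_connecting {T : Triangle (Ho A)} (hT : T ∈ distTriang (Ho A)) (k : ℤ × ℤ) :
    Function.Exact (connecting S T k) (precomp T.mor₂ (Ho.of (S.shift (k + (1, 0))))) := by
  intro f
  constructor
  · intro h
    obtain ⟨g, hg⟩ := T.yoneda_exact₃ hT f h
    let u : T.obj₁⟦(1 : ℤ)⟧ ⟶ (Ho.of (S.shift k))⟦(1 : ℤ)⟧ := g ≫ (shiftOneIso S k).inv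
    obtain ⟨v, hv⟩ := (shiftFunctor (Ho A) (1 : ℤ)).map_surjective u
    refine ⟨v, ?_⟩
    change T.mor₃ ≫ (shiftFunctor (Ho A) (1 : ℤ)).map v ≫ _ = f
    rw [hv, hg]
    rw [Category.assoc, Iso.inv_hom_id, Category.comp_id]
  · rintro ⟨g, rfl⟩
    change T.mor₂ ≫ T.mor₃ ≫ _ = 0
    rw [← Category.assoc, comp_distTriang_mor_zero₂₃ T hT, zero_comp]

theorem exact_precomp_connecting {T : Triangle (Ho A)} (hT : T ∈ distTriang (Ho A)) (k : ℤ × ℤ) :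
    Function.Exact (precomp T.mor₁ (Ho.of (S.shift k))) (connecting S T k) := by
  intro f
  constructor
  · intro h
    have h' : T.mor₃ ≫ (shiftFunctor (Ho A) (1 : ℤ)).map f = 0 := by
      have h2 : T.mor₃ ≫ (shiftFunctor (Ho A) (1 : ℤ)).map f ≫ (shiftOneIso S k).hom = 0 := h
      rw [← Category.assoc] at h2
      exact (cancel_mono (shiftOneIso S k).hom).1 (h2.trans zero_comp.symm)
    obtain ⟨g, hg⟩ := Triangle.yoneda_exact₃ _ (rot_of_distTriang T hT) _ h'
    change T.obj₂⟦(1 : ℤ)⟧ ⟶ _ at g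
    obtain ⟨v, rfl⟩ := (shiftFunctor (Ho A) (1 : ℤ)).map_surjective g
    refine ⟨-v, (shiftFunctor (Ho A) (1 : ℤ)).map_injective ?_⟩
    refine Eq.trans ?_ hg.symm
    change (shiftFunctor (Ho A) (1 : ℤ)).map (T.mor₁ ≫ (-v)) = (-(shiftFunctor (Ho A) (1 : ℤ)).map T.mor₁) ≫
      (shiftFunctor (Ho A) (1 : ℤ)).map v
    rw [Preadditive.comp_neg, Functor.map_neg, Functor.map_comp, Preadditive.neg_comp]
  · rintro ⟨g, rfl⟩
    change T.mor₃ ≫ (shiftFunctor (Ho A) (1 : ℤ)).map (T.mor₁ ≫ g) ≫ _ = 0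
    rw [Functor.map_comp, ← Category.assoc, ← Category.assoc, comp_distTriang_mor_zero₃₁ T hT,
      zero_comp, zero_comp]

variable (S)

/-- The spaces of morphisms to all the shifts of `S` are finite dimensional, and zero for almost
all shifts. -/
def HomFin (X : Ho A) : Prop :=
  (∀ k, Module.Finite 𝔽 (X ⟶ Ho.of (S.shift k))) ∧ {k | hdim S X k ≠ 0}.Finite

open LaurentPolynomial in
/-- The weight `(-1)^i q^j` of the bidegree `(i, j)`. -/
def weight (k : ℤ × ℤ) : Λ := ((k.1.negOnePow : ℤˣ) : ℤ) • T k.2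

theorem weight_add (k l : ℤ × ℤ) : weight (k + l) = weight k * weight l := by
  rw [weight, weight, weight, Prod.fst_add, Prod.snd_add, Int.negOnePow_add, LaurentPolynomial.T_add,
    Units.val_mul, smul_mul_smul_comm]

theorem weight_one : weight (1, 0) = -1 := by
  rw [weight, Int.negOnePow_one, LaurentPolynomial.T_zero]; simp

theorem weight_zero : weight 0 = 1 := by
  simp [weight]

/-- The graded Euler characteristic of the morphisms to the shifts of `S`. -/
def euler (X : Ho A) : Λ := ∑ᶠ k, (hdim S X k) • weight k

variable {S}

theorem hdim_iso {X Y : Ho A} (e : X ≅ Y) (k : ℤ × ℤ) : hdim S X k = hdim S Y k := by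
  refine LinearEquiv.finrank_eq (LinearEquiv.ofLinearMap (precomp e.inv _) (precomp e.hom _) ?_ ?_)
  · exact LinearMap.ext fun f => e.inv_hom_id_assoc f
  · exact LinearMap.ext fun f => e.hom_inv_id_assoc f

theorem HomFin.iso {X Y : Ho A} (e : X ≅ Y) (h : HomFin S X) : HomFin S Y := by
  refine ⟨fun k => ?_, ?_⟩
  · have := h.1 k
    exact Module.Finite.of_surjective (precomp e.inv _) fun f =>
      ⟨e.hom ≫ f, e.inv_hom_id_assoc f⟩
  · have := h.2
    simpa only [hdim_iso e] using this

theorem euler_iso {X Y : Ho A} (e : X ≅ Y) : euler S X = euler S Y := by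
  simp only [euler, hdim_iso e]

/-- Morphisms between shifted objects. -/
def homShiftEquiv (M : DGMod A) (a k : ℤ × ℤ) :
    (Ho.of M ⟶ Ho.of (S.shift k)) ≃ₗ[𝔽] (Ho.of (M.shift a) ⟶ Ho.of (S.shift (k + a))) := by
  refine LinearEquiv.ofBijective
    ((postcomp _ (shiftShiftIso S k a).hom) ∘ₗ AddMonoidHom.toZModLinearMap 2
      { toFun := fun f => (hoShift A a).map f
        map_zero' := rfl
        map_add' := fun f g => by
          obtain ⟨f, rfl⟩ := cls_surj f
          obtain ⟨g, rfl⟩ := cls_surj g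
          rfl }) ⟨?_, ?_⟩
  · rw [injective_iff_map_eq_zero]
    intro f hf
    obtain ⟨f, rfl⟩ := cls_surj f
    obtain ⟨h, hh, e⟩ := cls_eq_iff (M := M.shift a) (N := S.shift (k + a)) (g := 0) |>.1 hf
    refine cls_eq (M := M) (N := S.shift k) (g := 0) h (fun l m hm => ?_) e
    have h1 := hh (l - a) m (by
      change m ∈ M.gr (l - a + a)
      rwa [sub_add_cancel])
    change h m ∈ S.gr (l + (-1, 0) + k)
    change h m ∈ S.gr (l - a + (-1, 0) + (k + a)) at h1
    rwa [show l - a + (-1, 0) + (k + a) = l + (-1, 0) + k by abel] at h1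
  · intro f
    obtain ⟨f, rfl⟩ := cls_surj f
    refine ⟨cls (M := M) (N := S.shift k) (zmk (M := M) (N := S.shift k) f.1 (fun l m hm => ?_)
      (fun m => Z0_comm f m)), rfl⟩
    have h1 : f.1 m ∈ S.gr (l - a + (k + a)) := Z0_mem f (k := l - a) (m := m) (by
      change m ∈ M.gr (l - a + a)
      rwa [sub_add_cancel])
    change f.1 m ∈ S.gr (l + k)
    rwa [show l - a + (k + a) = l + k by abel] at h1

theorem hdim_shift (M : DGMod A) (a k : ℤ × ℤ) :
    hdim S (Ho.of (M.shift a)) (k + a) = hdim S (Ho.of M) k :=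
  (homShiftEquiv M a k).finrank_eq.symm

theorem HomFin.shift {M : DGMod A} (h : HomFin S (Ho.of M)) (a : ℤ × ℤ) :
    HomFin S (Ho.of (M.shift a)) := by
  refine ⟨fun k => ?_, ?_⟩
  · have h1 := h.1 (k - a)
    have h2 := Module.Finite.equiv (homShiftEquiv (S := S) M a (k - a))
    rwa [sub_add_cancel] at h2
  · refine (h.2.image (· + a)).subset fun k hk => ⟨k - a, ?_, sub_add_cancel k a⟩
    change hdim S _ _ ≠ 0
    rw [← hdim_shift M a, sub_add_cancel]
    exact hk

theorem euler_shift (M : DGMod A) (a : ℤ × ℤ) :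
    euler S (Ho.of (M.shift a)) = weight a * euler S (Ho.of M) := by
  rw [euler, euler, ← smul_eq_mul, smul_finsum, ← finsum_comp_equiv (Equiv.addRight a)]
  refine finsum_congr fun k => ?_
  rw [Equiv.coe_addRight, hdim_shift, weight_add, smul_eq_mul, mul_smul_comm, mul_comm]

section

/-- The dimension of the middle term of an exact sequence. -/
theorem finrank_exact {M N P : Type} [AddCommGroup M] [Module 𝔽 M] [AddCommGroup N]
    [Module 𝔽 N] [AddCommGroup P] [Module 𝔽 P] [Module.Finite 𝔽 N] {f : M →ₗ[𝔽] N}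
    {g : N →ₗ[𝔽] P} (h : Function.Exact f g) :
    Module.finrank 𝔽 N = Module.finrank 𝔽 (LinearMap.range f) +
      Module.finrank 𝔽 (LinearMap.range g) := by
  rw [← LinearMap.finrank_range_add_finrank_ker g, (LinearMap.exact_iff.1 h), add_comm]

theorem HomFin.ext₃ {T : Triangle (Ho A)} (hT : T ∈ distTriang (Ho A)) (h₁ : HomFin S T.obj₁) (h₂ : HomFin S T.obj₂) : HomFin S T.obj₃ := by
  have hf : ∀ k, Module.Finite 𝔽 (T.obj₃ ⟶ Ho.of (S.shift (k + (1, 0)))) := fun k => by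
    have := h₁.1 k
    have := h₂.1 (k + (1, 0))
    refine Module.Finite.of_exact (f := connecting S T k)
      (g := (precomp T.mor₂ (Ho.of (S.shift (k + (1, 0))))).rangeRestrict) (fun f => ?_)
      (LinearMap.surjective_rangeRestrict _)
    exact (Subtype.ext_iff.trans (exact_connecting (S := S) hT k f))
  refine ⟨fun k => by
    have h := hf (k - (1, 0))
    rwa [sub_add_cancel] at h, ((h₁.2.image (· + (1, 0))).union h₂.2).subset fun k hk => ?_⟩
  obtain ⟨k, rfl⟩ : ∃ l, l + (1, 0) = k := ⟨_, sub_add_cancel k (1, 0)⟩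
  by_contra hc
  rw [Set.mem_union, not_or] at hc
  obtain ⟨c1, c2⟩ := hc
  have c1' : hdim S T.obj₁ k = 0 := by
    by_contra c
    exact c1 ⟨_, c, rfl⟩
  have c2' : hdim S T.obj₂ (k + (1, 0)) = 0 := not_not.1 c2
  have := h₁.1 k
  have := h₂.1 (k + (1, 0))
  have := hf k
  have e1 := finrank_exact (exact_connecting (S := S) hT k)
  have e2 := LinearMap.finrank_range_le (connecting S T k)
  have e3 := Submodule.finrank_le (LinearMap.range (precomp T.mor₂ (Ho.of (S.shift (k + (1, 0))))))
  change _ ≤ hdim S T.obj₁ k at e2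
  change _ ≤ hdim S T.obj₂ (k + (1, 0)) at e3
  change hdim S T.obj₃ (k + (1, 0)) = _ at e1
  have hk' : hdim S T.obj₃ (k + (1, 0)) ≠ 0 := hk
  omega

/-- The Euler characteristic is additive on distinguished triangles. -/
theorem euler_triangle {T : Triangle (Ho A)} (hT : T ∈ distTriang (Ho A)) (h₁ : HomFin S T.obj₁) (h₂ : HomFin S T.obj₂) :
    euler S T.obj₂ = euler S T.obj₁ + euler S T.obj₃ := by
  have h₃ := HomFin.ext₃ hT h₁ h₂
  -- The ranks of the maps in the long exact sequence; that of the connecting map contributes to two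
  -- terms in neighbouring degrees, hence with opposite signs.
  let a : ℤ × ℤ → ℕ := fun k => Module.finrank 𝔽 (LinearMap.range (precomp T.mor₁ (Ho.of (S.shift k))))
  let b : ℤ × ℤ → ℕ := fun k => Module.finrank 𝔽 (LinearMap.range (precomp T.mor₂ (Ho.of (S.shift k))))
  let c : ℤ × ℤ → ℕ := fun k => Module.finrank 𝔽 (LinearMap.range (connecting S T k))
  have e1 : ∀ k, hdim S T.obj₁ k = a k + c k := fun k => by
    have := h₁.1 k
    exact finrank_exact (exact_precomp_connecting hT k)
  have e2 : ∀ k, hdim S T.obj₂ k = b k + a k := fun k => by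
    have := h₂.1 k
    exact finrank_exact (exact_precomp hT _)
  have e3 : ∀ k, hdim S T.obj₃ (k + (1, 0)) = c k + b (k + (1, 0)) := fun k => by
    have := h₃.1 (k + (1, 0))
    exact finrank_exact (exact_connecting hT k)
  have ha : (Function.support a).Finite := h₁.2.subset fun k hk => by
    have := e1 k
    change a k ≠ 0 at hk
    change hdim S T.obj₁ k ≠ 0
    omega
  have hb : (Function.support b).Finite := h₂.2.subset fun k hk => by
    have := e2 k
    change b k ≠ 0 at hk
    change hdim S T.obj₂ k ≠ 0
    omega
  have hc : (Function.support c).Finite := h₁.2.subset fun k hk => by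
    have := e1 k
    change c k ≠ 0 at hk
    change hdim S T.obj₁ k ≠ 0
    omega
  have hs : ∀ u : ℤ × ℤ → ℕ, (Function.support u).Finite →
      (Function.support fun k => u k • weight k).Finite := fun u hu =>
    hu.subset fun k hk hk' => hk (by change u k • weight k = 0; rw [hk', zero_smul])
  have hadd : ∀ u v : ℤ × ℤ → ℕ, (Function.support u).Finite → (Function.support v).Finite →
      ∑ᶠ k, (u k + v k) • weight k = ∑ᶠ k, u k • weight k + ∑ᶠ k, v k • weight k := fun u v hu hv => by
    rw [← finsum_add_distrib (hs u hu) (hs v hv)]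
    exact finsum_congr fun k => add_smul _ _ _
  have s1 : euler S T.obj₁ = ∑ᶠ k, a k • weight k + ∑ᶠ k, c k • weight k := by
    rw [← hadd a c ha hc]
    exact finsum_congr fun k => by rw [e1]
  have s2 : euler S T.obj₂ = ∑ᶠ k, b k • weight k + ∑ᶠ k, a k • weight k := by
    rw [← hadd b a hb ha]
    exact finsum_congr fun k => by rw [e2]
  have hc' : (Function.support fun k => c (k - (1, 0))).Finite :=
    (hc.image (· + (1, 0))).subset fun k hk => ⟨_, hk, sub_add_cancel _ _⟩
  have s3 : euler S T.obj₃ = ∑ᶠ k, c (k - (1, 0)) • weight k + ∑ᶠ k, b k • weight k := by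
    rw [← hadd _ b hc' hb]
    refine finsum_congr fun k => ?_
    have := e3 (k - (1, 0))
    rw [sub_add_cancel] at this
    rw [this]
  have s4 : ∑ᶠ k, c (k - (1, 0)) • weight k = - ∑ᶠ k, c k • weight k := by
    rw [← finsum_neg_distrib, ← finsum_comp_equiv (Equiv.addRight ((1, 0) : ℤ × ℤ))]
    refine finsum_congr fun k => ?_
    rw [Equiv.coe_addRight, add_sub_cancel_right, weight_add, weight_one, mul_neg_one, smul_neg]
  rw [s1, s2, s3, s4]
  abel

end

end Euler


/-! ### Simple modules and the classes of the projective modules -/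

theorem f2_cases (c : 𝔽) : c = 0 ∨ c = 1 := by revert c; decide

namespace LQuiver

variable {Q : LQuiver}

/-- The character of the path algebra at a vertex: it is one on the idempotent of the vertex, and
zero on the other idempotents and on the arrows. -/
def aug (v : Q.V) : Q.Alg →ₐ[𝔽] 𝔽 :=
  lift
    { e := fun w => if w = v then 1 else 0
      r := fun _ _ => 0
      e_mul := fun u w => by
        by_cases h : u = w
        · subst h
          by_cases h' : u = v <;> simp [h']
        · by_cases h' : u = v
          · have h2 : w ≠ v := fun h3 => h (h'.trans h3.symm)
            simp [h, h2]
          · simp [h, h']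
      e_r := fun _ _ => mul_zero _
      r_e := fun _ _ => zero_mul _
      r_invalid := fun _ _ _ => rfl
      r_comm := fun _ _ _ _ => rfl
      sum_e := by simp }

theorem aug_e (v w : Q.V) : aug v (Q.e w) = if w = v then 1 else 0 := lift_e _ w

theorem aug_r (v w : Q.V) (l : Q.L) : aug v (Q.r w l) = 0 := lift_r _ w l

theorem span_induction {p : Q.Alg → Prop} (h0 : p 0) (hadd : ∀ a b, p a → p b → p (a + b))
    (s : Set Q.Alg) (h1 : 1 ∈ s) (hm : ∀ a ∈ s, ∀ b ∈ s, a * b ∈ s)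
    (he : ∀ v, Q.e v ∈ s) (hr : ∀ v l, Q.r v l ∈ s) (hs : ∀ a ∈ s, p a) (a : Q.Alg) : p a := by
  induction mem_span s h1 hm he hr a using Submodule.span_induction with
  | mem x hx => exact hs x hx
  | zero => exact h0
  | add x y _ _ hx hy => exact hadd x y hx hy
  | smul c x _ hx =>
    rcases f2_cases c with rfl | rfl
    · rw [zero_smul]; exact h0
    · rwa [one_smul]

theorem aug_of_mem_gr (v : Q.V) {k : ℤ × ℤ} (hk : k ≠ 0) {a : Q.Alg} (ha : a ∈ Q.gr k) :
    aug v a = 0 := by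
  have key : ∀ a : Q.Alg, ∀ k, k ≠ 0 → aug v (Q.comp a k) = 0 := by
    refine span_induction (fun k _ => by rw [map_zero, Finsupp.zero_apply, map_zero])
      (fun a b ha hb k hk => by
        rw [map_add, Finsupp.add_apply, map_add, ha k hk, hb k hk, add_zero])
      {a | ∃ k, a ∈ Q.gr k ∧ (k ≠ 0 → aug v a = 0)} ⟨0, one_mem_gr, fun h => absurd rfl h⟩ ?_
      (fun v => ⟨0, e_mem v, fun h => absurd rfl h⟩) (fun v l => ⟨_, r_mem v l, fun _ => aug_r _ _ _⟩) ?_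
    · rintro a ⟨k, ha, h⟩ b ⟨l, hb, h'⟩
      refine ⟨k + l, mul_mem_gr ha hb, fun hkl => ?_⟩
      rw [map_mul]
      by_cases hk : k = 0
      · have hl : l ≠ 0 := fun hl => hkl (by rw [hk, hl, add_zero])
        rw [h' hl, mul_zero]
      · rw [h hk, zero_mul]
    · rintro a ⟨i, ha, h⟩ k hk
      rw [comp_of_mem ha]
      by_cases hi : i = k
      · rw [hi, Finsupp.single_eq_same]
        exact h (hi ▸ hk)
      · rw [Finsupp.single_eq_of_ne (Ne.symm hi), map_zero]
  have h := key a k hk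
  rwa [comp_of_mem ha, Finsupp.single_eq_same] at h

end LQuiver

section Simple

open LQuiver

variable {Q : LQuiver} (D : Q.DerivData) (h : ∀ v l, deriv D (D.δ v l) = 0)

instance (M : DGMod (dgAlg D h)) : Module Q.Alg M := M.module

instance (M : DGMod (dgAlg D h)) : IsScalarTower 𝔽 Q.Alg M := M.tower

/-- The differential of the arrows is in the radical, so that simple modules are DG modules. -/
def Minimal : Prop := ∀ v w l, aug v (D.δ w l) = 0

variable {D} in
theorem Minimal.aug_deriv (hD : Minimal D) (v : Q.V) (a : Q.Alg) : aug v (deriv D a) = 0 := by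
  refine LQuiver.span_induction (p := fun a => aug v (deriv D a) = 0) (by rw [map_zero, map_zero])
    (fun a b ha hb => by rw [map_add, map_add, ha, hb, add_zero])
    {a | aug v (deriv D a) = 0} ?_ ?_ ?_ ?_ (fun _ h => h) a
  · change aug v (deriv D 1) = 0
    rw [deriv_one, map_zero]
  · intro a ha b hb
    change aug v (deriv D (a * b)) = 0
    have ha' : aug v (deriv D a) = 0 := ha
    have hb' : aug v (deriv D b) = 0 := hb
    rw [deriv_mul, map_add, map_mul, map_mul, ha', hb', zero_mul, mul_zero, add_zero]
  · intro w
    change aug v (deriv D (Q.e w)) = 0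
    rw [deriv_e, map_zero]
  · intro w l
    change aug v (deriv D (Q.r w l)) = 0
    rw [deriv_r, hD]

variable {D} (hD : Minimal D)

/-- The grading concentrated in degree `0`. -/
def ptGr (k : ℤ × ℤ) : Submodule 𝔽 𝔽 := if k = 0 then ⊤ else ⊥

theorem ptGr_internal : DirectSum.IsInternal ptGr := by
  refine isInternal_of_comp _ (Finsupp.lsingle 0) ?_ ?_ ?_
  · intro m
    simp
  · intro m k
    by_cases hk : k = 0
    · rw [ptGr, if_pos hk]; trivial
    · rw [Finsupp.lsingle_apply, Finsupp.single_eq_of_ne hk]; exact zero_mem _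
  · intro k m hm
    by_cases hk : k = 0
    · rw [hk]; rfl
    · rw [ptGr, if_neg hk, Submodule.mem_bot] at hm
      rw [hm, map_zero, Finsupp.single_zero]

/-- The simple DG module at a vertex, in degree zero. -/
def simple (v : Q.V) : DGMod (dgAlg D h) :=
  letI : Module Q.Alg 𝔽 := Module.compHom 𝔽 (aug v).toRingHom
  { carrier := 𝔽
    tower := ⟨fun c a x => by
      change aug v (c • a) * x = c • (aug v a * x)
      rw [map_smul, smul_mul_assoc]⟩
    gr := ptGr
    internal := ptGr_internal
    smul_mem := fun {k l a m} ha hm => by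
      change aug v a * m ∈ ptGr (k + l)
      by_cases hk : k = 0
      · rw [hk, zero_add]
        exact Submodule.smul_mem _ _ hm
      · rw [aug_of_mem_gr v hk ha, zero_mul]
        exact zero_mem _
    d := 0
    d_mem := fun _ => zero_mem _
    d_d := fun _ => rfl
    leibniz := fun a m => by
      change (0 : 𝔽) = aug v (deriv D a) * m + aug v a * 0
      rw [hD.aug_deriv, zero_mul, mul_zero, add_zero] }

/-- The generator of `P(v)`. -/
def gen (v : Q.V) : Q.leftIdeal v := ⟨Q.e v, LQuiver.mem_leftIdeal.2 (by rw [e_mul, if_pos rfl])⟩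

theorem smul_gen {v : Q.V} (x : Q.leftIdeal v) : x.1 • gen v = x :=
  Subtype.ext (LQuiver.mem_leftIdeal.1 x.2)

theorem e_smul_gen (v : Q.V) : Q.e v • gen v = gen v := smul_gen (gen v)

theorem proj_hom_apply {M : DGMod (dgAlg D h)} {v : Q.V} (f : proj D h v →ₗ[dgAlg D h] M)
    (x : Q.leftIdeal v) : f x = (x.1 : dgAlg D h) • f (gen v) := by
  conv_lhs => rw [← smul_gen x]
  exact f.map_smul x.1 (gen v)

theorem hom_simple_gen {v w : Q.V} {k : ℤ × ℤ}
    (f : proj D h v →ₗ[dgAlg D h] (simple h hD w).shift k) (hvw : v ≠ w) : f = 0 := by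
  refine LinearMap.ext fun x => ?_
  refine (proj_hom_apply h f x).trans ?_
  have h1 : f (gen v) = (Q.e v : dgAlg D h) • f (gen v) :=
    (congrArg f (e_smul_gen v)).symm.trans (f.map_smul (Q.e v) (gen v))
  have h2 : f (gen v) = 0 := by
    refine h1.trans ?_
    change aug w (Q.e v) * _ = _
    rw [aug_e, if_neg hvw]
    exact zero_mul (M₀ := 𝔽) _
  rw [h2, smul_zero]; rfl

theorem hdim_simple_proj_of_ne {v w : Q.V} {k : ℤ × ℤ} (hk : v ≠ w ∨ k ≠ 0) :
    Subsingleton (Ho.of (proj D h v) ⟶ Ho.of ((simple h hD w).shift k)) := by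
  refine subsingleton_of_forall_eq 0 fun f => ?_
  obtain ⟨f, rfl⟩ := cls_surj f
  have hf : f.1 = 0 := by
    by_cases hvw : v = w
    · have hk' := hk.resolve_left (not_not.2 hvw)
      refine LinearMap.ext fun x => ?_
      refine (proj_hom_apply h f.1 x).trans ?_
      have h1 : f.1 (gen v) ∈ ptGr (0 + k) :=
        Z0_mem f (k := 0) (m := gen v) (LQuiver.mem_idealGr.2 (e_mem v))
      rw [ptGr, zero_add, if_neg hk'] at h1
      have h2 : f.1 (gen v) = (0 : 𝔽) := (Submodule.mem_bot (R := 𝔽) (M := 𝔽)).1 h1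
      rw [h2]
      exact mul_zero (aug w x.1)
    · exact hom_simple_gen h hD f.1 hvw
  exact congrArg cls (Subtype.ext hf)

/-- The projection of `P(v)` to its simple quotient. -/
def toSimple (v : Q.V) : Z0 (proj D h v) ((simple h hD v).shift 0) :=
  zmk (M := proj D h v) (N := (simple h hD v).shift 0)
    { toFun := fun x => aug v x.1
      map_add' := fun x y => map_add (aug v) x.1 y.1
      map_smul' := fun a x => map_mul (aug v) a x.1 }
    (fun k x hx => by
      change aug v x.1 ∈ ptGr (k + 0)
      by_cases hk : k = 0
      · rw [ptGr, hk, add_zero, if_pos rfl]; trivial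
      · have h2 := aug_of_mem_gr v hk (LQuiver.mem_idealGr.1 hx)
        rw [h2]; exact zero_mem _)
    (fun x => (hD.aug_deriv v x.1).symm)

theorem finrank_simple_proj (v : Q.V) :
    Module.finrank 𝔽 (Ho.of (proj D h v) ⟶ Ho.of ((simple h hD v).shift 0)) = 1 := by
  refine (finrank_eq_one_iff_of_nonzero' (cls (toSimple h hD v)) ?_).2 ?_
  · intro h0
    obtain ⟨s, hs, e⟩ := (cls_eq_iff (g := 0)).1 h0
    have h1 : s (gen v) = 0 := by
      have := hs 0 (gen v) (LQuiver.mem_idealGr.2 (e_mem v))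
      change s (gen v) ∈ ptGr (0 + (-1, 0) + 0) at this
      rw [ptGr, if_neg (by decide)] at this
      exact (Submodule.mem_bot 𝔽).1 this
    have h2 : s = 0 := LinearMap.ext fun x => by
      refine (proj_hom_apply h s x).trans ?_
      rw [h1]
      exact smul_zero _
    have h3 := e (gen v)
    rw [h2] at h3
    have h4 : aug v (Q.e v) = 0 := h3.trans (by
      change (0 : 𝔽) + (0 + 0) = 0
      simp)
    rw [aug_e, if_pos rfl] at h4
    exact absurd h4 (by decide)
  · intro f
    obtain ⟨f, rfl⟩ := cls_surj f
    have hc := f2_cases (f.1 (gen v))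
    rcases hc with hc | hc
    · refine ⟨0, ?_⟩
      rw [zero_smul]
      refine congrArg cls (a₁ := 0) (a₂ := f) (Subtype.ext (LinearMap.ext fun x => ?_))
      refine Eq.trans ?_ (proj_hom_apply h f.1 x).symm
      rw [hc]
      exact (mul_zero (aug v x.1)).symm
    · refine ⟨1, ?_⟩
      rw [one_smul]
      refine congrArg cls (Subtype.ext (LinearMap.ext fun x => ?_))
      refine Eq.trans ?_ (proj_hom_apply h f.1 x).symm
      rw [hc]
      exact (mul_one (aug v x.1)).symm

/-- The classes of `X` in the Grothendieck group: the Euler characteristics of the morphisms to the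
simple modules. -/
def chi (X : Ho (dgAlg D h)) (v : Q.V) : Λ := euler (simple h hD v) X

theorem homFin_proj (v w : Q.V) : HomFin (simple h hD w) (Ho.of (proj D h v)) := by
  constructor
  · intro k
    by_cases hk : v ≠ w ∨ k ≠ 0
    · have := hdim_simple_proj_of_ne h hD hk
      infer_instance
    · rw [not_or, not_not, not_not] at hk
      obtain ⟨rfl, rfl⟩ := hk
      exact Module.finite_of_finrank_eq_succ (finrank_simple_proj h hD v)
  · refine (Set.finite_singleton 0).subset fun k hk => ?_
    by_contra hc
    have := hdim_simple_proj_of_ne h hD (v := v) (w := w) (k := k) (Or.inr hc)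
    exact hk (Module.finrank_zero_of_subsingleton)

theorem chi_proj (v : Q.V) : chi h hD (Ho.of (proj D h v)) = Pi.single v 1 := by
  funext w
  rw [chi, euler, finsum_eq_single _ 0]
  · rw [weight_zero]
    by_cases hvw : v = w
    · subst hvw
      rw [Pi.single_eq_same, hdim, finrank_simple_proj, one_smul]
    · have := hdim_simple_proj_of_ne h hD (v := v) (w := w) (k := 0) (Or.inl hvw)
      rw [Pi.single_eq_of_ne (Ne.symm hvw), hdim, Module.finrank_zero_of_subsingleton, zero_smul]
  · intro k hk
    have := hdim_simple_proj_of_ne h hD (v := v) (w := w) (k := k) (Or.inr hk)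
    rw [hdim, Module.finrank_zero_of_subsingleton, zero_smul]

theorem chi_iso {X Y : Ho (dgAlg D h)} (e : X ≅ Y) : chi h hD X = chi h hD Y :=
  funext fun _ => euler_iso e

theorem chi_shift (M : DGMod (dgAlg D h)) (a : ℤ × ℤ) :
    chi h hD (Ho.of (M.shift a)) = weight a • chi h hD (Ho.of M) :=
  funext fun _ => euler_shift M a

variable (D) in
/-- The objects generated by the projective modules `P(v)`. -/
def genProj : ObjectProperty (Ho (dgAlg D h)) := Generated fun X => ∃ v, X = Ho.of (proj D h v)

variable {h}

theorem homFin_of_genProj {X : Ho (dgAlg D h)} (hX : genProj D h X) (w : Q.V) :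
    HomFin (simple h hD w) X := by
  induction hX with
  | basic X hX =>
    obtain ⟨v, rfl⟩ := hX
    exact homFin_proj h hD v w
  | shift M a _ ih => exact ih.shift a
  | cone f _ _ ihM ihN => exact HomFin.ext₃ (coneTriangle_distinguished f) ihM ihN
  | iso e _ ih => exact ih.iso e

theorem chi_cone {M N : DGMod (dgAlg D h)} (f : Z0 M N) (hM : genProj D h (Ho.of M))
    (hN : genProj D h (Ho.of N)) :
    chi h hD (Ho.of (cone f)) = chi h hD (Ho.of N) - chi h hD (Ho.of M) :=
  funext fun w => eq_sub_of_add_eq' (euler_triangle (coneTriangle_distinguished f)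
    (homFin_of_genProj hD hM w) (homFin_of_genProj hD hN w)).symm

end Simple

section Generation

variable {A : QDGAlg}

/-- The mapping cone of the identity is a zero object. -/
theorem isZero_cone_id (M : DGMod A) : IsZero (Ho.of (cone (zid M))) :=
  Pretriangulated.Triangle.isZero₃_of_isIso₁ _ (coneTriangle_distinguished (zid M))
    (inferInstanceAs (IsIso (𝟙 (Ho.of M))))

open Pretriangulated in
/-- The objects generated by `S` form a triangulated subcategory. -/
theorem generated_ext {S : Ho A → Prop} {T : Triangle (Ho A)} (hT : T ∈ distTriang (Ho A))
    (h₁ : Generated S T.obj₁) (h₃ : Generated S T.obj₃) : Generated S T.obj₂ := by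
  obtain ⟨M, N, f, ⟨e⟩⟩ := inv_rot_of_distTriang T hT
  have e1 : (T.obj₃⟦(-1 : ℤ)⟧) ≅ Ho.of M := Triangle.π₁.mapIso e
  have e2 : T.obj₁ ≅ Ho.of N := Triangle.π₂.mapIso e
  have e3 : T.obj₂ ≅ Ho.of (cone f) := Triangle.π₃.mapIso e
  exact Generated.iso e3.symm (Generated.cone f
    (Generated.iso e1 (Generated.shift T.obj₃.obj (-1, 0) h₃)) (Generated.iso e2 h₁))

theorem generated_isZero {S : Ho A → Prop} (hS : ∃ X, Generated S X) {Z : Ho A} (hZ : IsZero Z) :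
    Generated S Z := by
  obtain ⟨X, hX⟩ := hS
  exact Generated.iso ((isZero_cone_id X.obj).iso hZ) (Generated.cone _ hX hX)

end Generation


/-! ### Dense subcategories of the category generated by the projective modules -/

section DenseProj

open LQuiver Pretriangulated ZeroObject

variable {A : QDGAlg} {Pr : ObjectProperty (Ho A)} [Pr.IsTriangulated]
  [Pr.IsClosedUnderIsomorphisms]

theorem dens_shift {M : DGMod A} (hM : dens Pr (Ho.of M)) (a : ℤ) :
    dens Pr (Ho.of (M.shift (a, 0))) := by
  obtain ⟨Y, hY⟩ := hM
  let r : Retract (Ho.of M) (Ho.of M ⊞ Y) :=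
    { i := biprod.inl, r := biprod.fst, retract := biprod.inl_fst }
  exact dens_of_retract (r.map (shiftFunctor (Ho A) a)) (Pr.le_shift a _ hY)

theorem densK_shift_one {M : DGMod A} (hM : dens Pr (Ho.of M)) :
    densK Pr (Ho.of (M.shift (1, 0))) = -densK Pr (Ho.of M) := by
  have h0 : dens Pr (0 : Ho A) := dens_of_prop Pr.prop_zero
  have hz : densK Pr (0 : Ho A) = 0 := by
    have h := densK_triangle (P := Pr) (contractible_distinguished (0 : Ho A)) h0 h0 h0
    exact left_eq_add.1 h
  have h := densK_triangle (rot_of_distTriang _ (contractible_distinguished (Ho.of M))) hM h0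
    (dens_shift hM 1)
  exact eq_neg_of_add_eq_zero_right (h.symm.trans hz)

theorem densK_shift {M : DGMod A} (hM : dens Pr (Ho.of M)) (a : ℤ) :
    densK Pr (Ho.of (M.shift (a, 0))) = ((a.negOnePow : ℤˣ) : ℤ) • densK Pr (Ho.of M) := by
  have hs : ∀ a : ℤ, densK Pr (Ho.of (M.shift (a + 1, 0))) = -densK Pr (Ho.of (M.shift (a, 0))) :=
    fun a => by
      have h := densK_shift_one (dens_shift hM a)
      rw [← h]
      exact densK_iso (shiftShiftIso M (a, 0) (1, 0)).symm
  induction a using Int.induction_on with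
  | zero =>
    rw [Int.negOnePow_zero, Units.val_one, one_smul]
    exact densK_iso (shiftZeroIso M)
  | succ a ih => rw [hs, ih, Int.negOnePow_succ, Units.val_neg, neg_smul]
  | pred a ih =>
    have h := hs (-(a : ℤ) - 1)
    rw [sub_add_cancel, ih] at h
    rw [← neg_inj, ← h, Int.negOnePow_sub, Int.negOnePow_one]
    simp

variable {Q : LQuiver} {D : Q.DerivData} {h : ∀ v l, deriv D (D.δ v l) = 0} (hD : Minimal D)
  {P : ObjectProperty (Ho (dgAlg D h))} [P.IsTriangulated] [P.IsClosedUnderIsomorphisms]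

variable (P) in
/-- The homomorphism from the free module on the vertices that sends `q^b v` to the class of
`P(v){b}`. -/
def projK : (Q.V → Λ) →+ DensGroup P :=
  ∑ v, ((Finsupp.liftAddHom fun b : ℤ =>
      zmultiplesHom (DensGroup P) (densK P (Ho.of ((proj D h v).shift (0, b))))).comp
    (AddMonoidAlgebra.coeffAddEquiv (R := ℤ) (M := ℤ)).toAddMonoidHom).comp
    (Pi.evalAddMonoidHom (fun _ : Q.V => Λ) v)

theorem projK_single (v : Q.V) (b : ℤ) : projK P (Pi.single v (LaurentPolynomial.T b)) =
    densK P (Ho.of ((proj D h v).shift (0, b))) := by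
  rw [projK, AddMonoidHom.finsetSum_apply, Finset.sum_eq_single v]
  · simp [LaurentPolynomial.T, -LaurentPolynomial.single_eq_C_mul_T]
  · intro w _ hw
    simp [Pi.single_eq_of_ne hw]
  · simp

/-- If all the `P(v){b}` are direct summands of objects of `P`, then the classes of the objects
generated by them are determined by their Euler characteristics. -/
theorem densK_eq_projK (hP : ∀ v b, dens P (Ho.of ((proj D h v).shift (0, b))))
    {X : Ho (dgAlg D h)} (hX : genProj D h X) :
    dens P X ∧ densK P X = projK P (chi h hD X) := by
  -- The statement is proved for all shifts at once, since the shift is a case of the induction.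
  have key : ∀ a, dens P ((hoShift _ a).obj X) ∧
      densK P ((hoShift _ a).obj X) = projK P (chi h hD ((hoShift _ a).obj X)) := by
    induction hX with
    | basic X hX =>
      obtain ⟨v, rfl⟩ := hX
      rintro ⟨a, b⟩
      have e : Ho.of (((proj D h v).shift (0, b)).shift (a, 0)) ≅
          (hoShift _ (a, b)).obj (Ho.of (proj D h v)) :=
        (shiftShiftIso (proj D h v) (0, b) (a, 0)).trans
          (eqToIso (by rw [Prod.mk_add_mk, zero_add, add_zero]; rfl))
      refine ⟨dens_iso e (dens_shift (hP v b) a), ?_⟩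
      rw [← densK_iso e, densK_shift (hP v b), ← projK_single, ← map_zsmul]
      refine congrArg _ ?_
      refine Eq.trans ?_ (chi_shift h hD (proj D h v) (a, b)).symm
      rw [chi_proj, weight, ← Pi.single_smul, ← Pi.single_smul, smul_eq_mul, mul_one]
    | shift M a _ ih =>
      intro c
      have e := shiftShiftIso M a c
      obtain ⟨h1, h2⟩ := ih (a + c)
      refine ⟨dens_iso e.symm h1, ?_⟩
      have h3 := densK_iso (P := P) e
      have h4 := chi_iso h hD e
      exact h3.trans (h2.trans (congrArg _ h4.symm))
    | cone f hM hN ihM ihN =>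
      intro c
      have e := coneShiftIso f c
      have ht := coneTriangle_distinguished (zshift f c)
      have h1 : dens P (Ho.of (cone (zshift f c))) := dens_of_isTri₃ ht (ihM c).1 (ihN c).1
      refine ⟨dens_iso e h1, ?_⟩
      refine (densK_iso e).symm.trans (Eq.trans ?_ (congrArg _ (chi_iso h hD e)))
      have h2 := densK_triangle ht (ihM c).1 (ihN c).1 h1
      rw [chi_cone hD _ (Generated.shift _ c hM) (Generated.shift _ c hN), map_sub]
      refine eq_sub_of_add_eq' ?_
      refine Eq.trans (congrArg (· + _) (ihM c).2.symm) (h2.symm.trans (ihN c).2)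
    | iso e _ ih =>
      intro c
      have e' := (hoShift _ c).mapIso e
      exact ⟨dens_iso e' (ih c).1, (densK_iso e').symm.trans
        ((ih c).2.trans (congrArg _ (chi_iso h hD e')))⟩
  obtain ⟨h1, h2⟩ := key 0
  have e := (hoShiftZero (dgAlg D h)).app X
  exact ⟨dens_iso e h1, (densK_iso e).symm.trans (h2.trans (congrArg _ (chi_iso h hD e)))⟩

/-- Thomason's theorem: a dense triangulated subcategory of the category generated by the
projective modules contains every object whose Euler characteristics are those of one of its
objects, with the same class in its Grothendieck group. -/
theorem prop_of_chi_eq (hP : ∀ v b, dens P (Ho.of ((proj D h v).shift (0, b))))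
    {X Y : Ho (dgAlg D h)} (hX : genProj D h X) (hY : genProj D h Y)
    (e : chi h hD X = chi h hD Y) (hPY : P Y) :
    ∃ h : P X, (K0.cls ⟨X, h⟩ : K0 P.FullSubcategory) = K0.cls ⟨Y, hPY⟩ := by
  obtain ⟨h1, h2⟩ := densK_eq_projK hD hP hX
  obtain ⟨_, h4⟩ := densK_eq_projK hD hP hY
  exact prop_of_densK_eq h1 (by rw [h2, h4, e]) hPY

end DenseProj

/-! ### Semifree modules -/

section Semifree

open LQuiver

variable {Q : LQuiver} [Nonempty Q.V] {D : Q.DerivData} {h : ∀ v l, deriv D (D.δ v l) = 0}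

/-- Right multiplication of `P(v)` into a module. -/
def projMap {M : DGMod (dgAlg D h)} (v : Q.V) (m : M) : Q.leftIdeal v →ₗ[Q.Alg] M where
  toFun x := x.1 • m
  map_add' x y := add_smul x.1 y.1 m
  map_smul' a x := mul_smul a x.1 m

/-- A module with a finite filtration by homogeneous generators `m i`, each generating a copy of
`P(z i)` modulo the later ones, is generated by the projective modules, and its Euler
characteristics are the sums of those of the copies. -/
theorem generated_of_semifree (hD : Minimal D) {M : DGMod (dgAlg D h)} {ι : Type} [Fintype ι]
    (rk : ι → ℕ) (z : ι → Q.V) (c : ι → ℤ × ℤ) (m : ι → M) (hm : ∀ i, m i ∈ M.gr (c i))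
    (hz : ∀ i, Q.e (z i) • m i = m i)
    (hd : ∀ i, M.d (m i) ∈ Submodule.span Q.Alg (m '' {j | rk i < rk j}))
    (hinj : ∀ a : ι → Q.Alg, (∀ i, a i ∈ Q.leftIdeal (z i)) → ∑ i, a i • m i = 0 → a = 0)
    (hsurj : ∀ x, x ∈ Submodule.span Q.Alg (Set.range m)) :
    genProj D h (Ho.of M) ∧
      chi h hD (Ho.of M) = ∑ i, Pi.single (z i) (weight (-c i)) := by
  classical
  have hz' : ∀ i (a : Q.Alg), (a * Q.e (z i)) • m i = a • m i := fun i a => by rw [mul_smul, hz]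
  -- For a set `U` of indices closed under passing to greater ranks, the generators in `U` span a
  -- submodule, the image of an embedding `φ` of a module of the required kind. An index `i` of least
  -- rank is then added by the cone of the map `P(z i) ⟶ X` given by the boundary of `m i`.
  have key : ∀ N : ℕ, ∀ U : Finset ι, U.card = N → (∀ i ∈ U, ∀ j, rk i < rk j → j ∈ U) →
      ∃ (X : DGMod (dgAlg D h)) (φ : Z0 X M), Function.Injective φ.1 ∧
        (∀ x, (∃ y, φ.1 y = x) ↔ x ∈ Submodule.span Q.Alg (m '' U)) ∧
        genProj D h (Ho.of X) ∧ chi h hD (Ho.of X) = ∑ i ∈ U, Pi.single (z i) (weight (-c i)) := by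
    intro N
    induction N with
    | zero =>
      intro U hU _
      obtain rfl := Finset.card_eq_zero.1 hU
      let v : Q.V := Classical.arbitrary _
      have hv : genProj D h (Ho.of (proj D h v)) := Generated.basic _ ⟨v, rfl⟩
      have e := (isZero_zeroMod (A := dgAlg D h)).iso (isZero_cone_id (proj D h v))
      refine ⟨zeroMod _, 0, fun _ _ _ => Subsingleton.elim (α := PUnit) _ _, fun x => ?_,
        generated_isZero ⟨_, hv⟩ isZero_zeroMod, ?_⟩
      · rw [Finset.coe_empty, Set.image_empty, Submodule.span_empty, Submodule.mem_bot]
        exact ⟨fun ⟨_, h⟩ => h.symm, fun h => ⟨PUnit.unit, h.symm⟩⟩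
      · rw [chi_iso h hD e, chi_cone hD _ hv hv, sub_self, Finset.sum_empty]
    | succ N ih =>
      intro U hU hup
      have hne : U.Nonempty := Finset.card_pos.1 (by omega)
      obtain ⟨i, hi, hmin⟩ := Finset.exists_min_image U rk hne
      obtain ⟨X, φ, hφ, hr, hg, hc⟩ := ih (U.erase i) (by rw [Finset.card_erase_of_mem hi]; omega)
        (fun j hj k hjk => Finset.mem_erase.2 ⟨fun hk => by
          have h1 := hmin j (Finset.mem_of_mem_erase hj)
          rw [hk] at hjk
          omega, hup j (Finset.mem_of_mem_erase hj) k hjk⟩)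
      obtain ⟨x₀, hx₀⟩ : ∃ y, φ.1 y = M.d (m i) := by
        rw [hr]
        refine Submodule.span_mono (Set.image_mono fun j hj => ?_) (hd i)
        have hj' : rk i < rk j := hj
        exact Finset.mem_coe.2 (Finset.mem_erase.2 ⟨fun e => by rw [e] at hj'; omega, hup i hi j hj'⟩)
      have hx₀gr : x₀ ∈ X.gr (c i + (1, 0)) :=
        mem_gr_of_injective X.internal M.internal (φ.1.restrictScalars 𝔽) hφ
          (fun _ _ h => Z0_mem φ h) (by
            change φ.1 x₀ ∈ _
            rw [hx₀]
            exact M.d_mem (hm i))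
      have hx₀d : X.d x₀ = 0 := hφ (by rw [← Z0_comm, hx₀, M.d_d, map_zero])
      let Pi' : DGMod (dgAlg D h) := (proj D h (z i)).shift (-c i - (1, 0))
      let g : Z0 Pi' X := zmk (M := Pi') (N := X) (projMap (z i) x₀)
        (fun k x hx => by
          have hx' : x.1 ∈ Q.gr (k + (-c i - (1, 0))) := hx
          have h1 := X.smul_mem (a := x.1) hx' hx₀gr
          rwa [show k + (-c i - (1, 0)) + (c i + (1, 0)) = k by abel] at h1)
        (fun x => by
          refine (X.leibniz x.1 x₀).trans ?_
          rw [hx₀d, smul_zero, add_zero]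
          rfl)
      have hgφ : ∀ x : Q.leftIdeal (z i), φ.1 (g.1 x) = x.1 • M.d (m i) := fun x => by
        refine (φ.1.map_smul x.1 x₀).trans ?_
        rw [hx₀]
      let ψ : Z0 (cone g) M := zmk (M := cone g) (N := M)
        (LinearMap.coprod φ.1 (projMap (z i) (m i)))
        (fun k x hx => by
          refine add_mem (Z0_mem φ hx.1) ?_
          have hx' : x.2.1 ∈ Q.gr (k + (1, 0) + (-c i - (1, 0))) := hx.2
          have h1 := M.smul_mem (a := x.2.1) hx' (hm i)
          rwa [show k + (1, 0) + (-c i - (1, 0)) + c i = k by abel] at h1)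
        (fun x => by
          change M.d (φ.1 x.1 + x.2.1 • m i) = φ.1 (X.d x.1 + g.1 x.2) + deriv D x.2.1 • m i
          rw [map_add, map_add, Z0_comm]
          have h1 := M.leibniz x.2.1 (m i)
          refine (congrArg (φ.1 (X.d x.1) + ·) h1).trans ?_
          rw [add_comm (_ • _) (_ • _), ← add_assoc]
          exact congrArg (φ.1 (X.d x.1) + · + deriv D x.2.1 • m i) (hgφ x.2).symm)
      have hψ : ∀ x, ψ.1 x = φ.1 x.1 + x.2.1 • m i := fun _ => rfl
      refine ⟨cone g, ψ, ?_, ?_, Generated.cone g (Generated.shift _ _ (Generated.basic _ ⟨_, rfl⟩)) hg,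
        ?_⟩
      · rw [injective_iff_map_eq_zero]
        rintro ⟨y, x⟩ h0
        rw [hψ] at h0
        obtain ⟨b, hb⟩ := (Submodule.mem_span_image_finset_iff_exists_fun' Q.Alg).1
          ((hr (φ.1 y)).1 ⟨y, rfl⟩)
        have h1 := hinj (fun j => if j = i then x.1 else if j ∈ U then b j * Q.e (z j) else 0)
          (fun j => by
            by_cases hj : j = i
            · subst hj
              rw [if_pos rfl]
              exact x.2
            · rw [if_neg hj]
              split_ifs
              · rw [LQuiver.mem_leftIdeal, mul_assoc, e_mul, if_pos rfl]
              · exact zero_mem _) (by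
            rw [← Finset.sum_subset (Finset.subset_univ U) (fun j _ hj => by
              rw [if_neg (fun e => hj (by rw [e]; exact hi)), if_neg hj, zero_smul]),
              ← Finset.add_sum_erase U _ hi, if_pos rfl, add_comm, ← h0, ← hb]
            refine congrArg (· + _) (Finset.sum_congr rfl fun j hj => ?_)
            rw [if_neg (Finset.ne_of_mem_erase hj), if_pos (Finset.mem_of_mem_erase hj), hz'])
        have hx : x = 0 := Subtype.ext (by
          exact (if_pos rfl).symm.trans (congrFun h1 i))
        have hy : y = 0 := hφ (by
          rw [map_zero, ← h0, hx]
          exact ((congrArg (φ.1 y + ·) (zero_smul _ _)).trans (add_zero _)).symm)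
        rw [hx, hy]; rfl
      · intro x
        rw [← Finset.insert_erase hi, Finset.coe_insert, Set.image_insert_eq, Submodule.mem_span_insert]
        constructor
        · rintro ⟨⟨y, a⟩, rfl⟩
          exact ⟨a.1, φ.1 y, (hr _).1 ⟨y, rfl⟩, add_comm _ _⟩
        · rintro ⟨a, w, hw, rfl⟩
          obtain ⟨y, rfl⟩ := (hr _).2 hw
          refine ⟨(y, ⟨a * Q.e (z i), by
            rw [LQuiver.mem_leftIdeal, mul_assoc, e_mul, if_pos rfl]⟩), ?_⟩
          rw [hψ, hz', add_comm]
      · rw [chi_cone hD g (Generated.shift _ _ (Generated.basic _ ⟨_, rfl⟩)) hg, hc,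
          ← Finset.add_sum_erase U _ hi, chi_shift, chi_proj, sub_eq_add_neg, add_comm,
          sub_eq_add_neg (-c i), show -((1, 0) : ℤ × ℤ) = (-1, 0) from rfl, weight_add]
        congr 1
        have hw : weight (-1, 0) = -1 := by
          rw [weight, show Int.negOnePow ((-1, 0) : ℤ × ℤ).1 = -1 from rfl, LaurentPolynomial.T_zero]
          simp
        rw [hw, mul_neg_one, neg_smul, neg_neg, ← Pi.single_smul, smul_eq_mul, mul_one]
  obtain ⟨X, φ, hφ, hr, hg, hc⟩ := key _ Finset.univ rfl (fun _ _ j _ => Finset.mem_univ j)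
  have e := isoOfBijective φ ⟨hφ, fun x => (hr x).2 (by
    rw [Finset.coe_univ, Set.image_univ]
    exact hsurj x)⟩
  exact ⟨Generated.iso e hg, (chi_iso h hD e).symm.trans hc⟩

end Semifree


/-! ### Tensor products with projective modules -/

section TensorProj

open LQuiver

variable {B : QDGAlg} {Q : LQuiver} {D : Q.DerivData} {h : ∀ v l, deriv D (D.δ v l) = 0}

instance (T : DGBimod B (dgAlg D h)) : Module Q.Algᵐᵒᵖ T := T.right

instance (T : DGBimod B (dgAlg D h)) : IsScalarTower 𝔽 Q.Algᵐᵒᵖ T := T.towerRight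

instance (T : DGBimod B (dgAlg D h)) : SMulCommClass B Q.Algᵐᵒᵖ T := T.comm

instance (T : DGBimod (dgAlg D h) B) : Module Q.Alg T := T.left

instance {Q' : LQuiver} {D' : Q'.DerivData} {h' : ∀ v l, deriv D' (D'.δ v l) = 0}
    (T : DGBimod (dgAlg D' h') (dgAlg D h)) : SMulCommClass Q'.Alg Q.Algᵐᵒᵖ T := T.comm

variable (T : DGBimod B (dgAlg D h)) (w : Q.V)

/-- The map `t ↦ t ⊗ e(w)` to `T ⊗ P(w)`. -/
def tensorGen : T →ₗ[B] tensorMod T (proj D h w) where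
  toFun t := tensorMk T (proj D h w) (t ⊗ₜ gen w)
  map_add' s t := (congrArg (tensorMk T (proj D h w)) (TensorProduct.add_tmul s t _)).trans
    (map_add _ _ _)
  map_smul' _ _ := rfl

/-- The evaluation `t ⊗ a ↦ t a` on `T ⊗ P(w)`. -/
def tensorEval : tensorMod T (proj D h w) →ₗ[B] T :=
  (balanced T (proj D h w)).liftQ
    (TensorProduct.AlgebraTensorModule.lift
      { toFun := fun t =>
          { toFun := fun x => MulOpposite.op (x.1) • t
            map_add' := fun x y => by
              change MulOpposite.op (x.1 + y.1) • t = _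
              exact add_smul (MulOpposite.op (x.1)) (MulOpposite.op y.1) t
            map_smul' := fun c x => by
              change MulOpposite.op (c • (x.1)) • t = _
              rw [MulOpposite.op_smul, smul_assoc]; rfl }
        map_add' := fun s t => LinearMap.ext fun x => smul_add _ _ _
        map_smul' := fun b t => LinearMap.ext fun x => (smul_comm _ _ _).symm }) (by
      refine Submodule.span_le.2 ?_
      rintro _ ⟨t, a, x, rfl⟩
      refine (map_sub _ _ _).trans (sub_eq_zero.2 ?_)
      change MulOpposite.op (x.1) • MulOpposite.op a • t =
        MulOpposite.op (a * (x.1)) • t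
      rw [MulOpposite.op_mul, mul_smul])

theorem tensorEval_gen (t : T) :
    tensorEval T w (tensorGen T w t) = MulOpposite.op (Q.e w) • t := rfl

theorem tensorGen_surj (x : tensorMod T (proj D h w)) :
    ∃ t : T, MulOpposite.op (Q.e w) • t = t ∧ tensorGen T w t = x := by
  refine tensorMod_ind T (p := fun x => ∃ t : T, MulOpposite.op (Q.e w) • t = t ∧ tensorGen T w t = x)
    ⟨0, smul_zero _, map_zero _⟩ ?_ ?_ x
  · rintro _ _ ⟨s, hs, rfl⟩ ⟨t, ht, rfl⟩
    exact ⟨s + t, by rw [smul_add, hs, ht], map_add _ _ _⟩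
  · intro t a
    refine ⟨MulOpposite.op (a.1) • t, ?_, ?_⟩
    · rw [← mul_smul, ← MulOpposite.op_mul]
      exact congrArg (fun y : Q.Alg => MulOpposite.op y • t) (LQuiver.mem_leftIdeal.1 a.2)
    · refine sub_eq_zero.1 ((map_sub (tensorMk T (proj D h w)) _ _).symm.trans ?_)
      rw [tensorMk_eq_zero]
      refine Submodule.subset_span ⟨t, a.1, gen w, ?_⟩
      congr 2
      exact (smul_gen a).symm

theorem tensorGen_d (t : T) :
    (tensorMod T (proj D h w)).d (tensorGen T w t) = tensorGen T w (T.d t) := by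
  refine (tensorMod_d_mk T (proj D h w) t (gen w)).trans ?_
  have hg : (proj D h w).d (gen w) = 0 := Subtype.ext (deriv_e D w)
  rw [hg, TensorProduct.tmul_zero, map_zero, add_zero]
  rfl

variable {Q' : LQuiver} [Nonempty Q'.V] {D' : Q'.DerivData}
  {h' : ∀ v l, deriv D' (D'.δ v l) = 0}

/-- If `T e(w)` has a finite filtration with homogeneous generators `t i`, each generating a copy
of `P(z i)`, then `T ⊗ P(w)` is generated by projective modules. -/
theorem generated_tensor_proj (hD : Minimal D') (T : DGBimod (dgAlg D' h') (dgAlg D h)) (w : Q.V)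
    {ι : Type} [Fintype ι] (rk : ι → ℕ) (z : ι → Q'.V) (c : ι → ℤ × ℤ) (t : ι → T)
    (ht : ∀ i, t i ∈ T.gr (c i)) (hz : ∀ i, Q'.e (z i) • t i = t i)
    (hw : ∀ i, MulOpposite.op (Q.e w) • t i = t i)
    (hd : ∀ i, T.d (t i) ∈ Submodule.span Q'.Alg (t '' {j | rk i < rk j}))
    (hinj : ∀ a : ι → Q'.Alg, (∀ i, a i ∈ Q'.leftIdeal (z i)) → ∑ i, a i • t i = 0 → a = 0)
    (hsurj : ∀ x : T, MulOpposite.op (Q.e w) • x = x →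
      x ∈ Submodule.span Q'.Alg (Set.range t)) :
    genProj D' h' (Ho.of (tensorMod T (proj D h w))) ∧
      chi h' hD (Ho.of (tensorMod T (proj D h w))) = ∑ i, Pi.single (z i) (weight (-c i)) := by
  refine generated_of_semifree hD rk z c (fun i => tensorGen T w (t i)) ?_ ?_ ?_ ?_ ?_
  · intro i
    refine ⟨t i ⊗ₜ gen w, Submodule.subset_span ⟨c i, 0, add_zero _, t i, ht i, gen w, ?_, rfl⟩, rfl⟩
    exact e_mem (Q := Q) w
  · intro i
    exact ((tensorGen T w).map_smul (Q'.e (z i)) (t i)).symm.trans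
      (congrArg _ (hz i))
  · intro i
    have h1 := Submodule.mem_map_of_mem (f := tensorGen T w) (hd i)
    rw [Submodule.map_span, ← Set.image_comp, ← tensorGen_d] at h1
    exact h1
  · intro a ha h0
    refine hinj a ha ?_
    have h1 : tensorGen T w (∑ i, a i • t i) = 0 := by
      refine Eq.trans ?_ h0
      rw [map_sum]
      exact Finset.sum_congr rfl fun i _ => map_smul _ _ _
    have h2 := congrArg (tensorEval T w) h1
    rw [tensorEval_gen, map_zero, Finset.smul_sum] at h2
    refine Eq.trans (Finset.sum_congr rfl fun i _ => ?_) h2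
    rw [← smul_comm, hw]
  · intro x
    obtain ⟨t, ht, rfl⟩ := tensorGen_surj T w x
    have h1 := Submodule.mem_map_of_mem (f := tensorGen T w) (hsurj t ht)
    rw [Submodule.map_span, ← Set.range_comp] at h1
    exact h1

end TensorProj


/-! ### Combinatorics of the indices of the stacking bimodule -/

section States

variable {n : ℕ}

/-- Membership of a natural number in a vertex. -/
def Has (x : Vert n) (k : ℕ) : Prop := ∃ b ∈ x, b.val = k

theorem has_val {x : Vert n} {b : Fin (n + 1)} : Has x b.val ↔ b ∈ x :=
  ⟨fun ⟨c, hc, e⟩ => by rwa [Fin.ext e] at hc, fun h => ⟨b, h, rfl⟩⟩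

theorem Has.le {x : Vert n} {k : ℕ} (h : Has x k) : k ≤ n := by
  obtain ⟨b, _, rfl⟩ := h
  omega

theorem vert_ext {x y : Vert n} (h : ∀ k, Has x k ↔ Has y k) : x = y :=
  Finset.ext fun b => by rw [← has_val, h, has_val]

theorem has_union {x y : Vert n} {k : ℕ} : Has (x ∪ y) k ↔ Has x k ∨ Has y k := by
  simp only [Has, Finset.mem_union, or_and_right, exists_or]

theorem has_pair {s : ℕ} (hs : s + 1 ≤ n) {k : ℕ} : Has (pair n s) k ↔ k = s ∨ k = s + 1 := by
  constructor
  · rintro ⟨b, hb, rfl⟩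
    simpa [pair] using hb
  · intro hk
    exact ⟨⟨k, by omega⟩, by simpa [pair] using hk, rfl⟩

theorem canAdd_iff {x : Vert n} {s : ℕ} :
    CanAdd x s ↔ s + 1 ≤ n ∧ ¬ Has x s ∧ ¬ Has x (s + 1) := by
  refine and_congr_right fun hs => ?_
  rw [Finset.disjoint_left]
  constructor
  · intro h
    exact ⟨fun ⟨b, hb, e⟩ => h (by simp [pair, e]) hb, fun ⟨b, hb, e⟩ => h (by simp [pair, e]) hb⟩
  · rintro ⟨h1, h2⟩ b hb hx
    have hb' : b.val = s ∨ b.val = s + 1 := by simpa [pair] using hb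
    rcases hb' with e | e
    · exact h1 ⟨b, hx, e⟩
    · exact h2 ⟨b, hx, e⟩

theorem disjoint_iff_has {x y : Vert n} : Disjoint x y ↔ ∀ k, Has x k → ¬ Has y k := by
  rw [Finset.disjoint_left]
  refine ⟨?_, fun h b hb hy => h b.val (has_val.2 hb) (has_val.2 hy)⟩
  rintro h _ ⟨b, hb, rfl⟩ hy
  exact h hb (has_val.1 hy)

/-- The states of the stacking: a pair of vertices, and the set of the adjacent pairs that are
not contracted. -/
abbrev St (n : ℕ) : Type := (Vert n × Vert n) × Finset (Fin n)

/-- The condition on an index of a summand of the stacking bimodule. -/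
def IsIdx (p : St n) : Prop := p.2 ⊆ adj p.1 ∧ Disjoint (restLeft p) (restRight p)

/-- The vertex of a state. -/
def svtx (p : St n) : Vert n := restLeft p ∪ restRight p

/-- The contracted pairs of a state. -/
def contr (p : St n) : Finset (Fin n) := adj p.1 \ p.2

/-- The pair `k, k + 1` is kept, that is, not contracted. -/
def Kept (p : St n) (k : ℕ) : Prop := ∃ s ∈ p.2, s.val = k

/-- The pair `k, k + 1` is contracted: it is adjacent and not kept. -/
def Con (p : St n) (k : ℕ) : Prop := Has p.1.1 k ∧ Has p.1.2 (k + 1) ∧ ¬ Kept p k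

theorem kept_val {p : St n} {s : Fin n} : Kept p s.val ↔ s ∈ p.2 :=
  ⟨fun ⟨c, hc, e⟩ => by rwa [Fin.ext e] at hc, fun h => ⟨s, h, rfl⟩⟩

theorem mem_adj {v : Vert n × Vert n} {s : Fin n} :
    s ∈ adj v ↔ Has v.1 s.val ∧ Has v.2 (s.val + 1) := by
  simp only [adj, Finset.mem_filter, Finset.mem_univ, true_and]
  rw [← has_val, ← has_val]
  rfl

theorem mem_contr {p : St n} {s : Fin n} : s ∈ contr p ↔ Con p s.val := by
  rw [contr, Finset.mem_sdiff, mem_adj, Con, kept_val, and_assoc]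

theorem has_restLeft {p : St n} {k : ℕ} : Has (restLeft p) k ↔ Has p.1.1 k ∧ ¬ Con p k := by
  constructor
  · rintro ⟨b, hb, rfl⟩
    rw [restLeft, Finset.mem_sdiff] at hb
    refine ⟨has_val.2 hb.1, fun hc => hb.2 (Finset.mem_image.2 ?_)⟩
    have := hc.2.1.le
    exact ⟨⟨b.val, by omega⟩, mem_contr.2 hc, rfl⟩
  · rintro ⟨⟨b, hb, rfl⟩, hc⟩
    refine ⟨b, Finset.mem_sdiff.2 ⟨hb, fun h => hc ?_⟩, rfl⟩
    obtain ⟨s, hs, rfl⟩ := Finset.mem_image.1 h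
    exact mem_contr.1 hs

theorem has_restRight {p : St n} {k : ℕ} :
    Has (restRight p) k ↔ Has p.1.2 k ∧ ∀ j, k = j + 1 → ¬ Con p j := by
  constructor
  · rintro ⟨b, hb, rfl⟩
    rw [restRight, Finset.mem_sdiff] at hb
    refine ⟨has_val.2 hb.1, fun j hj hc => hb.2 (Finset.mem_image.2 ?_)⟩
    have := hc.2.1.le
    exact ⟨⟨j, by omega⟩, mem_contr.2 hc, Fin.ext hj.symm⟩
  · rintro ⟨⟨b, hb, rfl⟩, hc⟩
    refine ⟨b, Finset.mem_sdiff.2 ⟨hb, fun h => ?_⟩, rfl⟩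
    obtain ⟨s, hs, rfl⟩ := Finset.mem_image.1 h
    exact hc s.val rfl (mem_contr.1 hs)

theorem isIdx_iff {p : St n} : IsIdx p ↔ (∀ k, Kept p k → Has p.1.1 k ∧ Has p.1.2 (k + 1)) ∧
    ∀ k, Has (restLeft p) k → ¬ Has (restRight p) k := by
  rw [IsIdx, disjoint_iff_has]
  refine and_congr_left fun _ => ⟨?_, fun h s hs => mem_adj.2 (h _ (kept_val.2 hs))⟩
  rintro h _ ⟨s, hs, rfl⟩
  exact mem_adj.1 (h hs)

theorem has_svtx {p : St n} {k : ℕ} :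
    Has (svtx p) k ↔ Has (restLeft p) k ∨ Has (restRight p) k := has_union

/-- The state reached by an arrow. -/
def next (p : St n) (l : Lab) : St n := (Lab.move p.1 l, nextPairs p l)

open Classical in
/-- The number of the domino added to the vertex of a state over `v` by an arrow, if it does not leave the
vertex unchanged. -/
def emit (v : Vert n × Vert n) : Lab → Option ℕ
  | Lab.left t => if Has v.2 (t + 1) then none else some t
  | Lab.right t => if Has v.1 t then none else some t
  | Lab.both _ => none

theorem move_left_fst {v : Vert n × Vert n} {t : ℕ} :
    (Lab.move v (Lab.left t)).1 = v.1 ∪ pair n t := rfl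

theorem move_left_snd {v : Vert n × Vert n} {t : ℕ} : (Lab.move v (Lab.left t)).2 = v.2 := rfl

theorem move_right_fst {v : Vert n × Vert n} {t : ℕ} : (Lab.move v (Lab.right t)).1 = v.1 := rfl

theorem move_right_snd {v : Vert n × Vert n} {t : ℕ} :
    (Lab.move v (Lab.right t)).2 = v.2 ∪ pair n t := rfl

theorem move_both_fst {v : Vert n × Vert n} {t : ℕ} :
    (Lab.move v (Lab.both t)).1 = v.1 ∪ pair n t := rfl

theorem move_both_snd {v : Vert n × Vert n} {t : ℕ} :
    (Lab.move v (Lab.both t)).2 = v.2 ∪ pair n (t + 1) := rfl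

theorem next_fst {p : St n} {l : Lab} : (next p l).1 = Lab.move p.1 l := rfl

theorem valid_left {v : Vert n × Vert n} {t : ℕ} : Lab.valid v (Lab.left t) ↔
    t + 1 ≤ n ∧ ¬ Has v.1 t ∧ ¬ Has v.1 (t + 1) := canAdd_iff

theorem valid_right {v : Vert n × Vert n} {t : ℕ} : Lab.valid v (Lab.right t) ↔
    t + 1 ≤ n ∧ ¬ Has v.2 t ∧ ¬ Has v.2 (t + 1) := canAdd_iff

theorem valid_both {v : Vert n × Vert n} {t : ℕ} : Lab.valid v (Lab.both t) ↔
    (t + 1 ≤ n ∧ ¬ Has v.1 t ∧ ¬ Has v.1 (t + 1)) ∧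
      (t + 1 + 1 ≤ n ∧ ¬ Has v.2 (t + 1) ∧ ¬ Has v.2 (t + 1 + 1)) :=
  and_congr canAdd_iff canAdd_iff

theorem kept_left {p : St n} {t k : ℕ} :
    Kept (next p (Lab.left t)) k ↔ Kept p k ∨ (k = t + 1 ∧ Has p.1.2 (k + 1)) := by
  simp only [Kept, next, nextPairs, Finset.mem_union, or_and_right, exists_or]
  refine or_congr_right ⟨?_, ?_⟩
  · rintro ⟨s, hs, rfl⟩
    simp only [Finset.mem_filter, Finset.mem_univ, true_and] at hs
    exact ⟨hs.1, has_val.2 hs.2⟩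
  · rintro ⟨rfl, h⟩
    have := h.le
    exact ⟨⟨t + 1, by omega⟩, by
      simp only [Finset.mem_filter, Finset.mem_univ, true_and]; exact has_val.1 h, rfl⟩

theorem kept_right {p : St n} {t k : ℕ} (ht : t + 1 ≤ n) :
    Kept (next p (Lab.right t)) k ↔ Kept p k ∨ (k + 1 = t ∧ Has p.1.1 k) := by
  simp only [Kept, next, nextPairs, Finset.mem_union, or_and_right, exists_or]
  refine or_congr_right ⟨?_, ?_⟩
  · rintro ⟨s, hs, rfl⟩
    simp only [Finset.mem_filter, Finset.mem_univ, true_and] at hs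
    exact ⟨hs.1, has_val.2 hs.2⟩
  · rintro ⟨rfl, h⟩
    exact ⟨⟨k, by omega⟩, by
      simp only [Finset.mem_filter, Finset.mem_univ, true_and]; exact has_val.1 h, rfl⟩

theorem kept_both {p : St n} {t k : ℕ} : Kept (next p (Lab.both t)) k ↔ Kept p k := Iff.rfl

theorem con_left {p : St n} (hp : IsIdx p) {t k : ℕ} (h : CanAdd p.1.1 t) :
    Con (next p (Lab.left t)) k ↔ Con p k ∨ (k = t ∧ Has p.1.2 (t + 1)) := by
  rw [canAdd_iff] at h
  have h1 := (isIdx_iff.1 hp).1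
  have e1 : (next p (Lab.left t)).1.1 = p.1.1 ∪ pair n t := rfl
  have e2 : (next p (Lab.left t)).1.2 = p.1.2 := rfl
  rw [Con, kept_left, e1, e2, has_union, has_pair h.1, Con]
  grind

theorem con_right {p : St n} (hp : IsIdx p) {t k : ℕ} (h : CanAdd p.1.2 t) :
    Con (next p (Lab.right t)) k ↔ Con p k ∨ (k = t ∧ Has p.1.1 t) := by
  rw [canAdd_iff] at h
  have h1 := (isIdx_iff.1 hp).1
  have e1 : (next p (Lab.right t)).1.1 = p.1.1 := rfl
  have e2 : (next p (Lab.right t)).1.2 = p.1.2 ∪ pair n t := rfl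
  rw [Con, kept_right h.1, e1, e2, has_union, has_pair h.1, Con]
  grind

theorem con_both {p : St n} (hp : IsIdx p) {t k : ℕ} (h : CanAdd p.1.1 t)
    (h' : CanAdd p.1.2 (t + 1)) :
    Con (next p (Lab.both t)) k ↔ Con p k ∨ k = t ∨ k = t + 1 := by
  rw [canAdd_iff] at h h'
  have h1 := (isIdx_iff.1 hp).1
  have e1 : (next p (Lab.both t)).1.1 = p.1.1 ∪ pair n t := rfl
  have e2 : (next p (Lab.both t)).1.2 = p.1.2 ∪ pair n (t + 1) := rfl
  rw [Con, kept_both, e1, e2, has_union, has_union, has_pair h.1, has_pair h'.1, Con]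
  grind

theorem svtx_next {p : St n} (hp : IsIdx p) {l : Lab} (h : Lab.valid p.1 l) :
    svtx (next p l) = (emit p.1 l).elim (svtx p) (svtx p ∪ pair n ·) := by
  refine vert_ext fun k => ?_
  cases l with
  | left t =>
    have hc := fun k => con_left (k := k) hp h
    have h' := canAdd_iff.1 h
    have e1 : (next p (Lab.left t)).1.1 = p.1.1 ∪ pair n t := rfl
    have e2 : (next p (Lab.left t)).1.2 = p.1.2 := rfl
    have hl : ∀ k, Con p k → Has p.1.1 k := fun k h => h.1
    have hr : ∀ k, Con p k → Has p.1.2 (k + 1) := fun k h => h.2.1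
    rw [has_svtx, has_restLeft, has_restRight, e1, e2, has_union, has_pair h'.1]
    simp only [hc, emit]
    split_ifs with hy
    · simp only [Option.elim, has_svtx, has_restLeft, has_restRight]
      grind
    · simp only [Option.elim, has_svtx, has_restLeft, has_restRight, has_union, has_pair h'.1]
      grind
  | right t =>
    have hc := fun k => con_right (k := k) hp h
    have h' := canAdd_iff.1 h
    have e1 : (next p (Lab.right t)).1.1 = p.1.1 := rfl
    have e2 : (next p (Lab.right t)).1.2 = p.1.2 ∪ pair n t := rfl
    have hl : ∀ k, Con p k → Has p.1.1 k := fun k h => h.1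
    have hr : ∀ k, Con p k → Has p.1.2 (k + 1) := fun k h => h.2.1
    rw [has_svtx, has_restLeft, has_restRight, e1, e2, has_union, has_pair h'.1]
    simp only [hc, emit]
    split_ifs with hy
    · simp only [Option.elim, has_svtx, has_restLeft, has_restRight]
      grind
    · simp only [Option.elim, has_svtx, has_restLeft, has_restRight, has_union, has_pair h'.1]
      grind
  | both t =>
    have hc := fun k => con_both (k := k) hp h.1 h.2
    have h' := canAdd_iff.1 h.1
    have h'' := canAdd_iff.1 h.2
    have e1 : (next p (Lab.both t)).1.1 = p.1.1 ∪ pair n t := rfl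
    have e2 : (next p (Lab.both t)).1.2 = p.1.2 ∪ pair n (t + 1) := rfl
    have hl : ∀ k, Con p k → Has p.1.1 k := fun k h => h.1
    have hr : ∀ k, Con p k → Has p.1.2 (k + 1) := fun k h => h.2.1
    rw [has_svtx, has_restLeft, has_restRight, e1, e2, has_union, has_union, has_pair h'.1,
      has_pair h''.1]
    simp only [hc, emit, Option.elim, has_svtx, has_restLeft, has_restRight]
    grind

theorem isIdx_next {p : St n} (hp : IsIdx p) {l : Lab} (h : Lab.valid p.1 l) :
    IsIdx (next p l) ↔ ∀ t, emit p.1 l = some t → CanAdd (svtx p) t := by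
  have hp' := isIdx_iff.1 hp
  have hl : ∀ k, Con p k → Has p.1.1 k := fun k h => h.1
  have hr : ∀ k, Con p k → Has p.1.2 (k + 1) := fun k h => h.2.1
  simp only [has_restLeft, has_restRight] at hp'
  cases l with
  | left t =>
    have hc := fun k => con_left (k := k) hp h
    have h' := canAdd_iff.1 h
    have e1 : (next p (Lab.left t)).1.1 = p.1.1 ∪ pair n t := rfl
    have e2 : (next p (Lab.left t)).1.2 = p.1.2 := rfl
    simp only [isIdx_iff, has_restLeft, has_restRight, hc, e1, e2, has_union, has_pair h'.1,
      kept_left, emit, canAdd_iff, has_svtx]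
    grind
  | right t =>
    have hc := fun k => con_right (k := k) hp h
    have h' := canAdd_iff.1 h
    have e1 : (next p (Lab.right t)).1.1 = p.1.1 := rfl
    have e2 : (next p (Lab.right t)).1.2 = p.1.2 ∪ pair n t := rfl
    simp only [isIdx_iff, has_restLeft, has_restRight, hc, e1, e2, has_union, has_pair h'.1,
      kept_right h'.1, emit, canAdd_iff, has_svtx]
    grind
  | both t =>
    have hc := fun k => con_both (k := k) hp h.1 h.2
    have h' := canAdd_iff.1 h.1
    have h'' := canAdd_iff.1 h.2
    have e1 : (next p (Lab.both t)).1.1 = p.1.1 ∪ pair n t := rfl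
    have e2 : (next p (Lab.both t)).1.2 = p.1.2 ∪ pair n (t + 1) := rfl
    simp only [isIdx_iff, has_restLeft, has_restRight, hc, e1, e2, has_union, has_pair h'.1,
      has_pair h''.1, kept_both, emit, canAdd_iff, has_svtx]
    grind

/-- The state in which the contraction of a pair is undone. -/
def keep (p : St n) (s : Fin n) : St n := (p.1, insert s p.2)

theorem kept_keep {p : St n} {s : Fin n} {k : ℕ} : Kept (keep p s) k ↔ Kept p k ∨ k = s.val := by
  simp only [Kept, keep, Finset.mem_insert, or_and_right, exists_or, exists_eq_left]
  rw [or_comm, eq_comm]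

theorem con_keep {p : St n} {s : Fin n} {k : ℕ} : Con (keep p s) k ↔ Con p k ∧ k ≠ s.val := by
  have e1 : (keep p s).1 = p.1 := rfl
  rw [Con, kept_keep, e1, Con]
  tauto

theorem svtx_keep {p : St n} {s : Fin n} (hs : s ∈ contr p) :
    svtx (keep p s) = svtx p ∪ pair n s.val := by
  refine vert_ext fun k => ?_
  have e1 : (keep p s).1 = p.1 := rfl
  have h := mem_contr.1 hs
  have hl : ∀ k, Con p k → Has p.1.1 k := fun k h => h.1
  have hr : ∀ k, Con p k → Has p.1.2 (k + 1) := fun k h => h.2.1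
  have hn : s.val + 1 ≤ n := by omega
  simp only [has_svtx, has_restLeft, has_restRight, has_union, has_pair hn, con_keep, e1]
  grind

theorem isIdx_keep {p : St n} (hp : IsIdx p) {s : Fin n} (hs : s ∈ contr p) :
    IsIdx (keep p s) ↔ CanAdd (svtx p) s.val := by
  have hp' := isIdx_iff.1 hp
  have hl : ∀ k, Con p k → Has p.1.1 k := fun k h => h.1
  have hr : ∀ k, Con p k → Has p.1.2 (k + 1) := fun k h => h.2.1
  simp only [has_restLeft, has_restRight] at hp'
  have e1 : (keep p s).1 = p.1 := rfl
  have h := mem_contr.1 hs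
  simp only [isIdx_iff, has_restLeft, has_restRight, con_keep, e1,
    kept_keep, canAdd_iff, has_svtx]
  grind

theorem st_ext {p q : St n} (h : p.1 = q.1) (h' : ∀ k, Kept p k ↔ Kept q k) : p = q :=
  Prod.ext h (Finset.ext fun s => by rw [← kept_val, ← kept_val, h'])

theorem next_next {p : St n} {l l' : Lab} (hc : Lab.comm l l') (h : Lab.valid p.1 l)
    (h' : Lab.valid (Lab.move p.1 l) l') :
    next (next p l) l' = next (next p l') l := by
  refine st_ext (box_move_move p.1 l l') fun k => ?_
  cases l with
  | left s =>
    rw [valid_left] at h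
    cases l' with
    | left t => simp only [kept_left, next_fst, move_left_snd]; tauto
    | right t =>
      rw [valid_right, move_left_snd] at h'
      have hc' : t ≠ s + 1 := hc
      simp only [kept_right h'.1, kept_left, next_fst, move_left_fst, move_right_snd, has_union,
        has_pair h.1, has_pair h'.1]
      grind
    | both t =>
      rw [valid_both, move_left_fst, move_left_snd, has_union, has_union, has_pair h.1,
        has_pair h.1] at h'
      simp only [kept_both, kept_left, next_fst, move_both_snd, has_union, has_pair h'.2.1]
      grind
  | right s =>
    rw [valid_right] at h
    cases l' with
    | left t =>
      rw [valid_left, move_right_fst] at h'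
      have hc' : s ≠ t + 1 := hc
      simp only [kept_right h.1, kept_left, next_fst, move_left_fst, move_right_snd, has_union,
        has_pair h.1, has_pair h'.1]
      grind
    | right t =>
      rw [valid_right] at h'
      simp only [kept_right h.1, kept_right h'.1, next_fst, move_right_fst]
      tauto
    | both t =>
      rw [valid_both, move_right_fst, move_right_snd, has_union, has_union, has_pair h.1,
        has_pair h.1] at h'
      simp only [kept_both, kept_right h.1, next_fst, move_both_fst, has_union, has_pair h'.1.1]
      grind
  | both s =>
    rw [valid_both] at h
    cases l' with
    | left t =>
      rw [valid_left, move_both_fst, has_union, has_union, has_pair h.1.1, has_pair h.1.1] at h'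
      simp only [kept_both, kept_left, next_fst, move_both_snd, has_union, has_pair h.2.1]
      grind
    | right t =>
      rw [valid_right, move_both_snd, has_union, has_union, has_pair h.2.1, has_pair h.2.1] at h'
      simp only [kept_both, kept_right h'.1, next_fst, move_both_fst, has_union, has_pair h.1.1]
      grind
    | both t => rfl

theorem valid_swap {v : Vert n × Vert n} {l l' : Lab} (h : Lab.valid v l)
    (h' : Lab.valid (Lab.move v l) l') : Lab.valid v l' ∧ Lab.valid (Lab.move v l') l := by
  obtain ⟨x, y⟩ := v
  cases l <;> cases l' <;> simp only [Lab.valid, Lab.move] at h h' ⊢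
  · exact canAdd_swap h h'
  · exact ⟨h', h⟩
  · exact ⟨⟨(canAdd_swap h h'.1).1, h'.2⟩, (canAdd_swap h h'.1).2⟩
  · exact ⟨h', h⟩
  · exact canAdd_swap h h'
  · exact ⟨⟨h'.1, (canAdd_swap h h'.2).1⟩, (canAdd_swap h h'.2).2⟩
  · exact ⟨(canAdd_swap h.1 h').1, (canAdd_swap h.1 h').2, h.2⟩
  · exact ⟨(canAdd_swap h.2 h').1, h.1, (canAdd_swap h.2 h').2⟩
  · exact ⟨⟨(canAdd_swap h.1 h'.1).1, (canAdd_swap h.2 h'.2).1⟩,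
      (canAdd_swap h.1 h'.1).2, (canAdd_swap h.2 h'.2).2⟩

theorem has_move_left {v : Vert n × Vert n} {s k : ℕ} (hs : s + 1 ≤ n) :
    (Has (Lab.move v (Lab.left s)).1 k ↔ Has v.1 k ∨ k = s ∨ k = s + 1) ∧
      (Has (Lab.move v (Lab.left s)).2 k ↔ Has v.2 k) :=
  ⟨by rw [move_left_fst, has_union, has_pair hs], by rw [move_left_snd]⟩

theorem has_move_right {v : Vert n × Vert n} {s k : ℕ} (hs : s + 1 ≤ n) :
    (Has (Lab.move v (Lab.right s)).1 k ↔ Has v.1 k) ∧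
      (Has (Lab.move v (Lab.right s)).2 k ↔ Has v.2 k ∨ k = s ∨ k = s + 1) :=
  ⟨by rw [move_right_fst], by rw [move_right_snd, has_union, has_pair hs]⟩

theorem has_move_both {v : Vert n × Vert n} {s k : ℕ} (hs : s + 1 + 1 ≤ n) :
    (Has (Lab.move v (Lab.both s)).1 k ↔ Has v.1 k ∨ k = s ∨ k = s + 1) ∧
      (Has (Lab.move v (Lab.both s)).2 k ↔ Has v.2 k ∨ k = s + 1 ∨ k = s + 1 + 1) :=
  ⟨by rw [move_both_fst, has_union, has_pair (by omega)],
    by rw [move_both_snd, has_union, has_pair hs]⟩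

open Classical in
/-- Commuting arrows add the same dominoes in both orders; only for the arrows `(s, ∅)` and
`(∅, s)` does the order matter for which of the two adds the domino. -/
theorem emit_comm {v : Vert n × Vert n} {l l' : Lab} (hc : Lab.comm l l') (h : Lab.valid v l)
    (h' : Lab.valid (Lab.move v l) l') :
    (emit (Lab.move v l) l' = emit v l' ∧ emit (Lab.move v l') l = emit v l) ∨
      (emit v l = emit v l' ∧ emit (Lab.move v l) l' = none ∧ emit (Lab.move v l') l = none) := by
  cases l with
  | left s =>
    rw [valid_left] at h
    cases l' with
    | left t => exact Or.inl ⟨rfl, rfl⟩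
    | right t =>
      rw [valid_right, (has_move_left h.1).2, (has_move_left h.1).2] at h'
      have hc' : t ≠ s + 1 := hc
      simp only [emit, (has_move_left h.1).1, (has_move_right h'.1).2]
      by_cases hst : s = t
      · subst hst; grind
      · left; grind
    | both t =>
      left
      rw [valid_both, (has_move_left h.1).1, (has_move_left h.1).1, (has_move_left h.1).2,
        (has_move_left h.1).2] at h'
      simp only [emit, (has_move_both h'.2.1).2]
      grind
  | right s =>
    rw [valid_right] at h
    cases l' with
    | left t =>
      rw [valid_left, (has_move_right h.1).1, (has_move_right h.1).1] at h'
      have hc' : s ≠ t + 1 := hc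
      simp only [emit, (has_move_left h'.1).1, (has_move_right h.1).2]
      by_cases hst : s = t
      · subst hst; grind
      · left; grind
    | right t => exact Or.inl ⟨rfl, rfl⟩
    | both t =>
      left
      rw [valid_both, (has_move_right h.1).1, (has_move_right h.1).1, (has_move_right h.1).2,
        (has_move_right h.1).2] at h'
      simp only [emit, (has_move_both h'.2.1).1]
      grind
  | both s =>
    left
    rw [valid_both] at h
    cases l' with
    | left t =>
      rw [valid_left, (has_move_both h.2.1).1, (has_move_both h.2.1).1] at h'
      simp only [emit, (has_move_both h.2.1).2]
      grind
    | right t =>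
      rw [valid_right, (has_move_both h.2.1).2, (has_move_both h.2.1).2] at h'
      simp only [emit, (has_move_both h.2.1).1]
      grind
    | both t => exact ⟨rfl, rfl⟩

theorem next_keep (p : St n) (l : Lab) (s : Fin n) : next (keep p s) l = keep (next p l) s := by
  refine Prod.ext rfl ?_
  cases l with
  | left t => exact Finset.insert_union _ _ _
  | right t => exact Finset.insert_union _ _ _
  | both t => rfl

end States


/-! ### The stacking bimodule -/

section Stack

open LQuiver

/-- A property of homogeneous elements that holds for the generators and is compatible with sums
and products holds for all homogeneous elements. -/
theorem LQuiver.homog_induction {Q : LQuiver} {p : ℤ × ℤ → Q.Alg → Prop} (h0 : ∀ k, p k 0)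
    (hadd : ∀ k a b, p k a → p k b → p k (a + b)) (h1 : p 0 1)
    (hmul : ∀ k l a b, p k a → p l b → p (k + l) (a * b)) (he : ∀ v, p 0 (Q.e v))
    (hr : ∀ v l, p (Q.deg l) (Q.r v l)) {k : ℤ × ℤ} {a : Q.Alg} (ha : a ∈ Q.gr k) : p k a := by
  have key : ∀ a : Q.Alg, ∀ k, p k (Q.comp a k) := by
    intro a
    refine LQuiver.span_induction (p := fun a => ∀ k, p k (Q.comp a k))
      (fun k => by rw [map_zero]; exact h0 k)
      (fun a b ha hb k => by rw [map_add, Finsupp.add_apply]; exact hadd k _ _ (ha k) (hb k))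
      {a | ∃ k, a ∈ Q.gr k ∧ p k a} ⟨0, one_mem_gr, h1⟩ ?_ (fun v => ⟨0, e_mem v, he v⟩)
      (fun v l => ⟨_, r_mem v l, hr v l⟩) ?_ a
    · rintro a ⟨k, ha, hka⟩ b ⟨l, hb, hlb⟩
      exact ⟨k + l, mul_mem_gr ha hb, hmul k l a b hka hlb⟩
    · rintro a ⟨l, ha, hp⟩ k
      rw [comp_of_mem ha]
      by_cases h : l = k
      · subst h; rw [Finsupp.single_eq_same]; exact hp
      · rw [Finsupp.single_eq_of_ne (Ne.symm h)]; exact h0 k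
  have h := key a k
  rwa [comp_of_mem ha, Finsupp.single_eq_same] at h

variable {n : ℕ}

variable (n) in
/-- The left module underlying the stacking bimodule. -/
abbrev StackCar : Type := ∀ i : Idx n, (quiver n).leftIdeal i.vtx

/-- The generator of the summand of a state, which is zero if the state is not an index. -/
def basis (p : St n) : StackCar n := fun i => if i.1 = p then gen (Q := quiver n) i.vtx else 0

theorem basis_of_not {p : St n} (hp : ¬ IsIdx p) : basis p = 0 :=
  funext fun i => if_neg fun h => hp (by rw [← h]; exact i.2)

theorem smul_basis_apply (a : (quiver n).Alg) (p : St n) (i : Idx n) :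
    ((a • basis p) i).1 = if i.1 = p then a * (quiver n).e i.vtx else 0 := by
  change a * (if i.1 = p then gen (Q := quiver n) i.vtx else 0 : (quiver n).leftIdeal i.vtx).1 = _
  split_ifs
  · rfl
  · exact mul_zero a

theorem e_basis (p : St n) : (quiver n).e (svtx p) • basis p = basis p := by
  refine funext fun i => ?_
  change (quiver n).e (svtx p) • (if i.1 = p then gen (Q := quiver n) i.vtx else 0) = if i.1 = p then gen (Q := quiver n) i.vtx else 0
  split_ifs with h
  · rw [← h]
    exact e_smul_gen (Q := quiver n) i.vtx
  · exact smul_zero _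

theorem sum_basis (f : StackCar n) : ∑ i : Idx n, (f i).1 • basis i.1 = f := by
  refine funext fun j => ?_
  rw [Finset.sum_apply, Finset.sum_eq_single j]
  · change (f j).1 • (if j.1 = j.1 then gen (Q := quiver n) j.vtx else 0) = f j
    rw [if_pos rfl]
    exact smul_gen (Q := quiver n) (f j)
  · intro i _ hij
    change (f i).1 • (if j.1 = i.1 then gen (Q := quiver n) j.vtx else 0) = 0
    rw [if_neg fun h => hij (Subtype.ext h.symm), smul_zero]
  · simp

/-- The map of left modules with prescribed values at the generators. -/
def ofBasis (B : Idx n → StackCar n) : StackCar n →ₗ[(quiver n).Alg] StackCar n where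
  toFun f := ∑ i, (f i).1 • B i
  map_add' f g := by
    rw [← Finset.sum_add_distrib]
    exact Finset.sum_congr rfl fun i _ => add_smul (f i).1 (g i).1 (B i)
  map_smul' a f := by
    rw [Finset.smul_sum]
    exact Finset.sum_congr rfl fun i _ => mul_smul a (f i).1 (B i)

theorem ofBasis_apply (B : Idx n → StackCar n) (f : StackCar n) (j : Idx n) :
    (ofBasis B f j).1 = ∑ i, (f i).1 * (B i j).1 := by
  change (((∑ i, (f i).1 • B i : StackCar n)) j).1 = _
  rw [Finset.sum_apply, AddSubmonoidClass.coe_finsetSum]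
  rfl

theorem ofBasis_basis (B : Idx n → StackCar n) (i : Idx n) :
    ofBasis B (basis i.1) = (quiver n).e i.vtx • B i := by
  refine (Finset.sum_eq_single i (fun j _ hj => ?_) (by simp)).trans ?_
  · have h : basis i.1 j = 0 := if_neg fun h => hj (Subtype.ext h)
    rw [h]
    exact zero_smul _ _
  · have h : basis i.1 i = gen (Q := quiver n) i.vtx := if_pos rfl
    rw [h]
    rfl

theorem stack_ext {M : Type} [AddCommGroup M] [Module (quiver n).Alg M]
    {f g : StackCar n →ₗ[(quiver n).Alg] M} (h : ∀ p : St n, IsIdx p → f (basis p) = g (basis p)) :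
    f = g := by
  refine LinearMap.ext fun x => ?_
  rw [← sum_basis x, map_sum, map_sum]
  exact Finset.sum_congr rfl fun i _ => by rw [map_smul, map_smul, h i.1 i.2]

/-- The coefficient in the action of an arrow on the generator of a state. -/
def coef (p : St n) (l : Lab) : (quiver n).Alg :=
  (emit p.1 l).elim 1 ((quiver n).r (svtx p))

theorem coef_eq_zero {p : St n} (hp : IsIdx p) {l : Lab} (h : Lab.valid p.1 l)
    (hn : ¬ IsIdx (next p l)) : coef p l = 0 := by
  rw [isIdx_next hp h] at hn
  push Not at hn
  obtain ⟨t, ht, hc⟩ := hn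
  rw [coef, ht]
  exact (quiver n).r_invalid hc

theorem r_keep_eq_zero {p : St n} (hp : IsIdx p) {s : Fin n} (hs : s ∈ contr p)
    (hn : ¬ IsIdx (keep p s)) : (quiver n).r (svtx p) s.val = 0 :=
  (quiver n).r_invalid fun h => hn ((isIdx_keep hp hs).2 h)

theorem e_coef_basis {p : St n} (hp : IsIdx p) {l : Lab} (h : Lab.valid p.1 l) :
    (quiver n).e (svtx p) • coef p l • basis (next p l) = coef p l • basis (next p l) := by
  have hv := svtx_next hp h
  rw [coef]
  cases he : emit p.1 l with
  | none =>
    rw [he] at hv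
    simp only [Option.elim, one_smul] at hv ⊢
    rw [← hv, e_basis]
  | some t =>
    simp only [Option.elim]
    rw [← mul_smul, e_r]

theorem coef_comm {p : St n} (hp : IsIdx p) {l l' : Lab} (hc : Lab.comm l l')
    (h : Lab.valid p.1 l) (h' : Lab.valid (Lab.move p.1 l) l') :
    coef p l * coef (next p l) l' = coef p l' * coef (next p l') l := by
  have hs := (valid_swap h h').1
  rw [coef, coef, coef, coef, svtx_next hp h, svtx_next hp hs, next_fst, next_fst]
  rcases emit_comm hc h h' with ⟨h1, h2⟩ | ⟨h1, h2, h3⟩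
  · rw [h1, h2]
    cases emit p.1 l with
    | none => simp
    | some s =>
      cases emit p.1 l' with
      | none => simp
      | some t => exact (quiver n).r_comm (svtx p) trivial
  · rw [h1, h2, h3]

open Classical in
/-- Right multiplication by the arrow at `v` with label `l`. -/
def arrOp (v : Vert n × Vert n) (l : Lab) : Module.End (quiver n).Alg (StackCar n) :=
  ofBasis fun i =>
    if i.1.1 = v ∧ Lab.valid v l then coef i.1 l • basis (next i.1 l) else 0

/-- Right multiplication by `e(v)`. -/
def idemOp (v : Vert n × Vert n) : Module.End (quiver n).Alg (StackCar n) :=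
  ofBasis fun i => if i.1.1 = v then basis i.1 else 0

theorem idemOp_basis (v : Vert n × Vert n) (p : St n) :
    idemOp v (basis p) = if p.1 = v then basis p else 0 := by
  by_cases hp : IsIdx p
  · refine (ofBasis_basis _ ⟨p, hp⟩).trans ?_
    dsimp only
    split_ifs
    · exact e_basis p
    · exact smul_zero _
  · rw [basis_of_not hp, map_zero, ite_self]

theorem arrOp_basis {p : St n} (hp : IsIdx p) {l : Lab} (h : Lab.valid p.1 l) :
    arrOp p.1 l (basis p) = coef p l • basis (next p l) := by
  refine (ofBasis_basis _ ⟨p, hp⟩).trans ?_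
  rw [if_pos ⟨rfl, h⟩]
  exact e_coef_basis hp h

theorem arrOp_basis_of_not {p : St n} {v : Vert n × Vert n} {l : Lab}
    (h : ¬ (p.1 = v ∧ Lab.valid v l)) : arrOp v l (basis p) = 0 := by
  by_cases hp : IsIdx p
  · refine (ofBasis_basis _ ⟨p, hp⟩).trans ?_
    rw [if_neg h, smul_zero]
  · rw [basis_of_not hp, map_zero]

theorem arrOp_arrOp {p : St n} (hp : IsIdx p) {l l' : Lab} (h : Lab.valid p.1 l)
    (h' : Lab.valid (Lab.move p.1 l) l') : arrOp (Lab.move p.1 l) l' (arrOp p.1 l (basis p)) =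
      (coef p l * coef (next p l) l') • basis (next (next p l) l') := by
  rw [arrOp_basis hp h, map_smul]
  by_cases hn : IsIdx (next p l)
  · have h1 := arrOp_basis hn h'
    rw [next_fst] at h1
    rw [h1, mul_smul]
  · rw [coef_eq_zero hp h hn, zero_smul, zero_mul, zero_smul]

variable (n) in
/-- The right action on the stacking bimodule. -/
def stackRep : (boxQuiver n).Rep (Module.End (quiver n).Alg (StackCar n))ᵐᵒᵖ where
  e v := MulOpposite.op (idemOp v)
  r v l := MulOpposite.op (arrOp v l)
  e_mul v w := by
    rw [← MulOpposite.op_mul]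
    have h : idemOp w * idemOp v = if v = w then idemOp v else (0 : Module.End (quiver n).Alg (StackCar n)) := by
      refine stack_ext fun p _ => ?_
      rw [Module.End.mul_apply, idemOp_basis]
      by_cases hv : p.1 = v
      · rw [if_pos hv, idemOp_basis, hv]
        split_ifs with hw
        · rw [idemOp_basis, if_pos hv]
        · rfl
      · rw [if_neg hv, map_zero]
        split_ifs
        · rw [idemOp_basis, if_neg hv]
        · rfl
    rw [h]
    split_ifs <;> rfl
  e_r v l := by
    rw [← MulOpposite.op_mul]
    refine congrArg _ (stack_ext fun p _ => ?_)
    rw [Module.End.mul_apply, idemOp_basis]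
    split_ifs with hv
    · rfl
    · rw [map_zero, arrOp_basis_of_not fun h => hv h.1]
  r_e v l := by
    rw [← MulOpposite.op_mul]
    refine congrArg _ (stack_ext fun p hp => ?_)
    rw [Module.End.mul_apply]
    by_cases h : p.1 = v ∧ Lab.valid v l
    · obtain ⟨rfl, h⟩ := h
      rw [arrOp_basis hp h, map_smul, idemOp_basis]
      exact congrArg _ (if_pos rfl)
    · rw [arrOp_basis_of_not h, map_zero]
  r_invalid v l hl := by
    refine (congrArg MulOpposite.op (stack_ext fun p _ => ?_)).trans MulOpposite.op_zero
    rw [arrOp_basis_of_not fun h => hl h.2, LinearMap.zero_apply]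
  r_comm v l l' hc := by
    rw [← MulOpposite.op_mul, ← MulOpposite.op_mul]
    refine congrArg _ (stack_ext fun p hp => ?_)
    rw [Module.End.mul_apply, Module.End.mul_apply]
    by_cases hv : p.1 = v
    · subst hv
      by_cases h : Lab.valid p.1 l ∧ Lab.valid (Lab.move p.1 l) l'
      · obtain ⟨h, h'⟩ := h
        have hs := valid_swap h h'
        rw [arrOp_arrOp hp h h', arrOp_arrOp hp hs.1 hs.2, coef_comm hp hc h h', next_next hc h h']
      · have h1 : ∀ {l l' : Lab}, ¬ (Lab.valid p.1 l ∧ Lab.valid (Lab.move p.1 l) l') →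
            arrOp (Lab.move p.1 l) l' (arrOp p.1 l (basis p)) = 0 := by
          intro l l' h
          by_cases hl : Lab.valid p.1 l
          · rw [arrOp_basis hp hl, map_smul, arrOp_basis_of_not fun h' => h ⟨hl, h'.2⟩, smul_zero]
          · rw [arrOp_basis_of_not fun h' => hl h'.2, map_zero]
        exact (h1 h).trans (h1 fun h' => h (valid_swap h'.1 h'.2)).symm
    · rw [arrOp_basis_of_not fun h => hv h.1, arrOp_basis_of_not fun h => hv h.1, map_zero,
        map_zero]
  sum_e := by
    refine (map_sum MulOpposite.opAddEquiv _ _).symm.trans ?_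
    refine (congrArg MulOpposite.op (stack_ext fun p _ => ?_)).trans MulOpposite.op_one
    rw [LinearMap.sum_apply, Module.End.one_apply]
    simp only [idemOp_basis, Finset.sum_ite_eq, Finset.mem_univ, if_true]

/-- The differential of the stacking bimodule. -/
def stackD : Module.End (quiver n).Alg (StackCar n) :=
  ofBasis fun i => ∑ s ∈ contr i.1, (quiver n).r (svtx i.1) s.val • basis (keep i.1 s)

theorem stackD_basis {p : St n} (hp : IsIdx p) : stackD (basis p) =
    ∑ s ∈ contr p, (quiver n).r (svtx p) s.val • basis (keep p s) := by
  refine (ofBasis_basis _ ⟨p, hp⟩).trans ?_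
  rw [Finset.smul_sum]
  refine Finset.sum_congr rfl fun s _ => ?_
  rw [← mul_smul]
  exact congrArg (· • _) ((quiver n).e_r _ _)

theorem contr_keep (p : St n) (s : Fin n) : contr (keep p s) = (contr p).erase s := by
  ext k
  rw [Finset.mem_erase, mem_contr, con_keep, mem_contr, and_comm, Ne, Ne, Fin.ext_iff]

theorem stackD_stackD : (stackD * stackD : Module.End (quiver n).Alg (StackCar n)) = 0 := by
  refine stack_ext fun p hp => ?_
  rw [Module.End.mul_apply, stackD_basis hp, map_sum, LinearMap.zero_apply]
  have h1 : ∀ s ∈ contr p, stackD ((quiver n).r (svtx p) s.val • basis (keep p s)) =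
      ∑ t ∈ (contr p).erase s, ((quiver n).r (svtx p) s.val *
        (quiver n).r (svtx p ∪ pair n s.val) t.val) • basis (keep (keep p s) t) := by
    intro s hs
    rw [map_smul]
    by_cases hn : IsIdx (keep p s)
    · rw [stackD_basis hn, contr_keep, svtx_keep hs, Finset.smul_sum]
      exact Finset.sum_congr rfl fun t _ => (mul_smul _ _ _).symm
    · rw [r_keep_eq_zero hp hs hn, zero_smul]
      exact (Finset.sum_eq_zero fun t _ => by rw [zero_mul, zero_smul]).symm
  rw [Finset.sum_congr rfl h1, Finset.sum_sigma']
  refine Finset.sum_involution (fun x _ => ⟨x.2, x.1⟩) ?_ ?_ ?_ ?_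
  · rintro ⟨s, t⟩ _
    have e1 : keep (keep p s) t = keep (keep p t) s := Prod.ext rfl (Finset.insert_comm _ _ _)
    have e2 := (quiver n).r_comm (svtx p) (l := s.val) (l' := t.val) trivial
    dsimp only
    refine (congrArg₂ (fun a b => a • basis b + _) e2 e1).trans (add_self _)
  · rintro ⟨s, t⟩ hx _ h
    rw [Finset.mem_sigma, Finset.mem_erase] at hx
    exact hx.2.1 (congrArg Sigma.fst h)
  · rintro ⟨s, t⟩ hx
    rw [Finset.mem_sigma, Finset.mem_erase] at hx ⊢
    exact ⟨hx.2.2, hx.2.1.symm, hx.1⟩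
  · intros; rfl

open Classical in
theorem contr_left {p : St n} (hp : IsIdx p) {t : ℕ} (h : Lab.valid p.1 (Lab.left t)) :
    contr (next p (Lab.left t)) = if Has p.1.2 (t + 1) then
      insert ⟨t, (valid_left.1 h).1⟩ (contr p) else contr p := by
  ext s
  rw [mem_contr, con_left hp h]
  split_ifs with hy
  · rw [Finset.mem_insert, mem_contr, Fin.ext_iff, or_comm]; tauto
  · rw [mem_contr]; tauto

open Classical in
theorem contr_right {p : St n} (hp : IsIdx p) {t : ℕ} (h : Lab.valid p.1 (Lab.right t)) :
    contr (next p (Lab.right t)) = if Has p.1.1 t then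
      insert ⟨t, (valid_right.1 h).1⟩ (contr p) else contr p := by
  ext s
  rw [mem_contr, con_right hp h]
  split_ifs with hy
  · rw [Finset.mem_insert, mem_contr, Fin.ext_iff, or_comm]; tauto
  · rw [mem_contr]; tauto

theorem contr_both {p : St n} (hp : IsIdx p) {t : ℕ} (h : Lab.valid p.1 (Lab.both t)) :
    contr (next p (Lab.both t)) = insert ⟨t, (valid_both.1 h).1.1⟩
      (insert ⟨t + 1, (valid_both.1 h).2.1⟩ (contr p)) := by
  ext s
  rw [mem_contr, con_both hp h.1 h.2, Finset.mem_insert, Finset.mem_insert, mem_contr, Fin.ext_iff,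
    Fin.ext_iff]
  tauto

/-! ### Degrees in the stacking bimodule -/

/-- The cohomological degree of a vertex `(x, y)`. -/
def mu (v : Vert n × Vert n) : ℤ :=
  ∑ a ∈ v.1, ∑ b ∈ v.2, if a.val + 1 < b.val then (-1 : ℤ) ^ (a.val + b.val + 1) else 0

theorem pair_eq {t : ℕ} (ht : t + 1 ≤ n) :
    pair n t = {⟨t, by omega⟩, ⟨t + 1, by omega⟩} := by
  ext b
  simp [pair, Fin.ext_iff]

theorem mu_union_left {x x' y : Vert n} (h : Disjoint x x') :
    mu (x ∪ x', y) = mu (x, y) + mu (x', y) := Finset.sum_union h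

theorem mu_union_right {x y y' : Vert n} (h : Disjoint y y') :
    mu (x, y ∪ y') = mu (x, y) + mu (x, y') := by
  simp only [mu]
  rw [← Finset.sum_add_distrib]
  exact Finset.sum_congr rfl fun a _ => Finset.sum_union h

theorem sum_has (x : Vert n) (k : ℕ) [Decidable (Has x k)] :
    (∑ b ∈ x, if b.val = k then (-1 : ℤ) else 0) = if Has x k then -1 else 0 := by
  split_ifs with h
  · obtain ⟨b, hb, rfl⟩ := h
    rw [Finset.sum_eq_single b (fun c _ hc => if_neg fun e => hc (Fin.ext e)) fun h => absurd hb h,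
      if_pos rfl]
  · exact Finset.sum_eq_zero fun b hb => if_neg fun e => h ⟨b, hb, e⟩

open Classical in
theorem mu_pair_left {t : ℕ} (ht : t + 1 ≤ n) (y : Vert n) :
    mu (pair n t, y) = if Has y (t + 2) then -1 else 0 := by
  simp only [mu]
  rw [pair_eq ht, Finset.sum_pair (by simp [Fin.ext_iff]), ← Finset.sum_add_distrib, ← sum_has]
  refine Finset.sum_congr rfl fun b _ => ?_
  rcases lt_trichotomy b.val (t + 2) with h | h | h
  · rw [if_neg (by dsimp only; omega), if_neg (by dsimp only; omega), if_neg (by omega), add_zero]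
  · rw [if_pos (by dsimp only; omega), if_neg (by dsimp only; omega), if_pos h, add_zero, h]
    exact Odd.neg_one_pow ⟨t + 1, by dsimp only; omega⟩
  · rw [if_pos (by dsimp only; omega), if_pos (by dsimp only; omega), if_neg (by omega)]
    dsimp only
    rw [show t + 1 + b.val + 1 = t + b.val + 1 + 1 by omega, pow_succ]
    ring

open Classical in
theorem mu_pair_right {t : ℕ} (ht : t + 1 + 1 ≤ n) (x : Vert n) :
    mu (x, pair n (t + 1)) = if Has x t then -1 else 0 := by
  simp only [mu]
  rw [← sum_has]
  refine Finset.sum_congr rfl fun a _ => ?_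
  rw [pair_eq ht, Finset.sum_pair (by simp [Fin.ext_iff])]
  rcases lt_trichotomy a.val t with h | h | h
  · rw [if_pos (by dsimp only; omega), if_pos (by dsimp only; omega), if_neg (by omega)]
    dsimp only
    rw [show a.val + (t + 1 + 1) + 1 = a.val + (t + 1) + 1 + 1 by omega, pow_succ]
    ring
  · rw [if_neg (by dsimp only; omega), if_pos (by dsimp only; omega), if_pos h, zero_add, h]
    exact Odd.neg_one_pow ⟨t + 1, by dsimp only; omega⟩
  · rw [if_neg (by dsimp only; omega), if_neg (by dsimp only; omega), if_neg (by omega), add_zero]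

theorem mu_pair_right_zero (hn : 1 ≤ n) (x : Vert n) : mu (x, pair n 0) = 0 := by
  refine Finset.sum_eq_zero fun a _ => ?_
  rw [pair_eq hn, Finset.sum_pair (by simp [Fin.ext_iff]), if_neg (by simp), if_neg (by simp),
    add_zero]

/-- The cohomological degree of the generator of a state, and the shift of its `q`-degree. -/
def scoh (p : St n) : ℤ := mu p.1 + p.2.card

/-- The shift of the `q`-degree of the summand of a state. -/
def sqs (p : St n) : ℤ := ∑ s ∈ contr p, (2 * (s.val : ℤ) + 1 - n)

open Classical in
theorem card_left {p : St n} (hp : IsIdx p) {t : ℕ} (h : Lab.valid p.1 (Lab.left t)) :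
    ((next p (Lab.left t)).2.card : ℤ) = p.2.card + if Has p.1.2 (t + 2) then 1 else 0 := by
  have hk := (isIdx_iff.1 hp).1
  have hv := valid_left.1 h
  split_ifs with hy
  · have e : (next p (Lab.left t)).2 = insert ⟨t + 1, by have := hy.le; omega⟩ p.2 := by
      ext s
      rw [← kept_val, kept_left, Finset.mem_insert, ← kept_val, Fin.ext_iff, or_comm]
      refine or_congr_left ⟨fun h => h.1, fun h => ?_⟩
      dsimp only at h
      exact ⟨h, by rw [h]; exact hy⟩
    rw [e, Finset.card_insert_of_notMem fun hm => hv.2.2 (hk _ (kept_val.2 hm)).1]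
    push_cast
    rfl
  · have e : (next p (Lab.left t)).2 = p.2 := by
      ext s
      rw [← kept_val, kept_left, ← kept_val]
      refine or_iff_left fun h => hy ?_
      rw [← show s.val + 1 = t + 2 by omega]
      exact h.2
    rw [e, add_zero]

open Classical in
theorem card_right {p : St n} (hp : IsIdx p) {t : ℕ} (h : Lab.valid p.1 (Lab.right (t + 1))) :
    ((next p (Lab.right (t + 1))).2.card : ℤ) = p.2.card + if Has p.1.1 t then 1 else 0 := by
  have hk := (isIdx_iff.1 hp).1
  have hv := valid_right.1 h
  split_ifs with hx
  · have e : (next p (Lab.right (t + 1))).2 = insert ⟨t, by omega⟩ p.2 := by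
      ext s
      rw [← kept_val, kept_right hv.1, Finset.mem_insert, ← kept_val, Fin.ext_iff, or_comm]
      refine or_congr_left ⟨fun h => by dsimp only; omega, fun h => ?_⟩
      dsimp only at h
      exact ⟨by omega, by rw [h]; exact hx⟩
    rw [e, Finset.card_insert_of_notMem fun hm => hv.2.1 (hk _ (kept_val.2 hm)).2]
    push_cast
    rfl
  · have e : (next p (Lab.right (t + 1))).2 = p.2 := by
      ext s
      rw [← kept_val, kept_right hv.1, ← kept_val]
      refine or_iff_left fun h => hx ?_
      rw [← show s.val = t by omega]
      exact h.2
    rw [e, add_zero]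

theorem card_right_zero {p : St n} (h : Lab.valid p.1 (Lab.right 0)) :
    (next p (Lab.right 0)).2 = p.2 := by
  ext s
  rw [← kept_val, kept_right (valid_right.1 h).1, ← kept_val]
  exact or_iff_left fun h => absurd h.1 (by omega)

theorem scoh_next {p : St n} (hp : IsIdx p) {l : Lab} (h : Lab.valid p.1 l) :
    scoh (next p l) = scoh p + (Lab.deg n l).1 := by
  classical
  cases l with
  | left t =>
    have h1 : mu (next p (Lab.left t)).1 = mu p.1 + _ := mu_union_left (show CanAdd _ _ from h).2.symm
    rw [scoh, card_left hp h, h1, mu_pair_left (valid_left.1 h).1, scoh]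
    change _ = _ + 0
    split_ifs <;> ring
  | right t =>
    have h1 : mu (next p (Lab.right t)).1 = mu p.1 + _ :=
      mu_union_right (show CanAdd _ _ from h).2.symm
    rw [scoh, h1, scoh]
    change _ = _ + 0
    cases t with
    | zero =>
      rw [mu_pair_right_zero (by have := (valid_right.1 h).1; omega), card_right_zero h]
      ring
    | succ t =>
      rw [mu_pair_right (valid_right.1 h).1, card_right hp h]
      split_ifs <;> ring
  | both t =>
    have hv := valid_both.1 h
    have h1 : mu (next p (Lab.both t)).1 = mu (p.1.1 ∪ pair n t, p.1.2) + _ :=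
      mu_union_right (show CanAdd _ _ from h.2).2.symm
    rw [scoh, h1, mu_union_left (show CanAdd _ _ from h.1).2.symm, mu_pair_left hv.1.1,
      mu_pair_right hv.2.1, if_neg hv.2.2.2,
      if_pos (has_union.2 (Or.inr ((has_pair hv.1.1).2 (Or.inl rfl)))), scoh]
    change _ + _ + _ + (p.2.card : ℤ) = _ + (-1)
    ring

/-- The `q`-degree of the coefficient in the action of an arrow. -/
def emitDeg (v : Vert n × Vert n) (l : Lab) : ℤ :=
  (emit v l).elim 0 fun t => (n : ℤ) - 1 - 2 * t

theorem coef_mem (p : St n) (l : Lab) : coef p l ∈ (quiver n).gr (0, emitDeg p.1 l) := by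
  rw [coef, emitDeg]
  cases emit p.1 l with
  | none => exact one_mem_gr
  | some t => exact r_mem (Q := quiver n) _ _

theorem sqs_next {p : St n} (hp : IsIdx p) {l : Lab} (h : Lab.valid p.1 l) :
    emitDeg p.1 l - sqs (next p l) = -sqs p + (Lab.deg n l).2 := by
  classical
  cases l with
  | left t =>
    have hv := valid_left.1 h
    rw [sqs, contr_left hp h, sqs, emitDeg]
    simp only [emit, Lab.deg]
    split_ifs with hy
    · rw [Finset.sum_insert fun hm => hv.2.1 (mem_contr.1 hm).1]
      simp only [Option.elim]
      ring
    · simp only [Option.elim]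
      ring
  | right t =>
    have hv := valid_right.1 h
    rw [sqs, contr_right hp h, sqs, emitDeg]
    simp only [emit, Lab.deg]
    split_ifs with hy
    · rw [Finset.sum_insert fun hm => hv.2.2 (mem_contr.1 hm).2.1]
      simp only [Option.elim]
      ring
    · simp only [Option.elim]
      ring
  | both t =>
    have hv := valid_both.1 h
    rw [sqs, contr_both hp h, sqs, emitDeg, Finset.sum_insert, Finset.sum_insert]
    · simp only [emit, Lab.deg, Option.elim]
      push_cast
      ring
    · exact fun hm => hv.1.2.2 (mem_contr.1 hm).1
    · rw [Finset.mem_insert, Fin.ext_iff]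
      rintro (hm | hm)
      · dsimp only at hm
        omega
      · exact hv.1.2.1 (mem_contr.1 hm).1

theorem scoh_keep {p : St n} {s : Fin n} (hs : s ∈ contr p) : scoh (keep p s) = scoh p + 1 := by
  have h : s ∉ p.2 := fun h => (mem_contr.1 hs).2.2 (kept_val.2 h)
  change mu p.1 + ((insert s p.2).card : ℤ) = _
  rw [Finset.card_insert_of_notMem h, scoh]
  push_cast
  ring

theorem sqs_keep {p : St n} {s : Fin n} (hs : s ∈ contr p) :
    ((n : ℤ) - 1 - 2 * s.val) - sqs (keep p s) = -sqs p := by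
  rw [sqs, contr_keep, sqs, ← Finset.add_sum_erase _ _ hs]
  ring

/-! ### The stacking bimodule is a DG bimodule -/

variable (n) in
/-- The right action, with values in the opposite of the endomorphism algebra. -/
def stackAct : (boxQuiver n).Alg →ₐ[𝔽] (Module.End (quiver n).Alg (StackCar n))ᵐᵒᵖ :=
  lift (stackRep n)

/-- Right multiplication by an element of `R_n ⊠ R_n`. -/
def rightMul (a : (boxQuiver n).Alg) : Module.End (quiver n).Alg (StackCar n) :=
  (stackAct n a).unop

theorem rightMul_mul (a b : (boxQuiver n).Alg) : rightMul (a * b) = rightMul b * rightMul a := by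
  rw [rightMul, map_mul, MulOpposite.unop_mul]; rfl

theorem rightMul_add (a b : (boxQuiver n).Alg) : rightMul (a + b) = rightMul a + rightMul b := by
  rw [rightMul, map_add, MulOpposite.unop_add]; rfl

theorem rightMul_one : rightMul (1 : (boxQuiver n).Alg) = 1 := by
  rw [rightMul, map_one, MulOpposite.unop_one]

theorem rightMul_zero : rightMul (0 : (boxQuiver n).Alg) = 0 := by
  rw [rightMul, map_zero, MulOpposite.unop_zero]

theorem rightMul_e (v : Vert n × Vert n) : rightMul ((boxQuiver n).e v) = idemOp v :=
  congrArg MulOpposite.unop (lift_e (stackRep n) v)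

theorem rightMul_r (v : Vert n × Vert n) (l : Lab) : rightMul ((boxQuiver n).r v l) = arrOp v l :=
  congrArg MulOpposite.unop (lift_r (stackRep n) v l)

theorem mem_contr_next {p : St n} (hp : IsIdx p) {l : Lab} (h : Lab.valid p.1 l) {s : Fin n}
    (hs : s ∈ contr p) : s ∈ contr (next p l) := by
  rw [mem_contr] at hs ⊢
  cases l with
  | left t => exact (con_left hp h).2 (Or.inl hs)
  | right t => exact (con_right hp h).2 (Or.inl hs)
  | both t => exact (con_both hp h.1 h.2).2 (Or.inl hs)

theorem coef_mul_r {p : St n} (hp : IsIdx p) {l : Lab} (h : Lab.valid p.1 l) {s : Fin n}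
    (hs : s ∈ contr p) : coef p l * (quiver n).r (svtx (next p l)) s.val =
      (quiver n).r (svtx p) s.val * coef (keep p s) l := by
  have e : (keep p s).1 = p.1 := rfl
  rw [coef, coef, svtx_next hp h, svtx_keep hs, e]
  cases emit p.1 l with
  | none => simp
  | some t => exact (quiver n).r_comm (svtx p) trivial

theorem stackD_arrOp {p : St n} (hp : IsIdx p) {l : Lab} (h : Lab.valid p.1 l) :
    stackD (arrOp p.1 l (basis p)) = ∑ s ∈ contr (next p l),
      (coef p l * (quiver n).r (svtx (next p l)) s.val) • basis (keep (next p l) s) := by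
  rw [arrOp_basis hp h, map_smul]
  by_cases hn : IsIdx (next p l)
  · rw [stackD_basis hn, Finset.smul_sum]
    exact Finset.sum_congr rfl fun s _ => (mul_smul _ _ _).symm
  · rw [coef_eq_zero hp h hn, zero_smul]
    exact (Finset.sum_eq_zero fun s _ => by rw [zero_mul, zero_smul]).symm

theorem arrOp_stackD {p : St n} (hp : IsIdx p) {l : Lab} (h : Lab.valid p.1 l) :
    arrOp p.1 l (stackD (basis p)) = ∑ s ∈ contr p,
      (coef p l * (quiver n).r (svtx (next p l)) s.val) • basis (keep (next p l) s) := by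
  rw [stackD_basis hp, map_sum]
  refine Finset.sum_congr rfl fun s hs => ?_
  rw [map_smul, coef_mul_r hp h hs]
  by_cases hn : IsIdx (keep p s)
  · have h1 := arrOp_basis (p := keep p s) hn (l := l) h
    rw [mul_smul, ← next_keep]
    exact congrArg _ h1
  · rw [r_keep_eq_zero hp hs hn, zero_smul, zero_mul, zero_smul]

theorem arrOp_stackD_of_not {p : St n} {v : Vert n × Vert n} (hp : IsIdx p) {l : Lab}
    (h : ¬ (p.1 = v ∧ Lab.valid v l)) : arrOp v l (stackD (basis p)) = 0 := by
  rw [stackD_basis hp, map_sum]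
  refine Finset.sum_eq_zero fun s _ => ?_
  rw [map_smul, arrOp_basis_of_not (p := keep p s) h, smul_zero]

/-- The terms of the differential that undo a contraction made by the arrow vanish, since the
vertex contains the corresponding number. -/
theorem stackD_comm_arrOp {p : St n} (hp : IsIdx p) {l : Lab} (h : Lab.valid p.1 l)
    (hl : ∀ t, l ≠ Lab.both t) :
    stackD (arrOp p.1 l (basis p)) = arrOp p.1 l (stackD (basis p)) := by
  rw [stackD_arrOp hp h, arrOp_stackD hp h]
  refine (Finset.sum_subset (fun s hs => mem_contr_next hp h hs) fun s hs hs' => ?_).symm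
  have h0 : (quiver n).r (svtx (next p l)) s.val = 0 := by
    refine (quiver n).r_invalid fun hc => ?_
    rw [mem_contr] at hs hs'
    have hc' := (canAdd_iff.1 hc).2
    rw [svtx_next hp h] at hc'
    cases l with
    | left t =>
      rw [con_left hp h] at hs
      obtain ⟨e, hy⟩ := hs.resolve_left hs'
      refine hc'.2 ?_
      rw [show emit p.1 (Lab.left t) = none from if_pos hy, e]
      exact has_svtx.2 (Or.inr (has_restRight.2 ⟨hy, fun j hj hcon =>
        (valid_left.1 h).2.1 (by rw [show t = j by omega]; exact hcon.1)⟩))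
    | right t =>
      rw [con_right hp h] at hs
      obtain ⟨e, hx⟩ := hs.resolve_left hs'
      refine hc'.1 ?_
      rw [show emit p.1 (Lab.right t) = none from if_pos hx, e]
      exact has_svtx.2 (Or.inl (has_restLeft.2 ⟨hx, fun hcon =>
        (valid_right.1 h).2.2 hcon.2.1⟩))
    | both t => exact hl t rfl
  rw [h0, mul_zero, zero_smul]

theorem stackD_arrOp_both {p : St n} (hp : IsIdx p) {t : ℕ} (h : Lab.valid p.1 (Lab.both t)) :
    stackD (arrOp p.1 (Lab.both t) (basis p)) = arrOp p.1 (Lab.both t) (stackD (basis p)) +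
      rightMul (boxδ p.1 (Lab.both t)) (basis p) := by
  have hv := valid_both.1 h
  have e0 : coef p (Lab.both t) = 1 := rfl
  rw [stackD_arrOp hp h, arrOp_stackD hp h, contr_both hp h, Finset.sum_insert, Finset.sum_insert,
    boxδ, rightMul_add, rightMul_mul, rightMul_mul, rightMul_r, rightMul_r, rightMul_r, rightMul_r,
    LinearMap.add_apply, Module.End.mul_apply, Module.End.mul_apply]
  · have hr : Lab.valid (Lab.move p.1 (Lab.left t)) (Lab.right (t + 1)) := h.2
    have hl : Lab.valid (Lab.move p.1 (Lab.right (t + 1))) (Lab.left t) := h.1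
    rw [arrOp_arrOp (l := Lab.left t) hp h.1 hr, arrOp_arrOp (l := Lab.right (t + 1)) hp h.2 hl]
    have hs : svtx (next p (Lab.both t)) = svtx p := svtx_next hp h
    have e1 : emit p.1 (Lab.left t) = some t := if_neg hv.2.2.1
    have e2 : emit p.1 (Lab.right (t + 1)) = some (t + 1) := if_neg hv.1.2.2
    have e3 : emit (Lab.move p.1 (Lab.left t)) (Lab.right (t + 1)) = none :=
      if_pos ((has_move_left hv.1.1).1.2 (Or.inr (Or.inr rfl)))
    have e4 : emit (Lab.move p.1 (Lab.right (t + 1))) (Lab.left t) = none :=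
      if_pos ((has_move_right hv.2.1).2.2 (Or.inr (Or.inl rfl)))
    have c1 : coef p (Lab.left t) = (quiver n).r (svtx p) t := by rw [coef, e1]; rfl
    have c2 : coef p (Lab.right (t + 1)) = (quiver n).r (svtx p) (t + 1) := by rw [coef, e2]; rfl
    have c3 : coef (next p (Lab.left t)) (Lab.right (t + 1)) = 1 := by rw [coef, next_fst, e3]; rfl
    have c4 : coef (next p (Lab.right (t + 1))) (Lab.left t) = 1 := by rw [coef, next_fst, e4]; rfl
    have hk := (isIdx_iff.1 hp).1
    have k1 : keep (next p (Lab.both t)) ⟨t, hv.1.1⟩ =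
        next (next p (Lab.left t)) (Lab.right (t + 1)) := by
      refine st_ext rfl fun k => ?_
      rw [kept_keep, kept_both, kept_right hv.2.1, kept_left, next_fst, (has_move_left hv.1.1).1]
      grind
    have k2 : keep (next p (Lab.both t)) ⟨t + 1, hv.2.1⟩ =
        next (next p (Lab.right (t + 1))) (Lab.left t) := by
      refine st_ext rfl fun k => ?_
      rw [kept_keep, kept_both, kept_left, kept_right hv.2.1, next_fst, (has_move_right hv.2.1).2]
      grind
    rw [e0, c1, c2, c3, c4, hs, k1, k2]
    simp only [one_mul, mul_one]
    rw [← add_assoc, add_comm]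
  · exact fun hm => hv.1.2.2 (mem_contr.1 hm).1
  · rw [Finset.mem_insert, Fin.ext_iff]
    rintro (hm | hm)
    · dsimp only at hm
      omega
    · exact hv.1.2.1 (mem_contr.1 hm).1

theorem stackD_mul_arrOp (v : Vert n × Vert n) (l : Lab) :
    stackD * arrOp v l = arrOp v l * stackD + rightMul (boxδ v l) := by
  refine stack_ext fun p hp => ?_
  rw [LinearMap.add_apply, Module.End.mul_apply, Module.End.mul_apply]
  by_cases hv : p.1 = v ∧ Lab.valid v l
  · obtain ⟨rfl, h⟩ := hv
    cases l with
    | left t =>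
      rw [stackD_comm_arrOp hp h (by simp), boxδ, rightMul_zero, LinearMap.zero_apply, add_zero]
      simp
    | right t =>
      rw [stackD_comm_arrOp hp h (by simp), boxδ, rightMul_zero, LinearMap.zero_apply, add_zero]
      simp
    | both t => exact stackD_arrOp_both hp h
  · rw [arrOp_basis_of_not hv, map_zero, arrOp_stackD_of_not hp hv, zero_add]
    by_cases h : Lab.valid v l
    · have hne : p.1 ≠ v := fun e => hv ⟨e, h⟩
      have e : boxδ v l = (boxQuiver n).e v * boxδ v l := ((boxDeriv n).src v l).symm
      rw [e, rightMul_mul, Module.End.mul_apply, rightMul_e, idemOp_basis, if_neg hne, map_zero]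
    · rw [boxδ_invalid v l h, rightMul_zero, LinearMap.zero_apply]

theorem stackD_mul_idemOp (v : Vert n × Vert n) :
    (stackD * idemOp v : Module.End (quiver n).Alg (StackCar n)) = idemOp v * stackD := by
  refine stack_ext fun p hp => ?_
  rw [Module.End.mul_apply, Module.End.mul_apply, idemOp_basis, stackD_basis hp, map_sum]
  split_ifs with h
  · rw [stackD_basis hp]
    refine Finset.sum_congr rfl fun s _ => ?_
    rw [map_smul, idemOp_basis (p := keep p s)]
    exact congrArg _ (if_pos h).symm
  · rw [map_zero]
    refine (Finset.sum_eq_zero fun s _ => ?_).symm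
    rw [map_smul, idemOp_basis (p := keep p s)]
    exact (congrArg _ (if_neg h)).trans (smul_zero _)

theorem stackD_leibniz (a : (boxQuiver n).Alg) :
    stackD * rightMul a = rightMul a * stackD + rightMul (deriv (boxDeriv n) a) := by
  refine LQuiver.span_induction
    (p := fun a => stackD * rightMul a = rightMul a * stackD + rightMul (deriv (boxDeriv n) a))
    ?_ ?_ {a | stackD * rightMul a = rightMul a * stackD + rightMul (deriv (boxDeriv n) a)}
    ?_ ?_ ?_ ?_ (fun _ h => h) a
  · rw [map_zero, rightMul_zero, mul_zero, zero_mul, add_zero]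
  · intro a b ha hb
    rw [map_add, rightMul_add, rightMul_add, mul_add, add_mul, ha, hb, add_add_add_comm]
  · change _ = _
    rw [deriv_one, rightMul_zero, rightMul_one, mul_one, one_mul, add_zero]
  · intro a ha b hb
    change _ = _ at ha hb ⊢
    rw [rightMul_mul, ← mul_assoc, hb, add_mul, mul_assoc, ha, deriv_mul, rightMul_add,
      rightMul_mul, rightMul_mul, mul_add, mul_assoc, add_assoc]
  · intro v
    change _ = _
    rw [deriv_e, rightMul_zero, add_zero, rightMul_e]
    exact stackD_mul_idemOp v
  · intro v l
    change _ = _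
    rw [deriv_r, rightMul_r]
    exact stackD_mul_arrOp v l

/-- The grading of the stacking bimodule. -/
def stackGr (k : ℤ × ℤ) : Submodule 𝔽 (StackCar n) :=
  Submodule.pi Set.univ fun i : Idx n => (quiver n).idealGr i.vtx (k + (-i.coh, i.qshift))

theorem mem_stackGr {k : ℤ × ℤ} {f : StackCar n} :
    f ∈ stackGr k ↔ ∀ i : Idx n, (f i).1 ∈ (quiver n).gr (k + (-i.coh, i.qshift)) :=
  ⟨fun h i => h i trivial, fun h i _ => h i⟩

theorem stackGr_internal : DirectSum.IsInternal (stackGr (n := n)) :=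
  isInternal_pi fun i : Idx n => isInternal_shift (idealGr_internal (Q := quiver n) i.vtx) (-i.coh, i.qshift)

theorem smul_mem_stackGr {k l : ℤ × ℤ} {a : (quiver n).Alg} {f : StackCar n}
    (ha : a ∈ (quiver n).gr k) (hf : f ∈ stackGr l) : a • f ∈ stackGr (k + l) := by
  rw [mem_stackGr] at hf ⊢
  intro i
  rw [add_assoc]
  exact mul_mem_gr ha (hf i)

theorem basis_mem (p : St n) : basis p ∈ stackGr (scoh p, -sqs p) := by
  rw [mem_stackGr]
  intro i
  by_cases h : i.1 = p
  · have e : basis p i = gen (Q := quiver n) i.vtx := if_pos h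
    subst h
    rw [e, show ((scoh i.1, -sqs i.1) : ℤ × ℤ) + (-i.coh, i.qshift) = 0 from
      Prod.ext (add_neg_cancel _) (neg_add_cancel _)]
    exact e_mem (Q := quiver n) i.vtx
  · have e : basis p i = 0 := if_neg h
    rw [e]
    exact zero_mem _

/-- The operators of degree `k`. -/
def opGr (k : ℤ × ℤ) : AddSubgroup (Module.End (quiver n).Alg (StackCar n)) where
  carrier := {f | ∀ l, ∀ x ∈ stackGr l, f x ∈ stackGr (l + k)}
  zero_mem' := fun _ _ _ => zero_mem _
  add_mem' := fun hf hg l x hx => add_mem (hf l x hx) (hg l x hx)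
  neg_mem' := fun hf l x hx => neg_mem (hf l x hx)

theorem ofBasis_mem {B : Idx n → StackCar n} {k : ℤ × ℤ}
    (h : ∀ i : Idx n, B i ∈ stackGr ((scoh i.1, -sqs i.1) + k)) : ofBasis B ∈ opGr k := by
  intro l x hx
  refine sum_mem fun i _ => ?_
  have h1 := smul_mem_stackGr (mem_stackGr.1 hx i) (h i)
  rwa [show l + (-i.coh, i.qshift) + ((scoh i.1, -sqs i.1) + k) = l + k from
    Prod.ext (by change l.1 + -scoh i.1 + (scoh i.1 + k.1) = l.1 + k.1; ring)
      (by change l.2 + sqs i.1 + (-sqs i.1 + k.2) = l.2 + k.2; ring)] at h1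

theorem idemOp_mem (v : Vert n × Vert n) : idemOp v ∈ opGr 0 := by
  refine ofBasis_mem fun i => ?_
  rw [add_zero]
  split_ifs
  · exact basis_mem i.1
  · exact zero_mem _

theorem arrOp_mem (v : Vert n × Vert n) (l : Lab) : arrOp v l ∈ opGr (Lab.deg n l) := by
  refine ofBasis_mem fun i => ?_
  split_ifs with h
  · obtain ⟨rfl, h⟩ := h
    have h1 := smul_mem_stackGr (coef_mem i.1 l) (basis_mem (next i.1 l))
    refine (congrArg (_ ∈ stackGr ·) (Prod.ext ?_ ?_)).mp h1
    · change 0 + scoh (next i.1 l) = scoh i.1 + (Lab.deg n l).1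
      rw [scoh_next i.2 h, zero_add]
    · change emitDeg i.1.1 l + -sqs (next i.1 l) = -sqs i.1 + (Lab.deg n l).2
      rw [← sqs_next i.2 h, sub_eq_add_neg]
  · exact zero_mem _

theorem stackD_mem : (stackD : Module.End (quiver n).Alg (StackCar n)) ∈ opGr (1, 0) := by
  refine ofBasis_mem fun i => sum_mem fun s hs => ?_
  have h1 := smul_mem_stackGr (r_mem (Q := quiver n) (svtx i.1) s.val) (basis_mem (keep i.1 s))
  refine (congrArg (_ ∈ stackGr ·) (Prod.ext ?_ ?_)).mp h1
  · change 0 + scoh (keep i.1 s) = scoh i.1 + 1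
    rw [scoh_keep hs, zero_add]
  · change ((n : ℤ) - 1 - 2 * s.val) + -sqs (keep i.1 s) = -sqs i.1 + 0
    rw [← sub_eq_add_neg, sqs_keep hs, add_zero]

theorem rightMul_mem {k : ℤ × ℤ} {a : (boxQuiver n).Alg} (ha : a ∈ (boxQuiver n).gr k) :
    rightMul a ∈ opGr k := by
  refine LQuiver.homog_induction (p := fun k a => rightMul a ∈ opGr k) ?_ ?_ ?_ ?_ ?_ ?_ ha
  · intro k; rw [rightMul_zero]; exact zero_mem _
  · intro k a b ha hb; rw [rightMul_add]; exact add_mem ha hb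
  · intro l x hx
    rw [rightMul_one, add_zero]
    exact hx
  · intro k l a b ha hb m x hx
    rw [rightMul_mul, ← add_assoc]
    exact hb _ _ (ha _ _ hx)
  · intro v; rw [rightMul_e]; exact idemOp_mem v
  · intro v l; rw [rightMul_r]; exact arrOp_mem v l

instance : Module (boxQuiver n).Algᵐᵒᵖ (StackCar n) where
  smul a f := rightMul a.unop f
  one_smul f := by
    change rightMul 1 f = f
    rw [rightMul_one]; rfl
  mul_smul a b f := by
    change rightMul (b.unop * a.unop) f = rightMul a.unop (rightMul b.unop f)
    rw [rightMul_mul]; rfl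
  smul_zero a := map_zero _
  smul_add a := map_add _
  add_smul a b f := by
    change rightMul (a.unop + b.unop) f = rightMul a.unop f + rightMul b.unop f
    rw [rightMul_add]; rfl
  zero_smul f := by
    change rightMul 0 f = 0
    rw [rightMul_zero]; rfl

variable (n) in
/-- The stacking bimodule `T_n`. -/
def stacking : DGBimod (R n) (RR n) where
  carrier := StackCar n
  left := inferInstanceAs (Module (quiver n).Alg (StackCar n))
  right := inferInstanceAs (Module (boxQuiver n).Algᵐᵒᵖ (StackCar n))
  comm := ⟨fun b a f => ((rightMul a.unop).map_smul b f).symm⟩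
  towerLeft := inferInstanceAs (IsScalarTower 𝔽 (quiver n).Alg (StackCar n))
  towerRight := ⟨fun c a f => by
    change (stackAct n (c • a.unop)).unop f = c • (stackAct n a.unop).unop f
    rw [map_smul]; rfl⟩
  gr := stackGr
  internal := stackGr_internal
  smul_mem := smul_mem_stackGr
  mul_mem := fun ht ha => rightMul_mem ha _ _ ht
  d := stackD.restrictScalars 𝔽
  d_mem := fun ht => stackD_mem _ _ ht
  d_d := fun t => by
    change stackD (stackD t) = 0
    exact LinearMap.congr_fun (stackD_stackD (n := n)) t
  leibniz := fun b t => by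
    have h : deriv (zeroDeriv (quiver n)) b = 0 := LQuiver.deriv_zero (quiver n) b
    change stackD (b • t) = deriv (zeroDeriv (quiver n)) b • t + b • stackD t
    rw [h, map_smul, zero_smul, zero_add]
  leibniz_right := fun a t => by
    change stackD (rightMul a t) =
      rightMul a (stackD t) + rightMul (deriv (boxDeriv n) a) t
    exact LinearMap.congr_fun (stackD_leibniz a) t

theorem isStacking_stacking : IsStacking n (stacking n) := by
  classical
  refine ⟨{ toFun := fun t i => (t i).1, map_zero' := rfl, map_add' := fun _ _ => rfl },
    fun s t h => funext fun i => Subtype.ext (congrFun h i), fun f => ⟨?_, fun h => ?_⟩,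
    fun _ _ _ => rfl, fun t k => ?_, fun t j => ?_, fun t v j => ?_, fun t v l j => ?_⟩
  · rintro ⟨t, rfl⟩ i
    exact (t i).2
  · exact ⟨fun i => ⟨f i, h i⟩, rfl⟩
  · refine mem_stackGr.trans (forall_congr' fun i => ?_)
    rw [show k + (-i.coh, i.qshift) = (k.1 - i.coh, k.2 + i.qshift) from
      Prod.ext (sub_eq_add_neg _ _).symm rfl]
    rfl
  · refine (ofBasis_apply _ t j).trans (Finset.sum_congr rfl fun i _ => congrArg _ ?_)
    rw [dCoeff, Finset.sum_apply, AddSubmonoidClass.coe_finsetSum]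
    refine Finset.sum_congr rfl fun s hs => (smul_basis_apply _ _ _).trans ?_
    change (if j.1 = keep i.1 s then _ else 0) = if j.1 = keep i.1 s then _ else 0
    split_ifs with h
    · have hv : j.vtx = svtx i.1 ∪ pair n s.val := (congrArg svtx h).trans (svtx_keep hs)
      rw [hv]
      exact (quiver n).r_e _ _
    · rfl
  · refine (congrArg (fun f : Module.End (quiver n).Alg (StackCar n) => (f t j).1)
      (rightMul_e v)).trans ((ofBasis_apply _ t j).trans (Finset.sum_congr rfl fun i _ =>
        congrArg _ ?_))
    rw [idemCoeff]
    by_cases hv : i.1.1 = v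
    · rw [if_pos hv]
      by_cases hj : j = i
      · subst hj
        rw [if_pos ⟨hv, rfl⟩, basis, if_pos rfl]
        rfl
      · rw [if_neg fun h => hj h.2, basis, if_neg fun h => hj (Subtype.ext h)]
        rfl
    · rw [if_neg hv, if_neg fun h => hv h.1]
      rfl
  · refine (congrArg (fun f : Module.End (quiver n).Alg (StackCar n) => (f t j).1)
      (rightMul_r v l)).trans ((ofBasis_apply _ t j).trans (Finset.sum_congr rfl fun i _ =>
        congrArg _ ?_))
    rw [arrCoeff]
    by_cases h : i.1.1 = v ∧ Lab.valid v l
    · rw [if_pos h, smul_basis_apply]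
      obtain ⟨rfl, hl⟩ := h
      by_cases hj : j.1 = next i.1 l
      · rw [if_pos hj, if_pos ⟨rfl, hl, hj⟩]
        have hv : j.vtx = _ := (congrArg svtx hj).trans (svtx_next i.2 hl)
        rw [coef, hv]
        cases l with
        | left s =>
          rw [arrWeight, hv]
          simp only [emit]
          by_cases hy : Has i.1.1.2 (s + 1)
          · rw [if_pos hy]
            exact (one_mul _).trans (if_pos hy).symm
          · rw [if_neg hy]
            exact ((quiver n).r_e _ _).trans (if_neg hy).symm
        | right s =>
          rw [arrWeight, hv]
          simp only [emit]
          by_cases hy : Has i.1.1.1 s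
          · rw [if_pos hy]
            exact (one_mul _).trans (if_pos hy).symm
          · rw [if_neg hy]
            exact ((quiver n).r_e _ _).trans (if_neg hy).symm
        | both s =>
          rw [arrWeight, hv]
          exact one_mul _
      · rw [if_neg hj, if_neg fun h => hj h.2.2]
    · rw [if_neg h, if_neg fun h' => h ⟨h'.1, h'.2.1⟩]
      rfl

end Stack


/-! ### Stacking of projective modules -/

section StackProj

open LQuiver

variable {n : ℕ}

theorem minimal_zeroDeriv (Q : LQuiver) : Minimal (zeroDeriv Q) := fun v _ _ => map_zero (aug v)

theorem aug_r_mul (Q : LQuiver) (u v : Q.V) (l : Q.L) (a : Q.Alg) : aug u (Q.r v l * a) = 0 := by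
  rw [map_mul, aug_r, zero_mul]

theorem minimal_boxDeriv (n : ℕ) : Minimal (boxDeriv n) := fun u v l => by
  cases l with
  | left s => exact map_zero _
  | right s => exact map_zero _
  | both s => exact (map_add _ _ _).trans (by rw [aug_r_mul, aug_r_mul, add_zero])

/-- The Euler characteristics of the morphisms to the simple modules. -/
def chiR (X : Ho (R n)) : Vert n → Λ := chi _ (minimal_zeroDeriv (quiver n)) X

/-- The Euler characteristics of the morphisms to the simple modules of `R_n ⊠ R_n`. -/
def chiRR (Z : Ho (RR n)) : Vert n × Vert n → Λ := chi _ (minimal_boxDeriv n) Z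

theorem stackD_basis_mem (w : Vert n × Vert n) (i : {i : Idx n // i.1.1 = w}) :
    stackD (basis i.1.1) ∈ Submodule.span (quiver n).Alg
      ((fun j : {i : Idx n // i.1.1 = w} => (basis j.1.1 : StackCar n)) ''
        {j | i.1.1.2.card < j.1.1.2.card}) := by
  rw [stackD_basis i.1.2]
  refine sum_mem fun s hs => Submodule.smul_mem _ _ ?_
  by_cases hn : IsIdx (keep i.1.1 s)
  · refine Submodule.subset_span ⟨⟨⟨keep i.1.1 s, hn⟩, i.2⟩, ?_, rfl⟩
    change i.1.1.2.card < (insert s i.1.1.2).card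
    rw [Finset.card_insert_of_notMem fun h => (mem_contr.1 hs).2.2 (kept_val.2 h)]
    exact Nat.lt_succ_self _
  · rw [basis_of_not hn]
    exact zero_mem _

theorem sum_smul_basis_inj {ι : Type} [Fintype ι] (f : ι → Idx n) (hf : Function.Injective f)
    (a : ι → (quiver n).Alg) (ha : ∀ i, a i ∈ (quiver n).leftIdeal (f i).vtx)
    (h0 : ∑ i, a i • (basis (f i).1 : StackCar n) = 0) : a = 0 := by
  funext j
  have h1 := congrArg (fun g : StackCar n => (g (f j)).1) h0
  have h2 : ((∑ i, a i • (basis (f i).1) : StackCar n) (f j)).1 = a j := by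
    rw [Finset.sum_apply, AddSubmonoidClass.coe_finsetSum, Finset.sum_eq_single j]
    · rw [smul_basis_apply, if_pos rfl]
      exact mem_leftIdeal.1 (ha j)
    · intro i _ hij
      rw [smul_basis_apply, if_neg fun h => hij (hf (Subtype.ext h.symm))]
    · simp
  exact h2.symm.trans h1

theorem mem_span_basis (w : Vert n × Vert n) (x : StackCar n) (hx : idemOp w x = x) :
    x ∈ Submodule.span (quiver n).Alg
      (Set.range fun j : {i : Idx n // i.1.1 = w} => (basis j.1.1 : StackCar n)) := by
  have h1 : x = ∑ i : Idx n, (x i).1 • idemOp w (basis i.1) := by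
    conv_lhs => rw [← hx, ← sum_basis x, map_sum]
    exact Finset.sum_congr rfl fun i _ => map_smul _ _ _
  rw [h1]
  refine sum_mem fun i _ => Submodule.smul_mem _ _ ?_
  rw [idemOp_basis]
  split_ifs with h
  · exact Submodule.subset_span ⟨⟨i, h⟩, rfl⟩
  · exact zero_mem _

/-- `T_n e(x, y)` is semifree, with one generator for each index over `(x, y)`. -/
theorem stacking_proj (w : Vert n × Vert n) :
    DGP n ((tensorFunctor (stacking n)).obj (Ho.of (PP n w))) ∧
      chiR ((tensorFunctor (stacking n)).obj (Ho.of (PP n w))) =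
        ∑ i : {i : Idx n // i.1.1 = w}, Pi.single i.1.vtx (weight (-i.1.coh, i.1.qshift)) := by
  have : Nonempty (quiver n).V := ⟨(∅ : Vert n)⟩
  have key := generated_tensor_proj (minimal_zeroDeriv (quiver n)) (stacking n) w
    (ι := {i : Idx n // i.1.1 = w}) (fun i => i.1.1.2.card) (fun i => i.1.vtx)
    (fun i => (i.1.coh, -i.1.qshift)) (fun i => basis i.1.1) (fun i => basis_mem i.1.1)
    (fun i => e_basis i.1.1) (fun i => ?_) (stackD_basis_mem w)
    (sum_smul_basis_inj _ Subtype.val_injective) (fun x hx => mem_span_basis w x ?_)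
  · refine ⟨key.1, key.2.trans (Finset.sum_congr rfl fun i _ => ?_)⟩
    rw [Prod.neg_mk, neg_neg]
  · refine (congrArg (fun f : Module.End (quiver n).Alg (StackCar n) => f (basis i.1.1))
      (rightMul_e w)).trans ?_
    rw [idemOp_basis, if_pos i.2]
  · exact (congrArg
      (fun f : Module.End (quiver n).Alg (StackCar n) => f x) (rightMul_e w)).symm.trans hx

end StackProj


/-! ### Moving the arrows of the second factor to the end of a path -/

section Transport

variable {n : ℕ} (t : ℕ)

/-- The vertices from which the pair `t, t + 1` of the second component can be removed. -/
def Held (v : Vert n × Vert n) : Prop := Has v.2 t ∧ Has v.2 (t + 1)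

/-- The vertex with the pair `t, t + 1` of the second component removed. -/
def unhold (v : Vert n × Vert n) : Vert n × Vert n := (v.1, v.2 \ pair n t)

/-- The labels that do not involve the pair `t, t + 1` of the second component. -/
def Passes : Lab → Prop
  | Lab.left _ => True
  | Lab.right s => s ≠ t
  | Lab.both s => s + 1 ≠ t

variable {t}

theorem has_sdiff {x y : Vert n} {k : ℕ} : Has (x \ y) k ↔ Has x k ∧ ¬ Has y k := by
  constructor
  · rintro ⟨b, hb, rfl⟩
    rw [Finset.mem_sdiff] at hb
    exact ⟨⟨b, hb.1, rfl⟩, fun h => hb.2 (has_val.1 h)⟩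
  · rintro ⟨⟨b, hb, rfl⟩, h⟩
    exact ⟨b, Finset.mem_sdiff.2 ⟨hb, fun h' => h ⟨b, h', rfl⟩⟩, rfl⟩

theorem Held.move {v : Vert n × Vert n} (h : Held t v) (l : Lab) : Held t (Lab.move v l) := by
  cases l with
  | left s => exact h
  | right s => exact ⟨has_union.2 (Or.inl h.1), has_union.2 (Or.inl h.2)⟩
  | both s => exact ⟨has_union.2 (Or.inl h.1), has_union.2 (Or.inl h.2)⟩

theorem unhold_move {v : Vert n × Vert n} (h : Held t v) {l : Lab} (hl : Lab.valid v l) :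
    unhold t (Lab.move v l) = Lab.move (unhold t v) l := by
  have ht : t + 1 ≤ n := h.2.le
  have key : ∀ s, CanAdd v.2 s → (v.2 ∪ pair n s) \ pair n t = (v.2 \ pair n t) ∪ pair n s := by
    intro s hs
    rw [canAdd_iff] at hs
    refine vert_ext fun k => ?_
    rw [has_sdiff, has_union, has_union, has_sdiff, has_pair ht, has_pair hs.1]
    obtain ⟨h1, h2⟩ := h
    grind
  cases l with
  | left s => rfl
  | right s => exact Prod.ext rfl (key s hl)
  | both s => exact Prod.ext rfl (key (s + 1) hl.2)

theorem held_right {v : Vert n × Vert n} (h : Lab.valid v (Lab.right t)) :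
    Held t (Lab.move v (Lab.right t)) := by
  have ht := (canAdd_iff.1 h).1
  exact ⟨has_union.2 (Or.inr ((has_pair ht).2 (Or.inl rfl))),
    has_union.2 (Or.inr ((has_pair ht).2 (Or.inr rfl)))⟩

theorem unhold_right {v : Vert n × Vert n} (h : Lab.valid v (Lab.right t)) :
    unhold t (Lab.move v (Lab.right t)) = v := by
  have ht := canAdd_iff.1 h
  refine Prod.ext rfl (vert_ext fun k => ?_)
  change Has ((v.2 ∪ pair n t) \ pair n t) k ↔ _
  rw [has_sdiff, has_union, has_pair ht.1]
  obtain ⟨_, h1, h2⟩ := ht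
  grind

theorem unhold_both {v : Vert n × Vert n} (h : Held t v) {s : ℕ} (hs : s + 1 = t) :
    Lab.move (unhold t v) (Lab.both s) = Lab.move v (Lab.left s) := by
  subst hs
  have ht : s + 1 + 1 ≤ n := h.2.le
  refine Prod.ext rfl (vert_ext fun k => ?_)
  change Has ((v.2 \ pair n (s + 1)) ∪ pair n (s + 1)) k ↔ Has v.2 k
  rw [has_union, has_sdiff, has_pair ht]
  obtain ⟨h1, h2⟩ := h
  grind

theorem unhold_then_right {v : Vert n × Vert n} (h : Held t v) :
    Lab.move (unhold t v) (Lab.right t) = v := by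
  have ht : t + 1 ≤ n := h.2.le
  refine Prod.ext rfl (vert_ext fun k => ?_)
  change Has ((v.2 \ pair n t) ∪ pair n t) k ↔ Has v.2 k
  rw [has_union, has_sdiff, has_pair ht]
  obtain ⟨h1, h2⟩ := h
  grind

theorem Held.not_valid {v : Vert n × Vert n} (h : Held t v) {l : Lab} (hl : ¬ Passes t l) :
    ¬ Lab.valid v l := by
  cases l with
  | left s => exact absurd trivial hl
  | right s =>
    obtain rfl : s = t := not_not.1 hl
    exact fun h' => (canAdd_iff.1 h').2.1 h.1
  | both s =>
    have hs : s + 1 = t := not_not.1 hl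
    subst hs
    exact fun h' => (canAdd_iff.1 h'.2).2.1 h.1

variable (t)

/-- Upper triangular matrices of size three. -/
def tri {S : Type} [Zero S] (a b c d g f : S) : Matrix (Fin 3) (Fin 3) S :=
  !![a, b, c; 0, d, g; 0, 0, f]

theorem tri_mul {S : Type} [Ring S] (a b c d g f a' b' c' d' g' f' : S) :
    tri a b c d g f * tri a' b' c' d' g' f' = tri (a * a') (a * b' + b * d')
      (a * c' + b * g' + c * f') (d * d') (d * g' + g * f') (f * f') := by
  ext i j
  fin_cases i <;> fin_cases j <;> simp [tri, Matrix.mul_apply, Fin.sum_univ_three]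

theorem tri_add {S : Type} [Ring S] (a b c d g f a' b' c' d' g' f' : S) :
    tri a b c d g f + tri a' b' c' d' g' f' =
      tri (a + a') (b + b') (c + c') (d + d') (g + g') (f + f') := by
  ext i j
  fin_cases i <;> fin_cases j <;> simp [tri]

theorem tri_map {S : Type} [Ring S] (D : S → S) (h0 : D 0 = 0) (a b c d g f : S) :
    (tri a b c d g f).map D = tri (D a) (D b) (D c) (D d) (D g) (D f) := by
  ext i j
  fin_cases i <;> fin_cases j <;> simp [tri, h0]

theorem tri_zero {S : Type} [Ring S] : tri (0 : S) 0 0 0 0 0 = 0 := by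
  ext i j
  fin_cases i <;> fin_cases j <;> simp [tri]

open LQuiver

/-- The algebra underlying `R_n ⊠ R_n`. -/
abbrev BoxAlg (n : ℕ) : Type := (boxQuiver n).Alg

open Classical in
/-- The arrow is kept, unless it involves the pair `t, t + 1` of the second component. -/
def passOp (v : Vert n × Vert n) (l : Lab) : BoxAlg n :=
  if Passes t l then (boxQuiver n).r v l else 0

open Classical in
/-- The arrow after the pair `t, t + 1` of the second component has been removed. -/
def heldOp (v : Vert n × Vert n) (l : Lab) : BoxAlg n :=
  if Held t v ∧ Lab.valid v l then passOp t (unhold t v) l else 0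

open Classical in
/-- The removal of the arrow `(∅, t)`. -/
def takeOp (v : Vert n × Vert n) : Lab → BoxAlg n
  | Lab.right s => if s = t ∧ Lab.valid v (Lab.right s) then (boxQuiver n).e v else 0
  | _ => 0

open Classical in
/-- The insertion of the removed arrow, next to the arrow `(t - 1, ∅)`, with which it forms an
arrow `(t - 1, t)`. -/
def joinOp (v : Vert n × Vert n) : Lab → BoxAlg n
  | Lab.left s => if s + 1 = t ∧ Held t v ∧ Lab.valid v (Lab.left s) then
      (boxQuiver n).r (unhold t v) (Lab.both s) else 0
  | _ => 0

/-- The matrix of an arrow: the arrow `(∅, t)` has not been met yet in the first row, has been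
removed in the second one, and has been inserted again in the third one. -/
def arrMat (v : Vert n × Vert n) (l : Lab) : Matrix (Fin 3) (Fin 3) (BoxAlg n) :=
  tri (passOp t v l) (takeOp t v l) 0 (heldOp t v l) (joinOp t v l) ((boxQuiver n).r v l)

variable {t}

theorem passOp_invalid {v : Vert n × Vert n} {l : Lab} (h : ¬ Lab.valid v l) :
    passOp t v l = 0 := by
  rw [passOp, (boxQuiver n).r_invalid h, ite_self]

theorem heldOp_of {v : Vert n × Vert n} {l : Lab} (hv : Held t v) (h : Lab.valid v l) :
    heldOp t v l = passOp t (unhold t v) l := if_pos ⟨hv, h⟩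

theorem heldOp_of_not {v : Vert n × Vert n} {l : Lab} (hv : ¬ (Held t v ∧ Lab.valid v l)) :
    heldOp t v l = 0 := if_neg hv

theorem heldOp_not_passes {v : Vert n × Vert n} {l : Lab} (h : ¬ Passes t l) :
    heldOp t v l = 0 := by
  rw [heldOp, passOp, if_neg h, ite_self]

theorem takeOp_right {v : Vert n × Vert n} (h : Lab.valid v (Lab.right t)) :
    takeOp t v (Lab.right t) = (boxQuiver n).e v := if_pos ⟨rfl, h⟩

theorem takeOp_of_ne {v : Vert n × Vert n} {l : Lab} (h : l ≠ Lab.right t) :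
    takeOp t v l = 0 := by
  cases l with
  | left s => rfl
  | right s => exact if_neg fun h' => h (congrArg Lab.right h'.1)
  | both s => rfl

theorem takeOp_invalid {v : Vert n × Vert n} {l : Lab} (h : ¬ Lab.valid v l) :
    takeOp t v l = 0 := by
  cases l with
  | left s => rfl
  | right s => exact if_neg fun h' => h h'.2
  | both s => rfl

theorem joinOp_invalid {v : Vert n × Vert n} {l : Lab} (h : ¬ (Held t v ∧ Lab.valid v l)) :
    joinOp t v l = 0 := by
  cases l with
  | left s => exact if_neg fun h' => h h'.2
  | right s => rfl
  | both s => rfl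

theorem passOp_comm (v : Vert n × Vert n) {l l' : Lab} (h : Lab.comm l l') :
    passOp t v l * passOp t (Lab.move v l) l' = passOp t v l' * passOp t (Lab.move v l') l := by
  unfold passOp
  by_cases h1 : Passes t l
  · by_cases h2 : Passes t l'
    · rw [if_pos h1, if_pos h2, if_pos h2, if_pos h1]
      exact box_comm v h
    · rw [if_neg h2, if_neg h2, mul_zero, zero_mul]
  · rw [if_neg h1, if_neg h1, mul_zero, zero_mul]

theorem heldOp_comm (v : Vert n × Vert n) {l l' : Lab} (h : Lab.comm l l') :
    heldOp t v l * heldOp t (Lab.move v l) l' = heldOp t v l' * heldOp t (Lab.move v l') l := by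
  by_cases hv : Held t v
  · by_cases h1 : Lab.valid v l ∧ Lab.valid (Lab.move v l) l'
    · have h2 := valid_swap h1.1 h1.2
      rw [heldOp_of hv h1.1, heldOp_of (hv.move l) h1.2, heldOp_of hv h2.1,
        heldOp_of (hv.move l') h2.2, unhold_move hv h1.1, unhold_move hv h2.1]
      exact passOp_comm _ h
    · have e : ∀ l l', ¬ (Lab.valid v l ∧ Lab.valid (Lab.move v l) l') →
          heldOp t v l * heldOp t (Lab.move v l) l' = 0 := by
        intro l l' h1
        by_cases h2 : Lab.valid v l
        · rw [heldOp_of_not (v := Lab.move v l) fun h3 => h1 ⟨h2, h3.2⟩, mul_zero]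
        · rw [heldOp_of_not fun h3 => h2 h3.2, zero_mul]
      rw [e _ _ h1, e _ _ fun h2 => h1 (valid_swap h2.1 h2.2)]
  · rw [heldOp_of_not fun h => hv h.1, heldOp_of_not fun h => hv h.1, zero_mul, zero_mul]

theorem pass_take (v : Vert n × Vert n) (l l' : Lab) :
    passOp t v l * takeOp t (Lab.move v l) l' = takeOp t v l' * heldOp t (Lab.move v l') l := by
  by_cases hl : l' = Lab.right t
  · subst hl
    by_cases h1 : Lab.valid v (Lab.right t) ∧ Lab.valid (Lab.move v (Lab.right t)) l
    · have h2 := valid_swap h1.1 h1.2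
      rw [takeOp_right h1.1, takeOp_right h2.2, heldOp_of (held_right h1.1) h1.2,
        unhold_right h1.1, passOp]
      split_ifs
      · exact ((boxQuiver n).r_e v l).trans ((boxQuiver n).e_r v l).symm
      · rw [zero_mul, mul_zero]
    · have e1 : takeOp t v (Lab.right t) * heldOp t (Lab.move v (Lab.right t)) l = 0 := by
        by_cases h2 : Lab.valid v (Lab.right t)
        · rw [heldOp_of_not (v := Lab.move v _) fun h3 => h1 ⟨h2, h3.2⟩, mul_zero]
        · rw [takeOp_invalid h2, zero_mul]
      rw [e1]
      by_cases h2 : Lab.valid v l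
      · rw [takeOp_invalid (v := Lab.move v l) fun h3 => h1 (valid_swap h2 h3), mul_zero]
      · rw [passOp_invalid h2, zero_mul]
  · rw [takeOp_of_ne hl, takeOp_of_ne hl, mul_zero, zero_mul]

theorem held_join (v : Vert n × Vert n) (l l' : Lab) :
    heldOp t v l * joinOp t (Lab.move v l) l' =
      joinOp t v l' * (boxQuiver n).r (Lab.move v l') l := by
  cases l' with
  | right s => exact (mul_zero _).trans (zero_mul _).symm
  | both s => exact (mul_zero _).trans (zero_mul _).symm
  | left s =>
    by_cases hs : s + 1 = t
    · by_cases hv : Held t v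
      · by_cases hl : Passes t l
        · by_cases h1 : Lab.valid v l ∧ Lab.valid (Lab.move v l) (Lab.left s)
          · have h2 := valid_swap h1.1 h1.2
            have e1 : joinOp t (Lab.move v l) (Lab.left s) =
                (boxQuiver n).r (unhold t (Lab.move v l)) (Lab.both s) :=
              if_pos ⟨hs, hv.move l, h1.2⟩
            have e2 : joinOp t v (Lab.left s) = (boxQuiver n).r (unhold t v) (Lab.both s) :=
              if_pos ⟨hs, hv, h2.1⟩
            rw [e1, e2, heldOp_of hv h1.1, unhold_move hv h1.1, passOp, if_pos hl,
              ← unhold_both hv hs]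
            exact box_comm (unhold t v) (by cases l <;> exact trivial)
          · have e1 : heldOp t v l * joinOp t (Lab.move v l) (Lab.left s) = 0 := by
              by_cases h2 : Lab.valid v l
              · rw [joinOp_invalid (v := Lab.move v l) fun h3 => h1 ⟨h2, h3.2⟩, mul_zero]
              · rw [heldOp_of_not fun h3 => h2 h3.2, zero_mul]
            rw [e1]
            by_cases h2 : Lab.valid v (Lab.left s)
            · have e := (boxQuiver n).r_invalid (v := Lab.move v (Lab.left s)) (l := l)
                fun h3 => h1 (valid_swap h2 h3)
              exact (congrArg _ e).trans (mul_zero _) |>.symm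
            · rw [joinOp_invalid fun h3 => h2 h3.2, zero_mul]
        · have e := (boxQuiver n).r_invalid ((hv.move (Lab.left s)).not_valid hl)
          rw [heldOp_not_passes hl, zero_mul]
          exact ((congrArg _ e).trans (mul_zero _)).symm
      · rw [heldOp_of_not fun h => hv h.1, joinOp_invalid fun h => hv h.1, zero_mul, zero_mul]
    · have e : ∀ v : Vert n × Vert n, joinOp t v (Lab.left s) = 0 := fun v =>
        if_neg fun h => hs h.1
      rw [e, e, mul_zero, zero_mul]

theorem take_join (v : Vert n × Vert n) {l l' : Lab} (h : Lab.comm l l') :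
    takeOp t v l * joinOp t (Lab.move v l) l' = 0 := by
  by_cases hl : l = Lab.right t
  · subst hl
    cases l' with
    | left s =>
      have e : joinOp t (Lab.move v (Lab.right t)) (Lab.left s) = 0 :=
        if_neg fun h' => h h'.1.symm
      rw [e, mul_zero]
    | right s => exact mul_zero _
    | both s => exact mul_zero _
  · rw [takeOp_of_ne hl, zero_mul]

theorem comm_symm {l l' : Lab} (h : Lab.comm l l') : Lab.comm l' l := by
  cases l <;> cases l' <;> exact h

theorem arrMat_comm (v : Vert n × Vert n) {l l' : Lab} (h : Lab.comm l l') :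
    arrMat t v l * arrMat t (Lab.move v l) l' = arrMat t v l' * arrMat t (Lab.move v l') l := by
  unfold arrMat
  rw [tri_mul, tri_mul, passOp_comm v h, heldOp_comm v h, box_comm v h, take_join v h,
    take_join v (comm_symm h), pass_take v l l', pass_take v l' l, held_join v l l',
    held_join v l' l, mul_zero, mul_zero, zero_mul, zero_mul,
    add_comm (takeOp t v l' * _), add_comm (joinOp t v l' * _)]

variable (t) in
/-- The representation of `R_n ⊠ R_n` by the matrices `arrMat`. -/
def transportRep : (boxQuiver n).Rep
    (Matrix (Vert n × Vert n) (Vert n × Vert n) (Matrix (Fin 3) (Fin 3) (BoxAlg n))) where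
  e := fun v => Matrix.single v v 1
  r := fun v l => Matrix.single v (Lab.move v l) (arrMat t v l)
  e_mul := fun v w => by
    split_ifs with h
    · subst h
      rw [Matrix.single_mul_single_same, mul_one]
    · rw [Matrix.single_mul_single_of_ne _ _ _ _ h]
  e_r := fun v l => by rw [Matrix.single_mul_single_same, one_mul]
  r_e := fun v l => by rw [Matrix.single_mul_single_same, mul_one]
  r_invalid := fun v l h => by
    rw [arrMat, passOp_invalid h, takeOp_invalid h, heldOp_of_not fun h' => h h'.2,
      joinOp_invalid fun h' => h h'.2, (boxQuiver n).r_invalid h, tri_zero, Matrix.single_zero]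
  r_comm := fun v l l' h => by
    rw [Matrix.single_mul_single_same, Matrix.single_mul_single_same, arrMat_comm v h,
      box_move_move]
  sum_e := by
    ext v w : 2
    rw [Matrix.sum_apply]
    rw [Finset.sum_eq_single v (fun u _ hu => Matrix.single_apply_of_row_ne hu _ _ _)
      fun h => absurd (Finset.mem_univ v) h, Matrix.single_apply, Matrix.one_apply]
    simp only [true_and]

end Transport


section TransportHomotopy

open LQuiver

theorem LQuiver.alg_induction {Q : LQuiver} {p : Q.Alg → Prop} (h0 : p 0)
    (hadd : ∀ a b, p a → p b → p (a + b)) (h1 : p 1) (hmul : ∀ a b, p a → p b → p (a * b))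
    (he : ∀ v, p (Q.e v)) (hr : ∀ v l, p (Q.r v l)) (a : Q.Alg) : p a :=
  span_induction h0 hadd {a | p a} h1 (fun a ha b hb => hmul a b ha hb) he hr (fun _ h => h) a

variable {n : ℕ} {t : ℕ}

variable (t) in
/-- The homomorphism given by the matrices `arrMat`. -/
def transport : BoxAlg n →ₐ[𝔽]
    Matrix (Vert n × Vert n) (Vert n × Vert n) (Matrix (Fin 3) (Fin 3) (BoxAlg n)) :=
  lift (transportRep t)

variable (n) in
/-- The differential of `R_n ⊠ R_n`. -/
abbrev boxD : BoxAlg n →ₗ[𝔽] BoxAlg n := deriv (boxDeriv n)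

open Classical in
variable (t) in
/-- The arrow `(∅, t)` that ends at `v`. -/
def putOp (v : Vert n × Vert n) : BoxAlg n :=
  if Held t v then (boxQuiver n).r (unhold t v) (Lab.right t) else 0

variable (t) in
/-- The matrix whose commutator is added to the differential of the matrices. -/
def twist (v : Vert n × Vert n) : Matrix (Fin 3) (Fin 3) (BoxAlg n) :=
  tri 0 0 1 0 (putOp t v) 0

theorem transport_e (v : Vert n × Vert n) :
    transport t ((boxQuiver n).e v) = Matrix.single v v 1 := lift_e _ _

theorem transport_r (v : Vert n × Vert n) (l : Lab) :
    transport t ((boxQuiver n).r v l) = Matrix.single v (Lab.move v l) (arrMat t v l) :=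
  lift_r _ _ _

theorem map_boxD_mul (X Y : Matrix (Fin 3) (Fin 3) (BoxAlg n)) :
    (X * Y).map (boxD n) = X.map (boxD n) * Y + X * Y.map (boxD n) := by
  ext i j
  simp only [Matrix.map_apply, Matrix.mul_apply, Matrix.add_apply, map_sum,
    ← Finset.sum_add_distrib]
  exact Finset.sum_congr rfl fun k _ => deriv_mul _ _ _

theorem map_boxD_sum {ι : Type} (s : Finset ι) (X : ι → Matrix (Fin 3) (Fin 3) (BoxAlg n)) :
    (∑ i ∈ s, X i).map (boxD n) = ∑ i ∈ s, (X i).map (boxD n) := by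
  ext i j
  simp only [Matrix.map_apply, Matrix.sum_apply, map_sum]

theorem mat_add_self (X : Matrix (Fin 3) (Fin 3) (BoxAlg n)) : X + X = 0 := by
  ext i j
  exact add_self _

theorem boxD_r (v : Vert n × Vert n) (l : Lab) : boxD n ((boxQuiver n).r v l) = boxδ v l :=
  deriv_r _ _ _

theorem boxD_takeOp (v : Vert n × Vert n) (l : Lab) : boxD n (takeOp t v l) = 0 := by
  cases l with
  | left s => exact map_zero _
  | both s => exact map_zero _
  | right s =>
    simp only [takeOp]
    split_ifs
    · exact deriv_e _ _
    · exact map_zero _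

/-- The upper right entry of the commutator with `twist`. -/
theorem twist_pass {v : Vert n × Vert n} {l : Lab} (hl : Lab.valid v l)
    (h : Passes t l ∨ l = Lab.right t) :
    (boxQuiver n).r v l + (passOp t v l + takeOp t v l * putOp t (Lab.move v l)) = 0 := by
  rcases h with h | rfl
  · rw [passOp, if_pos h, takeOp_of_ne fun h' => by subst h'; exact h rfl, zero_mul, add_zero]
    exact add_self _
  · rw [passOp, if_neg (by exact fun h => h rfl), takeOp_right hl, putOp,
      if_pos (held_right hl), unhold_right hl, zero_add]
    exact (congrArg _ ((boxQuiver n).e_r v (Lab.right t))).trans (add_self _)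

/-- The entry of the commutator with `twist` for the removed arrow. -/
theorem twist_held {v : Vert n × Vert n} {l : Lab} (hl : Lab.valid v l) :
    boxD n (joinOp t v l) + putOp t v * (boxQuiver n).r v l +
      heldOp t v l * putOp t (Lab.move v l) = 0 := by
  by_cases hv : Held t v
  · have hp : Passes t l := by
      by_contra h
      exact hv.not_valid h hl
    have h1 : (boxQuiver n).r v l =
        (boxQuiver n).r (Lab.move (unhold t v) (Lab.right t)) l := by rw [unhold_then_right hv]
    rw [heldOp_of hv hl, putOp, putOp, if_pos hv, if_pos (hv.move l), unhold_move hv hl, passOp,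
      if_pos hp, h1]
    by_cases hc : Lab.comm (Lab.right t) l
    · have h2 : joinOp t v l = 0 := by
        cases l with
        | left s => exact if_neg fun h => hc h.1.symm
        | right s => rfl
        | both s => rfl
      rw [h2, map_zero, zero_add, box_comm _ hc]
      exact add_self _
    · cases l with
      | right s => exact absurd trivial hc
      | both s => exact absurd trivial hc
      | left s =>
        obtain rfl : t = s + 1 := not_not.1 hc
        have h2 : joinOp (s + 1) v (Lab.left s) =
          (boxQuiver n).r (unhold (s + 1) v) (Lab.both s) := if_pos ⟨rfl, hv, hl⟩
        rw [h2, boxD_r, add_assoc, add_comm (_ * _) (_ * _)]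
        exact add_self _
  · rw [joinOp_invalid fun h => hv h.1, heldOp_of_not fun h => hv h.1, putOp, if_neg hv, map_zero,
      zero_mul, zero_mul, add_zero, add_zero]

theorem boxD_passOp (v : Vert n × Vert n) (s : ℕ) : boxD n (passOp t v (Lab.both s)) =
    passOp t v (Lab.left s) * passOp t (Lab.move v (Lab.left s)) (Lab.right (s + 1)) +
      passOp t v (Lab.right (s + 1)) * passOp t (Lab.move v (Lab.right (s + 1))) (Lab.left s) := by
  unfold passOp
  rw [if_pos (show Passes t (Lab.left s) from trivial), if_pos (show Passes t (Lab.left s) from trivial)]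
  by_cases h : s + 1 = t
  · rw [if_neg (show ¬ Passes t (Lab.both s) from fun h' => h' h),
      if_neg (show ¬ Passes t (Lab.right (s + 1)) from fun h' => h' h),
      if_neg (show ¬ Passes t (Lab.right (s + 1)) from fun h' => h' h), map_zero, mul_zero,
      zero_mul, add_zero]
  · rw [if_pos (show Passes t (Lab.both s) from h),
      if_pos (show Passes t (Lab.right (s + 1)) from h),
      if_pos (show Passes t (Lab.right (s + 1)) from h)]
    exact boxD_r _ _

theorem boxD_heldOp {v : Vert n × Vert n} {s : ℕ} (hl : Lab.valid v (Lab.both s)) :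
    boxD n (heldOp t v (Lab.both s)) =
    heldOp t v (Lab.left s) * heldOp t (Lab.move v (Lab.left s)) (Lab.right (s + 1)) +
      heldOp t v (Lab.right (s + 1)) * heldOp t (Lab.move v (Lab.right (s + 1))) (Lab.left s) := by
  have h1 : Lab.valid v (Lab.left s) := hl.1
  have h2 : Lab.valid v (Lab.right (s + 1)) := hl.2
  have h3 : Lab.valid (Lab.move v (Lab.left s)) (Lab.right (s + 1)) := hl.2
  have h4 : Lab.valid (Lab.move v (Lab.right (s + 1))) (Lab.left s) := hl.1
  by_cases hv : Held t v
  · rw [heldOp_of hv hl, heldOp_of hv h1, heldOp_of hv h2, heldOp_of (hv.move _) h3,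
      heldOp_of (hv.move _) h4, unhold_move hv h1, unhold_move hv h2, boxD_passOp]
  · rw [heldOp_of_not fun h => hv h.1, heldOp_of_not fun h => hv h.1,
      heldOp_of_not (l := Lab.right (s + 1)) fun h => hv h.1, map_zero, zero_mul, zero_mul,
      add_zero]

theorem take_join_both {v : Vert n × Vert n} {s : ℕ} (hl : Lab.valid v (Lab.both s)) :
    takeOp t v (Lab.right (s + 1)) * joinOp t (Lab.move v (Lab.right (s + 1))) (Lab.left s) =
      (boxQuiver n).r v (Lab.both s) + passOp t v (Lab.both s) := by
  by_cases h : s + 1 = t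
  · subst h
    have h2 : Lab.valid v (Lab.right (s + 1)) := hl.2
    have e : joinOp (s + 1) (Lab.move v (Lab.right (s + 1))) (Lab.left s) =
        (boxQuiver n).r (unhold (s + 1) (Lab.move v (Lab.right (s + 1)))) (Lab.both s) :=
      if_pos ⟨rfl, held_right h2, hl.1⟩
    rw [e, takeOp_right h2, unhold_right h2, passOp,
      if_neg (show ¬ Passes (s + 1) (Lab.both s) from fun h' => h' rfl), add_zero]
    exact (boxQuiver n).e_r _ _
  · rw [takeOp_of_ne fun h' => h (Lab.right.inj h'), zero_mul, passOp,
      if_pos (show Passes t (Lab.both s) from h)]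
    exact (add_self _).symm

/-- The matrix of the differential of an arrow. -/
theorem transport_boxδ (v : Vert n × Vert n) (l : Lab) (hl : Lab.valid v l) :
    transport t (boxδ v l) = Matrix.single v (Lab.move v l)
      ((arrMat t v l).map (boxD n) + twist t v * arrMat t v l +
        arrMat t v l * twist t (Lab.move v l)) := by
  have hM : (arrMat t v l).map (boxD n) + twist t v * arrMat t v l +
      arrMat t v l * twist t (Lab.move v l) = tri (boxD n (passOp t v l)) 0
        ((boxQuiver n).r v l + (passOp t v l + takeOp t v l * putOp t (Lab.move v l)))
        (boxD n (heldOp t v l)) 0 (boxδ v l) := by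
    rw [arrMat, twist, twist, tri_map _ (map_zero _), tri_mul, tri_mul, tri_add, tri_add,
      boxD_takeOp, boxD_r]
    simp only [map_zero, mul_zero, zero_mul, add_zero, zero_add, mul_one, one_mul]
    rw [twist_held hl]
  rw [hM]
  cases l with
  | left s =>
    have h0 : boxD n (passOp t v (Lab.left s)) = 0 := by
      unfold passOp
      split_ifs
      · exact boxD_r _ _
      · exact map_zero _
    have h1 : boxD n (heldOp t v (Lab.left s)) = 0 := by
      unfold heldOp passOp
      split_ifs
      · exact boxD_r _ _
      · exact map_zero _
      · exact map_zero _
    rw [twist_pass hl (Or.inl trivial), h0, h1]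
    exact (map_zero _).trans ((congrArg _ tri_zero).trans (Matrix.single_zero _ _)).symm
  | right s =>
    have h0 : boxD n (passOp t v (Lab.right s)) = 0 := by
      unfold passOp
      split_ifs
      · exact boxD_r _ _
      · exact map_zero _
    have h1 : boxD n (heldOp t v (Lab.right s)) = 0 := by
      unfold heldOp passOp
      split_ifs
      · exact boxD_r _ _
      · exact map_zero _
      · exact map_zero _
    rw [twist_pass hl (by
      by_cases h : s = t
      · exact Or.inr (congrArg _ h)
      · exact Or.inl h), h0, h1]
    exact (map_zero _).trans ((congrArg _ tri_zero).trans (Matrix.single_zero _ _)).symm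
  | both s =>
    have e1 : transport t (boxδ v (Lab.both s)) = Matrix.single v (Lab.move v (Lab.both s))
        (arrMat t v (Lab.left s) * arrMat t (Lab.move v (Lab.left s)) (Lab.right (s + 1)) +
        arrMat t v (Lab.right (s + 1)) *
          arrMat t (Lab.move v (Lab.right (s + 1))) (Lab.left s)) := by
      rw [boxδ, map_add, map_mul, map_mul, transport_r, transport_r, transport_r, transport_r,
        Matrix.single_mul_single_same, Matrix.single_mul_single_same, box_move_left_right,
        box_move_right_left, Matrix.single_add]
    rw [e1, boxD_passOp, boxD_heldOp hl, takeOp_of_ne (l := Lab.both s) (by simp), zero_mul,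
      add_zero, ← take_join_both hl]
    have e2 := pass_take (t := t) v (Lab.left s) (Lab.right (s + 1))
    have e3 := held_join (t := t) v (Lab.right (s + 1)) (Lab.left s)
    have e4 : ∀ u : Vert n × Vert n, takeOp t u (Lab.left s) = 0 := fun _ => rfl
    have e5 : ∀ u : Vert n × Vert n, joinOp t u (Lab.right (s + 1)) = 0 := fun _ => rfl
    refine congrArg _ ?_
    simp only [arrMat]
    rw [tri_mul, tri_mul, tri_add, e2, ← e3, e4, e4, e5, e5]
    simp only [mul_zero, zero_mul, add_zero, zero_add, add_self]
    rfl

/-- The homomorphism `transport` is compatible with the differentials, if that of the matrices is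
twisted by the commutator with `twist`. -/
theorem transport_d (a : BoxAlg n) : ∀ v w, transport t (boxD n a) v w =
    (transport t a v w).map (boxD n) + twist t v * transport t a v w +
      transport t a v w * twist t w := by
  have hz : ((0 : Matrix (Fin 3) (Fin 3) (BoxAlg n)).map (boxD n)) = 0 := by
    ext i j; exact map_zero (boxD n)
  have hone : ((1 : Matrix (Fin 3) (Fin 3) (BoxAlg n)).map (boxD n)) = 0 := by
    ext i j
    rw [Matrix.map_apply, Matrix.one_apply]
    split_ifs
    · exact deriv_one _
    · exact map_zero _
  refine alg_induction (Q := boxQuiver n) (p := fun a => ∀ v w, transport t (boxD n a) v w =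
    (transport t a v w).map (boxD n) + twist t v * transport t a v w +
      transport t a v w * twist t w) ?_ ?_ ?_ ?_ ?_ ?_ a
  · intro v w
    rw [map_zero, map_zero, Matrix.zero_apply, hz, mul_zero, zero_mul, add_zero, add_zero]
  · intro a b ha hb v w
    rw [map_add, map_add, map_add, Matrix.add_apply, Matrix.add_apply, ha, hb, mul_add, add_mul,
      Matrix.map_add _ fun x y => map_add _ x y]
    abel
  · intro v w
    rw [show boxD n 1 = 0 from deriv_one _, map_zero, map_one, Matrix.zero_apply,
      Matrix.one_apply]
    split_ifs with h
    · subst h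
      rw [hone, mul_one, one_mul, zero_add, mat_add_self]
    · rw [hz, mul_zero, zero_mul, add_zero, add_zero]
  · intro a b ha hb v w
    have e : boxD n (a * b) = boxD n a * b + a * boxD n b := deriv_mul _ _ _
    rw [e, map_add, map_mul, map_mul, map_mul, Matrix.add_apply, Matrix.mul_apply,
      Matrix.mul_apply, Matrix.mul_apply, map_boxD_sum, Finset.mul_sum, Finset.sum_mul,
      ← Finset.sum_add_distrib, ← Finset.sum_add_distrib, ← Finset.sum_add_distrib]
    refine Finset.sum_congr rfl fun u _ => ?_
    rw [ha, hb, map_boxD_mul]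
    have h2 := mat_add_self (transport t a v u * twist t u * transport t b u w)
    have e2 : ∀ A A' B B' N M L : Matrix (Fin 3) (Fin 3) (BoxAlg n), A * M * B + A * M * B = 0 →
        (A' + N * A + A * M) * B + A * (B' + M * B + B * L) =
          A' * B + A * B' + N * (A * B) + A * B * L := by
      intro A A' B B' N M L h
      have : (A' + N * A + A * M) * B + A * (B' + M * B + B * L) =
        A' * B + A * B' + N * (A * B) + A * B * L + (A * M * B + A * M * B) := by noncomm_ring
      rw [this, h, add_zero]
    exact e2 _ _ _ _ _ _ _ h2
  · intro u v w
    rw [show boxD n ((boxQuiver n).e u) = 0 from deriv_e _ _, map_zero, transport_e,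
      Matrix.zero_apply, Matrix.single_apply]
    split_ifs with h
    · obtain ⟨rfl, rfl⟩ := h
      rw [hone, mul_one, one_mul, zero_add, mat_add_self]
    · rw [hz, mul_zero, zero_mul, add_zero, add_zero]
  · intro u l v w
    have e : boxD n ((boxQuiver n).r u l) = boxδ u l := deriv_r _ _ _
    rw [e]
    by_cases hl : Lab.valid u l
    · rw [transport_boxδ u l hl, transport_r, Matrix.single_apply, Matrix.single_apply]
      split_ifs with h
      · obtain ⟨rfl, rfl⟩ := h
        rfl
      · rw [hz, mul_zero, zero_mul, add_zero, add_zero]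
    · rw [boxδ_invalid _ _ hl, (boxQuiver n).r_invalid hl, map_zero, Matrix.zero_apply, hz,
        mul_zero, zero_mul, add_zero, add_zero]

end TransportHomotopy


section Cycles

open LQuiver

variable {n : ℕ} {t : ℕ}

theorem transport_tri (a : BoxAlg n) : ∀ v w, transport t a v w 1 0 = 0 ∧
    transport t a v w 2 0 = 0 ∧ transport t a v w 2 1 = 0 := by
  refine alg_induction (Q := boxQuiver n) (p := fun a => ∀ v w, transport t a v w 1 0 = 0 ∧
    transport t a v w 2 0 = 0 ∧ transport t a v w 2 1 = 0) ?_ ?_ ?_ ?_ ?_ ?_ a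
  · intro v w
    rw [map_zero]
    exact ⟨rfl, rfl, rfl⟩
  · intro a b ha hb v w
    rw [map_add]
    obtain ⟨h1, h2, h3⟩ := ha v w
    obtain ⟨h4, h5, h6⟩ := hb v w
    refine ⟨?_, ?_, ?_⟩ <;> rw [Matrix.add_apply, Matrix.add_apply]
    · rw [h1, h4, add_zero]
    · rw [h2, h5, add_zero]
    · rw [h3, h6, add_zero]
  · intro v w
    rw [map_one, Matrix.one_apply]
    split_ifs
    · exact ⟨rfl, rfl, rfl⟩
    · exact ⟨rfl, rfl, rfl⟩
  · intro a b ha hb v w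
    rw [map_mul, Matrix.mul_apply]
    refine ⟨?_, ?_, ?_⟩ <;> rw [Matrix.sum_apply] <;> refine Finset.sum_eq_zero fun u _ => ?_ <;>
      rw [Matrix.mul_apply, Fin.sum_univ_three] <;> obtain ⟨h1, h2, h3⟩ := ha v u <;>
      obtain ⟨h4, h5, h6⟩ := hb u w
    · rw [h1, h4, h5]; simp
    · rw [h2, h3, h5]; simp
    · rw [h2, h3, h6]; simp
  · intro u v w
    rw [transport_e, Matrix.single_apply]
    split_ifs
    · exact ⟨rfl, rfl, rfl⟩
    · exact ⟨rfl, rfl, rfl⟩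
  · intro u l v w
    rw [transport_r, Matrix.single_apply]
    split_ifs
    · exact ⟨rfl, rfl, rfl⟩
    · exact ⟨rfl, rfl, rfl⟩

theorem transport_mul_last (a b : BoxAlg n) (v w : Vert n × Vert n) :
    transport t (a * b) v w 2 2 = ∑ u, transport t a v u 2 2 * transport t b u w 2 2 := by
  rw [map_mul, Matrix.mul_apply, Matrix.sum_apply]
  refine Finset.sum_congr rfl fun u _ => ?_
  rw [Matrix.mul_apply, Fin.sum_univ_three, (transport_tri a v u).2.1, (transport_tri a v u).2.2,
    zero_mul, zero_mul, zero_add, zero_add]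

/-- The third diagonal entries of the matrices reproduce the element. -/
theorem transport_last (a : BoxAlg n) : ∀ b w, ∑ v, b * (boxQuiver n).e v *
    transport t a v w 2 2 = b * a * (boxQuiver n).e w := by
  refine alg_induction (Q := boxQuiver n) (p := fun a => ∀ b w, ∑ v, b * (boxQuiver n).e v *
    transport t a v w 2 2 = b * a * (boxQuiver n).e w) ?_ ?_ ?_ ?_ ?_ ?_ a
  · intro b w
    rw [map_zero, mul_zero, zero_mul]
    exact Finset.sum_eq_zero fun v _ => mul_zero _
  · intro a a' ha ha' b w
    rw [mul_add, add_mul, ← ha, ← ha', ← Finset.sum_add_distrib]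
    refine Finset.sum_congr rfl fun v _ => ?_
    rw [map_add, ← mul_add]
    rfl
  · intro b w
    rw [map_one, mul_one, Finset.sum_eq_single w]
    · rw [Matrix.one_apply_eq, Matrix.one_apply_eq, mul_one]
    · intro v _ hv
      rw [Matrix.one_apply_ne hv, Matrix.zero_apply, mul_zero]
    · exact fun h => absurd (Finset.mem_univ w) h
  · intro a a' ha ha' b w
    have e : ∀ v, b * (boxQuiver n).e v * transport t (a * a') v w 2 2 =
        ∑ u, (b * (boxQuiver n).e v * transport t a v u 2 2) * transport t a' u w 2 2 := by
      intro v
      rw [transport_mul_last, Finset.mul_sum]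
      exact Finset.sum_congr rfl fun u _ => (mul_assoc _ _ _).symm
    rw [Finset.sum_congr rfl fun v _ => e v, Finset.sum_comm]
    have e2 : ∀ u, ∑ v, (b * (boxQuiver n).e v * transport t a v u 2 2) *
        transport t a' u w 2 2 = b * a * (boxQuiver n).e u * transport t a' u w 2 2 := by
      intro u
      rw [← Finset.sum_mul, ha]
    rw [Finset.sum_congr rfl fun u _ => e2 u, ha', mul_assoc b a a']
  · intro u b w
    rw [transport_e, Finset.sum_eq_single u]
    · rw [Matrix.single_apply, mul_assoc b _ ((boxQuiver n).e w), (boxQuiver n).e_mul]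
      by_cases h : u = w
      · rw [if_pos ⟨rfl, h⟩, if_pos h, Matrix.one_apply_eq, mul_one]
      · rw [if_neg fun h' => h h'.2, if_neg h, Matrix.zero_apply, mul_zero, mul_zero]
    · intro v _ hv
      rw [Matrix.single_apply, if_neg fun h => hv h.1.symm, Matrix.zero_apply, mul_zero]
    · exact fun h => absurd (Finset.mem_univ u) h
  · intro u l b w
    rw [transport_r, Finset.sum_eq_single u]
    · rw [Matrix.single_apply]
      have hr := (boxQuiver n).r_e u l
      have hc : ∀ x, (boxQuiver n).r u l * x =
        (boxQuiver n).r u l * ((boxQuiver n).e (Lab.move u l) * x) := fun x => by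
          rw [← mul_assoc]; exact congrArg (· * x) hr.symm
      rw [mul_assoc b ((boxQuiver n).r u l), hc ((boxQuiver n).e w), (boxQuiver n).e_mul]
      by_cases h : Lab.move u l = w
      · rw [if_pos ⟨rfl, h⟩, if_pos h, mul_assoc]
        refine congrArg (b * ·) ?_
        exact ((boxQuiver n).e_r u l).trans hr.symm
      · rw [if_neg fun h' => h h'.2, if_neg h, Matrix.zero_apply, mul_zero, mul_zero, mul_zero]
    · intro v _ hv
      rw [Matrix.single_apply, if_neg fun h => hv h.1.symm, Matrix.zero_apply, mul_zero]
    · exact fun h => absurd (Finset.mem_univ u) h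

variable (t) in
/-- The entries of the first row, for paths that start anywhere and end at `w`. -/
def transRow (k : Fin 3) (w : Vert n × Vert n) (a : BoxAlg n) : BoxAlg n :=
  ∑ v, (boxQuiver n).e v * transport t a v w 0 k

theorem boxD_e_mul (v : Vert n × Vert n) (a : BoxAlg n) :
    boxD n ((boxQuiver n).e v * a) = (boxQuiver n).e v * boxD n a := by
  have h : boxD n ((boxQuiver n).e v * a) = _ := deriv_mul (boxDeriv n) ((boxQuiver n).e v) a
  rw [h, deriv_e, zero_mul, zero_add]

theorem boxD_transRow (k : Fin 3) (w : Vert n × Vert n) (a : BoxAlg n) :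
    boxD n (transRow t k w a) = ∑ v, (boxQuiver n).e v * boxD n (transport t a v w 0 k) := by
  rw [transRow, map_sum]
  exact Finset.sum_congr rfl fun v _ => boxD_e_mul v _

theorem transRow_d_zero (w : Vert n × Vert n) (a : BoxAlg n) :
    transRow t 0 w (boxD n a) = boxD n (transRow t 0 w a) := by
  rw [boxD_transRow, transRow]
  refine Finset.sum_congr rfl fun v _ => congrArg _ ?_
  rw [transport_d, Matrix.add_apply, Matrix.add_apply, Matrix.mul_apply, Matrix.mul_apply,
    Fin.sum_univ_three, Fin.sum_univ_three, (transport_tri a v w).1, (transport_tri a v w).2.1]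
  simp [twist, tri]

theorem transRow_d_one (w : Vert n × Vert n) (a : BoxAlg n) :
    transRow t 1 w (boxD n a) = boxD n (transRow t 1 w a) := by
  rw [boxD_transRow, transRow]
  refine Finset.sum_congr rfl fun v _ => congrArg _ ?_
  rw [transport_d, Matrix.add_apply, Matrix.add_apply, Matrix.mul_apply, Matrix.mul_apply,
    Fin.sum_univ_three, Fin.sum_univ_three, (transport_tri a v w).2.2]
  simp [twist, tri]

theorem transRow_d_two (w : Vert n × Vert n) (a : BoxAlg n) :
    transRow t 2 w (boxD n a) = boxD n (transRow t 2 w a) + a * (boxQuiver n).e w +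
      (transRow t 0 w a + transRow t 1 w a * putOp t w) := by
  have h := transport_last (t := t) a 1 w
  rw [one_mul] at h
  rw [boxD_transRow, ← h, transRow, transRow, transRow, Finset.sum_mul,
    ← Finset.sum_add_distrib, ← Finset.sum_add_distrib, ← Finset.sum_add_distrib]
  refine Finset.sum_congr rfl fun v _ => ?_
  rw [one_mul, mul_assoc, ← mul_add, ← mul_add, ← mul_add]
  refine congrArg _ ?_
  rw [transport_d, Matrix.add_apply, Matrix.add_apply, Matrix.mul_apply, Matrix.mul_apply,
    Fin.sum_univ_three, Fin.sum_univ_three]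
  simp [twist, tri]

/-- The arrows that remain after the arrows `(∅, s)` with `s < t` have been moved to the end. -/
def Allowed (t : ℕ) : Lab → Prop
  | Lab.left _ => True
  | Lab.right s => t ≤ s
  | Lab.both s => t ≤ s + 1

variable (n t) in
/-- The subalgebra generated by these arrows and the idempotents. -/
def restAlg : Subalgebra 𝔽 (BoxAlg n) :=
  Algebra.adjoin 𝔽 {a | (∃ v, a = (boxQuiver n).e v) ∨
    ∃ v l, Allowed t l ∧ a = (boxQuiver n).r v l}

theorem e_mem_rest (v : Vert n × Vert n) : (boxQuiver n).e v ∈ restAlg n t :=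
  Algebra.subset_adjoin (Or.inl ⟨v, rfl⟩)

theorem passOp_mem_rest {l : Lab} (h : Allowed t l) (v : Vert n × Vert n) :
    passOp t v l ∈ restAlg n (t + 1) := by
  unfold passOp
  split_ifs with hp
  · refine Algebra.subset_adjoin (Or.inr ⟨v, l, ?_, rfl⟩)
    cases l with
    | left s => trivial
    | right s => exact lt_of_le_of_ne h (Ne.symm hp)
    | both s => exact lt_of_le_of_ne h (Ne.symm hp)
  · exact zero_mem _

theorem transport_mem {a : BoxAlg n} (ha : a ∈ restAlg n t) : ∀ v w,
    transport t a v w 0 0 ∈ restAlg n (t + 1) ∧ transport t a v w 0 1 ∈ restAlg n (t + 1) ∧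
      transport t a v w 1 1 ∈ restAlg n (t + 1) := by
  have hone : ∀ v w : Vert n × Vert n, ∀ c d : Fin 3,
      (if v = w then (1 : Matrix (Fin 3) (Fin 3) (BoxAlg n)) else 0) c d ∈ restAlg n (t + 1) := by
    intro v w c d
    split_ifs
    · rw [Matrix.one_apply]
      split_ifs
      · exact one_mem _
      · exact zero_mem _
    · exact zero_mem _
  induction ha using Algebra.adjoin_induction with
  | mem x hx =>
    rcases hx with ⟨u, rfl⟩ | ⟨u, l, hl, rfl⟩
    · intro v w
      rw [transport_e, Matrix.single_apply]
      by_cases h : u = v ∧ u = w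
      · rw [if_pos h]
        exact ⟨one_mem _, zero_mem _, one_mem _⟩
      · rw [if_neg h]
        exact ⟨zero_mem _, zero_mem _, zero_mem _⟩
    · intro v w
      rw [transport_r, Matrix.single_apply]
      split_ifs
      · refine ⟨passOp_mem_rest hl _, ?_, ?_⟩
        · change takeOp t u l ∈ _
          by_cases h : l = Lab.right t
          · subst h
            simp only [takeOp]
            split_ifs
            · exact e_mem_rest _
            · exact zero_mem _
          · rw [takeOp_of_ne h]
            exact zero_mem _
        · change heldOp t u l ∈ _
          unfold heldOp
          split_ifs
          · exact passOp_mem_rest hl _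
          · exact zero_mem _
      · exact ⟨zero_mem _, zero_mem _, zero_mem _⟩
  | algebraMap c =>
    intro v w
    rw [AlgHom.commutes, Algebra.algebraMap_eq_smul_one, Matrix.smul_apply, Matrix.smul_apply,
      Matrix.smul_apply, Matrix.smul_apply, Matrix.one_apply]
    exact ⟨Subalgebra.smul_mem _ (hone _ _ _ _) _, Subalgebra.smul_mem _ (hone _ _ _ _) _,
      Subalgebra.smul_mem _ (hone _ _ _ _) _⟩
  | add x y _ _ hx hy =>
    intro v w
    rw [map_add]
    exact ⟨add_mem (hx v w).1 (hy v w).1, add_mem (hx v w).2.1 (hy v w).2.1,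
      add_mem (hx v w).2.2 (hy v w).2.2⟩
  | mul x y _ _ hx hy =>
    intro v w
    rw [map_mul, Matrix.mul_apply]
    refine ⟨?_, ?_, ?_⟩ <;> rw [Matrix.sum_apply] <;> refine sum_mem fun u _ => ?_ <;>
      rw [Matrix.mul_apply, Fin.sum_univ_three] <;> obtain ⟨h1, h2, h3⟩ := hx v u <;>
      obtain ⟨h4, h5, h6⟩ := hy u w <;> obtain ⟨h7, h8, h9⟩ := transport_tri (t := t) x v u <;>
      obtain ⟨h10, h11, h12⟩ := transport_tri (t := t) y u w
    · rw [h10, h11, mul_zero, mul_zero, add_zero, add_zero]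
      exact mul_mem h1 h4
    · rw [h12, mul_zero, add_zero]
      exact add_mem (mul_mem h1 h5) (mul_mem h2 h6)
    · rw [h7, h12, zero_mul, mul_zero, zero_add, add_zero]
      exact mul_mem h3 h6

theorem transRow_mem {a : BoxAlg n} (ha : a ∈ restAlg n t) (w : Vert n × Vert n) :
    transRow t 0 w a ∈ restAlg n (t + 1) ∧ transRow t 1 w a ∈ restAlg n (t + 1) :=
  ⟨sum_mem fun v _ => mul_mem (e_mem_rest v) (transport_mem ha v w).1,
    sum_mem fun v _ => mul_mem (e_mem_rest v) (transport_mem ha v w).2.1⟩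

/-- A cycle is homologous to a sum of cycles not involving the arrow `(∅, t)`, multiplied by such
arrows. -/
theorem cycle_decomp {a : BoxAlg n} (ha : boxD n a = 0) :
    a = ∑ w, (transRow t 0 w a + transRow t 1 w a * putOp t w) +
      boxD n (∑ w, transRow t 2 w a) := by
  have h : ∀ w, a * (boxQuiver n).e w = (transRow t 0 w a + transRow t 1 w a * putOp t w) +
      boxD n (transRow t 2 w a) := by
    intro w
    -- The upper right entries form a homotopy between the identity, the third diagonal entry, and the
    -- sum of the passing and the removed parts.
    have h := transRow_d_two (t := t) w a
    have h0 : transRow t 2 w (boxD n a) = 0 := by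
      rw [ha, transRow]
      refine Finset.sum_eq_zero fun v _ => ?_
      rw [map_zero, Matrix.zero_apply, Matrix.zero_apply, mul_zero]
    rw [h0] at h
    have e : ∀ x y z : BoxAlg n, 0 = x + y + z → y = z + x := fun x y z h => by
      rw [← neg_eq (z + x)]
      exact eq_neg_of_add_eq_zero_left (by rw [h]; abel)
    exact e _ _ _ h
  rw [map_sum, ← Finset.sum_add_distrib, ← Finset.sum_congr rfl fun w _ => h w, ← Finset.mul_sum,
    (boxQuiver n).sum_e, mul_one]

end Cycles


/-! ### Formality -/

section Formality

open LQuiver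

variable {n : ℕ}

/-- Products of elements of corners. -/
theorem corner_mul_zero {Q : LQuiver} {v w : Q.V} {a b : Q.Alg} (ha : a * Q.e v = a)
    (hb : Q.e w * b = b) (h : v ≠ w) : a * b = 0 := by
  rw [← ha, ← hb, mul_assoc, ← mul_assoc (Q.e v), LQuiver.e_mul, if_neg h, zero_mul, mul_zero]

theorem e_e (Q : LQuiver) (v : Q.V) : Q.e v * Q.e v = Q.e v := by
  rw [LQuiver.e_mul, if_pos rfl]

theorem sum_mul_sum_corner {Q : LQuiver} {ι : Type} [Fintype ι] (u w : ι → Q.V) (f g : ι → Q.Alg)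
    (hf : ∀ i, f i * Q.e (u i) = f i) (hg : ∀ i, Q.e (w i) * g i = g i)
    (h : ∀ i j, u i = w j → i = j) : (∑ i, f i) * ∑ j, g j = ∑ i, f i * g i := by
  rw [Finset.sum_mul_sum]
  exact Finset.sum_congr rfl fun i _ => Finset.sum_eq_single i
    (fun j _ hj => corner_mul_zero (hf i) (hg j) fun h' => hj (h i j h').symm)
    fun h => absurd (Finset.mem_univ i) h

variable (n) in
/-- The inclusion of the first factor. -/
def leftIncl : (quiver n).Alg →ₐ[𝔽] BoxAlg n :=
  lift
    { e := fun x => ∑ y : Vert n, (boxQuiver n).e (x, y)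
      r := fun x s => ∑ y : Vert n, (boxQuiver n).r (x, y) (Lab.left s)
      e_mul := fun x x' => by
        refine (sum_mul_sum_corner (Q := boxQuiver n) (fun y => (x, y)) (fun y => (x', y)) _ _
          (fun _ => e_e _ _) (fun _ => e_e _ _) fun _ _ h => congrArg Prod.snd h).trans ?_
        split_ifs with h
        · subst h
          exact Finset.sum_congr rfl fun y _ => e_e _ _
        · exact Finset.sum_eq_zero fun y _ => corner_mul_zero (e_e _ _) (e_e _ _)
            fun h' => h (congrArg Prod.fst h')
      e_r := fun x s => (sum_mul_sum_corner (Q := boxQuiver n) (fun y => (x, y)) (fun y => (x, y))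
        _ _ (fun _ => e_e _ _) (fun _ => (boxQuiver n).e_r _ _)
        fun _ _ h => congrArg Prod.snd h).trans
          (Finset.sum_congr rfl fun y _ => (boxQuiver n).e_r _ _)
      r_e := fun x s => (sum_mul_sum_corner (Q := boxQuiver n) (fun y => (x ∪ pair n s, y))
        (fun y => (x ∪ pair n s, y)) _ _ (fun y => (boxQuiver n).r_e (x, y) (Lab.left s))
        (fun _ => e_e _ _) fun _ _ h => congrArg Prod.snd h).trans
          (Finset.sum_congr rfl fun y _ => (boxQuiver n).r_e (x, y) (Lab.left s))
      r_invalid := fun x s h => Finset.sum_eq_zero fun y _ => (boxQuiver n).r_invalid h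
      r_comm := fun x s s' _ => by
        refine (sum_mul_sum_corner (Q := boxQuiver n) (fun y => (x ∪ pair n s, y))
          (fun y => (x ∪ pair n s, y)) _ _ (fun y => (boxQuiver n).r_e (x, y) (Lab.left s))
          (fun y => (boxQuiver n).e_r _ _) fun _ _ h => congrArg Prod.snd h).trans ?_
        refine Eq.trans ?_ (sum_mul_sum_corner (Q := boxQuiver n) (fun y => (x ∪ pair n s', y))
          (fun y => (x ∪ pair n s', y)) _ _ (fun y => (boxQuiver n).r_e (x, y) (Lab.left s'))
          (fun y => (boxQuiver n).e_r _ _) fun _ _ h => congrArg Prod.snd h).symm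
        exact Finset.sum_congr rfl fun y _ =>
          box_comm (x, y) (l := Lab.left s) (l' := Lab.left s') trivial
      sum_e := by
        rw [← (boxQuiver n).sum_e]
        exact (Fintype.sum_prod_type _).symm }

variable (n) in
/-- The inclusion of the second factor. -/
def rightIncl : (quiver n).Alg →ₐ[𝔽] BoxAlg n :=
  lift
    { e := fun y => ∑ x : Vert n, (boxQuiver n).e (x, y)
      r := fun y s => ∑ x : Vert n, (boxQuiver n).r (x, y) (Lab.right s)
      e_mul := fun y y' => by
        refine (sum_mul_sum_corner (Q := boxQuiver n) (fun x => (x, y)) (fun x => (x, y')) _ _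
          (fun _ => e_e _ _) (fun _ => e_e _ _) fun _ _ h => congrArg Prod.fst h).trans ?_
        split_ifs with h
        · subst h
          exact Finset.sum_congr rfl fun x _ => e_e _ _
        · exact Finset.sum_eq_zero fun x _ => corner_mul_zero (e_e _ _) (e_e _ _)
            fun h' => h (congrArg Prod.snd h')
      e_r := fun y s => (sum_mul_sum_corner (Q := boxQuiver n) (fun x => (x, y)) (fun x => (x, y))
        _ _ (fun _ => e_e _ _) (fun _ => (boxQuiver n).e_r _ _)
        fun _ _ h => congrArg Prod.fst h).trans
          (Finset.sum_congr rfl fun x _ => (boxQuiver n).e_r _ _)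
      r_e := fun y s => (sum_mul_sum_corner (Q := boxQuiver n) (fun x => (x, y ∪ pair n s))
        (fun x => (x, y ∪ pair n s)) _ _ (fun x => (boxQuiver n).r_e (x, y) (Lab.right s))
        (fun _ => e_e _ _) fun _ _ h => congrArg Prod.fst h).trans
          (Finset.sum_congr rfl fun x _ => (boxQuiver n).r_e (x, y) (Lab.right s))
      r_invalid := fun y s h => Finset.sum_eq_zero fun x _ => (boxQuiver n).r_invalid h
      r_comm := fun y s s' _ => by
        refine (sum_mul_sum_corner (Q := boxQuiver n) (fun x => (x, y ∪ pair n s))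
          (fun x => (x, y ∪ pair n s)) _ _ (fun x => (boxQuiver n).r_e (x, y) (Lab.right s))
          (fun x => (boxQuiver n).e_r _ _) fun _ _ h => congrArg Prod.fst h).trans ?_
        refine Eq.trans ?_ (sum_mul_sum_corner (Q := boxQuiver n) (fun x => (x, y ∪ pair n s'))
          (fun x => (x, y ∪ pair n s')) _ _ (fun x => (boxQuiver n).r_e (x, y) (Lab.right s'))
          (fun x => (boxQuiver n).e_r _ _) fun _ _ h => congrArg Prod.fst h).symm
        exact Finset.sum_congr rfl fun x _ =>
          box_comm (x, y) (l := Lab.right s) (l' := Lab.right s') trivial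
      sum_e := by
        rw [← (boxQuiver n).sum_e]
        rw [Finset.sum_comm]
        exact (Fintype.sum_prod_type _).symm }

theorem leftIncl_e (x : Vert n) : leftIncl n ((quiver n).e x) =
    ∑ y : Vert n, (boxQuiver n).e (x, y) := lift_e _ _

theorem leftIncl_r (x : Vert n) (s : ℕ) : leftIncl n ((quiver n).r x s) =
    ∑ y : Vert n, (boxQuiver n).r (x, y) (Lab.left s) := lift_r _ _ _

theorem rightIncl_e (y : Vert n) : rightIncl n ((quiver n).e y) =
    ∑ x : Vert n, (boxQuiver n).e (x, y) := lift_e _ _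

theorem rightIncl_r (y : Vert n) (s : ℕ) : rightIncl n ((quiver n).r y s) =
    ∑ x : Vert n, (boxQuiver n).r (x, y) (Lab.right s) := lift_r _ _ _

theorem corner_sum_left {Q : LQuiver} {ι : Type} [Fintype ι] (f : ι → Q.V) (g : ι → Q.Alg)
    (hf : Function.Injective f) (hg : ∀ i, Q.e (f i) * g i = g i) (i : ι) :
    Q.e (f i) * ∑ j, g j = g i := by
  classical
  rw [Finset.mul_sum, Finset.sum_eq_single i, hg]
  · exact fun j _ hj => corner_mul_zero (e_e _ _) (hg j) fun h => hj (hf h).symm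
  · exact fun h => absurd (Finset.mem_univ i) h

theorem corner_sum_right {Q : LQuiver} {ι : Type} [Fintype ι] (f : ι → Q.V) (g : ι → Q.Alg)
    (hf : Function.Injective f) (hg : ∀ i, g i * Q.e (f i) = g i) (i : ι) :
    (∑ j, g j) * Q.e (f i) = g i := by
  classical
  rw [Finset.sum_mul, Finset.sum_eq_single i, hg]
  · exact fun j _ hj => corner_mul_zero (hg j) (e_e _ _) fun h => hj (hf h)
  · exact fun h => absurd (Finset.mem_univ i) h

theorem corner_sum_zero {Q : LQuiver} {ι : Type} [Fintype ι] (f : ι → Q.V) (g : ι → Q.Alg)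
    (hg : ∀ i, Q.e (f i) * g i = g i) (v : Q.V) (hv : ∀ i, v ≠ f i) : Q.e v * ∑ j, g j = 0 := by
  rw [Finset.mul_sum]
  exact Finset.sum_eq_zero fun j _ => corner_mul_zero (e_e _ _) (hg j) (hv j)

/-- The product of the idempotents of the factors, and their products with the arrows. -/
theorem left_e_right_e (x y : Vert n) : leftIncl n ((quiver n).e x) *
    rightIncl n ((quiver n).e y) = (boxQuiver n).e (x, y) := by
  rw [leftIncl_e, rightIncl_e, Finset.sum_mul, Finset.sum_eq_single y]
  · exact corner_sum_left (Q := boxQuiver n) (fun x : Vert n => (x, y)) _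
      (fun _ _ h => congrArg Prod.fst h) (fun x => e_e _ _) x
  · exact fun y' _ hy => corner_sum_zero (Q := boxQuiver n) (fun x : Vert n => (x, y)) _
      (fun x => e_e _ _) _ fun x' h => hy (congrArg Prod.snd h)
  · exact fun h => absurd (Finset.mem_univ y) h

theorem right_e_left_e (x y : Vert n) : rightIncl n ((quiver n).e y) *
    leftIncl n ((quiver n).e x) = (boxQuiver n).e (x, y) := by
  rw [leftIncl_e, rightIncl_e, Finset.sum_mul, Finset.sum_eq_single x]
  · exact corner_sum_left (Q := boxQuiver n) (fun y : Vert n => (x, y)) _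
      (fun _ _ h => congrArg Prod.snd h) (fun x => e_e _ _) y
  · exact fun x' _ hx => corner_sum_zero (Q := boxQuiver n) (fun y : Vert n => (x, y)) _
      (fun x => e_e _ _) _ fun x' h => hx (congrArg Prod.fst h)
  · exact fun h => absurd (Finset.mem_univ x) h

theorem left_r_right_e (x y : Vert n) (s : ℕ) : leftIncl n ((quiver n).r x s) *
    rightIncl n ((quiver n).e y) = (boxQuiver n).r (x, y) (Lab.left s) := by
  have h : leftIncl n ((quiver n).r x s) =
    leftIncl n ((quiver n).r x s) * leftIncl n ((quiver n).e (x ∪ pair n s)) := by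
      rw [← map_mul]; exact congrArg _ ((quiver n).r_e x s).symm
  rw [h, mul_assoc, left_e_right_e, leftIncl_r]
  exact corner_sum_right (Q := boxQuiver n) (fun y : Vert n => (x ∪ pair n s, y)) _
      (fun _ _ h => congrArg Prod.snd h) (fun y => (boxQuiver n).r_e (x, y) (Lab.left s)) y

theorem right_e_left_r (x y : Vert n) (s : ℕ) : rightIncl n ((quiver n).e y) *
    leftIncl n ((quiver n).r x s) = (boxQuiver n).r (x, y) (Lab.left s) := by
  have h : leftIncl n ((quiver n).r x s) =
    leftIncl n ((quiver n).e x) * leftIncl n ((quiver n).r x s) := by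
      rw [← map_mul]; exact congrArg _ ((quiver n).e_r x s).symm
  rw [h, ← mul_assoc, right_e_left_e, leftIncl_r]
  exact corner_sum_left (Q := boxQuiver n) (fun y : Vert n => (x, y)) _
      (fun _ _ h => congrArg Prod.snd h) (fun y => (boxQuiver n).e_r (x, y) (Lab.left s)) y

theorem left_e_right_r (x y : Vert n) (s : ℕ) : leftIncl n ((quiver n).e x) *
    rightIncl n ((quiver n).r y s) = (boxQuiver n).r (x, y) (Lab.right s) := by
  have h : rightIncl n ((quiver n).r y s) =
    rightIncl n ((quiver n).e y) * rightIncl n ((quiver n).r y s) := by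
      rw [← map_mul]; exact congrArg _ ((quiver n).e_r y s).symm
  rw [h, ← mul_assoc, left_e_right_e, rightIncl_r]
  exact corner_sum_left (Q := boxQuiver n) (fun x : Vert n => (x, y)) _
      (fun _ _ h => congrArg Prod.fst h) (fun x => (boxQuiver n).e_r (x, y) (Lab.right s)) x

theorem right_r_left_e (x y : Vert n) (s : ℕ) : rightIncl n ((quiver n).r y s) *
    leftIncl n ((quiver n).e x) = (boxQuiver n).r (x, y) (Lab.right s) := by
  have h : rightIncl n ((quiver n).r y s) =
    rightIncl n ((quiver n).r y s) * rightIncl n ((quiver n).e (y ∪ pair n s)) := by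
      rw [← map_mul]; exact congrArg _ ((quiver n).r_e y s).symm
  rw [h, mul_assoc, right_e_left_e, rightIncl_r]
  exact corner_sum_right (Q := boxQuiver n) (fun x : Vert n => (x, y ∪ pair n s)) _
      (fun _ _ h => congrArg Prod.fst h) (fun x => (boxQuiver n).r_e (x, y) (Lab.right s)) x

theorem commute_left_e (x : Vert n) (b : (quiver n).Alg) :
    Commute (leftIncl n ((quiver n).e x)) (rightIncl n b) := by
  refine alg_induction (Q := quiver n)
    (p := fun b => Commute (leftIncl n ((quiver n).e x)) (rightIncl n b)) ?_ ?_ ?_ ?_ ?_ ?_ b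
  · rw [map_zero]; exact Commute.zero_right _
  · intro a b ha hb
    rw [map_add]; exact ha.add_right hb
  · rw [map_one]; exact Commute.one_right _
  · intro a b ha hb
    rw [map_mul]; exact ha.mul_right hb
  · exact fun y => (left_e_right_e x y).trans (right_e_left_e x y).symm
  · exact fun y s => (left_e_right_r x y s).trans (right_r_left_e x y s).symm

theorem commute_right_e (y : Vert n) (a : (quiver n).Alg) :
    Commute (rightIncl n ((quiver n).e y)) (leftIncl n a) := by
  refine alg_induction (Q := quiver n)
    (p := fun a => Commute (rightIncl n ((quiver n).e y)) (leftIncl n a)) ?_ ?_ ?_ ?_ ?_ ?_ a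
  · rw [map_zero]; exact Commute.zero_right _
  · intro a b ha hb
    rw [map_add]; exact ha.add_right hb
  · rw [map_one]; exact Commute.one_right _
  · intro a b ha hb
    rw [map_mul]; exact ha.mul_right hb
  · exact fun x => (right_e_left_e x y).trans (left_e_right_e x y).symm
  · exact fun x s => (right_e_left_r x y s).trans (left_r_right_e x y s).symm

variable (n) in
/-- The section `a ⊗ b ↦ (a, ∅) (∅, b)` of `H`. -/
def boxSection : (quiver n).Alg ⊗[𝔽] (quiver n).Alg →ₗ[𝔽] BoxAlg n :=
  LinearMap.mul' 𝔽 (BoxAlg n) ∘ₗ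
    TensorProduct.map (leftIncl n).toLinearMap (rightIncl n).toLinearMap

theorem boxSection_tmul (a b : (quiver n).Alg) :
    boxSection n (a ⊗ₜ b) = leftIncl n a * rightIncl n b := rfl

/-- Multiplication by arrows of the first factor from the left and of the second one from the
right preserves the image of the section. -/
theorem mul_boxSection (c : (quiver n).Alg) (y : Vert n)
    (u : (quiver n).Alg ⊗[𝔽] (quiver n).Alg) :
    leftIncl n c * rightIncl n ((quiver n).e y) * boxSection n u ∈
      LinearMap.range (boxSection n) := by
  induction u using TensorProduct.induction_on with
  | zero => rw [map_zero, mul_zero]; exact zero_mem _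
  | add u u' h h' => rw [map_add, mul_add]; exact add_mem h h'
  | tmul a b =>
    refine ⟨(c * a) ⊗ₜ ((quiver n).e y * b), ?_⟩
    rw [boxSection_tmul, boxSection_tmul, map_mul, map_mul, mul_assoc, mul_assoc, ← mul_assoc _ _
      (rightIncl n b), ← (commute_right_e y a).eq, mul_assoc]

theorem boxSection_mul (c : (quiver n).Alg) (x : Vert n)
    (u : (quiver n).Alg ⊗[𝔽] (quiver n).Alg) :
    boxSection n u * (leftIncl n ((quiver n).e x) * rightIncl n c) ∈
      LinearMap.range (boxSection n) := by
  induction u using TensorProduct.induction_on with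
  | zero => rw [map_zero, zero_mul]; exact zero_mem _
  | add u u' h h' => rw [map_add, add_mul]; exact add_mem h h'
  | tmul a b =>
    refine ⟨(a * (quiver n).e x) ⊗ₜ (b * c), ?_⟩
    rw [boxSection_tmul, boxSection_tmul, map_mul, map_mul, mul_assoc, mul_assoc, ← mul_assoc _ _
      (rightIncl n c), (commute_left_e x b).eq, mul_assoc]

variable (n) in
/-- The homomorphism `H : R_n ⊠ R_n ⟶ R_n ⊗ R_n` of algebras. -/
abbrev boxH : BoxAlg n →ₐ[𝔽] (quiver n).Alg ⊗[𝔽] (quiver n).Alg := lift (formalityRep n)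

theorem boxH_e (x y : Vert n) :
    boxH n ((boxQuiver n).e (x, y)) = (quiver n).e x ⊗ₜ (quiver n).e y := lift_e _ _

theorem boxH_leftIncl (a : (quiver n).Alg) : boxH n (leftIncl n a) = a ⊗ₜ 1 := by
  refine AlgHom.congr_fun (φ₁ := (boxH n).comp (leftIncl n))
    (φ₂ := Algebra.TensorProduct.includeLeft) (algHom_ext (fun x => ?_) fun x s => ?_) a
  · rw [AlgHom.comp_apply, leftIncl_e, map_sum, Algebra.TensorProduct.includeLeft_apply,
      ← (quiver n).sum_e, TensorProduct.tmul_sum]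
    exact Finset.sum_congr rfl fun y _ => lift_e _ _
  · rw [AlgHom.comp_apply, leftIncl_r, map_sum, Algebra.TensorProduct.includeLeft_apply,
      ← (quiver n).sum_e, TensorProduct.tmul_sum]
    exact Finset.sum_congr rfl fun y _ => lift_r _ _ _

theorem boxH_rightIncl (b : (quiver n).Alg) : boxH n (rightIncl n b) = 1 ⊗ₜ b := by
  refine AlgHom.congr_fun (φ₁ := (boxH n).comp (rightIncl n))
    (φ₂ := Algebra.TensorProduct.includeRight) (algHom_ext (fun x => ?_) fun x s => ?_) b
  · rw [AlgHom.comp_apply, rightIncl_e, map_sum, Algebra.TensorProduct.includeRight_apply,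
      ← (quiver n).sum_e, TensorProduct.sum_tmul]
    exact Finset.sum_congr rfl fun y _ => lift_e _ _
  · rw [AlgHom.comp_apply, rightIncl_r, map_sum, Algebra.TensorProduct.includeRight_apply,
      ← (quiver n).sum_e, TensorProduct.sum_tmul]
    exact Finset.sum_congr rfl fun y _ => lift_r _ _ _

theorem boxH_boxSection (u : (quiver n).Alg ⊗[𝔽] (quiver n).Alg) :
    boxH n (boxSection n u) = u := by
  induction u using TensorProduct.induction_on with
  | zero => rw [map_zero, map_zero]
  | add u u' h h' => rw [map_add, map_add, h, h']
  | tmul a b =>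
    rw [boxSection_tmul, map_mul, boxH_leftIncl, boxH_rightIncl,
      Algebra.TensorProduct.tmul_mul_tmul, one_mul, mul_one]

theorem boxH_d (a : BoxAlg n) : boxH n (boxD n a) = 0 := formality_d n a

theorem boxD_leftIncl (a : (quiver n).Alg) : boxD n (leftIncl n a) = 0 := by
  refine alg_induction (Q := quiver n) (p := fun a => boxD n (leftIncl n a) = 0) ?_ ?_ ?_ ?_ ?_ ?_ a
  · rw [map_zero, map_zero]
  · intro a b ha hb
    rw [map_add, map_add, ha, hb, add_zero]
  · rw [map_one]; exact deriv_one _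
  · intro a b ha hb
    rw [map_mul]
    refine (deriv_mul _ _ _).trans ?_
    rw [show deriv (boxDeriv n) (leftIncl n a) = 0 from ha,
      show deriv (boxDeriv n) (leftIncl n b) = 0 from hb, zero_mul, mul_zero, add_zero]
  · intro x
    rw [leftIncl_e, map_sum]
    exact Finset.sum_eq_zero fun y _ => deriv_e _ _
  · intro x s
    rw [leftIncl_r, map_sum]
    exact Finset.sum_eq_zero fun y _ => boxD_r _ _

theorem boxD_rightIncl (a : (quiver n).Alg) : boxD n (rightIncl n a) = 0 := by
  refine alg_induction (Q := quiver n) (p := fun a => boxD n (rightIncl n a) = 0) ?_ ?_ ?_ ?_ ?_ ?_ a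
  · rw [map_zero, map_zero]
  · intro a b ha hb
    rw [map_add, map_add, ha, hb, add_zero]
  · rw [map_one]; exact deriv_one _
  · intro a b ha hb
    rw [map_mul]
    refine (deriv_mul _ _ _).trans ?_
    rw [show deriv (boxDeriv n) (rightIncl n a) = 0 from ha,
      show deriv (boxDeriv n) (rightIncl n b) = 0 from hb, zero_mul, mul_zero, add_zero]
  · intro x
    rw [rightIncl_e, map_sum]
    exact Finset.sum_eq_zero fun y _ => deriv_e _ _
  · intro x s
    rw [rightIncl_r, map_sum]
    exact Finset.sum_eq_zero fun y _ => boxD_r _ _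

theorem boxD_boxSection (u : (quiver n).Alg ⊗[𝔽] (quiver n).Alg) :
    boxD n (boxSection n u) = 0 := by
  induction u using TensorProduct.induction_on with
  | zero => rw [map_zero, map_zero]
  | add u u' h h' => rw [map_add, map_add, h, h', add_zero]
  | tmul a b =>
    rw [boxSection_tmul]
    refine (deriv_mul _ _ _).trans ?_
    rw [show deriv (boxDeriv n) (leftIncl n a) = 0 from boxD_leftIncl a,
      show deriv (boxDeriv n) (rightIncl n b) = 0 from boxD_rightIncl b, zero_mul, mul_zero,
      add_zero]

/-- A path that only involves arrows of the first factor is in the image of the section. -/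
theorem restAlg_le_range {a : BoxAlg n} (ha : a ∈ restAlg n n) :
    a ∈ LinearMap.range (boxSection n) := by
  have hone : (1 : BoxAlg n) ∈ LinearMap.range (boxSection n) :=
    ⟨1 ⊗ₜ 1, by rw [boxSection_tmul, map_one, map_one, mul_one]⟩
  have key : ∀ m ∈ LinearMap.range (boxSection n), a * m ∈ LinearMap.range (boxSection n) := by
    induction ha using Algebra.adjoin_induction with
    | mem x hx =>
      rintro _ ⟨u, rfl⟩
      rcases hx with ⟨⟨x, y⟩, rfl⟩ | ⟨⟨x, y⟩, l, hl, rfl⟩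
      · rw [← left_e_right_e]
        exact mul_boxSection _ _ _
      · cases l with
        | left s =>
          rw [← left_r_right_e]
          exact mul_boxSection _ _ _
        | right s =>
          have hs : n ≤ s := hl
          rw [(boxQuiver n).r_invalid (v := (x, y)) (l := Lab.right s) (fun h : CanAdd y s => absurd h.1 (by omega)), zero_mul]
          exact zero_mem _
        | both s =>
          have hs : n ≤ s + 1 := hl
          rw [(boxQuiver n).r_invalid (v := (x, y)) (l := Lab.both s)
            (fun h : CanAdd x s ∧ CanAdd y (s + 1) =>
            absurd h.2.1 (by omega)), zero_mul]
          exact zero_mem _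
    | algebraMap c =>
      intro m hm
      rw [← Algebra.smul_def]
      exact Submodule.smul_mem _ _ hm
    | add x y _ _ hx hy =>
      intro m hm
      rw [add_mul]
      exact add_mem (hx m hm) (hy m hm)
    | mul x y _ _ hx hy =>
      intro m hm
      rw [mul_assoc]
      exact hx _ (hy m hm)
  have h := key 1 hone
  rwa [mul_one] at h

theorem putOp_mem (t : ℕ) (w : Vert n × Vert n) (u : (quiver n).Alg ⊗[𝔽] (quiver n).Alg) :
    boxSection n u * putOp t w ∈ LinearMap.range (boxSection n) := by
  unfold putOp
  split_ifs
  · have h := left_e_right_r (unhold t w).1 (unhold t w).2 t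
    rw [show (boxQuiver n).r (unhold t w) (Lab.right t) = _ from h.symm]
    exact boxSection_mul _ _ _
  · rw [mul_zero]; exact zero_mem _

theorem boxD_putOp (t : ℕ) (w : Vert n × Vert n) : boxD n (putOp t w) = 0 := by
  unfold putOp
  split_ifs
  · exact boxD_r _ _
  · exact map_zero _

/-- Every cycle is homologous to an element of the image of the section. -/
theorem exists_section {a : BoxAlg n} (ha : boxD n a = 0) : ∃ u z, a = boxSection n u + boxD n z := by
  -- Induction on the number `k = n - t` of values of `s` whose arrows `(∅, s)` are still to be moved.
  have key : ∀ k t, n = t + k → ∀ a ∈ restAlg n t, boxD n a = 0 →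
      a ∈ LinearMap.range (boxSection n) ⊔ LinearMap.range (boxD n) := by
    intro k
    induction k with
    | zero =>
      rintro t rfl a ha _
      exact Submodule.mem_sup_left (restAlg_le_range ha)
    | succ k ih =>
      intro t ht a ha hd
      have h : ∀ w i, i = 0 ∨ i = 1 → transRow t i w a ∈
          LinearMap.range (boxSection n) ⊔ LinearMap.range (boxD n) := by
        intro w i hi
        have hz : ∀ i, transRow t i w 0 = 0 := fun i => by
          rw [transRow]
          refine Finset.sum_eq_zero fun v _ => ?_
          rw [map_zero, Matrix.zero_apply, Matrix.zero_apply, mul_zero]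
        refine ih (t + 1) (by omega) _ ?_ ?_
        · rcases hi with rfl | rfl
          · exact (transRow_mem ha w).1
          · exact (transRow_mem ha w).2
        · rcases hi with rfl | rfl
          · rw [← transRow_d_zero, hd, hz]
          · rw [← transRow_d_one, hd, hz]
      rw [cycle_decomp (t := t) hd]
      refine add_mem (sum_mem fun w _ => add_mem (h w 0 (Or.inl rfl)) ?_)
        (Submodule.mem_sup_right ⟨_, rfl⟩)
      obtain ⟨_, ⟨u, rfl⟩, _, ⟨z, rfl⟩, e⟩ := Submodule.mem_sup.1 (h w 1 (Or.inr rfl))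
      rw [← e, add_mul]
      refine add_mem (Submodule.mem_sup_left (putOp_mem t w u)) (Submodule.mem_sup_right
        ⟨z * putOp t w, ?_⟩)
      refine (deriv_mul _ _ _).trans ?_
      rw [show deriv (boxDeriv n) (putOp t w) = 0 from boxD_putOp t w, mul_zero, add_zero]
  -- Every element lies in the subalgebra for `t = 0`, from which no arrows are excluded.
  have htop : a ∈ restAlg n 0 := by
    refine alg_induction (Q := boxQuiver n) (p := fun a => a ∈ restAlg n 0) (zero_mem _)
      (fun _ _ => add_mem) (one_mem _) (fun _ _ => mul_mem) (fun v => e_mem_rest v)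
      (fun v l => Algebra.subset_adjoin (Or.inr ⟨v, l, ?_, rfl⟩)) a
    cases l
    · trivial
    · exact Nat.zero_le _
    · exact Nat.zero_le _
  obtain ⟨_, ⟨u, rfl⟩, _, ⟨z, rfl⟩, e⟩ := Submodule.mem_sup.1 (key n 0 (by omega) a htop ha)
  exact ⟨u, z, e.symm⟩

/-- `H` is injective on the homology. -/
theorem exists_boundary {a : BoxAlg n} (ha : boxD n a = 0) (h : boxH n a = 0) :
    ∃ z, a = boxD n z := by
  obtain ⟨u, z, rfl⟩ := exists_section ha
  rw [map_add, boxH_boxSection, boxH_d, add_zero] at h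
  exact ⟨z, by rw [h, map_zero, zero_add]⟩

end Formality


/-! ### Induction along a quasi-isomorphism -/

section Induction

variable {A B : QDGAlg} (φ : DGHom A B)

/-- Restriction of scalars. -/
def resMod (N : DGMod B) : DGMod A :=
  letI : Module A.carrier N.carrier := Module.compHom N.carrier φ.toAlgHom.toRingHom
  { carrier := N
    tower := ⟨fun c a x => by
      change φ.toAlgHom (c • a) • x = c • (φ.toAlgHom a • x)
      rw [map_smul, smul_assoc]⟩
    gr := N.gr
    internal := N.internal
    smul_mem := fun ha hm => N.smul_mem (φ.map_mem _ _ ha) hm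
    d := N.d
    d_mem := N.d_mem
    d_d := N.d_d
    leibniz := fun a m => by
      change N.d (φ.toAlgHom a • m) = φ.toAlgHom (A.d a) • m + φ.toAlgHom a • N.d m
      rw [N.leibniz, φ.map_d] }

/-- Maps over `B` are linear over `A`. -/
def resMap {N N' : DGMod B} (g : N →ₗ[B] N') : resMod φ N →ₗ[A] resMod φ N' where
  toFun := g
  map_add' := g.map_add
  map_smul' a x := g.map_smul (φ.toAlgHom a) x

/-- The induced module. -/
abbrev indMod (M : DGMod A) : DGMod B := tensorMod (indBimod φ) M

/-- The element `b ⊗ m` of the induced module. -/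
def indMk (M : DGMod A) (b : B) (m : M) : indMod φ M :=
  tensorMk (indBimod φ) M ((show indBimod φ from b) ⊗ₜ m)

theorem indMk_smul_left (M : DGMod A) (b c : B) (m : M) :
    b • indMk φ M c m = indMk φ M (b * c) m := rfl

theorem indMk_balanced (M : DGMod A) (b : B) (a : A) (m : M) :
    indMk φ M (b * φ.toAlgHom a) m = indMk φ M b (a • m) := by
  refine sub_eq_zero.1 ((map_sub (tensorMk (indBimod φ) M) _ _).symm.trans ?_)
  rw [tensorMk_eq_zero]
  exact Submodule.subset_span ⟨_, a, m, rfl⟩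

theorem indMk_add (M : DGMod A) (b : B) (m m' : M) :
    indMk φ M b (m + m') = indMk φ M b m + indMk φ M b m' :=
  (congrArg (tensorMk (indBimod φ) M) (TensorProduct.tmul_add _ _ _)).trans (map_add _ _ _)

theorem indMk_d (M : DGMod A) (b : B) (m : M) :
    (indMod φ M).d (indMk φ M b m) = indMk φ M (B.d b) m + indMk φ M b (M.d m) := rfl

theorem indMk_zero_left (M : DGMod A) (m : M) : indMk φ M 0 m = 0 :=
  (congrArg (tensorMk (indBimod φ) M) (TensorProduct.zero_tmul _ _)).trans (map_zero _)

theorem indMod_ind {M : DGMod A} {p : indMod φ M → Prop} (p0 : p 0)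
    (padd : ∀ x y, p x → p y → p (x + y)) (pt : ∀ b m, p (indMk φ M b m)) (x : indMod φ M) : p x :=
  tensorMod_ind (indBimod φ) p0 padd pt x

/-- The unit of the adjunction between induction and restriction. -/
def indUnit (M : DGMod A) : M →ₗ[A] resMod φ (indMod φ M) where
  toFun m := indMk φ M 1 m
  map_add' := indMk_add φ M 1
  map_smul' a m := by
    change indMk φ M 1 (a • m) = φ.toAlgHom a • indMk φ M 1 m
    rw [indMk_smul_left, ← indMk_balanced, one_mul, mul_one]

/-- The unit as an additive map to the induced module. -/
def unitMk (M : DGMod A) : M →+ indMod φ M where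
  toFun m := indMk φ M 1 m
  map_zero' := (indUnit φ M).map_zero
  map_add' := indMk_add φ M 1

theorem unitMk_d (M : DGMod A) (m : M) :
    (indMod φ M).d (unitMk φ M m) = unitMk φ M (M.d m) := by
  refine (indMk_d φ M 1 m).trans ?_
  rw [B.d_one, indMk_zero_left, zero_add]
  rfl

theorem indMk_mem (M : DGMod A) {b : B} {m : M} {k l : ℤ × ℤ} (hb : b ∈ B.gr k)
    (hm : m ∈ M.gr l) : indMk φ M b m ∈ (indMod φ M).gr (k + l) :=
  ⟨_, Submodule.subset_span ⟨k, l, rfl, _, hb, m, hm, rfl⟩, rfl⟩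

theorem unitMk_mem (M : DGMod A) {m : M} {k : ℤ × ℤ} (hm : m ∈ M.gr k) :
    unitMk φ M m ∈ (indMod φ M).gr k := by
  have h := indMk_mem φ M B.one_mem hm
  rwa [zero_add] at h

/-- The unit as a closed morphism. -/
def indUnitZ (M : DGMod A) : Z0 M (resMod φ (indMod φ M)) :=
  zmk (N := resMod φ (indMod φ M)) (indUnit φ M) (fun _ _ h => unitMk_mem φ M h) (unitMk_d φ M)

/-- The extension of a map to the induced module. -/
def indLift {M : DGMod A} {N : DGMod B} (g : M →ₗ[A] resMod φ N) : indMod φ M →ₗ[B] N :=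
  (balanced (indBimod φ) M).liftQ
    (TensorProduct.AlgebraTensorModule.lift
      { toFun := fun b =>
          { toFun := fun m => (show B from b) • (show N from g m)
            map_add' := fun x y => by
              rw [g.map_add]
              exact smul_add (show B from b) (show N from g x) (show N from g y)
            map_smul' := fun c x => by
              have h : g (c • x) = c • g x := map_smul (g.restrictScalars 𝔽) c x
              rw [h]
              exact smul_comm (show B from b) c (show N from g x) }
        map_add' := fun s t => LinearMap.ext fun x => add_smul (show B from s) (show B from t)
          (show N from g x)
        map_smul' := fun b t => LinearMap.ext fun x => mul_smul b (show B from t)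
          (show N from g x) }) (by
      refine Submodule.span_le.2 ?_
      rintro _ ⟨t, a, x, rfl⟩
      refine (map_sub _ _ _).trans (sub_eq_zero.2 ?_)
      change ((show B from t) * φ.toAlgHom a) • (show N from g x) =
        (show B from t) • (show N from g (a • x))
      rw [g.map_smul, mul_smul]
      rfl)

theorem indLift_mk {M : DGMod A} {N : DGMod B} (g : M →ₗ[A] resMod φ N) (b : B) (m : M) :
    indLift φ g (indMk φ M b m) = b • (show N from g m) := rfl

theorem indLift_mem {M : DGMod A} {N : DGMod B} {g : M →ₗ[A] resMod φ N} {i : ℤ}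
    (hg : g ∈ homDeg M (resMod φ N) i) : indLift φ g ∈ homDeg (indMod φ M) N i := by
  rintro k _ ⟨x, hx, rfl⟩
  induction hx using Submodule.span_induction with
  | mem x hx =>
    obtain ⟨a, b, rfl, t, ht, m, hm, rfl⟩ := hx
    have h := N.smul_mem (a := (show B from t)) ht (hg b m hm)
    rwa [← add_assoc] at h
  | zero => rw [map_zero, map_zero]; exact zero_mem _
  | add x y _ _ hx hy => rw [map_add, map_add]; exact add_mem hx hy
  | smul c x _ hx =>
    rw [map_smul]
    have h : indLift φ g (c • tensorMk (indBimod φ) M x) =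
      c • indLift φ g (tensorMk (indBimod φ) M x) := map_smul ((indLift φ g).restrictScalars 𝔽) c _
    rw [h]
    exact Submodule.smul_mem _ _ hx

/-- The unit of the adjunction is a quasi-isomorphism. -/
def UnitQis (M : DGMod A) : Prop :=
  (∀ m, M.d m = 0 → ∀ y, unitMk φ M m = (indMod φ M).d y → ∃ m', m = M.d m') ∧
    ∀ y, (indMod φ M).d y = 0 → ∃ m z, M.d m = 0 ∧ y = unitMk φ M m + (indMod φ M).d z

/-- All cycles are boundaries. -/
def Acyclic (N : DGMod A) : Prop := ∀ x, N.d x = 0 → ∃ y, x = N.d y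

theorem eq_of_add_eq_zero {N : Type} [AddCommGroup N] [Module 𝔽 N] {x y : N} (h : x + y = 0) :
    x = y := by
  rw [← neg_eq y]
  exact eq_neg_of_add_eq_zero_left h

theorem eq_add_of_add_eq {N : Type} [AddCommGroup N] [Module 𝔽 N] {x y z : N} (h : x + y = z) :
    x = y + z := by
  rw [← h, add_comm x y, ← add_assoc, add_self, zero_add]

variable {φ}

theorem UnitQis.acyclic {M : DGMod A} (h : UnitQis φ M) : Acyclic (cone (indUnitZ φ M)) := by
  intro x hx
  let y : indMod φ M := x.1
  obtain ⟨m, hm⟩ : ∃ m : M, m = x.2 := ⟨_, rfl⟩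
  have hxe : x = ((y : resMod φ (indMod φ M)), m) := Prod.ext rfl hm.symm
  rw [hxe] at hx
  have h1 : (indMod φ M).d y + unitMk φ M m = 0 := congrArg Prod.fst hx
  have h2 : M.d m = 0 := congrArg Prod.snd hx
  obtain ⟨m', rfl⟩ := h.1 m h2 y (eq_of_add_eq_zero h1).symm
  obtain ⟨m'', z, h3, h4⟩ := h.2 (y + unitMk φ M m') (by
    rw [map_add]
    exact (congrArg ((indMod φ M).d y + ·) (unitMk_d φ M m')).trans h1)
  refine ⟨((show resMod φ (indMod φ M) from z), m' + m''), hxe.trans (Prod.ext ?_ ?_)⟩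
  · change y = (indMod φ M).d z + unitMk φ M (m' + m'')
    rw [map_add]
    rw [add_comm, add_assoc, ← h4, add_comm y, ← add_assoc, add_self, zero_add]
  · change M.d m' = M.d (m' + m'')
    rw [map_add, h3, add_zero]

theorem UnitQis.shift {M : DGMod A} (h : UnitQis φ M) (a : ℤ × ℤ) : UnitQis φ (M.shift a) := h

theorem tensorZ_unit {M N : DGMod A} (f : Z0 M N) (m : M) :
    (tensorZ (indBimod φ) f).1 (unitMk φ M m) = unitMk φ N (f.1 m) := rfl

theorem UnitQis.iso {X Y : Ho A} (e : X ≅ Y) (h : UnitQis φ X.obj) : UnitQis φ Y.obj := by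
  obtain ⟨f, hf⟩ := cls_surj e.hom
  obtain ⟨g, hg⟩ := cls_surj e.inv
  have h1 : cls (zcomp g f) = cls (zid Y.obj) := by
    rw [← cls_comp, hf, hg]
    exact e.inv_hom_id
  obtain ⟨s, _, hs⟩ := cls_eq_iff.1 h1
  have h2 : cls (tensorZ (indBimod φ) (zcomp g f)) = cls (tensorZ (indBimod φ) (zid Y.obj)) :=
    congrArg (tensorFunctor (indBimod φ)).map h1
  obtain ⟨s', _, hs'⟩ := cls_eq_iff.1 h2
  constructor
  · intro y hy u hu
    obtain ⟨x, hx⟩ := h.1 (g.1 y) (by rw [Z0_comm, hy, map_zero])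
      ((tensorZ (indBimod φ) g).1 u) (by
        rw [Z0_comm, ← hu]
        rfl)
    have h3 : f.1 (g.1 y) = y + (Y.obj.d (s y) + s (Y.obj.d y)) := hs y
    rw [hy, map_zero, add_zero, hx] at h3
    exact ⟨f.1 x + s y, by
      rw [map_add, Z0_comm, h3, add_assoc, add_self, add_zero]⟩
  · intro y hy
    obtain ⟨x, z, hx, hz⟩ := h.2 ((tensorZ (indBimod φ) g).1 y) (by rw [Z0_comm, hy, map_zero])
    have h3 : (tensorZ (indBimod φ) (zcomp g f)).1 y = (tensorZ (indBimod φ) (zid Y.obj)).1 y +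
      ((indMod φ Y.obj).d (s' y) + s' ((indMod φ Y.obj).d y)) := hs' y
    rw [tensorZ_id, tensorZ_comp, hy, map_zero, add_zero] at h3
    have h4 : (tensorZ (indBimod φ) f).1 ((tensorZ (indBimod φ) g).1 y) =
      y + (indMod φ Y.obj).d (s' y) := h3
    rw [hz, map_add] at h4
    refine ⟨f.1 x, (tensorZ (indBimod φ) f).1 z + s' y, by rw [Z0_comm, hx, map_zero], ?_⟩
    rw [map_add, Z0_comm, ← add_assoc]
    have h5 := eq_add_of_add_eq h4.symm
    rw [add_comm, tensorZ_unit] at h5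
    exact h5

/-- The five lemma for the unit on the sequences `N ⟶ C(f) ⟶ M[1]`, by a chase of elements. -/
theorem UnitQis.cone {M N : DGMod A} (f : Z0 M N) (hM : UnitQis φ M) (hN : UnitQis φ N) :
    UnitQis φ (cone f) := by
  let F : Z0 (indMod φ M) (indMod φ N) := tensorZ (indBimod φ) f
  let c : Z0 (indMod φ (QDG.cone f)) (QDG.cone F) := (tensorConeMap (indBimod φ) f).1
  have hc : Function.Bijective c.1 := (tensorConeMap (indBimod φ) f).2
  have hcu : ∀ n m, c.1 (unitMk φ (QDG.cone f) (n, m)) = (unitMk φ N n, unitMk φ M m) :=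
    fun _ _ => rfl
  have hF : ∀ m, F.1 (unitMk φ M m) = unitMk φ N (f.1 m) := fun _ => rfl
  constructor
  · rintro ⟨n, m⟩ hx u hu
    have h1 : N.d n + f.1 m = 0 := congrArg Prod.fst hx
    have h2 : M.d m = 0 := congrArg Prod.snd hx
    have h3 := congrArg c.1 hu
    rw [← Z0_comm, hcu] at h3
    obtain ⟨⟨u₁, u₂⟩, hu'⟩ : ∃ u' : indMod φ N × indMod φ M, u' = c.1 u := ⟨_, rfl⟩
    rw [← hu'] at h3
    have h4 : unitMk φ N n = (indMod φ N).d u₁ + F.1 u₂ := congrArg Prod.fst h3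
    have h5 : unitMk φ M m = (indMod φ M).d u₂ := congrArg Prod.snd h3
    obtain ⟨m', rfl⟩ := hM.1 m h2 u₂ h5
    obtain ⟨z, w, hz, hw⟩ := hM.2 (u₂ + unitMk φ M m') (by
      rw [map_add, unitMk_d, ← h5, add_self])
    obtain ⟨n', hn'⟩ := hN.1 (n + f.1 (m' + z)) (by
        rw [map_add, Z0_comm, map_add M.d, hz, add_zero, h1])
      (u₁ + F.1 w) (by
        have h6 : u₂ = unitMk φ M m' + (unitMk φ M z + (indMod φ M).d w) := by
          rw [← hw, add_comm u₂, ← add_assoc, add_self, zero_add]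
        rw [map_add, h4, ← hF, map_add, map_add, map_add (indMod φ N).d, Z0_comm, h6]
        simp only [map_add]
        have h7 := add_self (F.1 (unitMk φ M m'))
        have h8 := add_self (F.1 (unitMk φ M z))
        calc _ = (indMod φ N).d u₁ + F.1 ((indMod φ M).d w) +
              (F.1 (unitMk φ M m') + F.1 (unitMk φ M m')) +
              (F.1 (unitMk φ M z) + F.1 (unitMk φ M z)) := by abel
          _ = _ := by rw [h7, h8, add_zero, add_zero])
    refine ⟨(n', m' + z), Prod.ext ?_ ?_⟩
    · change n = N.d n' + f.1 (m' + z)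
      rw [← hn', add_assoc, add_self, add_zero]
    · change M.d m' = M.d (m' + z)
      rw [map_add, hz, add_zero]
  · intro y hy
    have h1 := congrArg c.1 hy
    rw [← Z0_comm, map_zero] at h1
    obtain ⟨⟨y₁, y₂⟩, hy'⟩ : ∃ u' : indMod φ N × indMod φ M, u' = c.1 y := ⟨_, rfl⟩
    rw [← hy'] at h1
    have h2 : (indMod φ N).d y₁ + F.1 y₂ = 0 := congrArg Prod.fst h1
    have h3 : (indMod φ M).d y₂ = 0 := congrArg Prod.snd h1
    obtain ⟨m, u, hm, rfl⟩ := hM.2 y₂ h3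
    have h4 : (indMod φ N).d (y₁ + F.1 u) = unitMk φ N (f.1 m) := by
      rw [map_add, Z0_comm, ← hF]
      rw [map_add] at h2
      have h5 := eq_of_add_eq_zero h2
      rw [h5, add_assoc, add_self, add_zero]
    obtain ⟨n₁, hn₁⟩ := hN.1 (f.1 m) (by rw [Z0_comm, hm, map_zero]) _ h4.symm
    obtain ⟨n₂, u', hn₂, hu'⟩ := hN.2 (y₁ + F.1 u + unitMk φ N n₁) (by
      rw [map_add, h4, unitMk_d, ← hn₁, add_self])
    obtain ⟨z, hz⟩ := hc.2 (u', u)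
    refine ⟨(n₁ + n₂, m), z, Prod.ext ?_ hm, hc.1 ?_⟩
    · change N.d (n₁ + n₂) + f.1 m = 0
      rw [map_add, hn₂, add_zero, ← hn₁, add_self]
    · rw [map_add, hcu, ← Z0_comm, hz, ← hy']
      refine Prod.ext ?_ rfl
      change y₁ = unitMk φ N (n₁ + n₂) + ((indMod φ N).d u' + F.1 u)
      have h6 : y₁ = F.1 u + unitMk φ N n₁ + (unitMk φ N n₂ + (indMod φ N).d u') := by
        rw [← hu']
        have h7 := add_self (F.1 u + unitMk φ N n₁)
        calc y₁ = y₁ + (F.1 u + unitMk φ N n₁ + (F.1 u + unitMk φ N n₁)) := by rw [h7, add_zero]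
          _ = _ := by abel
      rw [h6, map_add]
      abel

open Pretriangulated LQuiver

theorem cls_comp_indUnitZ {φ : DGHom A B} {M M' : DGMod A} (g : Z0 M M')
    (h : cls (tensorZ (indBimod φ) g) = cls 0) : cls (zcomp g (indUnitZ φ M')) = cls 0 := by
  obtain ⟨s, hs, e⟩ := cls_eq_iff.1 h
  refine cls_eq (M := M) (N := resMod φ (indMod φ M')) (g := 0)
      (resMap φ s ∘ₗ indUnit φ M) (fun k m hm => hs k _ (unitMk_mem φ M hm)) fun m => ?_
  refine (e (unitMk φ M m)).trans ?_
  rw [unitMk_d]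
  rfl

theorem eq_zero_of_comp_indUnitZ {φ : DGHom A B} {M M' : DGMod A}
    (hX : ∀ N : DGMod A, Acyclic N → ∀ f : Ho.of M ⟶ Ho.of N, f = 0) (hY : UnitQis φ M')
    (f : Z0 M M') (hf : cls (zcomp f (indUnitZ φ M')) = cls 0) : cls f = 0 := by
  obtain ⟨s, hs, e⟩ := cls_eq_iff.1 hf
  let N : DGMod A := (cone (indUnitZ φ M')).shift (-1, 0)
  let g : Z0 M N := zmk (M := M) (N := N) (LinearMap.prod s f.1)
    (fun k m hm => by
      have h1 := hs k m hm
      have h2 : f.1 m ∈ M'.gr (k + (-1, 0) + (1, 0)) := by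
        rw [show k + (-1, 0) + (1, 0) = k by rw [add_assoc]; exact add_zero k]
        exact Z0_mem f hm
      exact ⟨h1, h2⟩)
    (fun m => by
      refine Prod.ext ?_ (Z0_comm f m)
      change (resMod φ (indMod φ M')).d (s m) + (indUnitZ φ M').1 (f.1 m) = s (M.d m)
      have h1 : (indUnitZ φ M').1 (f.1 m) =
        (resMod φ (indMod φ M')).d (s m) + s (M.d m) := (e m).trans (zero_add _)
      rw [h1, ← add_assoc, add_self, zero_add])
  obtain ⟨t, ht, e'⟩ := cls_eq_iff.1 ((hX N hY.acyclic (cls g)).trans cls_zero.symm)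
  refine (cls_eq (M := M) (N := M') (g := 0)
    (LinearMap.snd A (resMod φ (indMod φ M')) M' ∘ₗ t) (fun k m hm => ?_)
    fun m => congrArg Prod.snd (e' m)).trans cls_zero
  have h1 := (ht k m hm).2
  rw [show k + (-1, 0) + (-1, 0) + (1, 0) = k + (-1, 0) by
    rw [add_assoc (k + (-1, 0))]; exact add_zero _] at h1
  exact h1

/-- The functor of induction is faithful on the morphisms from `M` to `M'`, if the unit is a
quasi-isomorphism at `M'` and there are no morphisms from `M` to acyclic modules. -/
theorem indFunctor_map_injective {φ : DGHom A B} {M M' : DGMod A}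
    (hX : ∀ N : DGMod A, Acyclic N → ∀ f : Ho.of M ⟶ Ho.of N, f = 0) (hY : UnitQis φ M')
    {f f' : Z0 M M'} (hff : cls (tensorZ (indBimod φ) f) = cls (tensorZ (indBimod φ) f')) :
    cls f = cls f' := by
  obtain ⟨s, hs, e⟩ := cls_eq_iff.1 hff
  have h0 : cls (tensorZ (indBimod φ) (f + f')) = cls 0 := by
    have h1 : ∀ x, (tensorZ (indBimod φ) (f + f')).1 x =
        (tensorZ (indBimod φ) f).1 x + (tensorZ (indBimod φ) f').1 x := fun x => by
      refine indMod_ind φ (p := fun x => (tensorZ (indBimod φ) (f + f')).1 x =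
        (tensorZ (indBimod φ) f).1 x + (tensorZ (indBimod φ) f').1 x) ?_ ?_ ?_ x
      · simp only [map_zero, add_zero]
      · intro x y hx hy
        simp only [map_add, hx, hy]
        abel
      · intro b m
        exact indMk_add φ M' b (f.1 m) (f'.1 m)
    refine cls_eq (f := tensorZ (indBimod φ) (f + f')) (g := 0) s hs fun x => ?_
    rw [h1, e x]
    have h2 := add_self ((tensorZ (indBimod φ) f').1 x)
    calc _ = (tensorZ (indBimod φ) f').1 x + (tensorZ (indBimod φ) f').1 x +
          ((indMod φ M').d (s x) + s ((indMod φ M).d x)) := by abel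
      _ = _ := by rw [h2]; rfl
  have h3 : cls (f + f') = 0 := eq_zero_of_comp_indUnitZ hX hY _ (cls_comp_indUnitZ _ h0)
  have h4 : cls (f' + f') = 0 := by
    have : f' + f' = 0 := Subtype.ext (LinearMap.ext fun m => add_self (f'.1 m))
    rw [this]; rfl
  exact add_right_cancel (b := cls f') (h3.trans h4.symm)

theorem cls_indLift {φ : DGHom A B} {M M' : DGMod A} (g : Z0 (indMod φ M) (indMod φ M'))
    (f : Z0 M M') (s : M →ₗ[A] resMod φ (indMod φ M'))
    (hs : s ∈ homDeg M (resMod φ (indMod φ M')) (-1))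
    (e : ∀ m, g.1 (unitMk φ M m) = unitMk φ M' (f.1 m) +
        ((indMod φ M').d (s m) + (show indMod φ M' from s (M.d m)))) :
    cls g = cls (tensorZ (indBimod φ) f) := by
  refine cls_eq (M := indMod φ M) (N := indMod φ M') (indLift φ s) (indLift_mem φ hs) fun x => ?_
  refine indMod_ind φ (p := fun x => g.1 x = (tensorZ (indBimod φ) f).1 x +
    ((indMod φ M').d (indLift φ s x) + indLift φ s ((indMod φ M).d x))) ?_ ?_ ?_ x
  · simp only [map_zero, add_zero]
  · intro x y hx hy
    simp only [map_add, hx, hy]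
    abel
  · intro b m
    have e0 : indMk φ M b m = b • unitMk φ M m := by
      change _ = indMk φ M (b * 1) m
      rw [mul_one]
    have e1 : g.1 (indMk φ M b m) = b • g.1 (unitMk φ M m) :=
      (congrArg g.1 e0).trans (g.1.map_smul b _)
    have e2 : (tensorZ (indBimod φ) f).1 (indMk φ M b m) = b • unitMk φ M' (f.1 m) := by
      change indMk φ M' b (f.1 m) = indMk φ M' (b * 1) (f.1 m)
      rw [mul_one]
    obtain ⟨y, hy⟩ : ∃ y : indMod φ M', y = s m := ⟨_, rfl⟩
    obtain ⟨y', hy'⟩ : ∃ y : indMod φ M', y = s (M.d m) := ⟨_, rfl⟩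
    have e3 : indLift φ s (indMk φ M b m) = b • y := by rw [indLift_mk, hy]
    have e4 : indLift φ s ((indMod φ M).d (indMk φ M b m)) = B.d b • y + b • y' := by
      rw [indMk_d, map_add, indLift_mk, indLift_mk, hy, hy']
    have e5 : g.1 (unitMk φ M m) = unitMk φ M' (f.1 m) + ((indMod φ M').d y + y') := by
      rw [hy, hy']
      exact e m
    rw [e1, e2, e3, e4, e5, smul_add, smul_add, (indMod φ M').leibniz]
    have e6 := add_self (B.d b • y)
    calc _ = b • unitMk φ M' (f.1 m) + (b • (indMod φ M').d y + b • y') +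
          (B.d b • y + B.d b • y) := by rw [e6, add_zero]
      _ = _ := by abel

/-- A morphism between induced modules restricts to a morphism `u` from `X` to the restriction of the
induced module of `Y`, which lifts to `Y` since the cone of the unit is acyclic. -/
theorem indFunctor_map_surjective {φ : DGHom A B} {X Y : Ho A}
    (hX : ∀ N : DGMod A, Acyclic N → ∀ f : X ⟶ Ho.of N, f = 0) (hY : UnitQis φ Y.obj) :
    Function.Surjective fun f : X ⟶ Y => (tensorFunctor (indBimod φ)).map f := by
  have hT := coneTriangle_distinguished (indUnitZ φ Y.obj)
  intro g
  obtain ⟨g₀, hg₀⟩ := cls_surj g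
  let u : Z0 X.obj (resMod φ (indMod φ Y.obj)) :=
    zmk (M := X.obj) (N := resMod φ (indMod φ Y.obj)) (resMap φ g₀.1 ∘ₗ indUnit φ X.obj)
      (fun k m hm => Z0_mem g₀ (unitMk_mem φ X.obj hm))
      (fun m => (Z0_comm g₀ (unitMk φ X.obj m)).trans (congrArg g₀.1 (unitMk_d φ X.obj m)))
  obtain ⟨f, hf⟩ := Triangle.coyoneda_exact₂ _ hT (cls u)
    (hX (cone (indUnitZ φ Y.obj)) hY.acyclic (cls u ≫ cls (coneIn (indUnitZ φ Y.obj))))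
  refine ⟨f, ?_⟩
  obtain ⟨f₀, rfl⟩ : ∃ f₀ : Z0 X.obj Y.obj, cls f₀ = f := cls_surj f
  have hf' : cls u = cls (zcomp f₀ (indUnitZ φ Y.obj)) := hf
  obtain ⟨s, hs, e⟩ := cls_eq_iff.1 hf'
  rw [← hg₀]
  exact (cls_indLift g₀ f₀ s hs e).symm

variable {Q : LQuiver} {D : Q.DerivData} {h : ∀ v l, deriv D (D.δ v l) = 0}

theorem exists_boundary_homog {A : QDGAlg} {N : DGMod A} {k : ℤ × ℤ} {x y : N}
    (hx : x ∈ N.gr (k + (1, 0))) (hxy : x = N.d y) : ∃ y' ∈ N.gr k, x = N.d y' := by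
  obtain ⟨c, h1, h2, h3⟩ := exists_comp N.internal
  refine ⟨c y k, h2 y k, ?_⟩
  have h4 : c x = (c y).sum fun l z => Finsupp.single (l + (1, 0)) (N.d z) := by
    conv_lhs => rw [hxy, ← h1 y]
    rw [Finsupp.sum, Finsupp.sum, map_sum, map_sum]
    exact Finset.sum_congr rfl fun l _ => h3 _ _ (N.d_mem (h2 y l))
  have h5 := DFunLike.congr_fun h4 (k + (1, 0))
  rw [h3 _ _ hx, Finsupp.single_eq_same, Finsupp.sum_apply, Finsupp.sum,
    Finset.sum_eq_single k] at h5
  · rw [h5, Finsupp.single_eq_same]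
  · intro l _ hl
    exact Finsupp.single_eq_of_ne fun h' => hl (add_right_cancel h').symm
  · intro hk
    rw [Finsupp.notMem_support_iff.1 hk, map_zero, Finsupp.single_zero, Finsupp.zero_apply]

/-- Closed morphisms from a shifted module, as closed morphisms to a shifted module. -/
theorem cls_zero_of_shift {A : QDGAlg} {M N : DGMod A} {a : ℤ × ℤ}
    (hM : ∀ f : Ho.of M ⟶ Ho.of (N.shift (-a)), f = 0) (f : Ho.of (M.shift a) ⟶ Ho.of N) : f = 0 := by
  obtain ⟨g, rfl⟩ := cls_surj f
  let g' : Z0 M (N.shift (-a)) := zmk (M := M) (N := N.shift (-a)) g.1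
    (fun k m hm => Z0_mem g (k := k + -a) (by
      change m ∈ M.gr (k + -a + a)
      rwa [neg_add_cancel_right])) (fun m => Z0_comm g m)
  obtain ⟨s, hs, e⟩ := cls_eq_iff.1 ((hM (cls g')).trans cls_zero.symm)
  refine (cls_eq (M := M.shift a) (N := N) (g := 0) s (fun k m hm => ?_) e).trans cls_zero
  have h1 : s m ∈ N.gr (k + a + (-1, 0) + -a) := hs _ m hm
  rwa [show k + a + (-1, 0) + -a = k + (-1, 0) by abel] at h1

/-- There are no morphisms from the modules generated by the projective ones to acyclic modules. -/
theorem hom_acyclic {X : Ho (dgAlg D h)} (hX : genProj D h X) :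
    ∀ N : DGMod (dgAlg D h), Acyclic N → ∀ f : X ⟶ Ho.of N, f = 0 := by
  induction hX with
  | basic X hX =>
    intro N hN f
    obtain ⟨v, rfl⟩ := hX
    obtain ⟨g, rfl⟩ : ∃ g : Z0 (proj D h v) N, cls g = f := cls_surj f
    have hg : (proj D h v).d (gen v) = 0 := Subtype.ext (deriv_e D v)
    obtain ⟨y₀, hy₀⟩ := hN (g.1 (gen v))
      ((Z0_comm g _).trans ((congrArg g.1 hg).trans (map_zero _)))
    have hmem : g.1 (gen v) ∈ N.gr ((-1, 0) + (1, 0)) :=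
      Z0_mem g (k := (-1, 0) + (1, 0)) (e_mem (Q := Q) v)
    obtain ⟨y, hy, hy'⟩ := exists_boundary_homog hmem hy₀
    refine (cls_eq (M := proj D h v) (N := N) (g := 0) (projMap v y) (fun k m hm => ?_)
      fun m => ?_).trans cls_zero
    · exact N.smul_mem (a := m.1) hm hy
    · refine (proj_hom_apply (D := D) (h := h) g.1 m).trans ?_
      rw [hy']
      refine Eq.trans ?_ (zero_add _).symm
      change m.1 • N.d y = N.d (m.1 • y) + deriv D m.1 • y
      refine Eq.trans ?_ (congrArg (· + deriv D m.1 • y) (N.leibniz m.1 y).symm)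
      change m.1 • N.d y = deriv D m.1 • y + m.1 • N.d y + deriv D m.1 • y
      rw [add_comm (_ • y), add_assoc, add_self, add_zero]
  | shift M a _ ih =>
    intro N hN f
    exact cls_zero_of_shift (ih (N.shift (-a)) hN) f
  | @cone M M' g _ _ ih ih' =>
    intro N hN f
    obtain ⟨f', hf'⟩ := Triangle.yoneda_exact₃ (coneTriangle g) (coneTriangle_distinguished g) f
      (ih' N hN _)
    have h0 : f' = 0 := cls_zero_of_shift (a := (1, 0)) (ih (N.shift (-(1, 0))) hN) f'
    rw [hf', h0]
    exact comp_zero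
  | iso e _ ih =>
    intro N hN f
    rw [← Iso.inv_hom_id_assoc e f, ih N hN (e.hom ≫ f), comp_zero]

theorem unitQis_of_genProj {φ : DGHom (dgAlg D h) B} (hP : ∀ v, UnitQis φ (proj D h v))
    {X : Ho (dgAlg D h)} (hX : genProj D h X) : UnitQis φ X.obj := by
  induction hX with
  | basic X hX =>
    obtain ⟨v, rfl⟩ := hX
    exact hP v
  | shift M a _ ih => exact ih.shift a
  | cone g _ _ ih ih' => exact ih.cone g ih'
  | iso e _ ih => exact UnitQis.iso e ih

/-- Induction along a quasi-isomorphism is fully faithful on the modules generated by the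
projective ones. -/
theorem indFunctor_map_bijective {φ : DGHom (dgAlg D h) B} (hP : ∀ v, UnitQis φ (proj D h v))
    {X Y : Ho (dgAlg D h)} (hX : genProj D h X) (hY : genProj D h Y) :
    Function.Bijective fun f : X ⟶ Y => (tensorFunctor (indBimod φ)).map f :=
  ⟨fun f f' hff => by
    obtain ⟨f, rfl⟩ := cls_surj f
    obtain ⟨f', rfl⟩ := cls_surj f'
    exact indFunctor_map_injective (hom_acyclic hX) (unitQis_of_genProj hP hY) hff,
    indFunctor_map_surjective (hom_acyclic hX) (unitQis_of_genProj hP hY)⟩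

end Induction


/-! ### Induction from `R_n ⊠ R_n` to `R_n ⊗ R_n` -/

section Formality

open LQuiver Pretriangulated

variable {n : ℕ}

theorem unitMk_proj (v : Vert n × Vert n) (x : PP n v) :
    unitMk (formality n) (PP n v) x =
      tensorGen (indBimod (formality n)) v (show (indBimod (formality n)) from boxH n x.1) := by
  have h1 : indMk (formality n) (PP n v) (1 * boxH n x.1) (gen (Q := boxQuiver n) v) =
      indMk (formality n) (PP n v) 1 (x.1 • gen (Q := boxQuiver n) v) :=
    indMk_balanced (formality n) (PP n v) 1 x.1 (gen (Q := boxQuiver n) v)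
  have h2 : x.1 • gen (Q := boxQuiver n) v = x := smul_gen (Q := boxQuiver n) x
  refine (congrArg (indMk (formality n) (PP n v) 1) h2).symm.trans (h1.symm.trans ?_)
  exact congrArg (fun r => indMk (formality n) (PP n v) r (gen (Q := boxQuiver n) v)) (one_mul _)

/-- The quasi-isomorphism from `R_n ⊠ R_n` to its homology makes the unit of the induction functor
a quasi-isomorphism at projective modules. -/
theorem unitQis_proj (v : Vert n × Vert n) : UnitQis (formality n) (PP n v) := by
  have hd : ∀ y, (indMod (formality n) (PP n v)).d y = 0 := by
    intro y
    obtain ⟨t, -, rfl⟩ := tensorGen_surj (indBimod (formality n)) v y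
    refine (tensorGen_d (indBimod (formality n)) v t).trans ?_
    have h1 : (indBimod (formality n)).d t = 0 := tensor_d_zero n t
    rw [h1]
    exact map_zero _
  constructor
  · intro x hx y hy
    have h0 := (unitMk_proj v x).symm.trans (hy.trans (hd y))
    have h1 := (congrArg (tensorEval (indBimod (formality n)) v) h0).trans (map_zero _)
    have h2 : boxH n x.1 = 0 := by
      rw [← mem_leftIdeal.1 x.2, map_mul]
      exact h1
    obtain ⟨z, hz⟩ := exists_boundary (congrArg Subtype.val hx) h2
    refine ⟨(boxQuiver n).toIdeal v z, Subtype.ext ?_⟩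
    change x.1 = boxD n (z * (boxQuiver n).e v)
    refine (mem_leftIdeal.1 x.2).symm.trans ?_
    rw [hz]
    have h3 := deriv_mul (boxDeriv n) z ((boxQuiver n).e v)
    rw [deriv_e, mul_zero, add_zero] at h3
    exact h3.symm
  · intro y _
    obtain ⟨t, ht, rfl⟩ := tensorGen_surj (indBimod (formality n)) v y
    refine ⟨(boxQuiver n).toIdeal v (boxSection n t), 0, Subtype.ext ?_, ?_⟩
    · change boxD n (boxSection n t * (boxQuiver n).e v) = 0
      refine (deriv_mul (boxDeriv n) _ _).trans ?_
      rw [deriv_e, mul_zero, add_zero]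
      have h3 := boxD_boxSection (n := n) t
      exact (congrArg (· * (boxQuiver n).e v) h3).trans (zero_mul _)
    · have h5 := unitMk_proj v ((boxQuiver n).toIdeal v (boxSection n t))
      rw [map_zero, add_zero]
      refine Eq.trans (congrArg (tensorGen (indBimod (formality n)) v) ?_) h5.symm
      have h4 : boxH n (boxSection n t * (boxQuiver n).e v) = t :=
        (map_mul (boxH n) _ _).trans
          ((congrArg (· * boxH n ((boxQuiver n).e v)) (boxH_boxSection t)).trans ht)
      exact h4.symm

/-- The functor of induction along the quasi-isomorphism from `R_n ⊠ R_n` to `R_n ⊗ R_n`. -/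
abbrev formalityFunctor (n : ℕ) : Ho (RR n) ⥤ Ho ((R n).tensor (R n)) :=
  tensorFunctor (indBimod (formality n))

theorem formalityFunctor_bijective {Z Z' : Ho (RR n)} (hZ : DGPP n Z) (hZ' : DGPP n Z') :
    Function.Bijective ((formalityFunctor n).map (X := Z) (Y := Z')) :=
  indFunctor_map_bijective (Q := boxQuiver n) (D := boxDeriv n) 
    (φ := formality n) (fun v => unitQis_proj v) hZ hZ'

theorem iso_of_formality_iso {Z Z' : Ho (RR n)} (hZ : DGPP n Z) (hZ' : DGPP n Z')
    (e : (formalityFunctor n).obj Z ≅ (formalityFunctor n).obj Z') : Nonempty (Z ≅ Z') := by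
  obtain ⟨f, hf⟩ := (formalityFunctor_bijective hZ hZ').2 e.hom
  obtain ⟨g, hg⟩ := (formalityFunctor_bijective hZ' hZ).2 e.inv
  refine ⟨⟨f, g, (formalityFunctor_bijective hZ hZ).1 ?_, (formalityFunctor_bijective hZ' hZ').1 ?_⟩⟩
  · rw [Functor.map_comp, hf, hg, CategoryTheory.Functor.map_id, e.hom_inv_id]
  · rw [Functor.map_comp, hf, hg, CategoryTheory.Functor.map_id, e.inv_hom_id]

theorem retract_of_formality_retract {Z Z' : Ho (RR n)} (hZ : DGPP n Z) (hZ' : DGPP n Z')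
    (r : Retract ((formalityFunctor n).obj Z) ((formalityFunctor n).obj Z')) :
    Nonempty (Retract Z Z') := by
  obtain ⟨f, hf⟩ := (formalityFunctor_bijective hZ hZ').2 r.i
  obtain ⟨g, hg⟩ := (formalityFunctor_bijective hZ' hZ).2 r.r
  refine ⟨⟨f, g, (formalityFunctor_bijective hZ hZ).1 ?_⟩⟩
  rw [Functor.map_comp, hf, hg, CategoryTheory.Functor.map_id, r.retract]

/-- The isomorphism class of a cone depends only on the isomorphism class of the map. -/
theorem cone_iso {A : QDGAlg} {M N M' N' : DGMod A} (f : Z0 M N) (f' : Z0 M' N')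
    (e₁ : Ho.of M ≅ Ho.of M') (e₂ : Ho.of N ≅ Ho.of N') (h : cls f ≫ e₂.hom = e₁.hom ≫ cls f') :
    Nonempty (Ho.of (cone f) ≅ Ho.of (cone f')) :=
  ⟨Triangle.π₃.mapIso (isoTriangleOfIso₁₂ _ _ (coneTriangle_distinguished f)
    (coneTriangle_distinguished f') e₁ e₂ h)⟩

/-- Maps between the images of induction lift, and so do their cones. -/
theorem exists_cone_lift {Z Z' : Ho (RR n)} (hZ : DGPP n Z) (hZ' : DGPP n Z')
    {W W' : DGMod ((R n).tensor (R n))} (w : Z0 W W')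
    (e : (formalityFunctor n).obj Z ≅ Ho.of W) (e' : (formalityFunctor n).obj Z' ≅ Ho.of W') :
    ∃ g : Z0 Z.obj Z'.obj,
      Nonempty ((formalityFunctor n).obj (Ho.of (cone g)) ≅ Ho.of (cone w)) := by
  obtain ⟨g, hg⟩ := (formalityFunctor_bijective hZ hZ').2 (e.hom ≫ cls w ≫ e'.inv)
  obtain ⟨g, rfl⟩ : ∃ g₀ : Z0 Z.obj Z'.obj, cls g₀ = g := cls_surj g
  refine ⟨g, ?_⟩
  obtain ⟨i⟩ := cone_iso (tensorZ (indBimod (formality n)) g) w e e' (by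
    have h1 : (formalityFunctor n).map (X := Z) (Y := Z') (cls g) ≫ e'.hom = e.hom ≫ cls w := by
      rw [hg, Category.assoc, Category.assoc, e'.inv_hom_id, Category.comp_id]
    exact h1)
  exact ⟨tensorConeIso (indBimod (formality n)) g ≪≫ i⟩

end Formality


/-! ### Exactness of external tensor products -/

section External

variable {A B : QDGAlg}

instance (N : DGMod (A.tensor B)) : Module (A ⊗[𝔽] B) N := N.module

theorem extTensor_ind {X : DGMod A} {Y : DGMod B} {p : extTensor X Y → Prop} (p0 : p 0)
    (padd : ∀ u v, p u → p v → p (u + v))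
    (pt : ∀ x y, p (show extTensor X Y from x ⊗ₜ[𝔽] y)) (u : extTensor X Y) : p u :=
  TensorProduct.induction_on (motive := p) u p0 pt padd

/-- The tensor product of two maps of modules. -/
def extMap {X X' : DGMod A} {Y Y' : DGMod B} (f : X →ₗ[A] X') (g : Y →ₗ[B] Y') :
    extTensor X Y →ₗ[A.tensor B] extTensor X' Y' where
  toFun := TensorProduct.map (f.restrictScalars 𝔽) (g.restrictScalars 𝔽)
  map_add' := map_add _
  map_smul' r u := by
    refine extTensor_ind (X := X) (Y := Y) (p := fun u =>
      (show extTensor X' Y' from TensorProduct.map (f.restrictScalars 𝔽) (g.restrictScalars 𝔽)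
        (r • u)) = r • (show extTensor X' Y' from
          TensorProduct.map (f.restrictScalars 𝔽) (g.restrictScalars 𝔽) u)) ?_ ?_ ?_ u
    · rw [smul_zero]
      refine (map_zero _).trans ((smul_zero r).symm.trans (congrArg _ (map_zero _).symm))
    · intro u v hu hv
      rw [smul_add]
      refine (map_add _ _ _).trans ((congrArg₂ _ hu hv).trans ?_)
      refine (smul_add r _ _).symm.trans (congrArg (r • ·) (map_add _ _ _).symm)
    · intro x y
      induction r using TensorProduct.induction_on with
      | zero =>
        refine (congrArg (TensorProduct.map (f.restrictScalars 𝔽) (g.restrictScalars 𝔽))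
          (zero_smul (A.tensor B) (show extTensor X Y from x ⊗ₜ[𝔽] y))).trans ?_
        exact (map_zero _).trans (zero_smul (A.tensor B)
          (show extTensor X' Y' from f x ⊗ₜ[𝔽] g y)).symm
      | add r s hr hs =>
        refine (congrArg (TensorProduct.map (f.restrictScalars 𝔽) (g.restrictScalars 𝔽))
          (add_smul (show A.tensor B from r) s (show extTensor X Y from x ⊗ₜ[𝔽] y))).trans ?_
        exact (map_add _ _ _).trans ((congrArg₂ _ hr hs).trans (add_smul (show A.tensor B from r) s
          (show extTensor X' Y' from f x ⊗ₜ[𝔽] g y)).symm)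
      | tmul a b =>
        change f (a • x) ⊗ₜ[𝔽] g (b • y) = (a • f x) ⊗ₜ[𝔽] (b • g y)
        rw [f.map_smul, g.map_smul]

theorem tensorGr_map {M M' N N' : Type} [AddCommGroup M] [Module 𝔽 M] [AddCommGroup M']
    [Module 𝔽 M'] [AddCommGroup N] [Module 𝔽 N] [AddCommGroup N'] [Module 𝔽 N']
    {gr : ℤ × ℤ → Submodule 𝔽 M} {gr' : ℤ × ℤ → Submodule 𝔽 M'} {hr : ℤ × ℤ → Submodule 𝔽 N}
    {hr' : ℤ × ℤ → Submodule 𝔽 N'} {f : M →ₗ[𝔽] M'} {g : N →ₗ[𝔽] N'} {a b : ℤ × ℤ}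
    (hf : ∀ k, ∀ m ∈ gr k, f m ∈ gr' (k + a)) (hg : ∀ k, ∀ m ∈ hr k, g m ∈ hr' (k + b))
    {k : ℤ × ℤ} {u : M ⊗[𝔽] N} (hu : u ∈ tensorGr gr hr k) :
    TensorProduct.map f g u ∈ tensorGr gr' hr' (k + (a + b)) := by
  induction hu using Submodule.span_induction with
  | mem u hu =>
    obtain ⟨i, j, rfl, x, hx, y, hy, rfl⟩ := hu
    refine Submodule.subset_span ⟨i + a, j + b, ?_, f x, hf i x hx, g y, hg j y hy, rfl⟩
    rw [add_add_add_comm]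
  | zero => rw [map_zero]; exact zero_mem _
  | add u v _ _ hu' hv' => rw [map_add]; exact add_mem hu' hv'
  | smul c u _ hu' => rw [map_smul]; exact Submodule.smul_mem _ _ hu'

theorem extMap_mem {X X' : DGMod A} {Y Y' : DGMod B} {f : X →ₗ[A] X'} {g : Y →ₗ[B] Y'} {i j : ℤ}
    (hf : f ∈ homDeg X X' i) (hg : g ∈ homDeg Y Y' j) :
    extMap f g ∈ homDeg (extTensor X Y) (extTensor X' Y') (i + j) :=
  fun _ _ hu => tensorGr_map (f := f.restrictScalars 𝔽) (g := g.restrictScalars 𝔽) hf hg hu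

theorem extTensor_ext {X : DGMod A} {Y : DGMod B} {N : Type} [AddCommGroup N]
    {f g : extTensor X Y →+ N}
    (h : ∀ x y, f (show extTensor X Y from x ⊗ₜ[𝔽] y) =
      g (show extTensor X Y from x ⊗ₜ[𝔽] y)) : f = g :=
  AddMonoidHom.ext fun u => extTensor_ind (X := X) (Y := Y) (p := fun u => f u = g u)
    ((map_zero f).trans (map_zero g).symm)
    (fun u v hu hv => (map_add f u v).trans ((congrArg₂ _ hu hv).trans (map_add g u v).symm)) h u

theorem extTensor_d {X : DGMod A} {Y : DGMod B} (x : X) (y : Y) :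
    (extTensor X Y).d (show extTensor X Y from x ⊗ₜ[𝔽] y) =
      (show extTensor X Y from X.d x ⊗ₜ[𝔽] y + x ⊗ₜ[𝔽] Y.d y) := tensorD_tmul X.d Y.d x y

/-- The tensor product of closed morphisms. -/
def extZ {X X' : DGMod A} {Y Y' : DGMod B} (f : Z0 X X') (g : Z0 Y Y') :
    Z0 (extTensor X Y) (extTensor X' Y') :=
  zmk (M := extTensor X Y) (N := extTensor X' Y') (extMap f.1 g.1)
    (fun k u hu => by
      have h := extMap_mem f.2.1 g.2.1 k u hu
      rwa [show k + ((0 : ℤ) + 0, (0 : ℤ)) = k from add_zero k] at h)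
    (fun u => DFunLike.congr_fun (F := extTensor X Y →+ extTensor X' Y')
      (f := ((extTensor X' Y').d.toAddMonoidHom).comp (extMap f.1 g.1).toAddMonoidHom)
      (g := ((extMap f.1 g.1).toAddMonoidHom).comp (extTensor X Y).d.toAddMonoidHom)
      (extTensor_ext (X := X) (Y := Y) fun x y => by
        change tensorD X'.d Y'.d (f.1 x ⊗ₜ[𝔽] g.1 y) =
          TensorProduct.map (f.1.restrictScalars 𝔽) (g.1.restrictScalars 𝔽)
            (tensorD X.d Y.d (x ⊗ₜ[𝔽] y))
        rw [tensorD_tmul, tensorD_tmul, map_add, Z0_comm, Z0_comm]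
        rfl) u)

theorem cls_extZ_left {X X' : DGMod A} {Y Y' : DGMod B} {f f' : Z0 X X'} (g : Z0 Y Y')
    (h : cls f = cls f') : cls (extZ f g) = cls (extZ f' g) := by
  obtain ⟨s, hs, e⟩ := cls_eq_iff.1 h
  refine cls_eq (M := extTensor X Y) (N := extTensor X' Y') (extMap s g.1)
    (by have h := extMap_mem hs g.2.1; rwa [add_zero] at h)
    (fun u => DFunLike.congr_fun (F := extTensor X Y →+ extTensor X' Y')
      (f := (extMap f.1 g.1).toAddMonoidHom)
      (g := (extMap f'.1 g.1).toAddMonoidHom +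
        (((extTensor X' Y').d.toAddMonoidHom).comp (extMap s g.1).toAddMonoidHom +
        ((extMap s g.1).toAddMonoidHom).comp (extTensor X Y).d.toAddMonoidHom))
      (extTensor_ext (X := X) (Y := Y) fun x y => ?_) u)
  change f.1 x ⊗ₜ[𝔽] g.1 y = f'.1 x ⊗ₜ[𝔽] g.1 y + (tensorD X'.d Y'.d (s x ⊗ₜ[𝔽] g.1 y) +
    TensorProduct.map (s.restrictScalars 𝔽) (g.1.restrictScalars 𝔽) (tensorD X.d Y.d (x ⊗ₜ[𝔽] y)))
  rw [tensorD_tmul, tensorD_tmul, map_add, e x, TensorProduct.add_tmul, TensorProduct.add_tmul,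
    Z0_comm]
  change _ = f'.1 x ⊗ₜ[𝔽] g.1 y + (X'.d (s x) ⊗ₜ[𝔽] g.1 y + s x ⊗ₜ[𝔽] g.1 (Y.d y) +
    (s (X.d x) ⊗ₜ[𝔽] g.1 y + s x ⊗ₜ[𝔽] g.1 (Y.d y)))
  have h := add_self (s x ⊗ₜ[𝔽] g.1 (Y.d y))
  calc _ = f'.1 x ⊗ₜ[𝔽] g.1 y + (X'.d (s x) ⊗ₜ[𝔽] g.1 y + s (X.d x) ⊗ₜ[𝔽] g.1 y) + 0 := by abel
    _ = _ := by rw [← h]; abel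

theorem cls_extZ_right {X X' : DGMod A} {Y Y' : DGMod B} (f : Z0 X X') {g g' : Z0 Y Y'}
    (h : cls g = cls g') : cls (extZ f g) = cls (extZ f g') := by
  obtain ⟨s, hs, e⟩ := cls_eq_iff.1 h
  refine cls_eq (M := extTensor X Y) (N := extTensor X' Y') (extMap f.1 s)
    (by have h := extMap_mem f.2.1 hs; rwa [zero_add] at h)
    (fun u => DFunLike.congr_fun (F := extTensor X Y →+ extTensor X' Y')
      (f := (extMap f.1 g.1).toAddMonoidHom)
      (g := (extMap f.1 g'.1).toAddMonoidHom +
        (((extTensor X' Y').d.toAddMonoidHom).comp (extMap f.1 s).toAddMonoidHom +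
        ((extMap f.1 s).toAddMonoidHom).comp (extTensor X Y).d.toAddMonoidHom))
      (extTensor_ext (X := X) (Y := Y) fun x y => ?_) u)
  change f.1 x ⊗ₜ[𝔽] g.1 y = f.1 x ⊗ₜ[𝔽] g'.1 y + (tensorD X'.d Y'.d (f.1 x ⊗ₜ[𝔽] s y) +
    TensorProduct.map (f.1.restrictScalars 𝔽) (s.restrictScalars 𝔽) (tensorD X.d Y.d (x ⊗ₜ[𝔽] y)))
  rw [tensorD_tmul, tensorD_tmul, map_add, e y, TensorProduct.tmul_add, TensorProduct.tmul_add,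
    Z0_comm]
  change _ = f.1 x ⊗ₜ[𝔽] g'.1 y + (f.1 (X.d x) ⊗ₜ[𝔽] s y + f.1 x ⊗ₜ[𝔽] Y'.d (s y) +
    (f.1 (X.d x) ⊗ₜ[𝔽] s y + f.1 x ⊗ₜ[𝔽] s (Y.d y)))
  have h := add_self (f.1 (X.d x) ⊗ₜ[𝔽] s y)
  calc _ = f.1 x ⊗ₜ[𝔽] g'.1 y + (f.1 x ⊗ₜ[𝔽] Y'.d (s y) + f.1 x ⊗ₜ[𝔽] s (Y.d y)) + 0 := by abel
    _ = _ := by rw [← h]; abel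

theorem extZ_comp {X X' X'' : DGMod A} {Y Y' Y'' : DGMod B} (f : Z0 X X') (f' : Z0 X' X'')
    (g : Z0 Y Y') (g' : Z0 Y' Y'') :
    zcomp (extZ f g) (extZ f' g') = extZ (zcomp f f') (zcomp g g') :=
  Subtype.ext (LinearMap.ext fun u => DFunLike.congr_fun (F := extTensor X Y →+ extTensor X'' Y'')
      (f := ((extMap f'.1 g'.1).toAddMonoidHom).comp (extMap f.1 g.1).toAddMonoidHom)
      (g := (extMap (zcomp f f').1 (zcomp g g').1).toAddMonoidHom)
      (extTensor_ext (X := X) (Y := Y) fun _ _ => rfl) u)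

theorem extZ_id (X : DGMod A) (Y : DGMod B) : extZ (zid X) (zid Y) = zid (extTensor X Y) :=
  Subtype.ext (LinearMap.ext fun u => DFunLike.congr_fun (F := extTensor X Y →+ extTensor X Y)
      (f := (extMap (zid X).1 (zid Y).1).toAddMonoidHom)
      (g := AddMonoidHom.id _)
      (extTensor_ext (X := X) (Y := Y) fun _ _ => rfl) u)

theorem cls_extZ {X X' : DGMod A} {Y Y' : DGMod B} {f f' : Z0 X X'} {g g' : Z0 Y Y'}
    (hf : cls f = cls f') (hg : cls g = cls g') : cls (extZ f g) = cls (extZ f' g') :=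
  (cls_extZ_left g hf).trans (cls_extZ_right f' hg)

/-- Retracts of the factors give retracts of the tensor product. -/
theorem extRetract {X X' : Ho A} {Y Y' : Ho B} (r : Retract X X') (s : Retract Y Y') :
    Nonempty (Retract (Ho.of (extTensor X.obj Y.obj)) (Ho.of (extTensor X'.obj Y'.obj))) := by
  obtain ⟨f, hf⟩ := cls_surj r.i
  obtain ⟨f', hf'⟩ := cls_surj r.r
  obtain ⟨g, hg⟩ := cls_surj s.i
  obtain ⟨g', hg'⟩ := cls_surj s.r
  have h1 : cls (zcomp f f') = cls (zid X.obj) := by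
    rw [← cls_comp, hf, hf']
    exact r.retract
  have h2 : cls (zcomp g g') = cls (zid Y.obj) := by
    rw [← cls_comp, hg, hg']
    exact s.retract
  refine ⟨⟨cls (extZ f g), cls (extZ f' g'), ?_⟩⟩
  rw [cls_comp, extZ_comp, cls_extZ h1 h2, extZ_id]
  rfl

theorem extIso {X X' : Ho A} {Y Y' : Ho B} (e : X ≅ X') (e' : Y ≅ Y') :
    Nonempty (Ho.of (extTensor X.obj Y.obj) ≅ Ho.of (extTensor X'.obj Y'.obj)) := by
  obtain ⟨f, hf⟩ := cls_surj e.hom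
  obtain ⟨f', hf'⟩ := cls_surj e.inv
  obtain ⟨g, hg⟩ := cls_surj e'.hom
  obtain ⟨g', hg'⟩ := cls_surj e'.inv
  have h1 : cls (zcomp f f') = cls (zid X.obj) := by
    rw [← cls_comp, hf, hf']; exact e.hom_inv_id
  have h2 : cls (zcomp g g') = cls (zid Y.obj) := by
    rw [← cls_comp, hg, hg']; exact e'.hom_inv_id
  have h3 : cls (zcomp f' f) = cls (zid X'.obj) := by
    rw [← cls_comp, hf, hf']; exact e.inv_hom_id
  have h4 : cls (zcomp g' g) = cls (zid Y'.obj) := by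
    rw [← cls_comp, hg, hg']; exact e'.inv_hom_id
  refine ⟨⟨cls (extZ f g), cls (extZ f' g'), ?_, ?_⟩⟩
  · rw [cls_comp, extZ_comp, cls_extZ h1 h2, extZ_id]; rfl
  · rw [cls_comp, extZ_comp, cls_extZ h3 h4, extZ_id]; rfl

theorem tensorGr_shift_left {M N : Type} [AddCommGroup M] [Module 𝔽 M] [AddCommGroup N]
    [Module 𝔽 N] (gr : ℤ × ℤ → Submodule 𝔽 M) (gr' : ℤ × ℤ → Submodule 𝔽 N) (a k : ℤ × ℤ) :
    tensorGr (fun k => gr (k + a)) gr' k = tensorGr gr gr' (k + a) := by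
  refine le_antisymm (Submodule.span_mono ?_) (Submodule.span_mono ?_)
  · rintro _ ⟨i, j, rfl, m, hm, n, hn, rfl⟩
    exact ⟨i + a, j, add_right_comm _ _ _, m, hm, n, hn, rfl⟩
  · rintro _ ⟨i, j, h, m, hm, n, hn, rfl⟩
    refine ⟨i - a, j, ?_, m, ?_, n, hn, rfl⟩
    · rw [sub_add_eq_add_sub, h, add_sub_cancel_right]
    · change m ∈ gr (i - a + a)
      rwa [sub_add_cancel]

/-- The shift of the first factor of an exterior product. -/
def extShiftLeftIso (X : DGMod A) (Y : DGMod B) (a : ℤ × ℤ) :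
    Ho.of (extTensor (X.shift a) Y) ≅ Ho.of ((extTensor X Y).shift a) :=
  isoOfBijective (M := extTensor (X.shift a) Y) (N := (extTensor X Y).shift a)
    (zmk (M := extTensor (X.shift a) Y) (N := (extTensor X Y).shift a) LinearMap.id
      (fun k u hu => by
        change u ∈ tensorGr X.gr Y.gr (k + a)
        rw [← tensorGr_shift_left]
        exact hu) (fun _ => rfl)) Function.bijective_id

/-- The shift of the second factor of an exterior product. -/
def extShiftRightIso (X : DGMod A) (Y : DGMod B) (a : ℤ × ℤ) :
    Ho.of (extTensor X (Y.shift a)) ≅ Ho.of ((extTensor X Y).shift a) :=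
  isoOfBijective (M := extTensor X (Y.shift a)) (N := (extTensor X Y).shift a)
    (zmk (M := extTensor X (Y.shift a)) (N := (extTensor X Y).shift a) LinearMap.id
      (fun k u hu => by
        change u ∈ tensorGr X.gr Y.gr (k + a)
        rw [← tensorGr_shift]
        exact hu) (fun _ => rfl)) Function.bijective_id

theorem extMap_comp_eq_id {X X' : DGMod A} {Y Y' : DGMod B} {f : X →ₗ[A] X'} {f' : X' →ₗ[A] X}
    {g : Y →ₗ[B] Y'} {g' : Y' →ₗ[B] Y} (hf : ∀ x, f' (f x) = x) (hg : ∀ y, g' (g y) = y)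
    (u : extTensor X Y) : extMap f' g' (extMap f g u) = u :=
  DFunLike.congr_fun (F := extTensor X Y →+ extTensor X Y)
    (f := (extMap f' g').toAddMonoidHom.comp (extMap f g).toAddMonoidHom) (g := AddMonoidHom.id _)
    (extTensor_ext (X := X) (Y := Y) fun x y => by
      change f' (f x) ⊗ₜ[𝔽] g' (g y) = x ⊗ₜ[𝔽] y
      rw [hf, hg]) u

theorem extMap_comp_eq_zero {X X' X'' : DGMod A} {Y Y' Y'' : DGMod B} {f : X →ₗ[A] X'}
    {f' : X' →ₗ[A] X''} {g : Y →ₗ[B] Y'} {g' : Y' →ₗ[B] Y''}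
    (h : (∀ x, f' (f x) = 0) ∨ ∀ y, g' (g y) = 0)
    (u : extTensor X Y) : extMap f' g' (extMap f g u) = 0 :=
  DFunLike.congr_fun (F := extTensor X Y →+ extTensor X'' Y'')
    (f := (extMap f' g').toAddMonoidHom.comp (extMap f g).toAddMonoidHom) (g := 0)
    (extTensor_ext (X := X) (Y := Y) fun x y => by
      change f' (f x) ⊗ₜ[𝔽] g' (g y) = (0 : X'' ⊗[𝔽] Y'')
      obtain h | h := h
      · rw [h, TensorProduct.zero_tmul]
      · rw [h, TensorProduct.tmul_zero]) u

/-- The external tensor product with a cone in the first factor is a cone. -/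
theorem extConeLeftIso {X X' : DGMod A} (f : Z0 X X') (Y : DGMod B) :
    Nonempty (Ho.of (extTensor (cone f) Y) ≅ Ho.of (cone (extZ f (zid Y)))) := by
  let p₁ := extMap (X := cone f) (X' := X') (LinearMap.fst A X' X) (zid Y).1
  let p₂ := extMap (X := cone f) (X' := X) (LinearMap.snd A X' X) (zid Y).1
  let q₁ := extMap (X := X') (X' := cone f) (LinearMap.inl A X' X) (zid Y).1
  let q₂ := extMap (X := X) (X' := cone f) (LinearMap.inr A X' X) (zid Y).1
  refine ⟨isoOfBijection <| splitConeMap (E := extTensor (cone f) Y) p₁ p₂ q₁ q₂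
    (extMap_comp_eq_id (fun _ => rfl) fun _ => rfl)
    (extMap_comp_eq_id (fun _ => rfl) fun _ => rfl) (extMap_comp_eq_zero (.inl fun _ => rfl))
    (extMap_comp_eq_zero (.inl fun _ => rfl)) (DFunLike.congr_fun
      (f := q₁.toAddMonoidHom.comp p₁.toAddMonoidHom + q₂.toAddMonoidHom.comp p₂.toAddMonoidHom)
      (g := AddMonoidHom.id (extTensor (cone f) Y)) (extTensor_ext (X := cone f) (Y := Y) ?_))
    (extMap_mem (i := 0) (j := 0) (fst_mem_homDeg f) (zid Y).2.1)
    (extMap_mem (i := 1) (j := 0) (snd_mem_homDeg f) (zid Y).2.1)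
    (DFunLike.congr_fun (f := (extTensor X' Y).d.toAddMonoidHom.comp p₁.toAddMonoidHom +
        (extZ f (zid Y)).1.toAddMonoidHom.comp p₂.toAddMonoidHom)
      (g := p₁.toAddMonoidHom.comp (extTensor (cone f) Y).d.toAddMonoidHom)
      (extTensor_ext (X := cone f) (Y := Y) ?_))
    (DFunLike.congr_fun (f := (extTensor X Y).d.toAddMonoidHom.comp p₂.toAddMonoidHom)
      (g := p₂.toAddMonoidHom.comp (extTensor (cone f) Y).d.toAddMonoidHom)
      (extTensor_ext (X := cone f) (Y := Y) fun _ _ => rfl))⟩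
  · rintro ⟨x', x⟩ y
    change (x', (0 : X)) ⊗ₜ[𝔽] y + ((0 : X'), x) ⊗ₜ[𝔽] y = (x', x) ⊗ₜ[𝔽] y
    rw [← TensorProduct.add_tmul, Prod.mk_add_mk, add_zero, zero_add]
  · rintro ⟨x', x⟩ y
    change X'.d x' ⊗ₜ[𝔽] y + x' ⊗ₜ[𝔽] Y.d y + f.1 x ⊗ₜ[𝔽] y =
      (X'.d x' + f.1 x) ⊗ₜ[𝔽] y + x' ⊗ₜ[𝔽] Y.d y
    rw [TensorProduct.add_tmul]
    abel

/-- The external tensor product with a cone in the second factor is a cone. -/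
theorem extConeRightIso (X : DGMod A) {Y Y' : DGMod B} (f : Z0 Y Y') :
    Nonempty (Ho.of (extTensor X (cone f)) ≅ Ho.of (cone (extZ (zid X) f))) := by
  let p₁ := extMap (Y := cone f) (Y' := Y') (zid X).1 (LinearMap.fst B Y' Y)
  let p₂ := extMap (Y := cone f) (Y' := Y) (zid X).1 (LinearMap.snd B Y' Y)
  let q₁ := extMap (Y := Y') (Y' := cone f) (zid X).1 (LinearMap.inl B Y' Y)
  let q₂ := extMap (Y := Y) (Y' := cone f) (zid X).1 (LinearMap.inr B Y' Y)
  refine ⟨isoOfBijection <| splitConeMap (E := extTensor X (cone f)) p₁ p₂ q₁ q₂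
    (extMap_comp_eq_id (fun _ => rfl) fun _ => rfl)
    (extMap_comp_eq_id (fun _ => rfl) fun _ => rfl) (extMap_comp_eq_zero (.inr fun _ => rfl))
    (extMap_comp_eq_zero (.inr fun _ => rfl)) (DFunLike.congr_fun
      (f := q₁.toAddMonoidHom.comp p₁.toAddMonoidHom + q₂.toAddMonoidHom.comp p₂.toAddMonoidHom)
      (g := AddMonoidHom.id (extTensor X (cone f))) (extTensor_ext (X := X) (Y := cone f) ?_))
    (extMap_mem (i := 0) (j := 0) (zid X).2.1 (fst_mem_homDeg f))
    (extMap_mem (i := 0) (j := 1) (zid X).2.1 (snd_mem_homDeg f))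
    (DFunLike.congr_fun (f := (extTensor X Y').d.toAddMonoidHom.comp p₁.toAddMonoidHom +
        (extZ (zid X) f).1.toAddMonoidHom.comp p₂.toAddMonoidHom)
      (g := p₁.toAddMonoidHom.comp (extTensor X (cone f)).d.toAddMonoidHom)
      (extTensor_ext (X := X) (Y := cone f) ?_))
    (DFunLike.congr_fun (f := (extTensor X Y).d.toAddMonoidHom.comp p₂.toAddMonoidHom)
      (g := p₂.toAddMonoidHom.comp (extTensor X (cone f)).d.toAddMonoidHom)
      (extTensor_ext (X := X) (Y := cone f) fun _ _ => rfl))⟩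
  · rintro x ⟨y', y⟩
    change x ⊗ₜ[𝔽] (y', (0 : Y)) + x ⊗ₜ[𝔽] ((0 : Y'), y) = x ⊗ₜ[𝔽] (y', y)
    rw [← TensorProduct.tmul_add, Prod.mk_add_mk, add_zero, zero_add]
  · rintro x ⟨y', y⟩
    change X.d x ⊗ₜ[𝔽] y' + x ⊗ₜ[𝔽] Y'.d y' + x ⊗ₜ[𝔽] f.1 y =
      X.d x ⊗ₜ[𝔽] y' + x ⊗ₜ[𝔽] (Y'.d y' + f.1 y)
    rw [TensorProduct.tmul_add]
    abel

end External


/-! ### Existence and classes of the objects `χ(X, Y)` -/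

section Chi

open LQuiver

variable {n : ℕ}

theorem chiR_P (x : Vert n) : chiR (Ho.of (P n x)) = Pi.single x 1 :=
  chi_proj (Q := quiver n) (D := zeroDeriv (quiver n)) _ (minimal_zeroDeriv (quiver n)) x

theorem chiRR_PP (v : Vert n × Vert n) : chiRR (Ho.of (PP n v)) = Pi.single v 1 :=
  chi_proj (Q := boxQuiver n) (D := boxDeriv n) _ (minimal_boxDeriv n) v

theorem chiR_iso {X Y : Ho (R n)} (e : X ≅ Y) : chiR X = chiR Y := chi_iso _ _ e

theorem chiRR_iso {X Y : Ho (RR n)} (e : X ≅ Y) : chiRR X = chiRR Y := chi_iso _ _ e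

theorem chiR_shift (M : DGMod (R n)) (a : ℤ × ℤ) :
    chiR (Ho.of (M.shift a)) = weight a • chiR (Ho.of M) := chi_shift _ _ M a

theorem chiRR_shift (M : DGMod (RR n)) (a : ℤ × ℤ) :
    chiRR (Ho.of (M.shift a)) = weight a • chiRR (Ho.of M) := chi_shift _ _ M a

theorem chiR_cone {M N : DGMod (R n)} (f : Z0 M N) (hM : DGP n (Ho.of M)) (hN : DGP n (Ho.of N)) :
    chiR (Ho.of (cone f)) = chiR (Ho.of N) - chiR (Ho.of M) := chi_cone _ f hM hN

theorem chiRR_cone {M N : DGMod (RR n)} (f : Z0 M N) (hM : DGPP n (Ho.of M))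
    (hN : DGPP n (Ho.of N)) :
    chiRR (Ho.of (cone f)) = chiRR (Ho.of N) - chiRR (Ho.of M) := chi_cone _ f hM hN

instance (N : DGMod ((R n).tensor (R n))) : Module ((quiver n).Alg ⊗[𝔽] (quiver n).Alg) N := N.module

instance (T : DGBimod ((R n).tensor (R n)) (RR n)) :
    Module ((quiver n).Alg ⊗[𝔽] (quiver n).Alg) T := T.left

/-- The inclusion of the tensor product of two projective modules into the algebra. -/
def projIncl (x y : Vert n) :
    ((quiver n).leftIdeal x) ⊗[𝔽] ((quiver n).leftIdeal y) →ₗ[𝔽] (quiver n).Alg ⊗[𝔽] (quiver n).Alg :=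
  TensorProduct.map (((quiver n).leftIdeal x).subtype.restrictScalars 𝔽)
    (((quiver n).leftIdeal y).subtype.restrictScalars 𝔽)

/-- Right multiplication by `e(x) ⊗ e(y)`. -/
def projRet (x y : Vert n) :
    (quiver n).Alg ⊗[𝔽] (quiver n).Alg →ₗ[𝔽] ((quiver n).leftIdeal x) ⊗[𝔽] ((quiver n).leftIdeal y) :=
  TensorProduct.map ((quiver n).toIdeal x) ((quiver n).toIdeal y)

theorem projRet_projIncl (x y : Vert n) (u) : projRet x y (projIncl x y u) = u := by
  induction u using TensorProduct.induction_on with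
  | zero => rw [map_zero, map_zero]
  | add u v hu hv => rw [map_add, map_add, hu, hv]
  | tmul a b =>
    have h : ∀ (z : Vert n) (c : (quiver n).leftIdeal z), (quiver n).toIdeal z c.1 = c :=
      fun z c => Subtype.ext (mem_leftIdeal.1 c.2)
    change (quiver n).toIdeal x a.1 ⊗ₜ[𝔽] (quiver n).toIdeal y b.1 = _
    rw [h, h]

theorem projIncl_projRet (x y : Vert n) (u) :
    projIncl x y (projRet x y u) = u * ((quiver n).e x ⊗ₜ (quiver n).e y) := by
  induction u using TensorProduct.induction_on with
  | zero => rw [map_zero, map_zero, zero_mul]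
  | add u v hu hv => rw [map_add, map_add, hu, hv, add_mul]
  | tmul a b => exact (Algebra.TensorProduct.tmul_mul_tmul _ _ _ _).symm

theorem projIncl_smul (x y : Vert n) (r : (quiver n).Alg ⊗[𝔽] (quiver n).Alg)
    (u : extTensor (P n x) (P n y)) : projIncl x y (r • u) = r * projIncl x y u := by
  refine extTensor_ind (X := P n x) (Y := P n y)
    (p := fun u => projIncl x y (r • u) = r * projIncl x y u) ?_ ?_ ?_ u
  · rw [smul_zero]
    refine (map_zero (projIncl x y)).trans ((mul_zero r).symm.trans ?_)
    exact congrArg (r * ·) (map_zero (projIncl x y)).symm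
  · intro u v hu hv
    rw [smul_add]
    refine (map_add (projIncl x y) _ _).trans ((congrArg₂ _ hu hv).trans ?_)
    exact (mul_add r _ _).symm.trans (congrArg (r * ·) (map_add (projIncl x y) _ _).symm)
  · intro a b
    induction r using TensorProduct.induction_on with
    | zero =>
      refine (congrArg (projIncl x y) (zero_smul ((quiver n).Alg ⊗[𝔽] (quiver n).Alg)
        (show extTensor (P n x) (P n y) from a ⊗ₜ[𝔽] b))).trans ?_
      exact (map_zero (projIncl x y)).trans (zero_mul _).symm
    | add r s hr hs =>
      refine (congrArg (projIncl x y) (add_smul r s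
        (show extTensor (P n x) (P n y) from a ⊗ₜ[𝔽] b))).trans ?_
      exact (map_add (projIncl x y) _ _).trans ((congrArg₂ _ hr hs).trans (add_mul _ _ _).symm)
    | tmul r s => exact (Algebra.TensorProduct.tmul_mul_tmul r a.1 s b.1).symm

/-- The induction functor sends `P(x, y)` to `P(x) ⊗ P(y)`. -/
theorem formality_proj_iso (x y : Vert n) :
    Nonempty ((formalityFunctor n).obj (Ho.of (PP n (x, y))) ≅
      Ho.of (extTensor (P n x) (P n y))) := by
  let G : extTensor (P n x) (P n y) →ₗ[(R n).tensor (R n)]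
      tensorMod (indBimod (formality n)) (PP n (x, y)) :=
    { toFun := fun u => tensorGen (indBimod (formality n)) (x, y) (projIncl x y u)
      map_add' := fun u v => (congrArg (tensorGen (indBimod (formality n)) (x, y))
        (map_add (projIncl x y) u v)).trans (map_add _ _ _)
      map_smul' := fun r u => (congrArg (tensorGen (indBimod (formality n)) (x, y))
        (projIncl_smul x y r u)).trans
          ((tensorGen (indBimod (formality n)) (x, y)).map_smul r (projIncl x y u)) }
  have hev : ∀ t : (quiver n).Alg ⊗[𝔽] (quiver n).Alg,
      tensorEval (indBimod (formality n)) (x, y) (tensorGen (indBimod (formality n)) (x, y) t) =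
        t * ((quiver n).e x ⊗ₜ (quiver n).e y) := fun t =>
    congrArg (t * ·) (boxH_e x y)
  have hG : Function.Bijective G := by
    constructor
    · intro u v huv
      have h1 := congrArg (tensorEval (indBimod (formality n)) (x, y)) huv
      have h2 := (hev _).symm.trans (h1.trans (hev _))
      have h3 : ∀ w, projRet x y (projIncl x y w * ((quiver n).e x ⊗ₜ (quiver n).e y)) = w :=
        fun w => by rw [← projIncl_projRet, projRet_projIncl, projRet_projIncl]
      exact (h3 u).symm.trans ((congrArg (projRet x y) h2).trans (h3 v))
    · intro z
      obtain ⟨t, ht, rfl⟩ := tensorGen_surj (indBimod (formality n)) (x, y) z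
      refine ⟨projRet x y t, congrArg (tensorGen (indBimod (formality n)) (x, y)) ?_⟩
      refine (projIncl_projRet x y t).trans (Eq.trans ?_ ht)
      exact congrArg (fun r : (quiver n).Alg ⊗[𝔽] (quiver n).Alg =>
        (show (quiver n).Alg ⊗[𝔽] (quiver n).Alg from t) * r) (boxH_e x y).symm
  refine ⟨(isoOfBijective (zmk (M := extTensor (P n x) (P n y))
    (N := tensorMod (indBimod (formality n)) (PP n (x, y))) G (fun k u hu => ?_)
    (fun u => ?_)) hG).symm⟩
  · have h1 : projIncl x y u ∈ tensorGr (R n).gr (R n).gr (k + (0 + 0)) :=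
      tensorGr_map (gr := (P n x).gr) (hr := (P n y).gr) (a := 0) (b := 0)
        (fun l a ha => by rw [add_zero]; exact ha) (fun l a ha => by rw [add_zero]; exact ha) hu
    rw [add_zero, add_zero] at h1
    refine ⟨projIncl x y u ⊗ₜ gen (Q := boxQuiver n) (x, y), Submodule.subset_span
      ⟨k, 0, add_zero _, _, h1, _, ?_, rfl⟩, rfl⟩
    exact e_mem (Q := boxQuiver n) (x, y)
  · refine (tensorGen_d (indBimod (formality n)) (x, y) _).trans ?_
    have h1 : (indBimod (formality n)).d (projIncl x y u) = 0 := tensor_d_zero n _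
    have h2 : (extTensor (P n x) (P n y)).d u = 0 := by
      refine DFunLike.congr_fun (F := extTensor (P n x) (P n y) →+ extTensor (P n x) (P n y))
        (f := (extTensor (P n x) (P n y)).d.toAddMonoidHom) (g := 0)
        (extTensor_ext (X := P n x) (Y := P n y) fun a b => ?_) u
      have h3 : ∀ (z : Vert n) (c : P n z), (P n z).d c = 0 := fun z c =>
        Subtype.ext (LQuiver.deriv_zero (quiver n) c.1)
      refine (extTensor_d (X := P n x) (Y := P n y) a b).trans ?_
      rw [h3, h3, TensorProduct.zero_tmul, TensorProduct.tmul_zero]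
      exact add_zero _
    rw [h1, h2]
    exact (map_zero (tensorGen (indBimod (formality n)) (x, y))).trans (map_zero G).symm

/-- There is an object `χ(X, Y)`, whose class is the product of those of `X` and `Y`. -/
theorem exists_isChi {X Y : Ho (R n)} (hX : DGP n X) (hY : DGP n Y) :
    ∃ Z, IsChi n X Y Z ∧ ∀ v, chiRR Z v = chiR X v.1 * chiR Y v.2 := by
  -- First for `X = P(x)` by induction on `Y`, then by induction on `X` for all `Y`.
  induction hX with
  | basic X hX =>
    obtain ⟨x, rfl⟩ := hX
    induction hY with
    | basic Y hY =>
      obtain ⟨y, rfl⟩ := hY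
      refine ⟨Ho.of (PP n (x, y)), ⟨Generated.basic _ ⟨_, rfl⟩, formality_proj_iso x y⟩,
        fun v => ?_⟩
      rw [chiRR_PP, chiR_P, chiR_P, Pi.single_apply, Pi.single_apply, Pi.single_apply]
      obtain ⟨v₁, v₂⟩ := v
      by_cases h1 : v₁ = x <;> by_cases h2 : v₂ = y <;> simp [h1, h2]
    | shift M a _ ih =>
      obtain ⟨Z, ⟨hZ, ⟨e⟩⟩, hc⟩ := ih
      refine ⟨Ho.of (Z.obj.shift a), ⟨Generated.shift _ _ hZ,
        ⟨tensorShiftIso _ Z.obj a ≪≫ shiftIso e a ≪≫ (extShiftRightIso (P n x) M a).symm⟩⟩,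
        fun v => ?_⟩
      rw [chiRR_shift, chiR_shift, Pi.smul_apply, Pi.smul_apply, smul_eq_mul, smul_eq_mul, hc]
      ring
    | cone f hM hN ih ih' =>
      obtain ⟨Z, ⟨hZ, ⟨e⟩⟩, hc⟩ := ih
      obtain ⟨Z', ⟨hZ', ⟨e'⟩⟩, hc'⟩ := ih'
      obtain ⟨g, ⟨i⟩⟩ := exists_cone_lift hZ hZ' (extZ (zid (P n x)) f) e e'
      obtain ⟨j⟩ := extConeRightIso (P n x) f
      refine ⟨Ho.of (cone g), ⟨Generated.cone g hZ hZ', ⟨i ≪≫ j.symm⟩⟩, fun v => ?_⟩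
      rw [chiRR_cone g hZ hZ', chiR_cone f hM hN, Pi.sub_apply, Pi.sub_apply, hc, hc', mul_sub]
    | iso e _ ih =>
      obtain ⟨Z, ⟨hZ, ⟨e'⟩⟩, hc⟩ := ih
      obtain ⟨i⟩ := extIso (Iso.refl (Ho.of (P n x))) e
      exact ⟨Z, ⟨hZ, ⟨e' ≪≫ i⟩⟩, fun v => by rw [hc, chiR_iso e]⟩
  | shift M a _ ih =>
    obtain ⟨Z, ⟨hZ, ⟨e⟩⟩, hc⟩ := ih
    refine ⟨Ho.of (Z.obj.shift a), ⟨Generated.shift _ _ hZ,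
      ⟨tensorShiftIso _ Z.obj a ≪≫ shiftIso e a ≪≫ (extShiftLeftIso M Y.obj a).symm⟩⟩,
      fun v => ?_⟩
    rw [chiRR_shift, chiR_shift, Pi.smul_apply, Pi.smul_apply, smul_eq_mul, smul_eq_mul, hc]
    ring
  | cone f hM hN ih ih' =>
    obtain ⟨Z, ⟨hZ, ⟨e⟩⟩, hc⟩ := ih
    obtain ⟨Z', ⟨hZ', ⟨e'⟩⟩, hc'⟩ := ih'
    obtain ⟨g, ⟨i⟩⟩ := exists_cone_lift hZ hZ' (extZ f (zid Y.obj)) e e'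
    obtain ⟨j⟩ := extConeLeftIso f Y.obj
    refine ⟨Ho.of (cone g), ⟨Generated.cone g hZ hZ', ⟨i ≪≫ j.symm⟩⟩, fun v => ?_⟩
    rw [chiRR_cone g hZ hZ', chiR_cone f hM hN, Pi.sub_apply, Pi.sub_apply, hc, hc', sub_mul]
  | iso e _ ih =>
    obtain ⟨Z, ⟨hZ, ⟨e'⟩⟩, hc⟩ := ih
    obtain ⟨i⟩ := extIso e (Iso.refl Y)
    exact ⟨Z, ⟨hZ, ⟨e' ≪≫ i⟩⟩, fun v => by rw [hc, chiR_iso e]⟩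

/-- The class of `χ(X, Y)` is the product of the classes, as `χ(X, Y)` is unique up to isomorphism. -/
theorem chiRR_of_isChi {X Y : Ho (R n)} {Z : Ho (RR n)} (hX : DGP n X) (hY : DGP n Y)
    (h : IsChi n X Y Z) (v : Vert n × Vert n) : chiRR Z v = chiR X v.1 * chiR Y v.2 := by
  obtain ⟨Z', ⟨hZ', ⟨e'⟩⟩, hc⟩ := exists_isChi hX hY
  obtain ⟨hZ, ⟨e⟩⟩ := h
  obtain ⟨i⟩ := iso_of_formality_iso hZ hZ' (e ≪≫ e'.symm)
  rw [chiRR_iso i, hc]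

/-- The objects `χ(X, Y)` of retracts are retracts. -/
theorem IsChi.retract {X Y X' Y' : Ho (R n)} {Z Z' : Ho (RR n)} (h : IsChi n X Y Z)
    (h' : IsChi n X' Y' Z') (r : Retract X X') (s : Retract Y Y') : Nonempty (Retract Z Z') := by
  obtain ⟨hZ, ⟨e⟩⟩ := h
  obtain ⟨hZ', ⟨e'⟩⟩ := h'
  obtain ⟨t⟩ := extRetract r s
  exact retract_of_formality_retract hZ hZ'
    ⟨e.hom ≫ t.i ≫ e'.inv, e'.hom ≫ t.r ≫ e.inv, by simp⟩

theorem isChi_proj (x y : Vert n) :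
    IsChi n (Ho.of (P n x)) (Ho.of (P n y)) (Ho.of (PP n (x, y))) :=
  ⟨Generated.basic _ ⟨_, rfl⟩, formality_proj_iso x y⟩

theorem IsChi.shift_left {M N : DGMod (R n)} {Z : DGMod (RR n)}
    (h : IsChi n (Ho.of M) (Ho.of N) (Ho.of Z)) (a : ℤ × ℤ) :
    IsChi n (Ho.of (M.shift a)) (Ho.of N) (Ho.of (Z.shift a)) :=
  ⟨Generated.shift _ _ h.1,
    ⟨tensorShiftIso _ Z a ≪≫ shiftIso h.2.some a ≪≫ (extShiftLeftIso M N a).symm⟩⟩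

theorem IsChi.shift_right {M N : DGMod (R n)} {Z : DGMod (RR n)}
    (h : IsChi n (Ho.of M) (Ho.of N) (Ho.of Z)) (a : ℤ × ℤ) :
    IsChi n (Ho.of M) (Ho.of (N.shift a)) (Ho.of (Z.shift a)) :=
  ⟨Generated.shift _ _ h.1,
    ⟨tensorShiftIso _ Z a ≪≫ shiftIso h.2.some a ≪≫ (extShiftRightIso M N a).symm⟩⟩

end Chi


/-! ### The letters -/

section Letters

open LQuiver

/-- The summands are retracts of the direct sum. -/
def sumRetract {A : QDGAlg} {ι : Type} [Fintype ι] [DecidableEq ι] (M : ι → DGMod A) (i : ι) :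
    Retract (Ho.of (M i)) (Ho.of (sumMod M)) where
  i := cls (M := M i) (N := sumMod M) (zmk (M := M i) (N := sumMod M)
    (LinearMap.single A (fun i => M i) i)
    (fun k m hm j _ => by
      by_cases h : j = i
      · subst h
        change Pi.single (M := fun i => M i) j m j ∈ _
        rw [Pi.single_eq_same]; exact hm
      · change Pi.single (M := fun i => M i) i m j ∈ _
        rw [Pi.single_eq_of_ne h]; exact zero_mem _)
    (fun m => funext fun j => by
      change (M j).d (Pi.single (M := fun i => M i) i m j) =
        Pi.single (M := fun i => M i) i ((M i).d m) j
      by_cases h : j = i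
      · subst h
        rw [Pi.single_eq_same, Pi.single_eq_same]
      · rw [Pi.single_eq_of_ne h, Pi.single_eq_of_ne h, map_zero]))
  r := cls (M := sumMod M) (N := M i) (zmk (M := sumMod M) (N := M i)
    (LinearMap.proj (φ := fun i => M i) i) (fun k m hm => hm i trivial) (fun _ => rfl))
  retract := congrArg cls (Subtype.ext (LinearMap.ext fun m => by
    change Pi.single (M := fun i => M i) i m i = m
    rw [Pi.single_eq_same]))

theorem generated_sum_proj {Q : LQuiver} [Nonempty Q.V] {D : Q.DerivData}
    {h : ∀ v l, deriv D (D.δ v l) = 0} (hD : Minimal D) {ι : Type} [Fintype ι] (z : ι → Q.V) :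
    genProj D h (Ho.of (sumMod fun i => proj D h (z i))) ∧
      chi h hD (Ho.of (sumMod fun i => proj D h (z i))) = ∑ i, Pi.single (z i) 1 := by
  classical
  let M : DGMod (dgAlg D h) := sumMod fun i => proj D h (z i)
  let m : ι → M := fun i => Pi.single (M := fun i => proj D h (z i)) i (gen (z i))
  have hm : ∀ (a : Q.Alg) (i j : ι), ((show ∀ i, Q.leftIdeal (z i) from a • m i) j).1 =
      if j = i then a * Q.e (z i) else 0 := by
    intro a i j
    by_cases h' : j = i
    · subst h'
      rw [if_pos rfl]
      change a * (Pi.single (M := fun i => Q.leftIdeal (z i)) j (gen (z j)) j).1 = _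
      rw [Pi.single_eq_same]
      rfl
    · rw [if_neg h']
      change a * (Pi.single (M := fun i => Q.leftIdeal (z i)) i (gen (z i)) j).1 = _
      rw [Pi.single_eq_of_ne h']
      exact mul_zero a
  have hs : ∀ (a : ι → Q.Alg) (j : ι),
      ((show ∀ i, Q.leftIdeal (z i) from ∑ i, a i • m i) j).1 = a j * Q.e (z j) := by
    intro a j
    have h1 : ((show ∀ i, Q.leftIdeal (z i) from ∑ i, a i • m i) j).1 =
        ∑ i, ((show ∀ i, Q.leftIdeal (z i) from a i • m i) j).1 := by
      let p : M →+ Q.Alg := ((Q.leftIdeal (z j)).subtype.toAddMonoidHom).comp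
        (Pi.evalAddMonoidHom (fun i => Q.leftIdeal (z i)) j)
      exact map_sum p (fun i => a i • m i) Finset.univ
    rw [h1, Finset.sum_eq_single j, hm, if_pos rfl]
    · intro i _ hij
      rw [hm, if_neg (Ne.symm hij)]
    · simp
  have key := generated_of_semifree (M := M) hD (fun _ => 0) z (fun _ => 0) m ?_ ?_ ?_ ?_ ?_
  · refine ⟨key.1, key.2.trans (Finset.sum_congr rfl fun i _ => ?_)⟩
    rw [neg_zero, weight_zero]
  · intro i j _
    change (Pi.single (M := fun i => Q.leftIdeal (z i)) i (gen (z i)) j).1 ∈ Q.gr 0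
    by_cases h' : j = i
    · subst h'
      rw [Pi.single_eq_same]
      exact e_mem (Q := Q) (z j)
    · rw [Pi.single_eq_of_ne h']
      exact zero_mem _
  · intro i
    refine funext fun j => Subtype.ext ((hm _ i j).trans ?_)
    have h1 := hm 1 i j
    rw [one_smul, one_mul] at h1
    refine Eq.trans ?_ h1.symm
    rw [LQuiver.e_mul, if_pos rfl]
  · intro i
    have h1 : M.d (m i) = 0 := by
      refine funext fun j => Subtype.ext ?_
      change deriv D (Pi.single (M := fun i => Q.leftIdeal (z i)) i (gen (z i)) j).1 = 0
      by_cases h' : j = i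
      · subst h'
        rw [Pi.single_eq_same]
        exact deriv_e D _
      · rw [Pi.single_eq_of_ne h']
        exact map_zero _
    rw [h1]
    exact zero_mem _
  · intro a ha h0
    funext j
    refine (mem_leftIdeal.1 (ha j)).symm.trans ((hs a j).symm.trans ?_)
    exact congrArg (fun x : M => ((show ∀ i, Q.leftIdeal (z i) from x) j).1) h0
  · intro x
    have h1 : x = ∑ i, ((show ∀ i, Q.leftIdeal (z i) from x) i).1 • m i :=
      funext fun j => Subtype.ext ((hs (fun i => ((show ∀ i, Q.leftIdeal (z i) from x) i).1) j).trans
        (mem_leftIdeal.1 ((show ∀ i, Q.leftIdeal (z i) from x) j).2)).symm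
    rw [h1]
    exact sum_mem fun i _ => Submodule.smul_mem _ _ (Submodule.subset_span ⟨i, rfl⟩)

variable {n : ℕ}

theorem generated_sum_P {ι : Type} [Fintype ι] (z : ι → Vert n) :
    DGP n (Ho.of (sumMod fun i => P n (z i))) ∧
      chiR (Ho.of (sumMod fun i => P n (z i))) = ∑ i, Pi.single (z i) 1 := by
  have : Nonempty (quiver n).V := ⟨(∅ : Vert n)⟩
  exact generated_sum_proj (Q := quiver n) (D := zeroDeriv (quiver n))
    (minimal_zeroDeriv (quiver n)) z

end Letters


/-! ### The integral form and its action on the free module on the vertices -/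

section Integral

variable {n : ℕ}

open LaurentPolynomial (T)

/-- The free module on the vertices of `Γ_n`. -/
abbrev Fock (n : ℕ) : Type := Vert n → Λ

/-- The sign of the number of elements of `z` that are greater than `k`. -/
def sgn (z : Vert n) (k : Fin (n + 1)) : Λ := (-1) ^ (z.filter (k < ·)).card

theorem sgn_mul_self (z : Vert n) (k : Fin (n + 1)) : sgn z k * sgn z k = 1 := by
  rw [sgn, ← mul_pow]; simp

theorem sgn_insert {z : Vert n} {i : Fin (n + 1)} (hi : i ∉ z) (k : Fin (n + 1)) :
    sgn (insert i z) k = if k < i then -sgn z k else sgn z k := by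
  rw [sgn, sgn, Finset.filter_insert]
  split_ifs with h
  · rw [Finset.card_insert_of_notMem (by simp [hi]), pow_succ, mul_neg_one]
  · rfl

theorem sgn_erase {z : Vert n} {i : Fin (n + 1)} (hi : i ∈ z) (k : Fin (n + 1)) :
    sgn (z.erase i) k = if k < i then -sgn z k else sgn z k := by
  have h := sgn_insert (Finset.notMem_erase i z) k
  rw [Finset.insert_erase hi] at h
  rw [h]
  split_ifs <;> simp

/-- The creation operators. -/
def creation (i : Fin (n + 1)) : Module.End Λ (Fock n) where
  toFun f z := if i ∈ z then sgn z i * f (z.erase i) else 0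
  map_add' f g := by
    ext1 z
    simp only [Pi.add_apply]
    split_ifs <;> ring
  map_smul' c f := by
    ext1 z
    simp only [Pi.smul_apply, smul_eq_mul, RingHom.id_apply]
    split_ifs <;> ring

/-- The annihilation operators. -/
def annihilation (i : Fin (n + 1)) : Module.End Λ (Fock n) where
  toFun f z := if i ∈ z then 0 else sgn z i * f (insert i z)
  map_add' f g := by
    ext1 z
    simp only [Pi.add_apply]
    split_ifs <;> ring
  map_smul' c f := by
    ext1 z
    simp only [Pi.smul_apply, smul_eq_mul, RingHom.id_apply]
    split_ifs <;> ring

theorem creation_apply (i : Fin (n + 1)) (f : Fock n) (z : Vert n) :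
    creation i f z = if i ∈ z then sgn z i * f (z.erase i) else 0 := rfl

theorem annihilation_apply (i : Fin (n + 1)) (f : Fock n) (z : Vert n) :
    annihilation i f z = if i ∈ z then 0 else sgn z i * f (insert i z) := rfl

theorem creation_mul_self (i : Fin (n + 1)) : creation i * creation i = 0 := by
  refine LinearMap.ext fun f => funext fun z => ?_
  rw [Module.End.mul_apply, creation_apply, creation_apply]
  simp

theorem annihilation_mul_self (i : Fin (n + 1)) : annihilation i * annihilation i = 0 := by
  refine LinearMap.ext fun f => funext fun z => ?_
  rw [Module.End.mul_apply, annihilation_apply, annihilation_apply]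
  simp

theorem creation_anticomm (i j : Fin (n + 1)) :
    creation i * creation j + creation j * creation i = 0 := by
  by_cases hij : i = j
  · subst hij
    rw [creation_mul_self, add_zero]
  refine LinearMap.ext fun f => funext fun z => ?_
  rw [LinearMap.add_apply, Pi.add_apply, Module.End.mul_apply, Module.End.mul_apply]
  simp only [creation_apply, Finset.mem_erase]
  by_cases hi : i ∈ z
  · by_cases hj : j ∈ z
    · rw [if_pos hi, if_pos hj, if_pos ⟨Ne.symm hij, hj⟩, if_pos ⟨hij, hi⟩, sgn_erase hi,
        sgn_erase hj, Finset.erase_right_comm]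
      rcases lt_or_gt_of_ne hij with h | h
      · rw [if_neg (not_lt.2 h.le), if_pos h]
        simp only [LinearMap.zero_apply, Pi.zero_apply]
        ring
      · rw [if_pos h, if_neg (not_lt.2 h.le)]
        simp only [LinearMap.zero_apply, Pi.zero_apply]
        ring
    · simp [hj]
  · simp [hi]

theorem annihilation_anticomm (i j : Fin (n + 1)) :
    annihilation i * annihilation j + annihilation j * annihilation i = 0 := by
  by_cases hij : i = j
  · subst hij
    rw [annihilation_mul_self, add_zero]
  refine LinearMap.ext fun f => funext fun z => ?_
  rw [LinearMap.add_apply, Pi.add_apply, Module.End.mul_apply, Module.End.mul_apply]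
  simp only [annihilation_apply, Finset.mem_insert, Ne.symm hij, hij, false_or]
  by_cases hi : i ∈ z
  · simp [hi]
  · by_cases hj : j ∈ z
    · simp [hj]
    · rw [if_neg hi, if_neg hj, if_neg hj, if_neg hi, sgn_insert hi, sgn_insert hj,
        Finset.insert_comm]
      rcases lt_or_gt_of_ne hij with h | h
      · rw [if_neg (not_lt.2 h.le), if_pos h]
        simp only [LinearMap.zero_apply, Pi.zero_apply]
        ring
      · rw [if_pos h, if_neg (not_lt.2 h.le)]
        simp only [LinearMap.zero_apply, Pi.zero_apply]
        ring

theorem creation_annihilation (i j : Fin (n + 1)) :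
    creation i * annihilation j + annihilation j * creation i = if i = j then 1 else 0 := by
  refine LinearMap.ext fun f => funext fun z => ?_
  rw [LinearMap.add_apply, Pi.add_apply, Module.End.mul_apply, Module.End.mul_apply]
  simp only [annihilation_apply, creation_apply, Finset.mem_insert, Finset.mem_erase]
  by_cases hij : i = j
  · subst hij
    rw [if_pos rfl, Module.End.one_apply]
    by_cases hi : i ∈ z
    · simp only [hi, if_true, ne_eq, not_true_eq_false, false_and, if_false, sgn_erase hi,
        lt_irrefl, Finset.insert_erase hi, ← mul_assoc, sgn_mul_self, one_mul, add_zero]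
    · simp only [hi, if_true, if_false, true_or, sgn_insert hi, lt_irrefl,
        Finset.erase_insert hi, ← mul_assoc, sgn_mul_self, one_mul, zero_add]
  · rw [if_neg hij]
    simp only [LinearMap.zero_apply, Pi.zero_apply]
    by_cases hi : i ∈ z
    · by_cases hj : j ∈ z
      · simp [hj, Ne.symm hij]
      · have h1 : (insert j z).erase i = insert j (z.erase i) :=
          Finset.erase_insert_of_ne (Ne.symm hij)
        simp only [hi, hj, and_false, or_true, if_true, if_false, sgn_erase hi, sgn_insert hj, h1]
        rcases lt_or_gt_of_ne hij with h | h
        · rw [if_neg (not_lt.2 h.le), if_pos h]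
          ring
        · rw [if_pos h, if_neg (not_lt.2 h.le)]
          ring
    · by_cases hj : j ∈ z <;> simp [hi, hj, hij]

/-- The contraction with the successor, scaled by a power of `q`. -/
def contraction (i : Fin (n + 1)) : Module.End Λ (Fock n) :=
  if h : i.val + 1 < n + 1 then
    (T (2 * (i.val : ℤ) + 1 - n) : Λ) • annihilation ⟨i.val + 1, h⟩ else 0

/-- The constant in the anticommutator of the operators `leftOp`. -/
def anticoeff (i j : Fin (n + 1)) : Λ :=
  if i.val + 1 = j.val then T (2 * (i.val : ℤ) + 1 - n) else 0

/-- The operator of left multiplication by the vertex `{i}`. -/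
def leftOp (i : Fin (n + 1)) : Module.End Λ (Fock n) :=
  creation i + contraction i

theorem contraction_mul_self (i : Fin (n + 1)) : contraction i * contraction i = 0 := by
  unfold contraction
  split_ifs
  · rw [smul_mul_smul_comm, annihilation_mul_self, smul_zero]
  · rw [zero_mul]

theorem contraction_anticomm (i j : Fin (n + 1)) :
    contraction i * contraction j + contraction j * contraction i = 0 := by
  unfold contraction
  split_ifs
  · rw [smul_mul_smul_comm, smul_mul_smul_comm, mul_comm (T _ : Λ), ← smul_add,
      annihilation_anticomm, smul_zero]
  all_goals simp

theorem creation_contraction (i j : Fin (n + 1)) :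
    creation i * contraction j + contraction j * creation i = anticoeff j i • 1 := by
  unfold contraction anticoeff
  split_ifs with h1 h2 h2
  · rw [mul_smul_comm, smul_mul_assoc, ← smul_add, creation_annihilation, if_pos (Fin.ext h2.symm)]
  · rw [mul_smul_comm, smul_mul_assoc, ← smul_add, creation_annihilation,
      if_neg fun h => h2 (congrArg Fin.val h).symm, smul_zero, zero_smul]
  · exact absurd (h2 ▸ i.2) h1
  · simp

theorem leftOp_anticomm (i j : Fin (n + 1)) :
    leftOp i * leftOp j + leftOp j * leftOp i = (anticoeff i j + anticoeff j i) • 1 := by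
  unfold leftOp
  have h1 := creation_anticomm i j
  have h2 := contraction_anticomm i j
  have h3 := creation_contraction i j
  have h4 := creation_contraction j i
  rw [add_smul, ← h3, ← h4]
  calc _ = (creation i * creation j + creation j * creation i) +
        (contraction i * contraction j + contraction j * contraction i) +
        (creation j * contraction i + contraction i * creation j +
          (creation i * contraction j + contraction j * creation i)) := by noncomm_ring
    _ = _ := by rw [h1, h2, zero_add, zero_add]

theorem leftOp_mul_self (i : Fin (n + 1)) : leftOp i * leftOp i = 0 := by
  unfold leftOp
  have h3 := creation_contraction i i
  rw [anticoeff, if_neg (by omega), zero_smul] at h3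
  calc _ = creation i * creation i + contraction i * contraction i +
        (creation i * contraction i + contraction i * creation i) := by noncomm_ring
    _ = _ := by rw [creation_mul_self, contraction_mul_self, h3, add_zero, add_zero]

theorem leftOp_single {x : Vert n} {i : Fin (n + 1)} (h : ∀ j ∈ x, j < i) :
    leftOp i (Pi.single x 1) = Pi.single (insert i x) 1 := by
  have hi : i ∉ x := fun hi => lt_irrefl _ (h i hi)
  have h0 : contraction i (Pi.single x 1) = 0 := by
    unfold contraction
    split_ifs with h1
    · rw [LinearMap.smul_apply]
      refine (congrArg _ ?_).trans (smul_zero _)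
      funext z
      rw [annihilation_apply]
      split_ifs
      · rfl
      · rw [Pi.single_eq_of_ne, mul_zero]
        · rfl
        · rintro rfl
          have h2 := h _ (Finset.mem_insert_self _ z)
          exact absurd (Fin.lt_def.1 h2) (by simp)
    · rfl
  rw [leftOp, LinearMap.add_apply, h0, add_zero]
  funext z
  rw [creation_apply]
  by_cases hz : z = insert i x
  · subst hz
    rw [if_pos (Finset.mem_insert_self _ _), Finset.erase_insert hi, Pi.single_eq_same,
      Pi.single_eq_same, mul_one, sgn_insert hi, if_neg (lt_irrefl _), sgn,
      Finset.filter_eq_empty_iff.2 fun j hj => not_lt.2 (h j hj).le, Finset.card_empty, pow_zero]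
  · rw [Pi.single_eq_of_ne hz]
    split_ifs with h1
    · rw [Pi.single_eq_of_ne, mul_zero]
      rintro rfl
      exact hz (Finset.insert_erase h1).symm
    · rfl

/-- The sum of the operators `leftOp i` for `i` of given parity. -/
def evenOp (n : ℕ) : Module.End Λ (Fock n) :=
  ∑ i : Fin (n + 1) with Even i.val, leftOp i

/-- The sum of the operators `leftOp i` for odd `i`. -/
def oddOp (n : ℕ) : Module.End Λ (Fock n) :=
  ∑ i : Fin (n + 1) with Odd i.val, leftOp i

theorem sum_leftOp_mul_self (s : Finset (Fin (n + 1)))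
    (h : ∀ i ∈ s, ∀ j ∈ s, i.val + 1 ≠ j.val) :
    (∑ i ∈ s, leftOp i) * ∑ i ∈ s, leftOp i = 0 := by
  rw [Finset.sum_mul_sum, ← Finset.sum_product']
  refine Finset.sum_involution (fun p _ => (p.2, p.1)) ?_ ?_ ?_ ?_
  · rintro ⟨i, j⟩ hp
    rw [Finset.mem_product] at hp
    refine (leftOp_anticomm i j).trans ?_
    rw [anticoeff, anticoeff, if_neg (h i hp.1 j hp.2), if_neg (h j hp.2 i hp.1), add_zero, zero_smul]
  · rintro ⟨i, j⟩ hp h0 h1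
    have h2 : j = i := congrArg Prod.fst h1
    subst h2
    exact h0 (leftOp_mul_self j)
  · rintro ⟨i, j⟩ hp
    exact Finset.mem_product.2 (Finset.mem_product.1 hp).symm
  · rintro ⟨i, j⟩ hp
    rfl

theorem evenOp_mul_self : evenOp n * evenOp n = 0 :=
  sum_leftOp_mul_self _ fun i hi j hj h => by
    have h1 := (Finset.mem_filter.1 hi).2
    have h2 := (Finset.mem_filter.1 hj).2
    rw [← h] at h2
    exact Nat.not_even_iff_odd.2 h1.add_one h2

theorem oddOp_mul_self : oddOp n * oddOp n = 0 :=
  sum_leftOp_mul_self _ fun i hi j hj h => by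
    have h1 := (Finset.mem_filter.1 hi).2
    have h2 := (Finset.mem_filter.1 hj).2
    rw [← h] at h2
    exact Nat.not_odd_iff_even.2 h1.add_one h2

theorem sum_anticoeff : ∑ i : Fin (n + 1), ∑ j : Fin (n + 1), anticoeff i j =
    ∑ k ∈ Finset.range n, (T ((n : ℤ) - 1 - 2 * k) : Λ) := by
  have h1 : ∀ i : Fin (n + 1), ∑ j : Fin (n + 1), anticoeff i j =
      if i.val < n then (T (2 * (i.val : ℤ) + 1 - n) : Λ) else 0 := by
    intro i
    split_ifs with h
    · rw [Finset.sum_eq_single ⟨i.val + 1, by omega⟩]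
      · rw [anticoeff, if_pos rfl]
      · intro j _ hj
        rw [anticoeff, if_neg fun h' => hj (Fin.ext h'.symm)]
      · simp
    · exact Finset.sum_eq_zero fun j _ => if_neg (by omega)
  rw [Finset.sum_congr rfl fun i _ => h1 i, Fin.sum_univ_eq_sum_range
    (fun i => if i < n then (T (2 * (i : ℤ) + 1 - n) : Λ) else 0),
    Finset.sum_range_succ, if_neg (lt_irrefl n), add_zero, ← Finset.sum_range_reflect]
  refine Finset.sum_congr rfl fun k hk => ?_
  have hk' := Finset.mem_range.1 hk
  rw [if_pos (by omega)]
  congr 1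
  omega

theorem evenOp_oddOp : evenOp n * oddOp n + oddOp n * evenOp n =
    (∑ k ∈ Finset.range n, (T ((n : ℤ) - 1 - 2 * k) : Λ)) • 1 := by
  have h0 : ∀ f : Fin (n + 1) → Λ, ∑ i, f i =
      ∑ i with Even i.val, f i + ∑ i with Odd i.val, f i := fun f => by
    simp only [← Nat.not_even_iff_odd]
    exact (Finset.sum_filter_add_sum_filter_not _ _ _).symm
  have h1 : ∀ i j : Fin (n + 1), Even i.val → Even j.val → anticoeff i j = 0 := fun i j hi hj =>
    if_neg fun h => by rw [← h] at hj; exact Nat.not_even_iff_odd.2 hi.add_one hj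
  have h2 : ∀ i j : Fin (n + 1), Odd i.val → Odd j.val → anticoeff i j = 0 := fun i j hi hj =>
    if_neg fun h => by rw [← h] at hj; exact Nat.not_odd_iff_even.2 hi.add_one hj
  rw [← sum_anticoeff, h0]
  have h3 : ∑ i : Fin (n + 1) with Even i.val, ∑ j, anticoeff i j =
      ∑ i : Fin (n + 1) with Even i.val, ∑ j : Fin (n + 1) with Odd j.val, anticoeff i j :=
    Finset.sum_congr rfl fun i hi => by
      rw [h0, Finset.sum_eq_zero fun j hj => h1 i j (Finset.mem_filter.1 hi).2
        (Finset.mem_filter.1 hj).2, zero_add]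
  have h4 : ∑ i : Fin (n + 1) with Odd i.val, ∑ j, anticoeff i j =
      ∑ i : Fin (n + 1) with Odd i.val, ∑ j : Fin (n + 1) with Even j.val, anticoeff i j :=
    Finset.sum_congr rfl fun i hi => by
      rw [h0, Finset.sum_eq_zero (s := Finset.univ.filter fun j : Fin (n + 1) => Odd j.val)
        fun j hj => h2 i j (Finset.mem_filter.1 hi).2 (Finset.mem_filter.1 hj).2, add_zero]
  rw [h3, h4, Finset.sum_comm (s := Finset.univ.filter fun j : Fin (n + 1) => Odd j.val),
    evenOp, oddOp, Finset.sum_mul_sum, Finset.sum_mul_sum,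
    Finset.sum_comm (s := Finset.univ.filter fun j : Fin (n + 1) => Odd j.val),
    ← Finset.sum_add_distrib, ← Finset.sum_add_distrib, Finset.sum_smul]
  refine Finset.sum_congr rfl fun i _ => ?_
  rw [← Finset.sum_add_distrib, ← Finset.sum_add_distrib, Finset.sum_smul]
  exact Finset.sum_congr rfl fun j _ => leftOp_anticomm i j

end Integral


section Integral

variable {n : ℕ}

open LaurentPolynomial (T)

theorem Un.E_mul_E : Un.E n * Un.E n = 0 :=
  (map_mul (RingQuot.mkAlgHom Λ (UnRel n)) _ _).symm.trans
    ((RingQuot.mkAlgHom_rel Λ (UnRel.sq 0)).trans (map_zero _))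

theorem Un.F_mul_F : Un.F n * Un.F n = 0 :=
  (map_mul (RingQuot.mkAlgHom Λ (UnRel n)) _ _).symm.trans
    ((RingQuot.mkAlgHom_rel Λ (UnRel.sq 1)).trans (map_zero _))

theorem Un.anticomm : Un.E n * Un.F n + Un.F n * Un.E n =
    (∑ k ∈ Finset.range n, (T ((n : ℤ) - 1 - 2 * k) : Λ)) • (1 : Un n) := by
  rw [← Algebra.algebraMap_eq_smul_one]
  have h := RingQuot.mkAlgHom_rel Λ (UnRel.anti (n := n))
  rw [AlgHom.commutes, map_add, map_mul, map_mul] at h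
  exact h

/-- The action of `U_n` on the free module on the vertices. -/
def action (n : ℕ) :
    Un n →ₐ[Λ] Module.End Λ (Fock n) :=
  RingQuot.liftAlgHom Λ ⟨FreeAlgebra.lift Λ
    ![evenOp n, oddOp n], by
      intro a b h
      cases h with
      | sq i =>
        rw [map_mul, FreeAlgebra.lift_ι_apply, map_zero]
        fin_cases i
        · exact evenOp_mul_self
        · exact oddOp_mul_self
      | anti =>
        rw [map_add, map_mul, map_mul, FreeAlgebra.lift_ι_apply, FreeAlgebra.lift_ι_apply,
          AlgHom.commutes, Algebra.algebraMap_eq_smul_one]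
        exact evenOp_oddOp⟩

theorem action_E : action n (Un.E n) = evenOp n :=
  (RingQuot.liftAlgHom_mkAlgHom_apply Λ _ _ _).trans
    (FreeAlgebra.lift_ι_apply _ _)

theorem action_F : action n (Un.F n) = oddOp n :=
  (RingQuot.liftAlgHom_mkAlgHom_apply Λ _ _ _).trans
    (FreeAlgebra.lift_ι_apply _ _)

theorem Un.mem_of_mul_mem {W : Submodule Λ (Un n)} (h1 : (1 : Un n) ∈ W)
    (hE : ∀ w ∈ W, Un.E n * w ∈ W) (hF : ∀ w ∈ W, Un.F n * w ∈ W) (a : Un n) : a ∈ W := by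
  have key : ∀ b : FreeAlgebra Λ (Fin 2), ∀ w ∈ W,
      (show Un n from RingQuot.mkAlgHom Λ (UnRel n) b) * w ∈ W := by
    intro b
    induction b using FreeAlgebra.induction with
    | grade0 c =>
      intro w hw
      have h : (show Un n from RingQuot.mkAlgHom Λ (UnRel n)
          (algebraMap _ _ c)) = c • (1 : Un n) :=
        (AlgHom.commutes (RingQuot.mkAlgHom Λ (UnRel n)) c).trans (Algebra.algebraMap_eq_smul_one (A := RingQuot (UnRel n)) c)
      rw [h, smul_mul_assoc, one_mul]
      exact W.smul_mem c hw
    | grade1 i =>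
      intro w hw
      fin_cases i
      · exact hE w hw
      · exact hF w hw
    | mul a b ha hb =>
      intro w hw
      have h : (show Un n from RingQuot.mkAlgHom Λ (UnRel n) (a * b)) =
        (show Un n from RingQuot.mkAlgHom Λ (UnRel n) a) *
        (show Un n from RingQuot.mkAlgHom Λ (UnRel n) b) := map_mul _ a b
      rw [h, mul_assoc]
      exact ha _ (hb w hw)
    | add a b ha hb =>
      intro w hw
      have h : (show Un n from RingQuot.mkAlgHom Λ (UnRel n) (a + b)) =
        (show Un n from RingQuot.mkAlgHom Λ (UnRel n) a) +
        (show Un n from RingQuot.mkAlgHom Λ (UnRel n) b) := map_add _ a b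
      rw [h, add_mul]
      exact add_mem (ha w hw) (hb w hw)
  obtain ⟨b, rfl⟩ := RingQuot.mkAlgHom_surjective Λ (UnRel n) a
  have h2 := key b 1 h1
  rwa [mul_one] at h2

/-- The algebra `U_n` is spanned by `1`, `E`, `F` and `E F`. -/
theorem Un.span_eq_top : Submodule.span Λ
    {1, Un.E n, Un.F n, Un.E n * Un.F n} = ⊤ := by
  set W := Submodule.span Λ {1, Un.E n, Un.F n, Un.E n * Un.F n} with hW
  have m1 : (1 : Un n) ∈ W := Submodule.subset_span (by simp)
  have mE : Un.E n ∈ W := Submodule.subset_span (by simp)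
  have mF : Un.F n ∈ W := Submodule.subset_span (by simp)
  have mEF : Un.E n * Un.F n ∈ W := Submodule.subset_span (by simp)
  have hFE : Un.F n * Un.E n = (∑ k ∈ Finset.range n,
      (T ((n : ℤ) - 1 - 2 * k) : Λ)) • (1 : Un n) - Un.E n * Un.F n :=
    eq_sub_of_add_eq' Un.anticomm
  refine eq_top_iff.2 fun a _ => Un.mem_of_mul_mem m1 (fun w hw => ?_) (fun w hw => ?_) a
  · refine Submodule.span_induction (p := fun w _ => Un.E n * w ∈ W) ?_ ?_ ?_ ?_ hw
    · rintro x (rfl | rfl | rfl | rfl)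
      · rwa [mul_one]
      · rw [Un.E_mul_E]; exact zero_mem _
      · exact mEF
      · rw [← mul_assoc, Un.E_mul_E, zero_mul]; exact zero_mem _
    · rw [mul_zero]; exact zero_mem _
    · intro x y _ _ hx hy
      rw [mul_add]; exact add_mem hx hy
    · intro c x _ hx
      rw [mul_smul_comm]; exact W.smul_mem c hx
  · refine Submodule.span_induction (p := fun w _ => Un.F n * w ∈ W) ?_ ?_ ?_ ?_ hw
    · rintro x (rfl | rfl | rfl | rfl)
      · rwa [mul_one]
      · rw [hFE]; exact sub_mem (W.smul_mem _ m1) mEF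
      · rw [Un.F_mul_F]; exact zero_mem _
      · rw [← mul_assoc, hFE, sub_mul, mul_assoc, Un.F_mul_F, mul_zero, sub_zero, smul_mul_assoc,
          one_mul]
        exact W.smul_mem _ mF
    · rw [mul_zero]; exact zero_mem _
    · intro x y _ _ hx hy
      rw [mul_add]; exact add_mem hx hy
    · intro c x _ hx
      rw [mul_smul_comm]; exact W.smul_mem c hx

/-- The vacuum vector. -/
def vacuum (n : ℕ) : Fock n := Pi.single ∅ 1

/-- The embedding `a ↦ a ∅` of `U_n`, by the action on the vacuum vector. -/
def embed (n : ℕ) : Un n →ₗ[Λ] Fock n :=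
  LinearMap.applyₗ (vacuum n) ∘ₗ (action n).toLinearMap

theorem embed_apply (a : Un n) : embed n a = action n a (vacuum n) := rfl

theorem embed_one : embed n 1 = vacuum n := by
  rw [embed_apply, map_one]
  rfl

theorem embed_mul (a b : Un n) : embed n (a * b) = action n a (embed n b) := by
  rw [embed_apply, map_mul]
  rfl

theorem leftOp_vacuum (i : Fin (n + 1)) : leftOp i (vacuum n) = Pi.single {i} 1 := by
  rw [vacuum, leftOp_single (by simp), insert_empty_eq]

theorem embed_E : embed n (Un.E n) = ∑ i : Fin (n + 1) with Even i.val, Pi.single {i} 1 := by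
  rw [embed_apply, action_E, evenOp, LinearMap.sum_apply]
  exact Finset.sum_congr rfl fun i _ => leftOp_vacuum i

theorem embed_F : embed n (Un.F n) = ∑ i : Fin (n + 1) with Odd i.val, Pi.single {i} 1 := by
  rw [embed_apply, action_F, oddOp, LinearMap.sum_apply]
  exact Finset.sum_congr rfl fun i _ => leftOp_vacuum i

theorem embed_E_apply (z : Vert n) :
    embed n (Un.E n) z = if ∃ i : Fin (n + 1), Even i.val ∧ z = {i} then 1 else 0 := by
  rw [embed_E, Finset.sum_apply]
  split_ifs with h
  · obtain ⟨i, hi, rfl⟩ := h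
    rw [Finset.sum_eq_single i, Pi.single_eq_same]
    · intro j _ hj
      rw [Pi.single_eq_of_ne fun h => hj (Finset.singleton_injective h).symm]
    · intro h
      exact absurd (by simp [hi]) h
  · exact Finset.sum_eq_zero fun i hi =>
      Pi.single_eq_of_ne (fun hz => h ⟨i, (Finset.mem_filter.1 hi).2, hz⟩) _

theorem embed_F_apply (z : Vert n) :
    embed n (Un.F n) z = if ∃ i : Fin (n + 1), Odd i.val ∧ z = {i} then 1 else 0 := by
  rw [embed_F, Finset.sum_apply]
  split_ifs with h
  · obtain ⟨i, hi, rfl⟩ := h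
    rw [Finset.sum_eq_single i, Pi.single_eq_same]
    · intro j _ hj
      rw [Pi.single_eq_of_ne fun h => hj (Finset.singleton_injective h).symm]
    · intro h
      exact absurd (by simp [hi]) h
  · exact Finset.sum_eq_zero fun i hi =>
      Pi.single_eq_of_ne (fun hz => h ⟨i, (Finset.mem_filter.1 hi).2, hz⟩) _

/-- The value of a contraction vanishes at a nonempty vertex if the argument is supported on
vertices with one element. -/
theorem contraction_eq_zero {f : Fock n} (hf : ∀ z : Vert n, 1 < z.card → f z = 0)
    (i : Fin (n + 1)) {z : Vert n} (hz : z.Nonempty) : contraction i f z = 0 := by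
  unfold contraction
  split_ifs with h
  · rw [LinearMap.smul_apply, Pi.smul_apply, annihilation_apply]
    split_ifs with h1
    · exact smul_zero _
    · rw [hf, mul_zero, smul_zero]
      rw [Finset.card_insert_of_notMem h1]
      exact Nat.lt_add_of_pos_left hz.card_pos
  · rfl

theorem embed_EF_apply {z : Vert n} (hz : z.Nonempty) :
    embed n (Un.E n * Un.F n) z =
      ∑ i : Fin (n + 1) with Even i.val, creation i (embed n (Un.F n)) z := by
  rw [embed_mul, action_E, evenOp, LinearMap.sum_apply, Finset.sum_apply]
  refine Finset.sum_congr rfl fun i _ => ?_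
  rw [leftOp, LinearMap.add_apply, Pi.add_apply, contraction_eq_zero (fun y hy => ?_) i hz, add_zero]
  rw [embed_F_apply, if_neg]
  rintro ⟨i, -, rfl⟩
  simp at hy

variable (hn : 0 < n)

/-- A left inverse of the embedding, given by the coefficients at the vertices contained in
`{0, 1}`. -/
def retraction : Fock n →ₗ[Λ] Un n where
  toFun f := f ∅ • 1 + f {0} • Un.E n + f {⟨1, by omega⟩} • Un.F n -
    f {0, ⟨1, by omega⟩} • (Un.E n * Un.F n - embed n (Un.E n * Un.F n) ∅ • 1)
  map_add' f g := by
    simp only [Pi.add_apply, add_smul]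
    abel
  map_smul' c f := by
    simp only [Pi.smul_apply, smul_eq_mul, mul_smul, RingHom.id_apply, smul_add, smul_sub]

theorem retraction_apply (f : Fock n) : retraction hn f =
    f ∅ • 1 + f {0} • Un.E n + f {⟨1, by omega⟩} • Un.F n -
      f {0, ⟨1, by omega⟩} • (Un.E n * Un.F n - embed n (Un.E n * Un.F n) ∅ • 1) := rfl

/-- The vectors `E ∅` and `F ∅` are the sums of the vertices `{i}` for even and for odd `i`, and the
coefficient of `E F ∅` at `{0, 1}` is `-1`. -/
theorem retraction_embed (a : Un n) : retraction hn (embed n a) = a := by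
  have h01 : (0 : Fin (n + 1)) ≠ ⟨1, by omega⟩ := fun h => by simp [Fin.ext_iff] at h
  have hp : ∀ i : Fin (n + 1), ({0, ⟨1, by omega⟩} : Vert n) ≠ {i} := fun i h => by
    have h1 := congrArg Finset.card h
    rw [Finset.card_pair h01, Finset.card_singleton] at h1
    omega
  have key : ∀ x ∈ ({1, Un.E n, Un.F n, Un.E n * Un.F n} : Set (Un n)),
      retraction hn (embed n x) = x := by
    rintro x (rfl | rfl | rfl | rfl)
    · rw [embed_one, retraction_apply, vacuum, Pi.single_eq_same, Pi.single_eq_of_ne (by simp),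
        Pi.single_eq_of_ne (by simp), Pi.single_eq_of_ne (by simp)]
      simp
    · rw [retraction_apply, embed_E_apply, embed_E_apply, embed_E_apply, embed_E_apply,
        if_neg (by rintro ⟨i, -, h⟩; simp at h), if_pos ⟨0, by simp, rfl⟩,
        if_neg (by
          rintro ⟨i, hi, h⟩
          rw [← Finset.singleton_injective h] at hi
          simp at hi), if_neg (by rintro ⟨i, -, h⟩; exact hp i h)]
      simp
    · rw [retraction_apply, embed_F_apply, embed_F_apply, embed_F_apply, embed_F_apply,
        if_neg (by rintro ⟨i, -, h⟩; simp at h),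
        if_neg (by
          rintro ⟨i, hi, h⟩
          rw [← Finset.singleton_injective h] at hi
          simp at hi), if_pos ⟨⟨1, by omega⟩, by simp, rfl⟩,
        if_neg (by rintro ⟨i, -, h⟩; exact hp i h)]
      simp
    · have hs : ∀ i k : Fin (n + 1), creation i (embed n (Un.F n)) {k} = 0 := by
        intro i k
        rw [creation_apply]
        split_ifs with h
        · rw [Finset.mem_singleton.1 h, Finset.erase_singleton, embed_F_apply, if_neg, mul_zero]
          rintro ⟨j, -, h⟩
          simp at h
        · rfl
      have h3 : embed n (Un.E n * Un.F n) {0, ⟨1, by omega⟩} = -1 := by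
        rw [embed_EF_apply (by simp), Finset.sum_eq_single 0]
        · rw [creation_apply, if_pos (by simp), Finset.erase_insert (by simp),
            embed_F_apply, if_pos ⟨⟨1, by omega⟩, by simp, rfl⟩, mul_one, sgn]
          have : (({0, ⟨1, by omega⟩} : Vert n).filter ((0 : Fin (n + 1)) < ·)) =
              {⟨1, by omega⟩} := by
            ext k
            simp only [Finset.mem_filter, Finset.mem_insert, Finset.mem_singleton]
            constructor
            · rintro ⟨rfl | rfl, h⟩
              · exact absurd h (lt_irrefl _)
              · rfl
            · rintro rfl
              exact ⟨Or.inr rfl, Fin.lt_def.2 (by simp)⟩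
          rw [this, Finset.card_singleton, pow_one]
        · intro i hi h0
          rw [creation_apply, if_neg]
          simp only [Finset.mem_insert, Finset.mem_singleton]
          rintro (h | rfl)
          · exact h0 h
          · have := (Finset.mem_filter.1 hi).2
            simp at this
        · intro h
          exact absurd (Finset.mem_filter.2 ⟨Finset.mem_univ _, by simp⟩) h
      rw [retraction_apply, embed_EF_apply (z := {0}) (by simp),
        embed_EF_apply (z := {⟨1, by omega⟩}) (by simp), h3,
        Finset.sum_eq_zero fun i _ => hs i _, Finset.sum_eq_zero fun i _ => hs i _]
      module
  have h := Submodule.span_induction (p := fun x _ => retraction hn (embed n x) = x) key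
    (by rw [map_zero, map_zero]) (fun x y _ _ hx hy => by rw [map_add, map_add, hx, hy])
    (fun c x _ hx => by rw [map_smul, map_smul, hx]) (Un.span_eq_top ▸ Submodule.mem_top : a ∈ _)
  exact h

end Integral


/-! ### Stacking of vertices and the multiplication of the integral form -/

section StackMul

variable {n : ℕ}

open LaurentPolynomial (T)

/-- The contribution of a state to the product of its two vertices. -/
def stackTerm (p : St n) : Fock n :=
  if Disjoint (restLeft p) (restRight p) then Pi.single (svtx p) (weight (-scoh p, sqs p)) else 0

/-- The product of two vertices. -/
def stackVec (v : Vert n × Vert n) : Fock n := ∑ I ∈ (adj v).powerset, stackTerm (v, I)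

theorem sum_idx_eq_stackVec (w : Vert n × Vert n) :
    ∑ i : {i : Idx n // i.1.1 = w}, Pi.single i.1.vtx (weight (-i.1.coh, i.1.qshift)) =
      stackVec w := by
  rw [stackVec]
  unfold stackTerm
  rw [← Finset.sum_filter]
  refine Finset.sum_bij (fun i _ => i.1.1.2) ?_ ?_ ?_ ?_
  · rintro ⟨⟨⟨v, I⟩, h1, h2⟩, rfl⟩ _
    exact Finset.mem_filter.2 ⟨Finset.mem_powerset.2 h1, h2⟩
  · rintro ⟨⟨⟨v, I⟩, h⟩, rfl⟩ _ ⟨⟨⟨v', I'⟩, h'⟩, e⟩ _ hI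
    have e' : v' = v := e
    have hI' : I = I' := hI
    subst e' hI'
    rfl
  · intro I hI
    rw [Finset.mem_filter, Finset.mem_powerset] at hI
    exact ⟨⟨⟨(w, I), hI⟩, rfl⟩, Finset.mem_univ _, rfl⟩
  · rintro ⟨⟨⟨v, I⟩, h⟩, rfl⟩ _
    rfl

theorem weight_neg_sum {ι : Type} [DecidableEq ι] (y : Finset ι) (p : ι → Prop) [DecidablePred p]
    (f : ι → ℕ) : weight (-∑ b ∈ y, (if p b then (-1 : ℤ) ^ f b else 0), 0) =
      (-1) ^ (y.filter p).card := by
  induction y using Finset.induction_on with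
  | empty => simp [weight_zero, ← Prod.zero_eq_mk]
  | insert b y hb ih =>
    have h1 : ((-∑ b ∈ insert b y, (if p b then (-1 : ℤ) ^ f b else 0), 0) : ℤ × ℤ) =
        (-(if p b then (-1 : ℤ) ^ f b else 0), 0) +
          (-∑ b ∈ y, (if p b then (-1 : ℤ) ^ f b else 0), 0) := by
      rw [Finset.sum_insert hb, neg_add]
      rfl
    rw [h1, weight_add, ih, Finset.filter_insert]
    split_ifs with h
    · rw [Finset.card_insert_of_notMem (by simp [hb]), pow_succ']
      congr 1
      rcases neg_one_pow_eq_or ℤ (f b) with h2 | h2 <;> rw [h2]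
      · simp [weight]
      · rw [neg_neg, weight_one]
    · rw [neg_zero, ← Prod.zero_eq_mk, weight_zero, one_mul]

theorem creation_single (i : Fin (n + 1)) (z : Vert n) (c : Λ) :
    creation i (Pi.single z c) = if i ∈ z then 0 else Pi.single (insert i z) (sgn z i * c) := by
  funext y
  rw [creation_apply]
  by_cases hz : i ∈ z
  · rw [if_pos hz]
    split_ifs
    · rw [Pi.single_eq_of_ne, mul_zero]
      · rfl
      · rintro rfl
        exact absurd hz (Finset.notMem_erase _ _)
    · rfl
  · rw [if_neg hz]
    by_cases hy : y = insert i z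
    · subst hy
      rw [if_pos (Finset.mem_insert_self _ _), Finset.erase_insert hz, Pi.single_eq_same,
        Pi.single_eq_same, sgn_insert hz, if_neg (lt_irrefl _)]
    · rw [Pi.single_eq_of_ne hy]
      split_ifs with h
      · rw [Pi.single_eq_of_ne, mul_zero]
        rintro rfl
        exact hy (Finset.insert_erase h).symm
      · rfl

theorem annihilation_single (i : Fin (n + 1)) (z : Vert n) (c : Λ) :
    annihilation i (Pi.single z c) =
      if i ∈ z then Pi.single (z.erase i) (sgn z i * c) else 0 := by
  funext y
  rw [annihilation_apply]
  by_cases hz : i ∈ z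
  · rw [if_pos hz]
    by_cases hy : y = z.erase i
    · subst hy
      rw [if_neg (Finset.notMem_erase _ _), Finset.insert_erase hz, Pi.single_eq_same,
        Pi.single_eq_same, sgn_erase hz, if_neg (lt_irrefl _)]
    · rw [Pi.single_eq_of_ne hy]
      split_ifs with h
      · rfl
      · rw [Pi.single_eq_of_ne, mul_zero]
        rintro rfl
        exact hy (Finset.erase_insert h).symm
  · rw [if_neg hz]
    split_ifs
    · rfl
    · rw [Pi.single_eq_of_ne, mul_zero]
      · rfl
      · rintro rfl
        exact hz (Finset.mem_insert_self _ _)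

theorem has_insert {x : Vert n} {i : Fin (n + 1)} {k : ℕ} :
    Has (insert i x) k ↔ k = i.val ∨ Has x k := by
  simp only [Has, Finset.mem_insert, exists_eq_or_imp]
  rw [eq_comm]

theorem has_erase {x : Vert n} {i : Fin (n + 1)} {k : ℕ} :
    Has (x.erase i) k ↔ k ≠ i.val ∧ Has x k := by
  constructor
  · rintro ⟨b, hb, rfl⟩
    exact ⟨fun h => (Finset.mem_erase.1 hb).1 (Fin.ext h), has_val.2 (Finset.mem_of_mem_erase hb)⟩
  · rintro ⟨h1, b, hb, rfl⟩
    exact ⟨b, Finset.mem_erase.2 ⟨fun h => h1 (congrArg Fin.val h), hb⟩, rfl⟩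

theorem mu_insert {x y : Vert n} {i : Fin (n + 1)} (hi : i ∉ x) :
    mu (insert i x, y) =
      (∑ b ∈ y, if i.val + 1 < b.val then (-1 : ℤ) ^ (i.val + b.val + 1) else 0) + mu (x, y) :=
  Finset.sum_insert hi

/-- The elements of the vertex of a state that are beyond the elements of `x` come from `y`. -/
theorem filter_svtx {p : St n} {i k : Fin (n + 1)} (hx : ∀ j ∈ p.1.1, j < i) (hk : i ≤ k) :
    (svtx p).filter (k < ·) = p.1.2.filter (k < ·) := by
  ext b
  rw [Finset.mem_filter, Finset.mem_filter, ← has_val, ← has_val, has_svtx, has_restLeft,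
    has_restRight]
  refine and_congr_left fun h1 => ⟨?_, fun h => Or.inr ⟨h, fun j hj hc => ?_⟩⟩
  · rintro (h | h)
    · exact absurd (hx _ (has_val.1 h.1)) (not_lt.2 (hk.trans h1.le))
    · exact h.1
  · obtain ⟨c, hcx, rfl⟩ := hc.1
    have h2 := hx _ hcx
    rw [Fin.lt_def] at h1 h2
    rw [Fin.le_def] at hk
    omega

/-- The effect of a new greatest element of `x` on the sign of a state. -/
theorem weight_mu_insert {x y : Vert n} {i : Fin (n + 1)} (hi : i ∉ x) (c d : ℤ) :
    weight (-(mu (insert i x, y) + c), d) =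
      (-1) ^ (y.filter (fun b => i.val + 1 < b.val)).card * weight (-(mu (x, y) + c), d) := by
  rw [mu_insert hi, ← weight_neg_sum y (fun b => i.val + 1 < b.val) fun b => i.val + b.val + 1,
    ← weight_add]
  congr 1
  refine Prod.ext ?_ ?_
  · change -_ = -_ + -_
    ring
  · exact (zero_add _).symm

/-- If the new greatest element of `x` is reordered with its successor whenever that is in `y`, then
the state changes by a creation operator. -/
theorem stackTerm_creation {x y : Vert n} {I I' : Finset (Fin n)} {i : Fin (n + 1)}
    (hx : ∀ j ∈ x, j < i)
    (hI' : ∀ k, Kept ((insert i x, y), I') k ↔ Kept ((x, y), I) k ∨ (k = i.val ∧ Has y (i.val + 1)))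
    (hc : Has y (i.val + 1) → (I'.card : ℤ) = I.card + 1)
    (hc' : ¬ Has y (i.val + 1) → I'.card = I.card) :
    stackTerm ((insert i x, y), I') = creation i (stackTerm ((x, y), I)) := by
  have hi : i ∉ x := fun hi => lt_irrefl _ (hx i hi)
  have hxi : ∀ j, Has x j → j < i.val := by
    rintro _ ⟨b, hb, rfl⟩
    exact hx b hb
  have hcon : ∀ k, Con ((insert i x, y), I') k ↔ Con ((x, y), I) k := by
    intro k
    unfold Con
    rw [hI', has_insert]
    grind
  have hcontr : contr ((insert i x, y), I') = contr ((x, y), I) := by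
    ext s
    rw [mem_contr, mem_contr, hcon]
  have hL : restLeft ((insert i x, y), I') = insert i (restLeft ((x, y), I)) := by
    refine vert_ext fun k => ?_
    rw [has_insert, has_restLeft, has_restLeft, hcon, has_insert]
    have : ¬ Con ((x, y), I) i.val := fun h => lt_irrefl _ (hxi _ h.1)
    grind
  have hR : restRight ((insert i x, y), I') = restRight ((x, y), I) := by
    refine vert_ext fun k => ?_
    rw [has_restRight, has_restRight]
    simp only [hcon]
  have hS : svtx ((insert i x, y), I') = insert i (svtx ((x, y), I)) := by
    rw [svtx, svtx, hL, hR, Finset.insert_union]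
  have hiL : i ∉ restLeft ((x, y), I) := fun h => hi (Finset.sdiff_subset h)
  have hsgn : weight (-scoh ((insert i x, y), I'), sqs ((insert i x, y), I')) =
      sgn (svtx ((x, y), I)) i * weight (-scoh ((x, y), I), sqs ((x, y), I)) := by
    have h1 : sqs ((insert i x, y), I') = sqs ((x, y), I) := by rw [sqs, sqs, hcontr]
    have h2 : weight (-scoh ((insert i x, y), I'), sqs ((insert i x, y), I')) = _ :=
      weight_mu_insert hi _ _
    rw [h2, h1, sgn, filter_svtx (p := ((x, y), I)) hx le_rfl]
    change _ * weight (-(mu (x, y) + (I'.card : ℤ)), _) = (-1) ^ (y.filter (i < ·)).card *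
      weight (-(mu (x, y) + (I.card : ℤ)), _)
    by_cases h3 : Has y (i.val + 1)
    · obtain ⟨b, hb, hbi⟩ := h3
      have h4 : y.filter (i < ·) = insert b (y.filter fun b => i.val + 1 < b.val) := by
        ext c
        rw [Finset.mem_insert, Finset.mem_filter, Finset.mem_filter, Fin.lt_def, Fin.ext_iff]
        constructor
        · rintro ⟨h5, h6⟩
          by_cases h7 : c.val = b.val
          · exact Or.inl h7
          · exact Or.inr ⟨h5, by omega⟩
        · rintro (h5 | h5)
          · rw [Fin.ext h5]
            exact ⟨hb, by omega⟩
          · exact ⟨h5.1, by omega⟩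
      rw [h4, Finset.card_insert_of_notMem (by simp [hbi]), hc ⟨b, hb, hbi⟩, pow_succ,
        mul_assoc]
      congr 1
      have h5 : ((-(mu (x, y) + ((I.card : ℤ) + 1)), sqs ((x, y), I)) : ℤ × ℤ) =
          (-1, 0) + (-(mu (x, y) + (I.card : ℤ)), sqs ((x, y), I)) := by
        refine Prod.ext ?_ (zero_add _).symm
        change _ = -1 + -_
        ring
      rw [h5, weight_add]
      congr 1
      simp [weight]
    · rw [hc' h3]
      congr 3
      refine Finset.filter_congr fun c hc => ?_
      rw [Fin.lt_def]
      refine ⟨fun h => by omega, fun h => ?_⟩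
      by_contra h5
      exact h3 ⟨c, hc, by omega⟩
  have hdis : Disjoint (restLeft ((insert i x, y), I')) (restRight ((insert i x, y), I')) ↔
      i ∉ restRight ((x, y), I) ∧ Disjoint (restLeft ((x, y), I)) (restRight ((x, y), I)) := by
    rw [hL, hR, Finset.disjoint_insert_left]
  unfold stackTerm
  by_cases h1 : Disjoint (restLeft ((x, y), I)) (restRight ((x, y), I))
  · rw [if_pos h1, creation_single]
    by_cases h2 : i ∈ restRight ((x, y), I)
    · rw [if_neg fun h => (hdis.1 h).1 h2, if_pos (show i ∈ svtx _ from Finset.mem_union_right _ h2)]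
    · rw [if_pos (hdis.2 ⟨h2, h1⟩), if_neg, hS, hsgn]
      intro h3
      exact (Finset.mem_union.1 h3).elim hiL h2
  · rw [if_neg h1, if_neg fun h => h1 (hdis.1 h).2, map_zero]

/-- If the new greatest element of `x` is contracted with its successor in `y`, then the state
changes by an annihilation operator. -/
theorem stackTerm_annihilation {x y : Vert n} {I : Finset (Fin n)} {i : Fin (n + 1)} {s : Fin n}
    (hs : s.castSucc = i) (hx : ∀ j ∈ x, j < i) (hy : s.succ ∈ y)
    (hI : ∀ k, Kept ((x, y), I) k → k < i.val) :
    stackTerm ((insert i x, y), I) = contraction i (stackTerm ((x, y), I)) := by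
  subst hs
  have hi : s.castSucc ∉ x := fun hi => lt_irrefl _ (hx _ hi)
  have hxi : ∀ j, Has x j → j < s.val := by
    rintro _ ⟨b, hb, rfl⟩
    exact hx b hb
  have hI' : ∀ k, Kept ((insert s.castSucc x, y), I) k ↔ Kept ((x, y), I) k := fun k => Iff.rfl
  have hys : Has y (s.val + 1) := ⟨_, hy, rfl⟩
  have hns : ¬ Kept ((x, y), I) s.val := fun h => lt_irrefl _ (hI _ h)
  have hcon : ∀ k, Con ((insert s.castSucc x, y), I) k ↔ Con ((x, y), I) k ∨ k = s.val := by
    intro k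
    unfold Con
    rw [hI', has_insert, Fin.val_castSucc]
    grind
  have hncon : ¬ Con ((x, y), I) s.val := fun h => lt_irrefl _ (hxi _ h.1)
  have hcontr : contr ((insert s.castSucc x, y), I) = insert s (contr ((x, y), I)) := by
    ext t
    rw [Finset.mem_insert, mem_contr, mem_contr, hcon, or_comm, Fin.ext_iff]
  have hsc : s ∉ contr ((x, y), I) := fun h => hncon (mem_contr.1 h)
  have hL : restLeft ((insert s.castSucc x, y), I) = restLeft ((x, y), I) := by
    refine vert_ext fun k => ?_
    rw [has_restLeft, has_restLeft, hcon, has_insert, Fin.val_castSucc]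
    have := hxi k
    grind
  have hR : restRight ((insert s.castSucc x, y), I) = (restRight ((x, y), I)).erase s.succ := by
    refine vert_ext fun k => ?_
    rw [has_erase, has_restRight, has_restRight, Fin.val_succ]
    simp only [hcon]
    grind
  have hsL : s.succ ∉ restLeft ((x, y), I) := fun h => by
    have := hx _ (Finset.sdiff_subset h)
    rw [Fin.lt_def, Fin.val_succ, Fin.val_castSucc] at this
    omega
  have hsR : s.succ ∈ restRight ((x, y), I) := by
    rw [← has_val, has_restRight]
    refine ⟨has_val.2 hy, fun j hj h => ?_⟩
    rw [Fin.val_succ] at hj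
    exact hncon ((Nat.succ_injective hj : s.val = j) ▸ h)
  have hS : svtx ((insert s.castSucc x, y), I) = (svtx ((x, y), I)).erase s.succ := by
    rw [svtx, svtx, hL, hR, Finset.erase_union_distrib, Finset.erase_eq_of_notMem hsL]
  have hsgn : weight (-scoh ((insert s.castSucc x, y), I), sqs ((insert s.castSucc x, y), I)) =
      T (2 * (s.val : ℤ) + 1 - n) *
        (sgn (svtx ((x, y), I)) s.succ * weight (-scoh ((x, y), I), sqs ((x, y), I))) := by
    have h1 : sqs ((insert s.castSucc x, y), I) = (2 * (s.val : ℤ) + 1 - n) + sqs ((x, y), I) := by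
      rw [sqs, sqs, hcontr, Finset.sum_insert hsc]
    have h2 : weight (-scoh ((insert s.castSucc x, y), I), sqs ((insert s.castSucc x, y), I)) = _ :=
      weight_mu_insert hi _ _
    have h3 : y.filter (s.succ < ·) = y.filter fun b => s.castSucc.val + 1 < b.val := rfl
    have h4 : ((-(mu (x, y) + (I.card : ℤ)), (2 * (s.val : ℤ) + 1 - n) + sqs ((x, y), I)) : ℤ × ℤ) =
        (0, 2 * (s.val : ℤ) + 1 - n) + (-(mu (x, y) + (I.card : ℤ)), sqs ((x, y), I)) :=
      Prod.ext (zero_add _).symm rfl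
    rw [h2, h1, sgn, filter_svtx (p := ((x, y), I)) hx (Fin.castSucc_lt_succ).le, mul_left_comm]
    refine congrArg₂ _ (congrArg _ (congrArg Finset.card h3.symm)) ?_
    refine (congrArg weight h4).trans ((weight_add _ _).trans ?_)
    congr 1
    simp [weight]
  have hdis : Disjoint (restLeft ((insert s.castSucc x, y), I))
      (restRight ((insert s.castSucc x, y), I)) ↔
      Disjoint (restLeft ((x, y), I)) (restRight ((x, y), I)) := by
    rw [hL, hR, ← Finset.disjoint_erase_comm, Finset.erase_eq_of_notMem hsL]
  unfold stackTerm contraction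
  rw [dif_pos (show s.castSucc.val + 1 < n + 1 from s.succ.2), LinearMap.smul_apply]
  by_cases h1 : Disjoint (restLeft ((x, y), I)) (restRight ((x, y), I))
  · rw [if_pos h1, if_pos (hdis.2 h1), hS, hsgn]
    refine .trans ?_ (congrArg _ ((annihilation_single s.succ _ _).trans
      (if_pos (Finset.mem_union_right _ hsR))).symm)
    exact (Pi.single_smul' ((svtx ((x, y), I)).erase s.succ) (T (2 * (s.val : ℤ) + 1 - n) : Λ) _)
  · rw [if_neg h1, if_neg (mt hdis.1 h1), map_zero, smul_zero]

theorem mem_adj_iff {v : Vert n × Vert n} {s : Fin n} :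
    s ∈ adj v ↔ s.castSucc ∈ v.1 ∧ s.succ ∈ v.2 := by simp [adj]

/-- A new greatest element `i` of `x` multiplies the product of `x` and `y` from the left. -/
theorem stackVec_insert {x y : Vert n} {i : Fin (n + 1)} (hx : ∀ j ∈ x, j < i) :
    stackVec (insert i x, y) = leftOp i (stackVec (x, y)) := by
  have hi : i ∉ x := fun hi => lt_irrefl _ (hx i hi)
  have hkept : ∀ I ∈ (adj (x, y)).powerset, ∀ k, Kept ((x, y), I) k → k < i.val := by
    rintro I hI _ ⟨s, hs, rfl⟩
    exact hx _ (mem_adj_iff.1 (Finset.mem_powerset.1 hI hs)).1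
  unfold stackVec
  rw [map_sum]
  -- If `i + 1` is in `y`, then the new adjacent pair `s` can be kept or contracted: the states over
  -- `(x ∪ {i}, y)` are those with `s` kept, which give the creation operator, and those with `s`
  -- contracted, which give the annihilation operator. Otherwise the latter acts as zero.
  by_cases hy : Has y (i.val + 1)
  · obtain ⟨b, hb, hbi⟩ := hy
    have hin : i.val < n := by have := b.2; omega
    obtain ⟨s, rfl⟩ : ∃ s : Fin n, s.castSucc = i := ⟨⟨i.val, hin⟩, rfl⟩
    obtain rfl : b = s.succ := Fin.ext hbi
    have hadj : adj (insert s.castSucc x, y) = insert s (adj (x, y)) := by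
      ext t
      rw [Finset.mem_insert, mem_adj_iff, mem_adj_iff, Finset.mem_insert, Fin.castSucc_inj]
      constructor
      · rintro ⟨h | h, h'⟩
        · exact Or.inl h
        · exact Or.inr ⟨h, h'⟩
      · rintro (rfl | h)
        · exact ⟨Or.inl rfl, hb⟩
        · exact ⟨Or.inr h.1, h.2⟩
    have hs : s ∉ adj (x, y) := fun h => hi (mem_adj_iff.1 h).1
    rw [hadj, Finset.sum_powerset_insert hs, add_comm, ← Finset.sum_add_distrib]
    refine Finset.sum_congr rfl fun I hI => ?_
    have hsI : s ∉ I := fun h => hs (Finset.mem_powerset.1 hI h)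
    rw [leftOp, LinearMap.add_apply, stackTerm_annihilation rfl hx hb (hkept I hI)]
    congr 1
    refine stackTerm_creation hx (fun k => ?_)
      (fun _ => by rw [Finset.card_insert_of_notMem hsI, Nat.cast_succ])
      fun h => absurd ⟨_, hb, rfl⟩ h
    have h1 : Has y (s.castSucc.val + 1) := ⟨_, hb, rfl⟩
    exact (kept_keep (p := ((insert s.castSucc x, y), I))).trans
      (or_congr_right (iff_self_and.2 fun _ => h1))
  · have hadj : adj (insert i x, y) = adj (x, y) := by
      ext t
      rw [mem_adj_iff, mem_adj_iff, Finset.mem_insert]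
      refine and_congr_left fun h => or_iff_right ?_
      rintro rfl
      exact hy ⟨_, h, rfl⟩
    rw [hadj]
    refine Finset.sum_congr rfl fun I hI => ?_
    have h0 : contraction i (stackTerm ((x, y), I)) = 0 := by
      unfold contraction stackTerm
      split_ifs with h1 h2
      · rw [LinearMap.smul_apply, annihilation_single, if_neg, smul_zero]
        rw [← has_val, has_svtx, has_restLeft, has_restRight]
        rintro (h3 | h3)
        · have := hx _ (has_val.1 h3.1)
          rw [Fin.lt_def] at this
          exact absurd this (by simp)
        · exact hy h3.1
      · rw [map_zero]
      all_goals rfl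
    rw [leftOp, LinearMap.add_apply, h0, add_zero]
    exact stackTerm_creation hx (fun k => (or_iff_left fun h => hy h.2).symm)
      (fun h => absurd h hy) fun _ => rfl

theorem stackVec_empty (y : Vert n) : stackVec (∅, y) = Pi.single y 1 := by
  have h1 : adj ((∅ : Vert n), y) = ∅ := by
    ext s
    rw [mem_adj_iff]
    simp
  have h2 : restLeft (((∅ : Vert n), y), ∅) = ∅ := Finset.empty_sdiff _
  have h3 : restRight (((∅ : Vert n), y), ∅) = y := by
    rw [restRight, h1]
    simp
  have h4 : svtx (((∅ : Vert n), y), ∅) = y := by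
    rw [svtx, h2, h3, Finset.empty_union]
  rw [stackVec, h1, Finset.powerset_empty, Finset.sum_singleton, stackTerm, h2,
    if_pos (Finset.disjoint_empty_left _), h4]
  congr 1
  have h5 : scoh (((∅ : Vert n), y), ∅) = 0 := by simp [scoh, mu]
  have h6 : sqs (((∅ : Vert n), y), ∅) = 0 := by simp [sqs, contr, h1]
  rw [h5, h6, neg_zero, ← Prod.zero_eq_mk, weight_zero]

/-- Left multiplication by a vertex. -/
def mulVertex (x : Vert n) : Module.End Λ (Fock n) :=
  Fintype.linearCombination Λ fun y => stackVec (x, y)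

theorem mulVertex_apply (x : Vert n) (g : Fock n) : mulVertex x g = ∑ y, g y • stackVec (x, y) :=
  Fintype.linearCombination_apply _ _ _

theorem mulVertex_empty : mulVertex (∅ : Vert n) = 1 := by
  refine LinearMap.ext fun g => ?_
  rw [mulVertex_apply, Module.End.one_apply]
  simp only [stackVec_empty]
  exact (pi_eq_sum_univ' g).symm

theorem mulVertex_insert {x : Vert n} {i : Fin (n + 1)} (hx : ∀ j ∈ x, j < i) :
    mulVertex (insert i x) = leftOp i * mulVertex x := by
  refine LinearMap.ext fun g => ?_
  rw [Module.End.mul_apply, mulVertex_apply, mulVertex_apply, map_sum]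
  exact Finset.sum_congr rfl fun y _ => by rw [stackVec_insert hx, map_smul]

theorem mulVertex_singleton (i : Fin (n + 1)) : mulVertex {i} = leftOp i := by
  have h := mulVertex_insert (x := ∅) (i := i) (by simp)
  rwa [mulVertex_empty, mul_one] at h

/-- Left multiplication by a combination of vertices. -/
def leftMul : Fock n →ₗ[Λ] Module.End Λ (Fock n) :=
  Fintype.linearCombination Λ mulVertex

theorem leftMul_single (x : Vert n) : leftMul (Pi.single x 1) = mulVertex x := by
  refine (Fintype.linearCombination_apply_single _ _ _ _).trans ?_
  rw [one_smul]

/-- For `j < i` this is the definition of the product; the case `i < j` follows by anticommutation. -/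
theorem leftMul_leftOp (i j : Fin (n + 1)) :
    leftMul (leftOp i (Pi.single {j} 1)) = leftOp i * leftOp j := by
  rcases lt_trichotomy j i with h | rfl | h
  · have h1 : ∀ k ∈ ({j} : Vert n), k < i := by simpa using h
    rw [leftOp_single h1, leftMul_single, mulVertex_insert h1, mulVertex_singleton]
  · rw [← leftOp_vacuum, ← Module.End.mul_apply, leftOp_mul_self, LinearMap.zero_apply, map_zero]
  · have h1 : ∀ k ∈ ({i} : Vert n), k < j := by simpa using h
    have h2 := leftOp_anticomm i j
    have h3 : leftOp i (Pi.single {j} 1) =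
        (anticoeff i j + anticoeff j i) • vacuum n - Pi.single (insert j {i}) 1 := by
      rw [← leftOp_single h1, ← leftOp_vacuum, ← leftOp_vacuum, ← Module.End.mul_apply,
        ← Module.End.mul_apply, eq_sub_iff_add_eq, ← LinearMap.add_apply, h2]
      rfl
    rw [h3, map_sub, map_smul, vacuum, leftMul_single, leftMul_single, mulVertex_empty,
      mulVertex_insert h1, mulVertex_singleton, ← h2, add_sub_cancel_right]

/-- Left multiplication by the image of an element of `U_n` is the action of the element. It suffices
to see this for `1`, `E`, `F` and `E F`, which span `U_n`. -/
theorem leftMul_embed (a : Un n) : leftMul (embed n a) = (action n a : Module.End _ _) := by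
  have h1 : ∀ s : Finset (Fin (n + 1)),
      leftMul (∑ i ∈ s, Pi.single {i} (1 : Λ)) = ∑ i ∈ s, leftOp i := by
    intro s
    rw [map_sum]
    exact Finset.sum_congr rfl fun i _ => by rw [leftMul_single, mulVertex_singleton]
  have h2 : leftMul (embed n (Un.E n)) = (action n (Un.E n) : Module.End _ _) := by
    rw [embed_E, action_E, h1]
    rfl
  have h3 : leftMul (embed n (Un.F n)) = (action n (Un.F n) : Module.End _ _) := by
    rw [embed_F, action_F, h1]
    rfl
  have h4 : leftMul (embed n (Un.E n * Un.F n)) =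
      (action n (Un.E n * Un.F n) : Module.End _ _) := by
    rw [embed_mul, map_mul, action_E, action_F, embed_F, evenOp, oddOp, LinearMap.sum_apply,
      map_sum, Finset.sum_mul]
    refine Finset.sum_congr rfl fun i _ => ?_
    rw [map_sum, map_sum, Finset.mul_sum]
    exact Finset.sum_congr rfl fun j _ => leftMul_leftOp i j
  have ha : a ∈ Submodule.span Λ
      ({1, Un.E n, Un.F n, Un.E n * Un.F n} : Set (Un n)) := by
    rw [Un.span_eq_top]
    trivial
  induction ha using Submodule.span_induction with
  | mem x hx =>
    rcases hx with rfl | rfl | rfl | rfl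
    · rw [embed_one, vacuum, leftMul_single, mulVertex_empty, map_one]
    · exact h2
    · exact h3
    · exact h4
  | zero => simp
  | add x y _ _ hx hy => rw [map_add, map_add, map_add, hx, hy]
  | smul c x _ hx => rw [map_smul, map_smul, map_smul, hx]

/-- The product of a combination of pairs of vertices. -/
def stackSum : (Vert n × Vert n → Λ) →ₗ[Λ] Fock n :=
  Fintype.linearCombination Λ stackVec

theorem stackSum_single (v : Vert n × Vert n) : stackSum (Pi.single v 1) = stackVec v := by
  refine (Fintype.linearCombination_apply_single _ _ _ _).trans ?_
  rw [one_smul]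

/-- Stacking of vertices induces the multiplication of the integral form. -/
theorem stackSum_embed (a b : Un n) :
    stackSum (fun v => embed n a v.1 * embed n b v.2) = embed n (a * b) := by
  rw [embed_mul, ← leftMul_embed, stackSum, leftMul, Fintype.linearCombination_apply,
    Fintype.linearCombination_apply, Fintype.sum_prod_type, LinearMap.sum_apply]
  refine Finset.sum_congr rfl fun x _ => ?_
  rw [LinearMap.smul_apply, mulVertex_apply, Finset.smul_sum]
  exact Finset.sum_congr rfl fun y _ => by rw [mul_smul]

end StackMul


/-! ### Stacking of objects -/

section StackObj

open LQuiver

variable {n : ℕ}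

/-- On classes, the functor `T ⊗ -` is the stacking of vertices. -/
theorem stacking_generated {Z : Ho (RR n)} (hZ : DGPP n Z) :
    DGP n ((tensorFunctor (stacking n)).obj Z) ∧
      chiR ((tensorFunctor (stacking n)).obj Z) = stackSum (chiRR Z) := by
  induction hZ with
  | basic Z hZ =>
    obtain ⟨v, rfl⟩ := hZ
    obtain ⟨h1, h2⟩ := stacking_proj v
    exact ⟨h1, h2.trans (by rw [sum_idx_eq_stackVec, chiRR_PP, stackSum_single])⟩
  | shift M a _ ih =>
    have e := (tensorShiftIso (stacking n) M a).symm
    refine ⟨Generated.iso e (Generated.shift _ a ih.1), ?_⟩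
    refine (chiR_iso e).symm.trans ((chiR_shift (tensorMod (stacking n) M) a).trans ?_)
    rw [chiRR_shift, map_smul, ← ih.2]
    rfl
  | @cone M N f hM hN ihM ihN =>
    have e := (tensorConeIso (stacking n) f).symm
    refine ⟨Generated.iso e (Generated.cone _ ihM.1 ihN.1), ?_⟩
    refine (chiR_iso e).symm.trans ((chiR_cone (tensorZ (stacking n) f) ihM.1 ihN.1).trans ?_)
    rw [chiRR_cone f hM hN, map_sub, ← ihM.2, ← ihN.2]
    rfl
  | iso e _ ih =>
    have e' := (tensorFunctor (stacking n)).mapIso e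
    exact ⟨Generated.iso e' ih.1, by rw [← chiR_iso e', ih.2, chiRR_iso e]⟩

/-- If `T e(w)` is generated by a closed element of degree zero that generates a copy of `P(z)`, then
`T ⊗ P(w)` is `P(z)`. -/
theorem tensor_proj_iso {Q Q' : LQuiver} {D : Q.DerivData}
    {h : ∀ v l, deriv D (D.δ v l) = 0} {D' : Q'.DerivData} {h' : ∀ v l, deriv D' (D'.δ v l) = 0}
    (T : DGBimod (dgAlg D' h') (dgAlg D h)) (w : Q.V) (z : Q'.V) (t : T) (ht : t ∈ T.gr 0)
    (hz : Q'.e z • t = t) (hw : MulOpposite.op (Q.e w) • t = t) (hd : T.d t = 0)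
    (hinj : ∀ a ∈ Q'.leftIdeal z, a • t = 0 → a = 0)
    (hsurj : ∀ x : T, MulOpposite.op (Q.e w) • x = x → ∃ a : Q'.Alg, x = a • t) :
    Nonempty (Ho.of (tensorMod T (proj D h w)) ≅ Ho.of (proj D' h' z)) := by
  let m : tensorMod T (proj D h w) := tensorGen T w t
  have hm : m ∈ (tensorMod T (proj D h w)).gr 0 :=
    ⟨t ⊗ₜ gen w, Submodule.subset_span ⟨0, 0, add_zero _, t, ht, gen w, e_mem (Q := Q) w, rfl⟩, rfl⟩
  have hdm : (tensorMod T (proj D h w)).d m = 0 := by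
    refine (tensorGen_d T w t).trans ?_
    rw [hd, map_zero]
  have hsm : ∀ a : Q'.Alg, a • m = tensorGen T w (a • t) := fun a =>
    ((tensorGen T w).map_smul a t).symm
  refine ⟨(isoOfBijective (zmk (M := proj D' h' z) (N := tensorMod T (proj D h w)) (projMap z m)
    (fun k x hx => ?_) (fun x => ?_)) ⟨?_, fun x => ?_⟩).symm⟩
  · have h1 := (tensorMod T (proj D h w)).smul_mem (a := x.1) (m := m) hx hm
    rwa [add_zero] at h1
  · have h1 := (tensorMod T (proj D h w)).leibniz x.1 m
    rw [hdm, smul_zero, add_zero] at h1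
    exact h1
  · refine (injective_iff_map_eq_zero _).2 fun a ha => ?_
    have h1 : a.1 • m = 0 := ha
    rw [hsm] at h1
    have h2 := congrArg (tensorEval T w) h1
    rw [tensorEval_gen, map_zero, ← smul_comm, hw] at h2
    exact Subtype.ext (hinj a.1 a.2 h2)
  · obtain ⟨u, hu, rfl⟩ := tensorGen_surj T w x
    obtain ⟨a, rfl⟩ := hsurj u hu
    refine ⟨(Q'.toIdeal z) a, ?_⟩
    change (a * Q'.e z) • m = _
    rw [mul_smul, hsm, hz]
    exact hsm a

/-- Stacking two vertices without interaction. -/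
theorem stacking_proj_iso {x y : Vert n} (hadj : adj (x, y) = ∅) (hxy : Disjoint x y)
    (hmu : mu (x, y) = 0) :
    Nonempty ((tensorFunctor (stacking n)).obj (Ho.of (PP n (x, y))) ≅ Ho.of (P n (x ∪ y))) := by
  let p : St n := ((x, y), ∅)
  have hL : restLeft p = x := by rw [restLeft, hadj]; simp [p]
  have hR : restRight p = y := by rw [restRight, hadj]; simp [p]
  have hS : svtx p = x ∪ y := by rw [svtx, hL, hR]
  have hp : IsIdx p := ⟨Finset.empty_subset _, by rw [hL, hR]; exact hxy⟩
  let i : Idx n := ⟨p, hp⟩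
  have hcontr : contr p = ∅ := by rw [contr, hadj]; rfl
  have huniq : ∀ j : {i : Idx n // i.1.1 = (x, y)}, j.1 = i := by
    rintro ⟨j, hj⟩
    have h1 := j.2.1
    rw [hj, hadj] at h1
    exact Subtype.ext (Prod.ext hj (Finset.subset_empty.1 h1))
  have hdeg : ((i.coh, -i.qshift) : ℤ × ℤ) = 0 := by
    have h1 : i.coh = mu (x, y) + ((∅ : Finset (Fin n)).card : ℤ) := rfl
    have h2 : i.qshift = ∑ s ∈ contr p, (2 * (s.val : ℤ) + 1 - n) := rfl
    rw [h1, h2, hcontr, hmu]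
    simp
  have hinj := sum_smul_basis_inj (fun _ : Unit => i) (fun _ _ _ => rfl)
  refine tensor_proj_iso (stacking n) (x, y) (x ∪ y) (basis p) (hdeg ▸ basis_mem p)
    (hS ▸ e_basis p) ?_ ?_ (fun a ha h0 => ?_) fun t ht => ?_
  · refine (congrArg (fun f : Module.End (quiver n).Alg (StackCar n) => f (basis p))
      (rightMul_e (x, y))).trans ?_
    rw [idemOp_basis, if_pos rfl]
  · refine (stackD_basis hp).trans ?_
    rw [hcontr, Finset.sum_empty]
    rfl
  · refine congrFun (hinj (fun _ => a) (fun _ => ?_) ?_) ()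
    · exact (show i.vtx = x ∪ y from hS) ▸ ha
    · rw [Fintype.sum_unique]
      exact h0
  · have h1 : idemOp (x, y) t = t := (congrArg
      (fun f : Module.End (quiver n).Alg (StackCar n) => f t) (rightMul_e (x, y))).symm.trans ht
    have h2 := mem_span_basis (x, y) t h1
    have h3 : (Set.range fun j : {i : Idx n // i.1.1 = (x, y)} => (basis j.1.1 : StackCar n)) ⊆
        {basis p} := by
      rintro _ ⟨j, rfl⟩
      exact congrArg (fun i : Idx n => (basis i.1 : StackCar n)) (huniq j)
    obtain ⟨a, rfl⟩ := Submodule.mem_span_singleton.1 (Submodule.span_mono h3 h2)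
    exact ⟨a, rfl⟩

/-- Stacking with the empty vertex from the left. -/
theorem stacking_empty_iso (y : Vert n) :
    Nonempty ((tensorFunctor (stacking n)).obj (Ho.of (PP n (∅, y))) ≅ Ho.of (P n y)) := by
  have h := stacking_proj_iso (x := ∅) (y := y) (by ext s; rw [mem_adj_iff]; simp)
    (Finset.disjoint_empty_left _) (by simp [mu])
  rwa [Finset.empty_union] at h

/-- Stacking with a vertex `{i}` above all elements of `y`. -/
theorem stacking_insert_iso {y : Vert n} {i : Fin (n + 1)} (hy : ∀ j ∈ y, j < i) :
    Nonempty ((tensorFunctor (stacking n)).obj (Ho.of (PP n ({i}, y))) ≅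
      Ho.of (P n (insert i y))) := by
  refine stacking_proj_iso (x := {i}) (y := y) ?_ ?_ ?_
  · refine Finset.eq_empty_of_forall_notMem fun s hs => ?_
    rw [mem_adj_iff, Finset.mem_singleton] at hs
    have h := hy _ hs.2
    rw [← hs.1] at h
    exact absurd h (not_lt.2 (Fin.castSucc_lt_succ).le)
  · exact Finset.disjoint_singleton_left.2 fun h => lt_irrefl _ (hy i h)
  · rw [mu]
    refine Finset.sum_eq_zero fun a ha => Finset.sum_eq_zero fun b hb => if_neg fun h => ?_
    have h1 := hy b hb
    rw [← Finset.mem_singleton.1 ha, Fin.lt_def] at h1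
    omega

end StackObj


/-! ### Lifts of words -/

section Lifts

variable {n : ℕ}

open LaurentPolynomial (T)

theorem weight_q (b : ℤ) : weight (0, b) = T b := by simp [weight]

/-- The class of the lift of a letter is the image of its value. -/
theorem letter_class (a : Letter) :
    DGP n (a.obj n) ∧ chiR (a.obj n) = embed n (a.val n) := by
  have hP : DGP n (Ho.of (P n ∅)) := Generated.basic _ ⟨_, rfl⟩
  have hq : ∀ b, DGP n (Ho.of ((P n ∅).shift (0, b))) ∧ chiR (Ho.of ((P n ∅).shift (0, b))) =
      embed n (algebraMap Λ (Un n) (T b)) := fun b => by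
    refine ⟨Generated.shift _ _ hP, ?_⟩
    rw [chiR_shift, chiR_P, weight_q, Algebra.algebraMap_eq_smul_one, map_smul, embed_one]
    rfl
  have hsum : ∀ (p : ℕ → Prop) [DecidablePred p],
      ∑ i : {i : Fin (n + 1) // p i.val}, (Pi.single {i.1} 1 : Fock n) =
        ∑ i : Fin (n + 1) with p i.val, Pi.single {i} 1 := fun p _ =>
    (Finset.sum_subtype _ (by simp) fun i : Fin (n + 1) => (Pi.single {i} 1 : Fock n)).symm
  cases a with
  | one => exact ⟨hP, (chiR_P ∅).trans (embed_one).symm⟩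
  | q => exact hq 1
  | qinv => exact hq (-1)
  | E =>
    obtain ⟨h1, h2⟩ := generated_sum_P fun i : {i : Fin (n + 1) // Even i.val} => ({i.1} : Vert n)
    exact ⟨h1, h2.trans ((hsum Even).trans embed_E.symm)⟩
  | F =>
    obtain ⟨h1, h2⟩ := generated_sum_P fun i : {i : Fin (n + 1) // Odd i.val} => ({i.1} : Vert n)
    exact ⟨h1, h2.trans ((hsum Odd).trans embed_F.symm)⟩

theorem wordVal_mul (v w : FreeMagma Letter) : wordVal n (v * w) = wordVal n v * wordVal n w :=
  map_mul (FreeMagma.lift (Letter.val n)) v w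

theorem embed_tensor_class {a b : Un n} {X Y : Ho (R n)} {Z : Ho (RR n)} (hX : DGP n X)
    (hY : DGP n Y) (ha : chiR X = embed n a) (hb : chiR Y = embed n b) (hZ : IsChi n X Y Z) :
    chiRR Z = fun v => embed n a v.1 * embed n b v.2 :=
  funext fun v => by rw [chiRR_of_isChi hX hY hZ, ha, hb]

/-- The class of the lift of a word is the image of its value. -/
theorem lift_class {w : FreeMagma Letter} {X : Ho (R n)} (h : IsLift n (stacking n) w X) :
    DGP n X ∧ chiR X = embed n (wordVal n w) := by
  induction h with
  | letter a => exact letter_class a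
  | mul _ _ hZ ihX ihY =>
    obtain ⟨h1, h2⟩ := stacking_generated hZ.1
    refine ⟨h1, ?_⟩
    rw [h2, embed_tensor_class ihX.1 ihY.1 ihX.2 ihY.2 hZ, stackSum_embed, wordVal_mul]

theorem exists_lift (w : FreeMagma Letter) : ∃ X, IsLift n (stacking n) w X := by
  induction w with
  | ih1 a => exact ⟨_, IsLift.letter a⟩
  | ih2 v w hv hw =>
    obtain ⟨X, hX⟩ := hv
    obtain ⟨Y, hY⟩ := hw
    obtain ⟨Z, hZ, -⟩ := exists_isChi (lift_class hX).1 (lift_class hY).1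
    exact ⟨_, hX.mul hY hZ⟩

/-- `X` is a direct summand of a lift of a word. -/
def LiftSummand (n : ℕ) (X : Ho (R n)) : Prop :=
  ∃ w L, IsLift n (stacking n) w L ∧ Nonempty (Retract X L)

theorem LiftSummand.mul {X Y W : Ho (R n)} {Z : Ho (RR n)} (hX : LiftSummand n X)
    (hY : LiftSummand n Y) (hZ : IsChi n X Y Z) (e : (tensorFunctor (stacking n)).obj Z ≅ W) :
    LiftSummand n W := by
  obtain ⟨v, L, hL, ⟨r⟩⟩ := hX
  obtain ⟨w, L', hL', ⟨s⟩⟩ := hY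
  obtain ⟨Z', hZ', -⟩ := exists_isChi (lift_class hL).1 (lift_class hL').1
  obtain ⟨t⟩ := hZ.retract hZ' r s
  exact ⟨_, _, hL.mul hL' hZ', ⟨(Retract.ofIso e.symm).trans (t.map _)⟩⟩

theorem liftSummand_singleton (i : Fin (n + 1)) : LiftSummand n (Ho.of (P n {i})) := by
  rcases Nat.even_or_odd i.val with h | h
  · exact ⟨_, _, IsLift.letter Letter.E,
      ⟨sumRetract (fun i : {i : Fin (n + 1) // Even i.val} => P n {i.1}) ⟨i, h⟩⟩⟩
  · exact ⟨_, _, IsLift.letter Letter.F,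
      ⟨sumRetract (fun i : {i : Fin (n + 1) // Odd i.val} => P n {i.1}) ⟨i, h⟩⟩⟩

theorem liftSummand_empty (b : ℤ) : LiftSummand n (Ho.of ((P n ∅).shift (0, b))) := by
  obtain ⟨e⟩ := stacking_empty_iso (∅ : Vert n)
  have step : ∀ (b c : ℤ), LiftSummand n (Ho.of ((P n ∅).shift (0, b))) →
      LiftSummand n (Ho.of ((P n ∅).shift (0, c))) →
      LiftSummand n (Ho.of ((P n ∅).shift (0, b + c))) := fun b c hb hc => by
    refine hb.mul hc (((isChi_proj ∅ ∅).shift_left (0, b)).shift_right (0, c)) ?_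
    exact tensorShiftIso (stacking n) ((PP n (∅, ∅)).shift (0, b)) (0, c) ≪≫
      shiftIso (tensorShiftIso (stacking n) (PP n (∅, ∅)) (0, b)) (0, c) ≪≫
      shiftShiftIso (tensorMod (stacking n) (PP n (∅, ∅))) (0, b) (0, c) ≪≫ shiftIso e _
  induction b with
  | zero => exact ⟨_, _, IsLift.letter Letter.one, ⟨Retract.ofIso (shiftZeroIso (P n ∅))⟩⟩
  | succ k ih => exact step _ _ ih ⟨_, _, IsLift.letter Letter.q, ⟨Retract.refl _⟩⟩
  | pred k ih => exact step _ (-1) ih ⟨_, _, IsLift.letter Letter.qinv, ⟨Retract.refl _⟩⟩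

/-- The shifts of `P({i₁ < ⋯ < iₖ})` are summands of lifts of the words `iₖ(⋯(i₁ qᵇ))`. -/
theorem liftSummand_P (x : Vert n) (b : ℤ) : LiftSummand n (Ho.of ((P n x).shift (0, b))) := by
  induction x using Finset.induction_on_max with
  | empty => exact liftSummand_empty b
  | insert i x hx ih =>
    obtain ⟨e⟩ := stacking_insert_iso hx
    exact (liftSummand_singleton i).mul ih ((isChi_proj {i} x).shift_right (0, b))
      (tensorShiftIso (stacking n) (PP n ({i}, x)) (0, b) ≪≫ shiftIso e (0, b))

/-- The category `𝒰_n` is dense in `H⁰(DGP(R_n))`. -/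
theorem dens_U (x : Vert n) (b : ℤ) :
    dens (U n (stacking n)) (Ho.of ((P n x).shift (0, b))) := by
  obtain ⟨w, L, hL, ⟨r⟩⟩ := liftSummand_P x b
  exact dens_of_retract r (TriClosure.basic _ ⟨w, hL⟩)

/-- The category `𝒰_{n,n}` is dense in `H⁰(DGP(R_n ⊠ R_n))`. -/
theorem dens_UU (v : Vert n × Vert n) (b : ℤ) :
    dens (UU n (stacking n)) (Ho.of ((PP n v).shift (0, b))) := by
  obtain ⟨w, L, hL, ⟨r⟩⟩ := liftSummand_P v.1 b
  obtain ⟨w', L', hL', ⟨s⟩⟩ := liftSummand_P v.2 0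
  obtain ⟨Z, hZ, -⟩ := exists_isChi (lift_class hL).1 (lift_class hL').1
  have hv : IsChi n (Ho.of ((P n v.1).shift (0, b))) (Ho.of ((P n v.2).shift (0, 0)))
      (Ho.of (((PP n v).shift (0, b)).shift (0, 0))) :=
    ((isChi_proj v.1 v.2).shift_left (0, b)).shift_right (0, 0)
  obtain ⟨t⟩ := hv.retract hZ r s
  exact dens_of_retract ((Retract.ofIso (shiftZeroIso ((PP n v).shift (0, b))).symm).trans t)
    (TriClosure.basic _ ⟨L, L', TriClosure.basic _ ⟨w, hL⟩, TriClosure.basic _ ⟨w', hL'⟩, hZ⟩)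

end Lifts


/-! ### Grothendieck groups of dense subcategories -/

section DenseK0

open LQuiver Pretriangulated

variable {Q : LQuiver} {D : Q.DerivData} {h : ∀ v l, deriv D (D.δ v l) = 0}
  (hD : Minimal D)

theorem chi_triangle {S : Triangle (Ho (dgAlg D h))} (hS : S ∈ distTriang (Ho (dgAlg D h)))
    (h₁ : genProj D h S.obj₁) (h₂ : genProj D h S.obj₂) :
    chi h hD S.obj₂ = chi h hD S.obj₁ + chi h hD S.obj₃ :=
  funext fun w => euler_triangle hS (homFin_of_genProj hD h₁ w) (homFin_of_genProj hD h₂ w)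

theorem triClosure_chi_mem [Nonempty Q.V]
    (N : Submodule Λ (Q.V → Λ))
    {S : Ho (dgAlg D h) → Prop} (hS : ∀ X, S X → genProj D h X ∧ chi h hD X ∈ N)
    {X : Ho (dgAlg D h)} (hX : triClosure S X) : genProj D h X ∧ chi h hD X ∈ N := by
  have hne : ∃ X, genProj D h X := ⟨_, Generated.basic _ ⟨Classical.arbitrary Q.V, rfl⟩⟩
  change TriClosure S X at hX
  induction hX with
  | basic X hX => exact hS X hX
  | zero X hX =>
    refine ⟨generated_isZero hne hX, ?_⟩
    obtain ⟨Y, hY⟩ := hne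
    rw [chi_iso h hD (hX.iso (isZero_cone_id Y.obj)), chi_cone hD _ hY hY, sub_self]
    exact zero_mem _
  | shift X k _ ih =>
    refine ⟨Generated.shift X.obj (k, 0) ih.1, ?_⟩
    have h1 : chi h hD (X⟦k⟧) = weight (k, 0) • chi h hD X := chi_shift h hD X.obj (k, 0)
    rw [h1]
    exact N.smul_mem _ ih.2
  | iso e _ ih => exact ⟨Generated.iso e ih.1, chi_iso h hD e ▸ ih.2⟩
  | ext S hS _ _ h₁ h₃ =>
    have h₂ := generated_ext hS h₁.1 h₃.1
    refine ⟨h₂, ?_⟩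
    rw [chi_triangle hD hS h₁.1 h₂]
    exact N.add_mem h₁.2 h₃.2

variable {P : ObjectProperty (Ho (dgAlg D h))} [P.IsTriangulated]

/-- The Euler characteristics on the Grothendieck group of a triangulated subcategory. -/
def chiK0 (hP : P ≤ genProj D h) : K0 P.FullSubcategory →+ (Q.V → Λ) :=
  QuotientAddGroup.lift _ (FreeAbelianGroup.lift fun X => chi h hD X.obj) (by
    rw [triangleRel, AddSubgroup.closure_le]
    rintro _ ⟨S, hS, rfl⟩
    have h1 := chi_triangle hD (P.ι.map_distinguished S hS) (hP _ S.obj₁.2) (hP _ S.obj₂.2)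
    change FreeAbelianGroup.lift _ _ = 0
    rw [map_sub, map_sub, FreeAbelianGroup.lift_apply_of, FreeAbelianGroup.lift_apply_of,
      FreeAbelianGroup.lift_apply_of, sub_sub, sub_eq_zero]
    exact h1)

theorem chiK0_cls (hP : P ≤ genProj D h) (X : P.FullSubcategory) :
    chiK0 hD hP (K0.cls X) = chi h hD X.obj :=
  FreeAbelianGroup.lift_apply_of _ _

variable [P.IsClosedUnderIsomorphisms] {G : Type} [AddCommGroup G]
  (emb : G →+ (Q.V → Λ))

/-- The Grothendieck group of a dense triangulated subcategory is the group of the Euler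
characteristics of its objects. -/
theorem exists_K0_equiv (hP : ∀ X, P X → genProj D h X ∧ ∃ g, emb g = chi h hD X)
    (hdens : ∀ v b, dens P (Ho.of ((proj D h v).shift (0, b)))) (hinj : Function.Injective emb)
    (hgen : AddSubgroup.closure {g | ∃ X, P X ∧ chi h hD X = emb g} = ⊤) :
    (∃ κ : K0 P.FullSubcategory ≃+ G, ∀ X, emb (κ (K0.cls X)) = chi h hD X.obj) ∧
      ∀ X, genProj D h X → (∃ g, emb g = chi h hD X) → P X := by
  have hP' : P ≤ genProj D h := fun X hX => (hP X hX).1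
  -- The Euler characteristics take values in the image of `emb`, which gives `κ`; injectivity and the
  -- second claim are the theorem on dense subcategories.
  have hrange : ∀ x, ∃ g, emb g = chiK0 hD hP' x := fun x => by
    obtain ⟨X, rfl⟩ := K0_exists_cls x
    rw [chiK0_cls]
    exact (hP X.obj X.2).2
  choose f hf using hrange
  let κ : K0 P.FullSubcategory →+ G :=
    { toFun := f
      map_zero' := hinj (by rw [hf, map_zero, map_zero])
      map_add' := fun x y => hinj (by rw [hf, map_add, map_add, hf, hf]) }
  have hκ : ∀ X : P.FullSubcategory, emb (κ (K0.cls X)) = chi h hD X.obj := fun X =>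
    (hf _).trans (chiK0_cls hD hP' X)
  have hsurj : Function.Surjective κ := by
    rw [← AddMonoidHom.range_eq_top, eq_top_iff, ← hgen, AddSubgroup.closure_le]
    rintro g ⟨X, hX, e⟩
    exact ⟨K0.cls ⟨X, hX⟩, hinj ((hκ _).trans e)⟩
  refine ⟨⟨AddEquiv.ofBijective κ ⟨fun x y hxy => ?_, hsurj⟩, hκ⟩, fun X hX ⟨g, hg⟩ => ?_⟩
  · obtain ⟨X, rfl⟩ := K0_exists_cls x
    obtain ⟨Y, rfl⟩ := K0_exists_cls y
    have e : chi h hD X.obj = chi h hD Y.obj := by rw [← hκ, ← hκ, hxy]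
    exact (prop_of_chi_eq hD hdens (hP' _ X.2) (hP' _ Y.2) e Y.2).2
  · obtain ⟨y, rfl⟩ := hsurj g
    obtain ⟨Y, rfl⟩ := K0_exists_cls y
    exact (prop_of_chi_eq hD hdens hX (hP' _ Y.2) (hg.symm.trans (hκ Y)) Y.2).1

end DenseK0

/-! ### The categories `𝒰_n` and `𝒰_{n,n}` -/

section Categories

variable {n : ℕ}

open LaurentPolynomial (T)

/-- The classes of the objects of `𝒰_n` belong to the image of `U_n`. -/
theorem U_class {X : Ho (R n)} (hX : U n (stacking n) X) :
    DGP n X ∧ ∃ a, embed n a = chiR X := by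
  have : Nonempty (quiver n).V := ⟨(∅ : Vert n)⟩
  exact triClosure_chi_mem (Q := quiver n) (D := zeroDeriv (quiver n))
    (minimal_zeroDeriv (quiver n)) (LinearMap.range (embed n))
    (fun X ⟨w, hw⟩ => ⟨(lift_class hw).1, _, (lift_class hw).2.symm⟩) hX

/-- The map from the tensor square of the integral form to the combinations of pairs of vertices. -/
def embedTensor (n : ℕ) : Un n ⊗[Λ] Un n →ₗ[Λ]
    (Vert n × Vert n → Λ) :=
  TensorProduct.lift (LinearMap.mk₂ _ (fun a b v => embed n a v.1 * embed n b v.2)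
    (fun a a' b => funext fun v => by rw [map_add]; exact add_mul _ _ _)
    (fun c a b => funext fun v => by rw [map_smul]; exact mul_assoc _ _ _)
    (fun a b b' => funext fun v => by rw [map_add]; exact mul_add _ _ _)
    (fun c a b => funext fun v => by rw [map_smul]; exact mul_left_comm _ _ _))

theorem embedTensor_tmul (a b : Un n) :
    embedTensor n (a ⊗ₜ b) = fun v => embed n a v.1 * embed n b v.2 := rfl

theorem embed_injective (hn : 0 < n) : Function.Injective (embed n) :=
  Function.LeftInverse.injective (retraction_embed hn)

theorem embedTensor_injective (hn : 0 < n) : Function.Injective (embedTensor n) := by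
  let f : (Vert n × Vert n → Λ) →ₗ[Λ]
      Un n ⊗[Λ] Un n :=
    Fintype.linearCombination Λ fun v =>
      retraction hn (Pi.single v.1 1) ⊗ₜ retraction hn (Pi.single v.2 1)
  have h1 : ∀ a : Un n, ∑ x, embed n a x • retraction hn (Pi.single x 1) = a := fun a => by
    conv_rhs => rw [← retraction_embed hn a, pi_eq_sum_univ' (embed n a), map_sum]
    exact Finset.sum_congr rfl fun x _ => (map_smul _ _ _).symm
  have h2 : f ∘ₗ embedTensor n = LinearMap.id := by
    refine TensorProduct.ext' fun a b => ?_
    rw [LinearMap.comp_apply, embedTensor_tmul, LinearMap.id_apply]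
    refine (Fintype.linearCombination_apply _ _ _).trans ?_
    conv_rhs => rw [← h1 a, ← h1 b, TensorProduct.sum_tmul]
    rw [Fintype.sum_prod_type]
    refine Finset.sum_congr rfl fun x _ => ?_
    rw [TensorProduct.tmul_sum]
    exact Finset.sum_congr rfl fun y _ => (TensorProduct.smul_tmul_smul _ _ _ _).symm
  exact Function.LeftInverse.injective (g := f) (LinearMap.congr_fun h2)

theorem stackSum_embedTensor (t : Un n ⊗[Λ] Un n) :
    stackSum (embedTensor n t) = embed n (LinearMap.mul' Λ (Un n) t) := by
  have h : stackSum ∘ₗ embedTensor n = embed n ∘ₗ LinearMap.mul' Λ (Un n) :=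
    TensorProduct.ext' fun a b => stackSum_embed a b
  exact LinearMap.congr_fun h t

/-- The classes of the objects of `𝒰_{n,n}` belong to the image of the tensor square of `U_n`. -/
theorem UU_class {Z : Ho (RR n)} (hZ : UU n (stacking n) Z) :
    DGPP n Z ∧ ∃ t, embedTensor n t = chiRR Z := by
  have : Nonempty (boxQuiver n).V := ⟨((∅ : Vert n), (∅ : Vert n))⟩
  refine triClosure_chi_mem (Q := boxQuiver n) (D := boxDeriv n)
    (minimal_boxDeriv n) (LinearMap.range (embedTensor n)) ?_ hZ
  rintro Z ⟨X, Y, hX, hY, hXY⟩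
  obtain ⟨h1, a, ha⟩ := U_class hX
  obtain ⟨h2, b, hb⟩ := U_class hY
  exact ⟨hXY.1, a ⊗ₜ b, (embed_tensor_class h1 h2 ha.symm hb.symm hXY).symm⟩

theorem exists_word_T (b : ℤ) :
    ∃ w, wordVal n w = algebraMap Λ (Un n) (T b) := by
  have step : ∀ (b : ℤ) (a : Letter) (c : ℤ),
      a.val n = algebraMap Λ (Un n) (T c) →
      (∃ w, wordVal n w = algebraMap Λ (Un n) (T b)) →
      ∃ w, wordVal n w = algebraMap Λ (Un n) (T (b + c)) := by
    rintro b a c ha ⟨w, hw⟩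
    refine ⟨w * FreeMagma.of a, ?_⟩
    rw [wordVal_mul, hw, LaurentPolynomial.T_add, map_mul]
    exact congrArg _ ha
  induction b with
  | zero => exact ⟨FreeMagma.of Letter.one, (map_one _).symm⟩
  | succ k ih => exact step _ Letter.q 1 rfl ih
  | pred k ih => exact step _ Letter.qinv (-1) rfl ih

/-- The values of words generate the integral form as a group. -/
theorem closure_wordVal : AddSubgroup.closure (Set.range (wordVal n)) = ⊤ := by
  have hsmul : ∀ (c : Λ), ∀ a ∈ AddSubgroup.closure (Set.range (wordVal n)),
      c • a ∈ AddSubgroup.closure (Set.range (wordVal n)) := by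
    intro c a ha
    induction ha using AddSubgroup.closure_induction with
    | mem a ha =>
      obtain ⟨w, rfl⟩ := ha
      induction c using LaurentPolynomial.induction_on' with
      | add p q hp hq => rw [add_smul]; exact add_mem hp hq
      | C_mul_T b m =>
        obtain ⟨v, hv⟩ := exists_word_T (n := n) b
        rw [← LaurentPolynomial.smul_eq_C_mul, smul_assoc, Algebra.smul_def (T b), ← hv,
          ← wordVal_mul]
        exact zsmul_mem (AddSubgroup.subset_closure (Set.mem_range_self _)) m
    | zero => rw [smul_zero]; exact zero_mem _
    | add a b _ _ ha hb => rw [smul_add]; exact add_mem ha hb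
    | neg a _ ha => rw [smul_neg]; exact neg_mem ha
  refine eq_top_iff.2 fun a _ => ?_
  have ha : a ∈ Submodule.span Λ
      ({1, Un.E n, Un.F n, Un.E n * Un.F n} : Set (Un n)) := by
    rw [Un.span_eq_top]
    trivial
  induction ha using Submodule.span_induction with
  | mem x hx =>
    refine AddSubgroup.subset_closure ?_
    rcases hx with rfl | rfl | rfl | rfl
    · exact ⟨FreeMagma.of Letter.one, rfl⟩
    · exact ⟨FreeMagma.of Letter.E, rfl⟩
    · exact ⟨FreeMagma.of Letter.F, rfl⟩
    · exact ⟨FreeMagma.of Letter.E * FreeMagma.of Letter.F, rfl⟩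
  | zero => exact zero_mem _
  | add x y _ _ hx hy => exact add_mem (hx trivial) (hy trivial)
  | smul c x _ hx => exact hsmul c x (hx trivial)

/-- The isomorphism `κ₁`, and a criterion for objects to belong to `𝒰_n`. -/
theorem U_K0 (hn : 0 < n) :
    (∃ κ : K0 (U n (stacking n)).FullSubcategory ≃+ Un n,
      ∀ X, embed n (κ (K0.cls X)) = chiR X.obj) ∧
      ∀ X, DGP n X → (∃ a, embed n a = chiR X) → U n (stacking n) X := by
  have : Nonempty (quiver n).V := ⟨(∅ : Vert n)⟩
  refine exists_K0_equiv (Q := quiver n) (D := zeroDeriv (quiver n))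
    (minimal_zeroDeriv (quiver n)) (embed n).toAddMonoidHom (fun X hX => U_class hX) dens_U
    (embed_injective hn) (eq_top_iff.2 ?_)
  rw [← closure_wordVal]
  refine AddSubgroup.closure_mono ?_
  rintro _ ⟨w, rfl⟩
  obtain ⟨X, hX⟩ := exists_lift (n := n) w
  exact ⟨X, TriClosure.basic _ ⟨w, hX⟩, (lift_class hX).2⟩

/-- The isomorphism `κ₂`, and a criterion for objects to belong to `𝒰_{n,n}`. -/
theorem UU_K0 (hn : 0 < n) :
    (∃ κ : K0 (UU n (stacking n)).FullSubcategory ≃+ Un n ⊗[Λ] Un n,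
      ∀ Z, embedTensor n (κ (K0.cls Z)) = chiRR Z.obj) ∧
      ∀ Z, DGPP n Z → (∃ t, embedTensor n t = chiRR Z) → UU n (stacking n) Z := by
  have : Nonempty (boxQuiver n).V := ⟨((∅ : Vert n), (∅ : Vert n))⟩
  refine exists_K0_equiv (Q := boxQuiver n) (D := boxDeriv n)
    (minimal_boxDeriv n) (embedTensor n).toAddMonoidHom (fun X hX => UU_class hX) dens_UU
    (embedTensor_injective hn) (eq_top_iff.2 fun t _ => ?_)
  induction t using TensorProduct.induction_on with
  | zero => exact zero_mem _
  | add s t hs ht => exact add_mem (hs trivial) (ht trivial)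
  | tmul a b =>
    obtain ⟨κ, hκ⟩ := (U_K0 hn).1
    obtain ⟨X, hX⟩ := K0_exists_cls (κ.symm a)
    obtain ⟨Y, hY⟩ := K0_exists_cls (κ.symm b)
    have hX' := hκ X
    have hY' := hκ Y
    rw [← hX, κ.apply_symm_apply] at hX'
    rw [← hY, κ.apply_symm_apply] at hY'
    obtain ⟨Z, hZ, -⟩ := exists_isChi (U_class X.2).1 (U_class Y.2).1
    exact AddSubgroup.subset_closure ⟨Z, TriClosure.basic _ ⟨_, _, X.2, Y.2, hZ⟩,
      embed_tensor_class (U_class X.2).1 (U_class Y.2).1 hX'.symm hY'.symm hZ⟩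

end Categories

end

end QDG

theorem mainTheorem1 (n : ℕ) (hn : 0 < n) :
    ∃ T : DGBimod (R n) (RR n), IsStacking n T ∧
      (∀ X Y, DGP n X → DGP n Y → ∃ Z, IsChi n X Y Z) ∧
      U n T ≤ DGP n ∧ UU n T ≤ DGPP n ∧
      IsTriangulated (U n T).FullSubcategory ∧
      IsTriangulated (UU n T).FullSubcategory ∧
      ∃ (κ₁ : K0 (U n T).FullSubcategory ≃+ Un n)
        (κ₂ : K0 (UU n T).FullSubcategory ≃+ TensorProduct (LaurentPolynomial ℤ) (Un n) (Un n)),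
        (∀ (X : (U n T).FullSubcategory) (b : ℤ),
          ∃ h : U n T ((hoShift (R n) (0, b)).obj X.obj),
            κ₁ (K0.cls ⟨_, h⟩) = (LaurentPolynomial.T b : LaurentPolynomial ℤ) • κ₁ (K0.cls X)) ∧
        (∀ (Z : (UU n T).FullSubcategory) (b : ℤ),
          ∃ h : UU n T ((hoShift (RR n) (0, b)).obj Z.obj),
            κ₂ (K0.cls ⟨_, h⟩) = (LaurentPolynomial.T b : LaurentPolynomial ℤ) • κ₂ (K0.cls Z)) ∧
        (∀ (w : FreeMagma Letter) (X : (U n T).FullSubcategory),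
          IsLift n T w X.obj → κ₁ (K0.cls X) = wordVal n w) ∧
        (∀ (X Y : (U n T).FullSubcategory) (Z : (UU n T).FullSubcategory),
          IsChi n X.obj Y.obj Z.obj →
            κ₂ (K0.cls Z) = TensorProduct.tmul _ (κ₁ (K0.cls X)) (κ₁ (K0.cls Y))) ∧
        ∃ h : ∀ Z : (UU n T).FullSubcategory, U n T ((tensorFunctor T).obj Z.obj),
          ∃ (hs : ((U n T).lift ((UU n T).ι ⋙ tensorFunctor T) h).CommShift ℤ)
            (ht : ((U n T).lift ((UU n T).ι ⋙ tensorFunctor T) h).IsTriangulated),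
            ∀ x, κ₁ (K0.map ((U n T).lift ((UU n T).ι ⋙ tensorFunctor T) h) x) =
              LinearMap.mul' (LaurentPolynomial ℤ) (Un n) (κ₂ x) := by
  obtain ⟨⟨κ₁, hκ₁⟩, hU⟩ := U_K0 hn
  obtain ⟨⟨κ₂, hκ₂⟩, hUU⟩ := UU_K0 hn
  refine ⟨stacking n, isStacking_stacking, fun X Y hX hY => ?_, fun X hX => (U_class hX).1,
    fun Z hZ => (UU_class hZ).1, inferInstance, inferInstance, κ₁, κ₂, fun X b => ?_, fun Z b => ?_,
    fun w X hX => ?_, fun X Y Z hZ => ?_, fun Z => ?_, inferInstance, inferInstance, fun z => ?_⟩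
  · obtain ⟨Z, hZ, -⟩ := exists_isChi hX hY
    exact ⟨Z, hZ⟩
  · have h1 : chiR (Ho.of (X.obj.obj.shift (0, b))) =
        embed n ((LaurentPolynomial.T b : LaurentPolynomial ℤ) • κ₁ (K0.cls X)) := by
      rw [chiR_shift, weight_q, map_smul, hκ₁]
    have h2 := hU (Ho.of (X.obj.obj.shift (0, b))) (Generated.shift _ _ (U_class X.2).1) ⟨_, h1.symm⟩
    exact ⟨h2, embed_injective hn ((hκ₁ ⟨_, h2⟩).trans h1)⟩
  · have h1 : chiRR (Ho.of (Z.obj.obj.shift (0, b))) =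
        embedTensor n ((LaurentPolynomial.T b : LaurentPolynomial ℤ) • κ₂ (K0.cls Z)) := by
      rw [chiRR_shift, weight_q, map_smul, hκ₂]
    have h2 := hUU (Ho.of (Z.obj.obj.shift (0, b))) (Generated.shift _ _ (UU_class Z.2).1)
      ⟨_, h1.symm⟩
    exact ⟨h2, embedTensor_injective hn ((hκ₂ ⟨_, h2⟩).trans h1)⟩
  · exact embed_injective hn ((hκ₁ X).trans (lift_class hX).2)
  · exact embedTensor_injective hn ((hκ₂ Z).trans (embed_tensor_class (U_class X.2).1
      (U_class Y.2).1 (hκ₁ X).symm (hκ₁ Y).symm hZ))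
  · obtain ⟨h1, t, ht⟩ := UU_class Z.2
    obtain ⟨h2, h3⟩ := stacking_generated h1
    exact hU _ h2 ⟨_, (stackSum_embedTensor t).symm.trans ((congrArg _ ht).trans h3.symm)⟩
  · obtain ⟨Z, rfl⟩ := K0_exists_cls z
    rw [K0.map_cls]
    refine embed_injective hn ((hκ₁ _).trans ?_)
    rw [← stackSum_embedTensor, hκ₂]
    exact (stacking_generated (UU_class Z.2).1).2
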